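/- Let $\mathbb H$ be the Heisenberg group, i.e. $\mathbb R^3$ with the left invariant fields $X_1=\partial_{1}-\tfrac12x_2\partial_{3}$, $X_2=\partial_{2}+\tfrac12x_1\partial_{3}$, the sub-gradient $\nabla=(X_1,X_2)$ and Lebesgue measure $dx$. Let $N\in\mathbb N$, $\Omega=\mathbb H^{\mathbb Z^N}$, $|i|=\sum_l|i_l|$, and write $i\sim j$ if $|i-j|=1$. For continuous $\phi:\mathbb H\to\mathbb R$ and $V:\mathbb H\times\mathbb H\to\mathbb R$, real couplings $J_{ij}$, finite $\Lambda\subset\mathbb Z^N$ and $\omega\in\Omega$ put $$\mathbb E^{\omega}_\Lambda(dx_{\Lambda})=\frac1{Z^{\omega}_\Lambda}\exp\Big(-\sum_{i\in\Lambda}\phi(x_i)-\sum_{i\sim j,\ \{i,j\}\cap\Lambda\neq\emptyset}J_{ij}V(x_i,x_j)\Big)dx_\Lambda,\qquad x_i=\omega_i\ \text{ for } i\notin\Lambda,$$ where the second sum runs over ordered pairs $(i,j)$ (a sum over unordered pairs is the case in which $J$ vanishes on one of the two orderings), and where all $Z_\Lambda^\omega$ are assumed to be finite. A Gibbs measure is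 a probability measure $\nu$ on $\Omega$ with $\nu\,\mathbb E^{\cdot}_\Lambda f=\nu f$ for all finite $\Lambda$ and all bounded measurable $f$. For $a\in\mathbb R$, a measure $\nu$ on $\Omega$ is called $a$-tempered if for $\nu$-almost every $\omega$ there is $K$ with $\|\omega_i\|\le Ke^{a|i|}$ for all $i\in\mathbb Z^N$. Let $q\in(1,2]$, $c>0$ and $M,a\in\mathbb R$. There are $J_0>0$ and $C>0$, depending only on $N,q,c,M,a$, such that the following holds whenever $|J_{ij}|\le J_0$ for all $i,j$ and (H0) for all $i\in\mathbb Z^N$ and $\omega\in\Omega$ the single site measure $\mu=\mathbb E^\omega_{\{i\}}$ on $\mathbb H$ satisfies $(LS_q)$ with constant $c$: $\ \mu\big(|f|^q\log\frac{|f|^q}{\mu|f|^q}\big)\le c\,\mu(|\nabla f|^q)$ for all smooth $f\in L^q(\mu)$ with $\mu(|\nabla f|^q)<\infty$; (H1) the weak mixed derivatives of $V$ satisfy $\|\nabla_x\nabla_yV(x,y)\|_\infty\le M$. (1) There is at most one $a$-tempered Gibbs measure. (2) An $a$-tempered Gibbs measure $\nu$ satisfies $(LS_q)$ with constant $C$: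 $$\nu\Big(|f|^q\log\frac{|f|^q}{\nu|f|^q}\Big)\le C\,\nu\Big(\sum_{i\in\mathbb Z^N}|\nabla_if|^q\Big)$$ for all measurable $f\in L^q(\nu)$ that are $C^1$ in each coordinate and for which the right-hand side is finite, where $\nabla_i$ is the sub-gradient in the coordinate $i$; in particular the left-hand side is finite. -/

import Mathlib

open MeasureTheory
open scoped ENNReal

noncomputable section

namespace HeisGibbs

/-! ### The Heisenberg group and its sub-gradient -/

/-- The Heisenberg group in its global coordinates `(x 0, x 1, x 2)`, i.e. `ℝ³`.  Its Haar measure is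
Lebesgue measure (`volume`). -/
abbrev Heis : Type := Fin 3 → ℝ

/-- The left invariant horizontal frame:
`X₁ = ∂₁ - (x₂ / 2) ∂₃` (index `0`) and `X₂ = ∂₂ + (x₁ / 2) ∂₃` (index `1`). -/
def frame (k : Fin 2) (x : Heis) : Heis :=
  if k = 0 then ![1, 0, -(x 1) / 2] else ![0, 1, x 0 / 2]

/-- The derivative `X_k f (x)`. -/
def X (k : Fin 2) (f : Heis → ℝ) (x : Heis) : ℝ := fderiv ℝ f x (frame k x)

/-- The Euclidean length `|∇f (x)|` of the sub-gradient `∇f = (X₁ f, X₂ f)`. -/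
def subgradNorm (f : Heis → ℝ) (x : Heis) : ℝ := √(∑ k : Fin 2, X k f x ^ 2)

/-! ### Lattice and configurations -/

/-- The lattice `ℤ^N`. -/
abbrev Site (N : ℕ) : Type := Fin N → ℤ

/-- The `ℓ¹` lattice distance. -/
def latDist {N : ℕ} (i j : Site N) : ℤ := ∑ l, |i l - j l|

/-- The configuration space. -/
abbrev Config (N : ℕ) : Type := Site N → Heis

/-- The length `|∇ᵢ f (ω)|` of the sub-gradient in the coordinate `i`. -/
def siteGradNorm {N : ℕ} (f : Config N → ℝ) (i : Site N) (ω : Config N) : ℝ :=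
  subgradNorm (fun x => f (Function.update ω i x)) (ω i)

/-- The configuration equal to `x` on `Λ` and to `ω` off `Λ`. -/
def glue {N : ℕ} (Λ : Finset (Site N)) (ω : Config N) (x : Λ → Heis) : Config N :=
  fun i => if h : i ∈ Λ then x ⟨i, h⟩ else ω i

/-- The nearest neighbours of a site. -/
def nbrs {N : ℕ} (i : Site N) : Finset (Site N) :=
  (Finset.Icc (i - 1) (i + 1)).filter fun j => latDist i j = 1

/-- The ordered pairs of nearest neighbours with at least one point in `Λ`. -/
def bonds {N : ℕ} (Λ : Finset (Site N)) : Finset (Site N × Site N) :=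
  ((Λ ∪ Λ.biUnion nbrs) ×ˢ (Λ ∪ Λ.biUnion nbrs)).filter fun e =>
    latDist e.1 e.2 = 1 ∧ (e.1 ∈ Λ ∨ e.2 ∈ Λ)

theorem latDist_comm {N : ℕ} (i j : Site N) : latDist i j = latDist j i := by
  simp only [latDist, abs_sub_comm]

theorem mem_nbrs {N : ℕ} {i j : Site N} : j ∈ nbrs i ↔ latDist i j = 1 := by
  simp only [nbrs, Finset.mem_filter, Finset.mem_Icc, and_iff_right_iff_imp]
  intro h
  have key : ∀ l, |i l - j l| ≤ 1 := fun l => by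
    rw [← h]
    exact Finset.single_le_sum (f := fun l => |i l - j l|) (fun _ _ => abs_nonneg _)
      (Finset.mem_univ l)
  refine ⟨fun l => ?_, fun l => ?_⟩
  · have := (abs_le.mp (key l)).2
    simp only [Pi.sub_apply, Pi.one_apply]
    omega
  · have := (abs_le.mp (key l)).1
    simp only [Pi.add_apply, Pi.one_apply]
    omega

theorem mem_bonds {N : ℕ} {Λ : Finset (Site N)} {e : Site N × Site N} :
    e ∈ bonds Λ ↔ latDist e.1 e.2 = 1 ∧ (e.1 ∈ Λ ∨ e.2 ∈ Λ) := by
  simp only [bonds, Finset.mem_filter, Finset.mem_product, Finset.mem_union, Finset.mem_biUnion,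
    mem_nbrs, and_iff_right_iff_imp]
  rintro ⟨h, h1 | h2⟩
  · exact ⟨Or.inl h1, Or.inr ⟨_, h1, h⟩⟩
  · exact ⟨Or.inr ⟨_, h2, by rw [latDist_comm]; exact h⟩, Or.inl h2⟩

/-! ### Local specification and Gibbs measures -/

/-- `∑_{i ∈ Λ} φ(x_i) + ∑ J_{ij} V(x_i, x_j)`, the second sum over the ordered pairs of nearest
neighbours meeting `Λ`.  A sum over unordered pairs, with any choice of the order of the arguments
of `V` in each of them, is the case in which `J` vanishes on one of the two orderings. -/
def energy {N : ℕ} (φ : Heis → ℝ) (V : Heis → Heis → ℝ) (J : Site N → Site N → ℝ)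
    (Λ : Finset (Site N)) (η : Config N) : ℝ :=
  ∑ i ∈ Λ, φ (η i) + ∑ e ∈ bonds Λ, J e.1 e.2 * V (η e.1) (η e.2)

/-- The normalisation factor `Z_Λ^ω` is finite for all `Λ` and `ω` (it is never zero). -/
def FinitePartition {N : ℕ} (φ : Heis → ℝ) (V : Heis → Heis → ℝ) (J : Site N → Site N → ℝ) :
    Prop :=
  ∀ (Λ : Finset (Site N)) (ω : Config N),
    Integrable (fun x : Λ → Heis => Real.exp (-energy φ V J Λ (glue Λ ω x)))

/-- The finite volume measure `𝔼_Λ^ω`, as a measure on all configurations: the coordinates in `Λ`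
have density `exp (-energy) / Z_Λ^ω` for Lebesgue measure, the others are those of `ω`. -/
def localSpec {N : ℕ} (φ : Heis → ℝ) (V : Heis → Heis → ℝ) (J : Site N → Site N → ℝ)
    (Λ : Finset (Site N)) (ω : Config N) : Measure (Config N) :=
  ((volume : Measure (Λ → Heis)).tilted fun x => -energy φ V J Λ (glue Λ ω x)).map (glue Λ ω)

/-- The single site measure `𝔼_i^ω` on the Heisenberg group. -/
def singleSite {N : ℕ} (φ : Heis → ℝ) (V : Heis → Heis → ℝ) (J : Site N → Site N → ℝ)
    (i : Site N) (ω : Config N) : Measure Heis :=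
  (localSpec φ V J {i} ω).map fun η => η i

/-- Gibbs measures: probability measures that solve the DLR equations. -/
def IsGibbs {N : ℕ} (φ : Heis → ℝ) (V : Heis → Heis → ℝ) (J : Site N → Site N → ℝ)
    (ν : Measure (Config N)) : Prop :=
  IsProbabilityMeasure ν ∧
    ∀ (Λ : Finset (Site N)) (f : Config N → ℝ), Measurable f → (∃ B, ∀ ω, |f ω| ≤ B) →
      ∫ ω, (∫ η, f η ∂(localSpec φ V J Λ ω)) ∂ν = ∫ ω, f ω ∂ν

/-- `ν` is carried by the configurations that grow at most like `exp (a * |i|)`. -/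
def IsTempered {N : ℕ} (a : ℝ) (ν : Measure (Config N)) : Prop :=
  ∀ᵐ ω ∂ν, ∃ K : ℝ, ∀ i : Site N, ‖ω i‖ ≤ K * Real.exp (a * (latDist i 0 : ℝ))

/-! ### The inequality `(LS_q)` and the two hypotheses -/

/-- `μ (|f|^q log (|f|^q / μ |f|^q)) ≤ c μ (G)` for one function `f`, where `G` stands for `|∇f|^q`;
the finiteness of the left-hand side is part of the claim. -/
def LSIneq {S : Type*} [MeasurableSpace S] (μ : Measure S) (q c : ℝ) (f : S → ℝ) (G : S → ℝ≥0∞) :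
    Prop :=
  Integrable (fun x => |f x| ^ q) μ → ∫⁻ x, G x ∂μ ≠ ∞ →
    Integrable (fun x => |f x| ^ q * Real.log (|f x| ^ q / ∫ y, |f y| ^ q ∂μ)) μ ∧
    ENNReal.ofReal (∫ x, |f x| ^ q * Real.log (|f x| ^ q / ∫ y, |f y| ^ q ∂μ) ∂μ)
      ≤ ENNReal.ofReal c * ∫⁻ x, G x ∂μ

/-- `(LS_q)` with constant `c` for a measure on the Heisenberg group. -/
def LSHeis (μ : Measure Heis) (q c : ℝ) : Prop :=
  ∀ f : Heis → ℝ, ContDiff ℝ ((⊤ : ℕ∞) : WithTop ℕ∞) f →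
    LSIneq μ q c f fun x => ENNReal.ofReal (subgradNorm f x ^ q)

/-- `(LS_q)` with constant `c` for a measure on the configuration space, with
`|∇f|^q = ∑ᵢ |∇ᵢ f|^q`, for all measurable `f` that are `C¹` in each coordinate. -/
def LSConfig {N : ℕ} (ν : Measure (Config N)) (q c : ℝ) : Prop :=
  ∀ f : Config N → ℝ, Measurable f →
    (∀ (i : Site N) (ω : Config N), ContDiff ℝ 1 fun x => f (Function.update ω i x)) →
    LSIneq ν q c f fun ω => ∑' i : Site N, ENNReal.ofReal (siteGradNorm f i ω ^ q)

/-- (H0): the single site measures satisfy `(LS_q)` with a common constant `c`. -/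
def H0 {N : ℕ} (φ : Heis → ℝ) (V : Heis → Heis → ℝ) (J : Site N → Site N → ℝ) (q c : ℝ) : Prop :=
  ∀ (i : Site N) (ω : Config N), LSHeis (singleSite φ V J i ω) q c

/-- (H1): `‖∇ₓ ∇_y V(x, y)‖_∞ ≤ M`, the derivatives being taken in the weak sense (the fields
`X_k` have divergence zero, so two integrations by parts give the sign `+`).  For `V` of class `C²`
these are the classical derivatives. -/
def H1 (V : Heis → Heis → ℝ) (M : ℝ) : Prop :=
  ∃ g : Fin 2 → Fin 2 → Heis × Heis → ℝ,
    (∀ k l, Measurable (g k l)) ∧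
    (∀ p, √(∑ k, ∑ l, g k l p ^ 2) ≤ M) ∧
    ∀ (k l : Fin 2) (ψ : Heis × Heis → ℝ), ContDiff ℝ ((⊤ : ℕ∞) : WithTop ℕ∞) ψ → HasCompactSupport ψ →
      ∫ p : Heis × Heis, V p.1 p.2 * X k (fun x => X l (fun y => ψ (x, y)) p.2) p.1
        = ∫ p : Heis × Heis, g k l p * ψ p

end HeisGibbs

end

/-! The proof averages over one site at a time and follows what this does to entropy and to
horizontal derivatives. Write E_i for the average over the site i against its single site measure.

One site. The inequality (LS_q) is first passed from smooth functions to bounded horizontally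
Lipschitz functions u with a measurable bound G for their pointwise slopes (`LSHeis.lsLip`): left
translations commute with the flows of the left invariant fields, so mollifying by small left
translations averages slopes. Herbst's argument gives exponential moments of Lipschitz functions U,
and the same inequality applied to the two parts of u - median(u) gives a gap inequality. With the
entropy inequality these combine to the covariance bound |μ(u^q (U - μU))| ≤ K ‖u‖_q^(q-1) ‖G‖_q
(`LSLip.cov_le`), in which q ≤ 2 matters.

Interaction. (H1) says that the mixed difference of V along a flow of time s in x and a flow of time
t in y is at most M|s||t| (`abs_mixedDiff_le`). Hence moving one coordinate j ≠ i along a flow for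
the time t multiplies the single site measure at i by a density proportional to exp H, where H is
horizontally Lipschitz with constant at most 2 J₀ M |t| (`Regular.singleSite_shift`). No bound on φ
or V themselves is involved. The first order effect of such a density on a mean is a covariance with
H. Therefore E_i f has Lipschitz constant 0 at i and v_j + θ v_i at the neighbours j
(`SiteFamily.slip_siteAvg`), and (E_i f^q)^(1/q) has slope 0 at i and, at a neighbour j, slope at
most the L^q norm of G_j under the single site measure plus θ times that of G_i
(`SiteFamily.sslope_siteLq`). Both factors θ are small with J₀.

Finite volume. Average successively over a list of sites of Λ. Each average costs C times the q-th
power of the current slope norm at the visited site (`SiteFamily.ent_le_step`). A visit erases the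
slope at i and passes only a fraction θ of it to the neighbours, so the totals t_j collected at the
sites satisfy t_j ≤ b_j + θ ∑ t_m over neighbours m, and ∑ t_j^q ≤ 4 ∑ b_j^q. The list can be chosen
so that the final average is almost constant, because the sum of the Lipschitz constants loses at
least half the constant at each visited site (`exists_lipList_small`). This gives (LS_q) for
Lipschitz functions, uniformly in Λ and in the boundary condition. Mollification on the product and
cutoffs with small sub-gradients extend it to bounded functions that are C¹ in each coordinate
(`PLSLip.of_bounded`).

Infinite volume. With the weight exp((b+1)|j|) in the sum of Lipschitz constants, the same averages
show that two boundary conditions of growth exp(b|j|) give expectations of a local Lipschitz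
function on the box of radius n which differ by O(exp(-n)) (`Regular.abs_integral_sub_integral_le`).
So the finite volume expectations with boundary condition 0 converge to those of every tempered
Gibbs measure, which is uniqueness, since local Lipschitz functions are dense in L¹. For (2), split
the entropy of F = |f|^q under ν into the mean of its finite volume entropies, controlled uniformly,
and the entropy of the finite volume average of F, which tends to 0 since that average converges to
νF in L¹(ν). Unbounded f are reached by bounded C¹ truncations and Fatou's lemma. -/

noncomputable section

/-! ### Geometry of the Heisenberg group, and the pointwise meaning of (H1). -/

namespace HeisGibbs

/-! ### Horizontal flows and left translations -/

/-- The flow of the field `X_k`. -/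
def flow (k : Fin 2) (t : ℝ) (x : Heis) : Heis := x + t • frame k x

/-- The group law of the Heisenberg group. -/
def lmul (h x : Heis) : Heis :=
  ![h 0 + x 0, h 1 + x 1, h 2 + x 2 + (h 0 * x 1 - h 1 * x 0) / 2]

theorem flow_coord (k : Fin 2) (t : ℝ) (x : Heis) :
    flow k t x = if k = 0 then ![x 0 + t, x 1, x 2 - t * x 1 / 2]
      else ![x 0, x 1 + t, x 2 + t * x 0 / 2] := by
  fin_cases k <;> ext i <;> fin_cases i <;> simp [flow, frame] <;> ring

theorem frame_flow (k : Fin 2) (t : ℝ) (x : Heis) : frame k (flow k t x) = frame k x := by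
  rw [flow_coord]
  fin_cases k <;> ext i <;> fin_cases i <;> simp [frame]

theorem flow_flow (k : Fin 2) (s t : ℝ) (x : Heis) : flow k s (flow k t x) = flow k (t + s) x := by
  rw [flow, frame_flow, flow, flow, add_smul, add_assoc]

@[simp]
theorem flow_zero (k : Fin 2) (x : Heis) : flow k 0 x = x := by simp [flow]

/-- The fields are left invariant. For this reason all mollifications below use left translations:
slopes of an average are then bounded by averages of slopes, with no commutator terms. -/
theorem lmul_flow (h : Heis) (k : Fin 2) (t : ℝ) (x : Heis) :
    lmul h (flow k t x) = flow k t (lmul h x) := by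
  rw [flow_coord, flow_coord]
  fin_cases k <;> ext i <;> fin_cases i <;> simp [lmul] <;> ring

theorem lmul_neg_lmul (h x : Heis) : lmul (-h) (lmul h x) = x := by
  ext i; fin_cases i <;> simp [lmul]; ring

theorem lmul_lmul_neg (h x : Heis) : lmul h (lmul (-h) x) = x := by
  ext i; fin_cases i <;> simp [lmul]; ring

@[simp]
theorem lmul_zero_left (x : Heis) : lmul 0 x = x := by
  ext i; fin_cases i <;> simp [lmul]

theorem continuous_vec3 {S : Type*} [TopologicalSpace S] {a b c : S → ℝ} (ha : Continuous a)
    (hb : Continuous b) (hc : Continuous c) : Continuous fun s => (![a s, b s, c s] : Heis) := by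
  refine continuous_pi fun i => ?_
  fin_cases i
  · exact ha
  · exact hb
  · exact hc

theorem continuous_frame (k : Fin 2) : Continuous (frame k) := by
  fin_cases k
  · exact continuous_vec3 (by fun_prop) (by fun_prop) (by fun_prop)
  · exact continuous_vec3 (by fun_prop) (by fun_prop) (by fun_prop)

theorem continuous_flow_uncurry (k : Fin 2) : Continuous fun p : ℝ × Heis => flow k p.1 p.2 := by
  have := continuous_frame k
  unfold flow
  fun_prop

theorem continuous_flow (k : Fin 2) (t : ℝ) : Continuous (flow k t) :=
  (continuous_flow_uncurry k).comp (by fun_prop : Continuous fun x : Heis => (t, x))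

theorem continuous_flow_time (k : Fin 2) (x : Heis) : Continuous fun t => flow k t x :=
  (continuous_flow_uncurry k).comp (by fun_prop : Continuous fun t : ℝ => (t, x))

theorem continuous_lmul_uncurry : Continuous fun p : Heis × Heis => lmul p.1 p.2 :=
  continuous_vec3 (by fun_prop) (by fun_prop) (by fun_prop)

theorem continuous_lmul (h : Heis) : Continuous (lmul h) :=
  continuous_lmul_uncurry.comp (by fun_prop : Continuous fun x : Heis => (h, x))

/-- The shear `x ↦ (x₁, x₂, x₃ + p x₁ + r x₂)`. -/
def shear (p r : ℝ) : Matrix (Fin 3) (Fin 3) ℝ := !![1, 0, 0; 0, 1, 0; p, r, 1]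

/-- The common unimodular affine form of the flows, of the left translations and, after a
reflection, of h ↦ h⁻¹x. -/
theorem measurePreserving_shear (p r : ℝ) (b : Heis) :
    MeasurePreserving (fun x : Heis => (![x 0 + b 0, x 1 + b 1, x 2 + p * x 0 + r * x 1 + b 2] : Heis))
      volume volume := by
  have hdet : (shear p r).det = 1 := by simp [shear, Matrix.det_fin_three]
  have h1 : MeasurePreserving (Matrix.toLin' (shear p r)) (volume : Measure Heis) volume := by
    refine ⟨(LinearMap.continuous_of_finiteDimensional _).measurable, ?_⟩
    rw [Real.map_matrix_volume_pi_eq_smul_volume_pi (by rw [hdet]; exact one_ne_zero), hdet]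
    simp
  have h2 := (measurePreserving_add_right (volume : Measure Heis) b).comp h1
  convert h2 using 1
  ext x i
  fin_cases i <;> simp [shear, dotProduct, Fin.sum_univ_three]
  ring

theorem measurePreserving_flow (k : Fin 2) (t : ℝ) :
    MeasurePreserving (flow k t) volume volume := by
  have h0 := measurePreserving_shear 0 (-(t / 2)) ![t, 0, 0]
  have h1 := measurePreserving_shear (t / 2) 0 ![0, t, 0]
  have e : flow k t = fun x => flow k t x := rfl
  rw [e]
  simp only [flow_coord]
  fin_cases k
  · convert h0 using 1
    ext x i
    fin_cases i <;> simp
    ring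
  · convert h1 using 1
    ext x i
    fin_cases i <;> simp
    ring

theorem measurePreserving_lmul (h : Heis) : MeasurePreserving (lmul h) volume volume := by
  convert measurePreserving_shear (-(h 1) / 2) (h 0 / 2) h using 1
  ext x i
  fin_cases i <;> simp [lmul] <;> ring

theorem measurePreserving_lmul_neg (x : Heis) :
    MeasurePreserving (fun h => lmul (-h) x) volume volume := by
  convert (measurePreserving_shear (x 1 / 2) (-(x 0) / 2) x).comp
    (Measure.measurePreserving_neg (volume : Measure Heis)) using 1
  ext h i
  fin_cases i <;> simp [lmul]; ring

/-! ### Horizontally Lipschitz functions -/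

/-- `u` is Lipschitz along the horizontal lines, with constant `L`. -/
def HLip (L : ℝ) (u : Heis → ℝ) : Prop := ∀ (x : Heis) (k : Fin 2) (t : ℝ),
  |u (flow k t x) - u x| ≤ L * |t|

/-- An upper bound for the horizontal distance of `z` to the origin. -/
def hlen (z : Heis) : ℝ := |z 0| + |z 1| + 4 * √|z 2 - z 0 * z 1 / 2|

theorem continuous_hlen : Continuous hlen := by unfold hlen; fun_prop

@[simp]
theorem hlen_zero : hlen 0 = 0 := by simp [hlen]

/-- Two horizontal moves fix the first two coordinates and leave the vertical error z₂ - z₀z₁/2. A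
horizontal rectangle with sides s and t closes up except for a vertical displacement st, so sides of
length the square root of the error, with a suitable sign, remove it. -/
theorem lmul_eq_flows (x z : Heis) : ∃ s t : ℝ, |s| = √|z 2 - z 0 * z 1 / 2| ∧
    |t| = √|z 2 - z 0 * z 1 / 2| ∧ lmul x z = flow 1 (-t) (flow 0 (-s) (flow 1 t (flow 0 s
      (flow 1 (z 1) (flow 0 (z 0) x))))) := by
  have hr : ∃ s t : ℝ, |s| = √|z 2 - z 0 * z 1 / 2| ∧ |t| = √|z 2 - z 0 * z 1 / 2| ∧
      s * t = z 2 - z 0 * z 1 / 2 := by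
    generalize z 2 - z 0 * z 1 / 2 = r
    have hs := Real.mul_self_sqrt (abs_nonneg r)
    rcases le_total 0 r with h | h
    · refine ⟨√|r|, √|r|, by simp [abs_of_nonneg], by simp [abs_of_nonneg], ?_⟩
      rw [hs, abs_of_nonneg h]
    · refine ⟨√|r|, -√|r|, by simp [abs_of_nonneg], by simp [abs_of_nonneg], ?_⟩
      rw [mul_neg, hs, abs_of_nonpos h, neg_neg]
  obtain ⟨s, t, hs, ht, hst⟩ := hr
  refine ⟨s, t, hs, ht, ?_⟩
  simp only [flow_coord]
  have : z 2 = s * t + z 0 * z 1 / 2 := by rw [hst]; ring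
  ext i
  fin_cases i <;> simp [lmul]
  rw [this]
  ring

theorem HLip.abs_sub_lmul_le {L : ℝ} {u : Heis → ℝ} (hu : HLip L u) (x z : Heis) :
    |u (lmul x z) - u x| ≤ L * hlen z := by
  obtain ⟨s, t, hs, ht, h⟩ := lmul_eq_flows x z
  rw [h]
  have h1 := hu x 0 (z 0)
  have h2 := hu (flow 0 (z 0) x) 1 (z 1)
  have h3 := hu (flow 1 (z 1) (flow 0 (z 0) x)) 0 s
  have h4 := hu (flow 0 s (flow 1 (z 1) (flow 0 (z 0) x))) 1 t
  have h5 := hu (flow 1 t (flow 0 s (flow 1 (z 1) (flow 0 (z 0) x)))) 0 (-s)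
  have h6 := hu (flow 0 (-s) (flow 1 t (flow 0 s (flow 1 (z 1) (flow 0 (z 0) x))))) 1 (-t)
  rw [abs_neg] at h5 h6
  rw [hs] at h3 h5
  rw [ht] at h4 h6
  unfold hlen
  rw [abs_le] at *
  constructor <;> nlinarith

theorem HLip.abs_sub_le {L : ℝ} {u : Heis → ℝ} (hu : HLip L u) (x y : Heis) :
    |u y - u x| ≤ L * hlen (lmul (-x) y) := by
  simpa [lmul_lmul_neg] using hu.abs_sub_lmul_le x (lmul (-x) y)

theorem HLip.nonneg {L : ℝ} {u : Heis → ℝ} (hu : HLip L u) : 0 ≤ L := by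
  have := hu 0 0 1
  rw [abs_one, mul_one] at this
  exact (abs_nonneg _).trans this

theorem HLip.mono {L L' : ℝ} {u : Heis → ℝ} (hu : HLip L u) (h : L ≤ L') : HLip L' u :=
  fun x k t => (hu x k t).trans (by gcongr)

theorem lmul_neg_self (x : Heis) : lmul (-x) x = 0 := by
  ext i; fin_cases i <;> simp [lmul]; ring

/-- Horizontal control alone suffices because every displacement is made of horizontal moves whose
total length `hlen` tends to 0 with it. -/
theorem HLip.continuous {L : ℝ} {u : Heis → ℝ} (hu : HLip L u) : Continuous u := by
  rw [continuous_iff_continuousAt]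
  intro x
  rw [ContinuousAt, tendsto_iff_norm_sub_tendsto_zero]
  have h : Filter.Tendsto (fun y => L * hlen (lmul (-x) y)) (nhds x) (nhds 0) := by
    have : Continuous fun y => L * hlen (lmul (-x) y) :=
      continuous_const.mul (continuous_hlen.comp (continuous_lmul _))
    have h := this.tendsto x
    simpa [lmul_neg_self] using h
  exact squeeze_zero (fun _ => norm_nonneg _) (fun y => hu.abs_sub_le x y) h

theorem hlen_le_norm (z : Heis) : hlen z ≤ 4 + 12 * ‖z‖ := by
  have h0 : |z 0| ≤ ‖z‖ := norm_le_pi_norm z 0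
  have h1 : |z 1| ≤ ‖z‖ := norm_le_pi_norm z 1
  have h2 : |z 2| ≤ ‖z‖ := norm_le_pi_norm z 2
  have hz := norm_nonneg z
  have h3 : √|z 2 - z 0 * z 1 / 2| ≤ 1 + 2 * ‖z‖ := by
    rw [Real.sqrt_le_left (by positivity)]
    calc |z 2 - z 0 * z 1 / 2| ≤ |z 2| + |z 0| * |z 1| / 2 := by
          refine (abs_sub _ _).trans ?_
          rw [abs_div, abs_mul, abs_two]
      _ ≤ ‖z‖ + ‖z‖ * ‖z‖ / 2 := by gcongr
      _ ≤ (1 + 2 * ‖z‖) ^ 2 := by nlinarith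
  unfold hlen
  linarith

/-- Points are joined by horizontal lines through the origin. -/
theorem HLip.abs_sub_le_norm {L : ℝ} {u : Heis → ℝ} (hu : HLip L u) (x y : Heis) :
    |u y - u x| ≤ L * (8 + 12 * ‖x‖ + 12 * ‖y‖) := by
  have hl : ∀ z : Heis, lmul 0 z = z := lmul_zero_left
  have h1 := hu.abs_sub_lmul_le 0 x
  have h2 := hu.abs_sub_lmul_le 0 y
  rw [hl] at h1 h2
  have h3 := mul_le_mul_of_nonneg_left (hlen_le_norm x) hu.nonneg
  have h4 := mul_le_mul_of_nonneg_left (hlen_le_norm y) hu.nonneg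
  rw [abs_le] at *
  constructor <;> linarith

end HeisGibbs

namespace HeisGibbs

/-! ### Weak mixed derivatives and mixed differences -/

theorem hasDerivAt_flow (k : Fin 2) (t : ℝ) (x : Heis) :
    HasDerivAt (fun s => flow k s x) (frame k x) t := by
  simpa [flow] using ((hasDerivAt_id t).smul_const (frame k x)).const_add x

theorem hasDerivAt_comp_flow {f : Heis → ℝ} (k : Fin 2) (t : ℝ) {x : Heis}
    (hf : DifferentiableAt ℝ f (flow k t x)) :
    HasDerivAt (fun s => f (flow k s x)) (X k f (flow k t x)) t := by
  have := hf.hasFDerivAt.comp_hasDerivAt t (hasDerivAt_flow k t x)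
  rwa [X, frame_flow]

theorem X_eq_of_hasDerivAt {f : Heis → ℝ} {k : Fin 2} {x : Heis} {d : ℝ}
    (hf : DifferentiableAt ℝ f x) (h : HasDerivAt (fun s => f (flow k s x)) d 0) : X k f x = d := by
  have h0 : DifferentiableAt ℝ f (flow k 0 x) := by simpa using hf
  have := hasDerivAt_comp_flow k 0 h0
  rw [flow_zero] at this
  exact this.unique h

/-- Coordinates in which `X_k` is the first partial derivative. -/
def straight (k : Fin 2) (x : Heis) : Heis :=
  if k = 0 then ![x 0, x 1, x 2 + x 0 * x 1 / 2] else ![x 1, x 0, x 2 - x 0 * x 1 / 2]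

/-- The inverse of `straight`. -/
def unstraight (k : Fin 2) (y : Heis) : Heis :=
  if k = 0 then ![y 0, y 1, y 2 - y 0 * y 1 / 2] else ![y 1, y 0, y 2 + y 0 * y 1 / 2]

theorem unstraight_straight (k : Fin 2) (x : Heis) : unstraight k (straight k x) = x := by
  fin_cases k <;> ext i <;> fin_cases i <;> simp [straight, unstraight]; ring

theorem continuous_unstraight (k : Fin 2) : Continuous (unstraight k) := by
  fin_cases k
  · exact continuous_vec3 (by fun_prop) (by fun_prop) (by fun_prop)
  · exact continuous_vec3 (by fun_prop) (by fun_prop) (by fun_prop)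

theorem contDiff_straight (k : Fin 2) : ContDiff ℝ ((⊤ : ℕ∞) : WithTop ℕ∞) (straight k) := by
  rw [contDiff_pi]
  intro i
  fin_cases k <;> fin_cases i <;> simp [straight] <;> fun_prop

theorem straight_flow (k : Fin 2) (t : ℝ) (x : Heis) :
    straight k (flow k t x) = ![straight k x 0 + t, straight k x 1, straight k x 2] := by
  rw [flow_coord]
  fin_cases k <;> ext i <;> fin_cases i <;> simp [straight] <;> ring

/-- Products of functions of one variable in the straightened coordinates. -/
def strProd (k : Fin 2) (α β γ : ℝ → ℝ) (x : Heis) : ℝ :=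
  α (straight k x 0) * β (straight k x 1) * γ (straight k x 2)

theorem strProd_flow (k : Fin 2) (α β γ : ℝ → ℝ) (t : ℝ) (x : Heis) :
    strProd k α β γ (flow k t x)
      = α (straight k x 0 + t) * β (straight k x 1) * γ (straight k x 2) := by
  simp [strProd, straight_flow]

theorem contDiff_strProd (k : Fin 2) {α β γ : ℝ → ℝ}
    (hα : ContDiff ℝ ((⊤ : ℕ∞) : WithTop ℕ∞) α) (hβ : ContDiff ℝ ((⊤ : ℕ∞) : WithTop ℕ∞) β)
    (hγ : ContDiff ℝ ((⊤ : ℕ∞) : WithTop ℕ∞) γ) :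
    ContDiff ℝ ((⊤ : ℕ∞) : WithTop ℕ∞) (strProd k α β γ) := by
  have h := contDiff_pi.1 (contDiff_straight k)
  exact ((hα.comp (h 0)).mul (hβ.comp (h 1))).mul (hγ.comp (h 2))

theorem hasCompactSupport_strProd (k : Fin 2) {α β γ : ℝ → ℝ}
    (hα : HasCompactSupport α) (hβ : HasCompactSupport β) (hγ : HasCompactSupport γ) :
    HasCompactSupport (strProd k α β γ) := by
  have hK : IsCompact (Set.univ.pi (![tsupport α, tsupport β, tsupport γ] : Fin 3 → Set ℝ)) := by
    refine isCompact_univ_pi fun i => ?_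
    fin_cases i
    exacts [hα, hβ, hγ]
  refine HasCompactSupport.of_support_subset_isCompact (hK.image (continuous_unstraight k)) ?_
  intro x hx
  refine ⟨straight k x, ?_, unstraight_straight k x⟩
  rw [Function.mem_support, strProd] at hx
  have h1 := left_ne_zero_of_mul hx
  intro i _
  fin_cases i
  · exact subset_tsupport _ (left_ne_zero_of_mul h1)
  · exact subset_tsupport _ (right_ne_zero_of_mul h1)
  · exact subset_tsupport _ (right_ne_zero_of_mul hx)

/-- Localised test functions of product form in the straightened coordinates. The product form
reduces antiderivatives along the flow of X_k to the first factor. -/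
theorem exists_strProd (k : Fin 2) (p : Heis) {U : Set Heis} (hU : U ∈ nhds p) :
    ∃ α β γ : ℝ → ℝ, ContDiff ℝ ((⊤ : ℕ∞) : WithTop ℕ∞) α ∧ ContDiff ℝ ((⊤ : ℕ∞) : WithTop ℕ∞) β ∧
      ContDiff ℝ ((⊤ : ℕ∞) : WithTop ℕ∞) γ ∧ HasCompactSupport α ∧ HasCompactSupport β ∧
      HasCompactSupport γ ∧ (∀ r, 0 ≤ α r) ∧ (∀ r, 0 ≤ β r) ∧ (∀ r, 0 ≤ γ r) ∧
      0 < strProd k α β γ p ∧ ∀ x, strProd k α β γ x ≠ 0 → x ∈ U := by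
  have h1 : unstraight k ⁻¹' U ∈ nhds (straight k p) := by
    apply (continuous_unstraight k).continuousAt.preimage_mem_nhds
    rwa [unstraight_straight]
  obtain ⟨ε, hε, hball⟩ := Metric.mem_nhds_iff.1 h1
  let b : ∀ c : ℝ, ContDiffBump c := fun c => ⟨ε / 2, ε, by positivity, by linarith⟩
  refine ⟨b (straight k p 0), b (straight k p 1), b (straight k p 2), (b _).contDiff,
    (b _).contDiff, (b _).contDiff, (b _).hasCompactSupport, (b _).hasCompactSupport,
    (b _).hasCompactSupport, fun _ => (b _).nonneg, fun _ => (b _).nonneg, fun _ => (b _).nonneg,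
    ?_, ?_⟩
  · have : ∀ c, 0 < b c c := fun c => by
      apply (b c).pos_of_mem_ball
      simpa [b] using hε
    unfold strProd
    have h0 := this (straight k p 0)
    have h1 := this (straight k p 1)
    have h2 := this (straight k p 2)
    positivity
  · intro x hx
    rw [strProd] at hx
    have hx1 := left_ne_zero_of_mul hx
    have key : ∀ c r, b c r ≠ 0 → dist r c < ε := fun c r h => by
      have : r ∈ Function.support (b c) := h
      rw [(b c).support_eq] at this
      exact this
    have : straight k x ∈ Metric.ball (straight k p) ε := by
      rw [Metric.mem_ball, dist_pi_lt_iff hε]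
      intro i
      fin_cases i
      · exact key _ _ (left_ne_zero_of_mul hx1)
      · exact key _ _ (right_ne_zero_of_mul hx1)
      · exact key _ _ (right_ne_zero_of_mul hx)
    have := hball this
    rwa [Set.mem_preimage, unstraight_straight] at this

/-- An antiderivative of `ψ - ψ ∘ flow k (-s)` along the flow. -/
theorem exists_antideriv (k : Fin 2) (s : ℝ) {α β γ : ℝ → ℝ}
    (hα : ContDiff ℝ ((⊤ : ℕ∞) : WithTop ℕ∞) α) (hβ : ContDiff ℝ ((⊤ : ℕ∞) : WithTop ℕ∞) β)
    (hγ : ContDiff ℝ ((⊤ : ℕ∞) : WithTop ℕ∞) γ) (cα : HasCompactSupport α)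
    (cβ : HasCompactSupport β) (cγ : HasCompactSupport γ)
    (pα : ∀ r, 0 ≤ α r) (pβ : ∀ r, 0 ≤ β r) (pγ : ∀ r, 0 ≤ γ r) :
    ∃ A : Heis → ℝ, ContDiff ℝ ((⊤ : ℕ∞) : WithTop ℕ∞) A ∧ HasCompactSupport A ∧
      (∀ x, X k A x = strProd k α β γ x - strProd k α β γ (flow k (-s) x)) ∧
      ∫ x, |A x| ≤ |s| * ∫ x, strProd k α β γ x := by
  have hαc : Continuous α := hα.continuous
  set P : ℝ → ℝ := fun r => ∫ θ in (0 : ℝ)..r, α θ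
  have hP : ∀ r, HasDerivAt P (α r) r := fun r =>
    intervalIntegral.integral_hasDerivAt_right (hαc.intervalIntegrable _ _)
      (hαc.stronglyMeasurableAtFilter _ _) hαc.continuousAt
  have hPs : ContDiff ℝ ((⊤ : ℕ∞) : WithTop ℕ∞) P := by
    rw [contDiff_infty_iff_deriv]
    refine ⟨fun r => (hP r).differentiableAt, ?_⟩
    have : deriv P = α := funext fun r => (hP r).deriv
    rwa [this]
  -- P need not have compact support, but Q(r), the integral of α(r - θ) for θ from 0 to s, does.
  set Q : ℝ → ℝ := fun r => P r - P (r - s)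
  have hQ : ContDiff ℝ ((⊤ : ℕ∞) : WithTop ℕ∞) Q := hPs.sub (hPs.comp (by fun_prop))
  have hQ' : ∀ r, HasDerivAt Q (α r - α (r - s)) r := fun r => by
    have h2 : HasDerivAt (fun r => P (r - s)) (α (r - s)) r := by
      exact (hP (r - s)).comp_sub_const r s
    exact (hP r).sub h2
  have hQi : ∀ r, Q r = ∫ θ in (0 : ℝ)..s, α (r - θ) := fun r => by
    rw [intervalIntegral.integral_comp_sub_left (fun θ => α θ), sub_zero]
    exact intervalIntegral.integral_interval_sub_left (hαc.intervalIntegrable _ _)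
      (hαc.intervalIntegrable _ _)
  have cQ : HasCompactSupport Q := by
    obtain ⟨R, hR⟩ := cα.isBounded.subset_closedBall (0 : ℝ)
    refine HasCompactSupport.intro (isCompact_closedBall (0 : ℝ) (R + |s|)) fun r hr => ?_
    rw [hQi, intervalIntegral.integral_zero_ae]
    refine Filter.Eventually.of_forall fun θ hθ => ?_
    by_contra hne
    have h1 := hR (subset_tsupport _ hne)
    rw [mem_closedBall_zero_iff, Real.norm_eq_abs] at h1 hr
    have h2 : |θ| ≤ |s| := by
      have := Set.abs_sub_left_of_mem_uIcc (Set.uIoc_subset_uIcc hθ)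
      simpa using this
    have h3 := abs_sub_abs_le_abs_sub r θ
    linarith
  refine ⟨strProd k Q β γ, contDiff_strProd k hQ hβ hγ, hasCompactSupport_strProd k cQ cβ cγ,
    ?_, ?_⟩
  · intro x
    apply X_eq_of_hasDerivAt
    · exact (contDiff_strProd k hQ hβ hγ).differentiable (by simp) x
    · have ef : (fun t => strProd k Q β γ (flow k t x)) = fun t =>
          Q (straight k x 0 + t) * β (straight k x 1) * γ (straight k x 2) :=
        funext fun t => strProd_flow k Q β γ t x
      rw [ef]
      have h := ((hQ' (straight k x 0 + 0)).comp_const_add (straight k x 0) 0).mul_const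
        (β (straight k x 1))
      have h' := h.mul_const (γ (straight k x 2))
      have ed : strProd k α β γ x - strProd k α β γ (flow k (-s) x)
          = (α (straight k x 0 + 0) - α (straight k x 0 + 0 - s)) * β (straight k x 1)
            * γ (straight k x 2) := by
        rw [strProd_flow, strProd, add_zero, ← sub_eq_add_neg]
        ring
      rw [ed]
      exact h'
  · have hΨ := contDiff_strProd k hα hβ hγ
    have hc := hΨ.continuous
    have nn : ∀ x, 0 ≤ strProd k α β γ x := fun x =>
      mul_nonneg (mul_nonneg (pα _) (pβ _)) (pγ _)
    have hint : Integrable (strProd k α β γ) :=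
      hc.integrable_of_hasCompactSupport (hasCompactSupport_strProd k cα cβ cγ)
    -- The antiderivative is an integral of the nonnegative test function along a flow line of
    -- length |s|. Tonelli and the invariance of volume under the flow then give the L¹ bound.
    have hb : ∀ x, ENNReal.ofReal |strProd k Q β γ x|
        ≤ ∫⁻ θ in Set.uIoc 0 s, ENNReal.ofReal (strProd k α β γ (flow k (-θ) x)) := fun x => by
      have e1 : |strProd k Q β γ x|
          = |∫ θ in (0 : ℝ)..s, strProd k α β γ (flow k (-θ) x)| := by
        congr 1
        simp only [strProd_flow, ← sub_eq_add_neg]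
        rw [intervalIntegral.integral_mul_const, intervalIntegral.integral_mul_const, ← hQi, strProd]
      rw [e1, intervalIntegral.abs_integral_eq_abs_integral_uIoc,
        abs_of_nonneg (integral_nonneg fun θ => nn _), ofReal_integral_eq_lintegral_ofReal]
      · have hcc : Continuous fun θ => strProd k α β γ (flow k (-θ) x) :=
          hc.comp ((continuous_flow_time k x).comp continuous_neg)
        exact (hcc.integrableOn_uIcc).mono_set Set.uIoc_subset_uIcc
      · exact Filter.Eventually.of_forall fun θ => nn _
    rw [integral_eq_lintegral_of_nonneg_ae (Filter.Eventually.of_forall fun x => abs_nonneg _)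
      (contDiff_strProd k hQ hβ hγ).continuous.abs.aestronglyMeasurable]
    refine ENNReal.toReal_le_of_le_ofReal
      (mul_nonneg (abs_nonneg _) (integral_nonneg nn)) ?_
    have hcm : Continuous fun p : Heis × ℝ => strProd k α β γ (flow k (-p.2) p.1) :=
      hc.comp ((continuous_flow_uncurry k).comp
        (by fun_prop : Continuous fun p : Heis × ℝ => (-p.2, p.1)))
    calc ∫⁻ x, ENNReal.ofReal |strProd k Q β γ x|
        ≤ ∫⁻ x, ∫⁻ θ in Set.uIoc 0 s, ENNReal.ofReal (strProd k α β γ (flow k (-θ) x)) :=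
          lintegral_mono hb
      _ = ∫⁻ θ in Set.uIoc 0 s, ∫⁻ x, ENNReal.ofReal (strProd k α β γ (flow k (-θ) x)) :=
          lintegral_lintegral_swap (ENNReal.measurable_ofReal.comp hcm.measurable).aemeasurable
      _ = ∫⁻ θ in Set.uIoc 0 s, ∫⁻ x, ENNReal.ofReal (strProd k α β γ x) := by
          congr 1
          funext θ
          exact (measurePreserving_flow k (-θ)).lintegral_comp
            (ENNReal.measurable_ofReal.comp hc.measurable)
      _ = ENNReal.ofReal (|s| * ∫ x, strProd k α β γ x) := by
          rw [lintegral_const, Measure.restrict_apply_univ, ← ofReal_integral_eq_lintegral_ofReal hint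
            (Filter.Eventually.of_forall nn), Real.volume_uIoc, sub_zero, mul_comm,
            ENNReal.ofReal_mul (abs_nonneg _)]

theorem integral_flow_flow {k l : Fin 2} {s t : ℝ} {F : Heis × Heis → ℝ} (hF : Continuous F) :
    ∫ p : Heis × Heis, F (flow k s p.1, flow l t p.2) = ∫ p : Heis × Heis, F p := by
  have h : MeasurePreserving (Prod.map (flow k s) (flow l t)) (volume : Measure (Heis × Heis))
      volume := (measurePreserving_flow k s).prod (measurePreserving_flow l t)
  conv_rhs => rw [← h.map_eq]
  rw [integral_map h.measurable.aemeasurable hF.aestronglyMeasurable]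
  rfl

theorem integral_sub_sub_add {S : Type*} [MeasurableSpace S] {μ : Measure S} {a b c d : S → ℝ}
    (ha : Integrable a μ) (hb : Integrable b μ) (hc : Integrable c μ) (hd : Integrable d μ) :
    ∫ x, (a x - b x - c x + d x) ∂μ = ∫ x, a x ∂μ - ∫ x, b x ∂μ - ∫ x, c x ∂μ + ∫ x, d x ∂μ := by
  rw [integral_add (f := fun x => a x - b x - c x) ((ha.sub hb).sub hc) hd,
    integral_sub (f := fun x => a x - b x) (ha.sub hb) hc, integral_sub ha hb]

/-- The mixed difference of `V` along two horizontal lines. -/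
def mixedDiff (V : Heis → Heis → ℝ) (k l : Fin 2) (s t : ℝ) (x y : Heis) : ℝ :=
  V (flow k s x) (flow l t y) - V (flow k s x) y - V x (flow l t y) + V x y

theorem H1.nonneg {V : Heis → Heis → ℝ} {M : ℝ} (h : H1 V M) : 0 ≤ M := by
  obtain ⟨g, -, h2, -⟩ := h
  exact (Real.sqrt_nonneg _).trans (h2 0)

/-- By invariance of volume the difference operators move from V onto the test functions. There they
are X_k A and X_l B for compactly supported A and B, so (H1) rewrites the integral as that of g·A·B,
bounded by M ‖A‖₁ ‖B‖₁. -/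
theorem abs_integral_mixedDiff_le {V : Heis → Heis → ℝ} {M : ℝ} (h : H1 V M)
    (hV : Continuous fun p : Heis × Heis => V p.1 p.2) (k l : Fin 2) (s t : ℝ)
    {α β γ α' β' γ' : ℝ → ℝ}
    (hα : ContDiff ℝ ((⊤ : ℕ∞) : WithTop ℕ∞) α) (hβ : ContDiff ℝ ((⊤ : ℕ∞) : WithTop ℕ∞) β)
    (hγ : ContDiff ℝ ((⊤ : ℕ∞) : WithTop ℕ∞) γ) (cα : HasCompactSupport α)
    (cβ : HasCompactSupport β) (cγ : HasCompactSupport γ)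
    (pα : ∀ r, 0 ≤ α r) (pβ : ∀ r, 0 ≤ β r) (pγ : ∀ r, 0 ≤ γ r)
    (hα' : ContDiff ℝ ((⊤ : ℕ∞) : WithTop ℕ∞) α') (hβ' : ContDiff ℝ ((⊤ : ℕ∞) : WithTop ℕ∞) β')
    (hγ' : ContDiff ℝ ((⊤ : ℕ∞) : WithTop ℕ∞) γ') (cα' : HasCompactSupport α')
    (cβ' : HasCompactSupport β') (cγ' : HasCompactSupport γ')
    (pα' : ∀ r, 0 ≤ α' r) (pβ' : ∀ r, 0 ≤ β' r) (pγ' : ∀ r, 0 ≤ γ' r) :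
    |∫ p : Heis × Heis, mixedDiff V k l s t p.1 p.2
        * (strProd k α β γ p.1 * strProd l α' β' γ' p.2)|
      ≤ M * |s| * |t| * ∫ p : Heis × Heis, strProd k α β γ p.1 * strProd l α' β' γ' p.2 := by
  obtain ⟨A, hA, cA, XA, iA⟩ := exists_antideriv k s hα hβ hγ cα cβ cγ pα pβ pγ
  obtain ⟨B, hB, cB, XB, iB⟩ := exists_antideriv l t hα' hβ' hγ' cα' cβ' cγ' pα' pβ' pγ'
  have hM := h.nonneg
  obtain ⟨g, g1, g2, g3⟩ := h
  set Ψ := strProd k α β γ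
  set Φ := strProd l α' β' γ'
  have hΨ : Continuous Ψ := (contDiff_strProd k hα hβ hγ).continuous
  have hΦ : Continuous Φ := (contDiff_strProd l hα' hβ' hγ').continuous
  have cΨ : HasCompactSupport Ψ := hasCompactSupport_strProd k cα cβ cγ
  have cΦ : HasCompactSupport Φ := hasCompactSupport_strProd l cα' cβ' cγ'
  have nΨ : ∀ x, 0 ≤ Ψ x := fun x => mul_nonneg (mul_nonneg (pα _) (pβ _)) (pγ _)
  have nΦ : ∀ x, 0 ≤ Φ x := fun x => mul_nonneg (mul_nonneg (pα' _) (pβ' _)) (pγ' _)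
  have hcs : ∀ {a b : Heis → ℝ}, HasCompactSupport a → HasCompactSupport b →
      HasCompactSupport fun p : Heis × Heis => a p.1 * b p.2 := fun {a b} ha hb => by
    refine HasCompactSupport.intro (ha.prod hb) fun p hp => ?_
    by_contra hne
    exact hp ⟨subset_tsupport _ (left_ne_zero_of_mul hne), subset_tsupport _ (right_ne_zero_of_mul hne)⟩
  have hT := g3 k l (fun p => A p.1 * B p.2) ((hA.comp contDiff_fst).mul (hB.comp contDiff_snd))
    (hcs cA cB)
  have hX : ∀ p : Heis × Heis, X k (fun x => X l (fun y => A (x, y).1 * B (x, y).2) p.2) p.1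
      = (Ψ p.1 - Ψ (flow k (-s) p.1)) * (Φ p.2 - Φ (flow l (-t) p.2)) := fun p => by
    have e1 : (fun x => X l (fun y => A (x, y).1 * B (x, y).2) p.2) = fun x => A x * X l B p.2 := by
      funext x
      simp only [X]
      rw [fderiv_const_mul (hB.differentiable (by simp) _)]
      simp
    rw [e1]
    simp only [X]
    rw [fderiv_mul_const (hA.differentiable (by simp) _)]
    have h1 := XA p.1
    have h2 := XB p.2
    simp only [X] at h1 h2
    simp [h1, h2, mul_comm]
  simp only [hX] at hT
  -- integrability of the four terms
  have cflow : ∀ {a : Heis → ℝ} (k : Fin 2) (r : ℝ), HasCompactSupport a →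
      HasCompactSupport fun x => a (flow k r x) := fun {a} k r ha => by
    have hK : IsCompact (flow k (-r) '' tsupport a) := ha.isCompact.image (continuous_flow k _)
    refine HasCompactSupport.intro hK fun x hx => ?_
    by_contra hne
    exact hx ⟨flow k r x, subset_tsupport _ hne, by rw [flow_flow]; simp⟩
  have hI : ∀ {a b : Heis → ℝ}, Continuous a → Continuous b → HasCompactSupport a →
      HasCompactSupport b → ∀ {W : Heis × Heis → ℝ}, Continuous W →
      Integrable fun p : Heis × Heis => W p * (a p.1 * b p.2) :=
    fun {a b} ha hb hca hcb {W} hW => by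
      refine Continuous.integrable_of_hasCompactSupport (by fun_prop) ?_
      exact (hcs hca hcb).mul_left
  have hΨs : Continuous fun x => Ψ (flow k (-s) x) := hΨ.comp (continuous_flow k _)
  have hΦt : Continuous fun x => Φ (flow l (-t) x) := hΦ.comp (continuous_flow l _)
  have f1 : ∀ (r r' : ℝ), ∫ p : Heis × Heis, V p.1 p.2 * (Ψ (flow k (-r) p.1) * Φ (flow l (-r') p.2))
      = ∫ p : Heis × Heis, V (flow k r p.1) (flow l r' p.2) * (Ψ p.1 * Φ p.2) := fun r r' => by
    have := integral_flow_flow (k := k) (l := l) (s := r) (t := r')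
      (F := fun p => V p.1 p.2 * (Ψ (flow k (-r) p.1) * Φ (flow l (-r') p.2)))
      (hV.mul ((hΨ.comp ((continuous_flow k _).comp continuous_fst)).mul
        (hΦ.comp ((continuous_flow l _).comp continuous_snd))))
    rw [← this]
    simp [flow_flow]
  have hVf : ∀ r r', Continuous fun p : Heis × Heis => V (flow k r p.1) (flow l r' p.2) := fun r r' =>
    hV.comp (((continuous_flow k r).comp continuous_fst).prodMk
      ((continuous_flow l r').comp continuous_snd))
  have hVf1 : ∀ r, Continuous fun p : Heis × Heis => V (flow k r p.1) p.2 := fun r => by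
    simpa using hVf r 0
  have hVf2 : ∀ r, Continuous fun p : Heis × Heis => V p.1 (flow l r p.2) := fun r => by
    simpa using hVf 0 r
  have key : ∫ p : Heis × Heis, mixedDiff V k l s t p.1 p.2 * (Ψ p.1 * Φ p.2)
      = ∫ p : Heis × Heis, V p.1 p.2 * ((Ψ p.1 - Ψ (flow k (-s) p.1)) * (Φ p.2 - Φ (flow l (-t) p.2))) := by
    have e1 := f1 s t
    have e2 := f1 s 0
    have e3 := f1 0 t
    simp only [neg_zero, flow_zero] at e2 e3
    have i0 := hI hΨ hΦ cΨ cΦ hV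
    have i1 := hI hΨs hΦ (cflow k _ cΨ) cΦ hV
    have i2 := hI hΨ hΦt cΨ (cflow l _ cΦ) hV
    have i3 := hI hΨs hΦt (cflow k _ cΨ) (cflow l _ cΦ) hV
    have j1 := hI hΨ hΦ cΨ cΦ (hVf s t)
    have j2 := hI hΨ hΦ cΨ cΦ (hVf1 s)
    have j3 := hI hΨ hΦ cΨ cΦ (hVf2 t)
    calc _ = ∫ p : Heis × Heis, (V (flow k s p.1) (flow l t p.2) * (Ψ p.1 * Φ p.2)
          - V (flow k s p.1) p.2 * (Ψ p.1 * Φ p.2) - V p.1 (flow l t p.2) * (Ψ p.1 * Φ p.2)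
          + V p.1 p.2 * (Ψ p.1 * Φ p.2)) := by
          congr 1; funext p; unfold mixedDiff; ring
      _ = _ := by
          rw [integral_sub_sub_add j1 j2 j3 i0, ← e1, ← e2, ← e3, ← integral_sub_sub_add i3 i1 i2 i0]
          congr 1; funext p; ring
  rw [key, hT]
  have hg : ∀ p, |g k l p| ≤ M := fun p => by
    refine le_trans ?_ (g2 p)
    rw [← Real.sqrt_sq_eq_abs]
    apply Real.sqrt_le_sqrt
    calc g k l p ^ 2 ≤ ∑ l, g k l p ^ 2 :=
          Finset.single_le_sum (f := fun l => g k l p ^ 2) (fun _ _ => sq_nonneg _) (Finset.mem_univ l)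
      _ ≤ _ := Finset.single_le_sum (f := fun k => ∑ l, g k l p ^ 2)
          (fun _ _ => Finset.sum_nonneg fun _ _ => sq_nonneg _) (Finset.mem_univ k)
  have hAB : Integrable fun p : Heis × Heis => |A p.1| * |B p.2| := by
    have iA' : Integrable A := hA.continuous.integrable_of_hasCompactSupport cA
    have iB' : Integrable B := hB.continuous.integrable_of_hasCompactSupport cB
    exact iA'.norm.mul_prod iB'.norm
  calc |∫ p : Heis × Heis, g k l p * (A p.1 * B p.2)|
      ≤ ∫ p : Heis × Heis, M * (|A p.1| * |B p.2|) := by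
        rw [← Real.norm_eq_abs]
        refine norm_integral_le_of_norm_le (hAB.const_mul M) (Filter.Eventually.of_forall fun p => ?_)
        rw [Real.norm_eq_abs, abs_mul, abs_mul]
        exact mul_le_mul_of_nonneg_right (hg p) (by positivity)
    _ = M * ((∫ x, |A x|) * ∫ y, |B y|) := by
        rw [integral_const_mul]
        congr 1
        exact integral_prod_mul (μ := (volume : Measure Heis)) (ν := (volume : Measure Heis))
          (fun x => |A x|) (fun y => |B y|)
    _ ≤ M * ((|s| * ∫ x, Ψ x) * (|t| * ∫ x, Φ x)) := by
        gcongr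
        exact mul_nonneg (abs_nonneg _) (integral_nonneg nΨ)
    _ = _ := by
        have : ∫ p : Heis × Heis, Ψ p.1 * Φ p.2 = (∫ x, Ψ x) * ∫ x, Φ x :=
          integral_prod_mul (μ := (volume : Measure Heis)) (ν := (volume : Measure Heis)) Ψ Φ
        rw [this]; ring

/-- The mixed difference is continuous. If it exceeded the bound at a point it would do so on a
neighbourhood, and a product test function supported there would contradict the integrated estimate.
-/
theorem abs_mixedDiff_le {V : Heis → Heis → ℝ} {M : ℝ} (h : H1 V M)
    (hV : Continuous fun p : Heis × Heis => V p.1 p.2) (k l : Fin 2) (s t : ℝ) (x y : Heis) :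
    |mixedDiff V k l s t x y| ≤ M * |s| * |t| := by
  by_contra! hlt
  have hVf : ∀ r r', Continuous fun p : Heis × Heis => V (flow k r p.1) (flow l r' p.2) := fun r r' =>
    hV.comp (((continuous_flow k r).comp continuous_fst).prodMk
      ((continuous_flow l r').comp continuous_snd))
  have hD : Continuous fun p : Heis × Heis => mixedDiff V k l s t p.1 p.2 := by
    have h1 := hVf s t
    have h2 := hVf s 0
    have h3 := hVf 0 t
    simp only [flow_zero] at h2 h3
    exact ((h1.sub h2).sub h3).add hV
  obtain ⟨e, he, hes⟩ : ∃ e : ℝ, |e| = 1 ∧ M * |s| * |t| < e * mixedDiff V k l s t x y := by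
    rcases abs_cases (mixedDiff V k l s t x y) with ⟨h1, -⟩ | ⟨h1, -⟩
    · exact ⟨1, by simp, by rw [one_mul, ← h1]; exact hlt⟩
    · exact ⟨-1, by simp, by rw [neg_one_mul, ← h1]; exact hlt⟩
  obtain ⟨m, hm1, hm2⟩ := exists_between hes
  have hcont : Continuous fun p : Heis × Heis => e * mixedDiff V k l s t p.1 p.2 := by fun_prop
  have hU : {p : Heis × Heis | m < e * mixedDiff V k l s t p.1 p.2} ∈ nhds (x, y) :=
    (isOpen_lt continuous_const hcont).mem_nhds hm2
  rw [nhds_prod_eq, Filter.mem_prod_iff] at hU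
  obtain ⟨U₁, hU₁, U₂, hU₂, hUU⟩ := hU
  obtain ⟨α, β, γ, hα, hβ, hγ, cα, cβ, cγ, pα, pβ, pγ, pos, sup⟩ := exists_strProd k x hU₁
  obtain ⟨α', β', γ', hα', hβ', hγ', cα', cβ', cγ', pα', pβ', pγ', pos', sup'⟩ :=
    exists_strProd l y hU₂
  have main := abs_integral_mixedDiff_le h hV k l s t hα hβ hγ cα cβ cγ pα pβ pγ hα' hβ' hγ' cα'
    cβ' cγ' pα' pβ' pγ'
  set Ψ := strProd k α β γ
  set Φ := strProd l α' β' γ'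
  have hΨ : Continuous Ψ := (contDiff_strProd k hα hβ hγ).continuous
  have hΦ : Continuous Φ := (contDiff_strProd l hα' hβ' hγ').continuous
  have cΨ : HasCompactSupport Ψ := hasCompactSupport_strProd k cα cβ cγ
  have cΦ : HasCompactSupport Φ := hasCompactSupport_strProd l cα' cβ' cγ'
  have nΨ : ∀ x, 0 ≤ Ψ x := fun x => mul_nonneg (mul_nonneg (pα _) (pβ _)) (pγ _)
  have nΦ : ∀ x, 0 ≤ Φ x := fun x => mul_nonneg (mul_nonneg (pα' _) (pβ' _)) (pγ' _)
  have hcs : HasCompactSupport fun p : Heis × Heis => Ψ p.1 * Φ p.2 := by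
    refine HasCompactSupport.intro (cΨ.prod cΦ) fun p hp => ?_
    by_contra hne
    exact hp ⟨subset_tsupport _ (left_ne_zero_of_mul hne), subset_tsupport _ (right_ne_zero_of_mul hne)⟩
  have hcc : Continuous fun p : Heis × Heis => Ψ p.1 * Φ p.2 := by fun_prop
  have hint : Integrable fun p : Heis × Heis => Ψ p.1 * Φ p.2 :=
    hcc.integrable_of_hasCompactSupport hcs
  have hpos : 0 < ∫ p : Heis × Heis, Ψ p.1 * Φ p.2 := by
    refine hcc.integral_pos_of_hasCompactSupport_nonneg_nonzero hcs
      (fun p => mul_nonneg (nΨ _) (nΦ _)) (x := (x, y)) ?_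
    exact (mul_pos pos pos').ne'
  have hint2 : Integrable fun p : Heis × Heis => mixedDiff V k l s t p.1 p.2 * (Ψ p.1 * Φ p.2) :=
    (hD.mul hcc).integrable_of_hasCompactSupport hcs.mul_left
  have low : m * ∫ p : Heis × Heis, Ψ p.1 * Φ p.2
      ≤ e * ∫ p : Heis × Heis, mixedDiff V k l s t p.1 p.2 * (Ψ p.1 * Φ p.2) := by
    rw [← integral_const_mul, ← integral_const_mul]
    refine integral_mono (hint.const_mul m) (hint2.const_mul e) fun p => ?_
    simp only
    by_cases hz : Ψ p.1 * Φ p.2 = 0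
    · simp [hz]
    · have hp : m < e * mixedDiff V k l s t p.1 p.2 :=
        hUU ⟨sup _ (left_ne_zero_of_mul hz), sup' _ (right_ne_zero_of_mul hz)⟩
      rw [← mul_assoc e]
      exact mul_le_mul_of_nonneg_right hp.le (mul_nonneg (nΨ _) (nΦ _))
  have up : e * ∫ p : Heis × Heis, mixedDiff V k l s t p.1 p.2 * (Ψ p.1 * Φ p.2)
      ≤ M * |s| * |t| * ∫ p : Heis × Heis, Ψ p.1 * Φ p.2 := by
    refine (le_abs_self _).trans ?_
    rw [abs_mul, he, one_mul]
    exact main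
  have := mul_lt_mul_of_pos_right hm1 hpos
  linarith

end HeisGibbs

/-! ### One site: from (LS_q) to concentration, covariance and perturbation estimates. -/

namespace HeisGibbs

/-! ### Entropy of bounded functions -/

section Entropy

variable {S : Type*} [MeasurableSpace S] {μ : Measure S}

/-- The entropy `μ (F log F) - μ F log μ F`. -/
def ent (μ : Measure S) (F : S → ℝ) : ℝ :=
  ∫ x, F x * Real.log (F x) ∂μ - (∫ x, F x ∂μ) * Real.log (∫ x, F x ∂μ)

theorem integrable_of_abs_le [IsFiniteMeasure μ] {F : S → ℝ} (hF : Measurable F) {B : ℝ}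
    (h : ∀ x, |F x| ≤ B) : Integrable F μ :=
  Integrable.of_bound hF.aestronglyMeasurable B (Filter.Eventually.of_forall h)

theorem exists_mul_log_bound (B : ℝ) : ∃ K, 0 ≤ K ∧ ∀ x, 0 ≤ x → x ≤ B → |x * Real.log x| ≤ K := by
  obtain ⟨K, hK⟩ := (isCompact_Icc (a := (0 : ℝ)) (b := B)).exists_bound_of_continuousOn
    Real.continuous_mul_log.continuousOn
  exact ⟨max K 0, le_max_right _ _, fun x h0 h1 => (hK x ⟨h0, h1⟩).trans (le_max_left _ _)⟩

theorem measurable_mul_log {F : S → ℝ} (hF : Measurable F) :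
    Measurable fun x => F x * Real.log (F x) :=
  Real.continuous_mul_log.measurable.comp hF

theorem integrable_mul_log [IsFiniteMeasure μ] {F : S → ℝ} (hF : Measurable F) {B : ℝ}
    (h0 : ∀ x, 0 ≤ F x) (h : ∀ x, F x ≤ B) : Integrable (fun x => F x * Real.log (F x)) μ := by
  obtain ⟨K, -, hK⟩ := exists_mul_log_bound B
  exact integrable_of_abs_le (measurable_mul_log hF) fun x => hK _ (h0 x) (h x)

theorem integrable_of_bounds [IsFiniteMeasure μ] {F : S → ℝ} (hF : Measurable F) {B : ℝ}
    (h0 : ∀ x, 0 ≤ F x) (h : ∀ x, F x ≤ B) : Integrable F μ :=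
  integrable_of_abs_le hF fun x => by rw [abs_of_nonneg (h0 x)]; exact h x

theorem mul_log_div {a m : ℝ} (hm : m ≠ 0) :
    a * Real.log (a / m) = a * Real.log a - a * Real.log m := by
  rcases eq_or_ne a 0 with rfl | ha
  · simp
  · rw [Real.log_div ha hm]; ring

theorem ent_eq_integral {F : S → ℝ} (h0 : ∀ x, 0 ≤ F x) (hi : Integrable F μ)
    (hl : Integrable (fun x => F x * Real.log (F x)) μ) :
    ent μ F = ∫ x, F x * Real.log (F x / ∫ y, F y ∂μ) ∂μ := by
  rcases eq_or_ne (∫ y, F y ∂μ) 0 with hm | hm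
  · have hz : F =ᵐ[μ] 0 := (integral_eq_zero_iff_of_nonneg h0 hi).1 hm
    rw [ent, hm]
    simp only [div_zero, Real.log_zero, mul_zero, sub_zero, integral_zero]
    rw [integral_eq_zero_of_ae]
    filter_upwards [hz] with x hx
    simp [hx]
  · simp_rw [mul_log_div hm]
    rw [integral_sub hl (hi.mul_const _), integral_mul_const, ent]

theorem ent_tendsto [IsFiniteMeasure μ] {ι : Type*} {l : Filter ι} [l.IsCountablyGenerated]
    {F : ι → S → ℝ} {F₀ : S → ℝ} {B : ℝ} (hF : ∀ n, Measurable (F n)) (h0 : ∀ n x, 0 ≤ F n x)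
    (hB : ∀ n x, F n x ≤ B) (hl : ∀ᵐ x ∂μ, Filter.Tendsto (fun n => F n x) l (nhds (F₀ x))) :
    Filter.Tendsto (fun n => ent μ (F n)) l (nhds (ent μ F₀)) := by
  obtain ⟨K, -, hK⟩ := exists_mul_log_bound B
  have h1 : Filter.Tendsto (fun n => ∫ x, F n x ∂μ) l (nhds (∫ x, F₀ x ∂μ)) := by
    refine tendsto_integral_filter_of_dominated_convergence (fun _ => B)
      (Filter.Eventually.of_forall fun n => (hF n).aestronglyMeasurable)
      (Filter.Eventually.of_forall fun n => Filter.Eventually.of_forall fun x => ?_)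
      (integrable_const _) hl
    rw [Real.norm_eq_abs, abs_of_nonneg (h0 n x)]
    exact hB n x
  have h2 : Filter.Tendsto (fun n => ∫ x, F n x * Real.log (F n x) ∂μ) l
      (nhds (∫ x, F₀ x * Real.log (F₀ x) ∂μ)) := by
    refine tendsto_integral_filter_of_dominated_convergence (fun _ => K)
      (Filter.Eventually.of_forall fun n => (measurable_mul_log (hF n)).aestronglyMeasurable)
      (Filter.Eventually.of_forall fun n => Filter.Eventually.of_forall fun x => ?_)
      (integrable_const _) ?_
    · exact hK _ (h0 n x) (hB n x)
    · filter_upwards [hl] with x hx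
      exact (Real.continuous_mul_log.tendsto _).comp hx
  exact h2.sub ((Real.continuous_mul_log.tendsto _).comp h1)

/-- Convex duality between a log a and exp: this is 1 + y ≤ exp y at y = b - log(a/m). The case b =
0 gives the nonnegativity of a log(a/m) - a + m, used later with Fatou's lemma. -/
theorem young_entropy {a m b : ℝ} (ha : 0 ≤ a) (hm : 0 < m) :
    a * b ≤ a * Real.log (a / m) - a + m * Real.exp b := by
  rcases ha.eq_or_lt with rfl | ha
  · simpa using mul_nonneg hm.le (Real.exp_pos b).le
  · have h := Real.add_one_le_exp (b - Real.log (a / m))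
    rw [Real.exp_sub, Real.exp_log (by positivity), le_div_iff₀ (by positivity)] at h
    have h2 := mul_le_mul_of_nonneg_left h hm.le
    have h3 : m * ((b - Real.log (a / m) + 1) * (a / m)) = a * b - a * Real.log (a / m) + a := by
      field_simp
    linarith

/-- The entropy inequality. -/
theorem integral_mul_le_ent [IsProbabilityMeasure μ] {F ψ : S → ℝ} {B : ℝ} (hF : Measurable F)
    (h0 : ∀ x, 0 ≤ F x) (hB : ∀ x, F x ≤ B)
    (hψ : Integrable (fun x => Real.exp (ψ x)) μ) (hFψ : Integrable (fun x => F x * ψ x) μ) :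
    ∫ x, F x * ψ x ∂μ ≤ ent μ F + (∫ x, F x ∂μ) * Real.log (∫ x, Real.exp (ψ x) ∂μ) := by
  have hi : Integrable F μ := integrable_of_bounds hF h0 hB
  have hl : Integrable (fun x => F x * Real.log (F x)) μ := integrable_mul_log hF h0 hB
  have hm0 : 0 ≤ ∫ x, F x ∂μ := integral_nonneg h0
  rcases hm0.eq_or_lt with hm | hm
  · have hz : F =ᵐ[μ] 0 := (integral_eq_zero_iff_of_nonneg h0 hi).1 hm.symm
    have e1 : ∫ x, F x * ψ x ∂μ = 0 := integral_eq_zero_of_ae (by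
      filter_upwards [hz] with x hx
      simp [hx])
    have e2 : ∫ x, F x * Real.log (F x) ∂μ = 0 := integral_eq_zero_of_ae (by
      filter_upwards [hz] with x hx
      simp [hx])
    simp [ent, e1, e2, ← hm]
  · set m := ∫ x, F x ∂μ with hmdef
    set Z := ∫ x, Real.exp (ψ x) ∂μ with hZ
    have hZpos : 0 < Z := integral_exp_pos hψ
    have key : ∫ x, (F x * ψ x - F x * Real.log Z) ∂μ
        ≤ ∫ x, (F x * Real.log (F x / m) - F x + m * (Real.exp (ψ x) / Z)) ∂μ := by
      have hl' : Integrable (fun x => F x * Real.log (F x / m)) μ := by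
        simp_rw [mul_log_div hm.ne']
        exact hl.sub (hi.mul_const _)
      refine integral_mono (hFψ.sub (hi.mul_const _))
        ((hl'.sub hi).add ((hψ.div_const Z).const_mul m)) fun x => ?_
      have := young_entropy (b := ψ x - Real.log Z) (h0 x) hm
      rw [Real.exp_sub, Real.exp_log hZpos] at this
      simp only
      linarith
    rw [integral_sub hFψ (hi.mul_const _), integral_mul_const] at key
    have hl' : Integrable (fun x => F x * Real.log (F x / m)) μ := by
      simp_rw [mul_log_div hm.ne']
      exact hl.sub (hi.mul_const _)
    rw [integral_add (f := fun x => F x * Real.log (F x / m) - F x) (hl'.sub hi)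
      ((hψ.div_const Z).const_mul m), integral_sub hl' hi, integral_const_mul, integral_div,
      ← hZ, div_self hZpos.ne', ← ent_eq_integral h0 hi hl, ← hmdef] at key
    linarith

/-- From log y ≤ y - 1 the entropy is at most the variance divided by the mean, the mean is at least
δ, and the variance is the least of all second moments. The bound shows that almost constant
functions have small entropy. -/
theorem ent_le_of_lower_bound [IsProbabilityMeasure μ] {F : S → ℝ} {B δ : ℝ} (hF : Measurable F)
    (hδ : 0 < δ) (h0 : ∀ x, δ ≤ F x) (hB : ∀ x, F x ≤ B) (a : ℝ) :
    ent μ F ≤ δ⁻¹ * ∫ x, (F x - a) ^ 2 ∂μ := by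
  have hp : ∀ x, 0 ≤ F x := fun x => hδ.le.trans (h0 x)
  have hi : Integrable F μ := integrable_of_bounds hF hp hB
  have hl : Integrable (fun x => F x * Real.log (F x)) μ := integrable_mul_log hF hp hB
  have hm : δ ≤ ∫ x, F x ∂μ := by
    have := integral_mono (integrable_const δ) hi h0
    simpa using this
  set m := ∫ x, F x ∂μ with hmdef
  have hmpos : 0 < m := hδ.trans_le hm
  have hi2 : ∀ b, Integrable (fun x => (F x - b) ^ 2) μ := fun b => by
    refine integrable_of_bounds ((hF.sub_const b).pow_const 2) (B := (B + |b|) ^ 2)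
      (fun x => sq_nonneg _) fun x => ?_
    have := hp x; have := hB x; have := neg_abs_le b; have := le_abs_self b
    exact sq_le_sq' (by linarith) (by linarith)
  have him : Integrable (fun x => F x - m) μ := hi.sub (integrable_const m)
  have hz : ∫ x, (F x - m) ∂μ = 0 := by
    rw [integral_sub hi (integrable_const m)]
    simp [← hmdef]
  rw [ent_eq_integral hp hi hl, ← hmdef]
  have h1 : ∫ x, F x * Real.log (F x / m) ∂μ ≤ ∫ x, ((F x - m) + m⁻¹ * (F x - m) ^ 2) ∂μ := by
    have hl' : Integrable (fun x => F x * Real.log (F x / m)) μ := by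
      simp_rw [mul_log_div hmpos.ne']
      exact hl.sub (hi.mul_const _)
    refine integral_mono hl' (him.add ((hi2 m).const_mul _)) fun x => ?_
    have hx := hδ.trans_le (h0 x)
    have h2 := Real.log_le_sub_one_of_pos (div_pos hx hmpos)
    calc F x * Real.log (F x / m) ≤ F x * (F x / m - 1) := mul_le_mul_of_nonneg_left h2 hx.le
      _ = _ := by field_simp; ring
  rw [integral_add him ((hi2 m).const_mul _), hz, integral_const_mul, zero_add] at h1
  have h3 : ∫ x, (F x - m) ^ 2 ∂μ ≤ ∫ x, (F x - a) ^ 2 ∂μ := by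
    have e : ∫ x, (F x - a) ^ 2 ∂μ = ∫ x, ((F x - m) ^ 2 + 2 * (m - a) * (F x - m) + (m - a) ^ 2) ∂μ := by
      congr 1; funext x; ring
    rw [e, integral_add (f := fun x => (F x - m) ^ 2 + 2 * (m - a) * (F x - m))
      ((hi2 m).add (him.const_mul _)) (integrable_const _),
      integral_add (hi2 m) (him.const_mul _), integral_const_mul, hz]
    simp only [integral_const, probReal_univ, smul_eq_mul, one_mul, mul_zero, add_zero]
    nlinarith [sq_nonneg (m - a)]
  calc _ ≤ m⁻¹ * ∫ x, (F x - m) ^ 2 ∂μ := h1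
    _ ≤ δ⁻¹ * ∫ x, (F x - a) ^ 2 ∂μ := by
        have h5 : 0 ≤ ∫ x, (F x - m) ^ 2 ∂μ := integral_nonneg fun x => sq_nonneg _
        gcongr

end Entropy

end HeisGibbs

namespace HeisGibbs

/-! ### Slopes -/

/-- `G` bounds the pointwise horizontal slopes of `u`. -/
def HSlope (u G : Heis → ℝ) : Prop := ∀ (x : Heis) (k : Fin 2) (ε : ℝ), 0 < ε →
  ∀ᶠ t in nhds (0 : ℝ), |u (flow k t x) - u x| ≤ (G x + ε) * |t|

/-- The part of the difference quotient `D / |t|` exceeding `G`. -/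
def excess {S : Type*} (D : ℝ → S → ℝ) (G : S → ℝ) (t : ℝ) (s : S) : ℝ := max 0 (D t s / |t| - G s)

theorem le_add_excess {S : Type*} {D : ℝ → S → ℝ} {G : S → ℝ} {t : ℝ} (ht : t ≠ 0) (s : S) :
    D t s ≤ (G s + excess D G t s) * |t| := by
  have h := le_max_right 0 (D t s / |t| - G s)
  have ht' := abs_pos.2 ht
  rw [← div_le_iff₀ ht']
  unfold excess
  linarith

theorem excess_nonneg {S : Type*} (D : ℝ → S → ℝ) (G : S → ℝ) (t : ℝ) (s : S) :
    0 ≤ excess D G t s := le_max_left _ _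

theorem excess_le {S : Type*} {D : ℝ → S → ℝ} {G : S → ℝ} {L : ℝ} (hL : 0 ≤ L)
    (hG : ∀ s, 0 ≤ G s) (hD : ∀ t s, D t s ≤ L * |t|) (t : ℝ) (s : S) : excess D G t s ≤ L := by
  refine max_le hL ?_
  have h1 : D t s / |t| ≤ L := div_le_of_le_mul₀ (abs_nonneg t) hL (hD t s)
  linarith [hG s]

theorem measurable_excess {S : Type*} [MeasurableSpace S] {D : ℝ → S → ℝ} {G : S → ℝ}
    (hDm : ∀ t, Measurable (D t)) (hGm : Measurable G) (t : ℝ) : Measurable (excess D G t) :=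
  measurable_const.max (((hDm t).div_const _).sub hGm)

/-- Slope bounds hold only in the limit at each point. The uniform Lipschitz bound dominates the
excess, which therefore vanishes in L^q; this is how slopes are carried through integrals. -/
theorem tendsto_excess {S : Type*} [MeasurableSpace S] {μ : Measure S} [IsFiniteMeasure μ]
    {D : ℝ → S → ℝ} {G : S → ℝ} {L q : ℝ} (hq : 0 < q) (hL : 0 ≤ L)
    (hDm : ∀ t, Measurable (D t)) (hGm : Measurable G)
    (hG : ∀ s, 0 ≤ G s) (hD : ∀ t s, D t s ≤ L * |t|)
    (hs : ∀ s, ∀ ε : ℝ, 0 < ε → ∀ᶠ t in nhds (0 : ℝ), D t s ≤ (G s + ε) * |t|) :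
    Filter.Tendsto (fun t => ∫ s, excess D G t s ^ q ∂μ) (nhdsWithin 0 {0}ᶜ) (nhds 0) := by
  have h0 : ∫ _ : S, (0 : ℝ) ∂μ = 0 := by simp
  nth_rw 3 [← h0]
  refine tendsto_integral_filter_of_dominated_convergence (fun _ => L ^ q)
    (Filter.Eventually.of_forall fun t =>
      ((measurable_excess hDm hGm t).pow_const q).aestronglyMeasurable)
    (Filter.Eventually.of_forall fun t => Filter.Eventually.of_forall fun s => ?_)
    (integrable_const _) (Filter.Eventually.of_forall fun s => ?_)
  · rw [Real.norm_eq_abs, abs_of_nonneg (Real.rpow_nonneg (excess_nonneg _ _ _ _) _)]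
    exact Real.rpow_le_rpow (excess_nonneg _ _ _ _) (excess_le hL hG hD t s) hq.le
  · have h1 : Filter.Tendsto (fun t => excess D G t s) (nhdsWithin 0 {0}ᶜ) (nhds 0) := by
      rw [Metric.tendsto_nhds]
      intro ε hε
      have h2 := (hs s (ε / 2) (half_pos hε)).filter_mono (nhdsWithin_le_nhds (s := {0}ᶜ))
      filter_upwards [h2, self_mem_nhdsWithin] with t ht ht0
      rw [Real.dist_eq, sub_zero, abs_of_nonneg (excess_nonneg _ _ _ _)]
      refine lt_of_le_of_lt (max_le (half_pos hε).le ?_) (half_lt_self hε)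
      have ht' := abs_pos.2 (show t ≠ 0 from ht0)
      rw [sub_le_iff_le_add, div_le_iff₀ ht']
      linarith
    have h3 := h1.rpow_const (p := q) (Or.inr hq.le)
    rwa [Real.zero_rpow hq.ne'] at h3

theorem rpow_integral_le {S : Type*} [MeasurableSpace S] {μ : Measure S} [IsProbabilityMeasure μ]
    {G : S → ℝ} {q B : ℝ} (hq : 1 ≤ q) (hGm : Measurable G) (h0 : ∀ s, 0 ≤ G s)
    (hB : ∀ s, G s ≤ B) : (∫ s, G s ∂μ) ^ q ≤ ∫ s, G s ^ q ∂μ := by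
  refine (convexOn_rpow hq).map_integral_le (f := G) ?_ isClosed_Ici
    (Filter.Eventually.of_forall h0) (integrable_of_bounds hGm h0 hB) ?_
  · exact (Real.continuous_rpow_const (by linarith)).continuousOn
  · exact integrable_of_bounds (hGm.pow_const q) (fun s => Real.rpow_nonneg (h0 s) q)
      (B := B ^ q) fun s => Real.rpow_le_rpow (h0 s) (hB s) (by linarith)

theorem integral_comp_of_measurePreserving {S T : Type*} [MeasurableSpace S] [MeasurableSpace T]
    {μ : Measure S} {ν : Measure T} {g : S → T} (hg : MeasurePreserving g μ ν) {f : T → ℝ}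
    (hf : Measurable f) : ∫ x, f (g x) ∂μ = ∫ y, f y ∂ν := by
  rw [← hg.map_eq, integral_map hg.measurable.aemeasurable hf.aestronglyMeasurable]

/-! ### Averages over small left translations -/

/-- The average of `u` over left translations. -/
def lavg (π : Measure Heis) (u : Heis → ℝ) (x : Heis) : ℝ := ∫ h, u (lmul (-h) x) ∂π

theorem measurable_lmul_neg_uncurry :
    Measurable fun p : Heis × Heis => lmul (-p.1) p.2 :=
  (continuous_lmul_uncurry.comp
    (by fun_prop : Continuous fun p : Heis × Heis => (-p.1, p.2))).measurable

theorem measurable_lavg (π : Measure Heis) [SFinite π] {u : Heis → ℝ} (hu : Measurable u) :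
    Measurable (lavg π u) := by
  have h : Measurable fun p : Heis × Heis => u (lmul (-p.2) p.1) :=
    hu.comp (measurable_lmul_neg_uncurry.comp measurable_swap)
  exact (h.stronglyMeasurable.integral_prod_right (ν := π)).measurable

/-- Translations commute with the flow, so a difference quotient of the average is the average of
difference quotients of u. These are at most G plus the excess, whose average tends to 0. -/
theorem abs_X_lavg_le (π : Measure Heis) [IsProbabilityMeasure π] {u G : Heis → ℝ} {L B : ℝ}
    (hu : HLip L u) (hB : ∀ x, |u x| ≤ B) (hGm : Measurable G) (hG0 : ∀ x, 0 ≤ G x)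
    (hGB : ∀ x, G x ≤ B) (hs : HSlope u G) (k : Fin 2) (x : Heis)
    (hd : DifferentiableAt ℝ (lavg π u) x) : |X k (lavg π u) x| ≤ lavg π G x := by
  have hum : Measurable u := hu.continuous.measurable
  have hlm : Measurable fun h => lmul (-h) x :=
    measurable_lmul_neg_uncurry.comp (measurable_id.prodMk measurable_const)
  set D : ℝ → Heis → ℝ := fun t h => |u (flow k t (lmul (-h) x)) - u (lmul (-h) x)|
  set G' : Heis → ℝ := fun h => G (lmul (-h) x)
  have hDm : ∀ t, Measurable (D t) := fun t =>
    ((hum.comp ((continuous_flow k t).measurable.comp hlm)).sub (hum.comp hlm)).abs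
  have hG'm : Measurable G' := hGm.comp hlm
  have hD : ∀ t h, D t h ≤ L * |t| := fun t h => hu _ _ _
  have htend := tendsto_excess (μ := π) (q := 1) one_pos hu.nonneg hDm hG'm (fun h => hG0 _) hD
    (fun h ε hε => hs _ k ε hε)
  simp only [Real.rpow_one] at htend
  have hder : HasDerivAt (fun s => lavg π u (flow k s x)) (X k (lavg π u) x) 0 := by
    have := hasDerivAt_comp_flow k 0 (f := lavg π u) (x := x) (by simpa using hd)
    rwa [flow_zero] at this
  have h1 := hder.tendsto_slope.abs
  have h2 : Filter.Tendsto (fun t => lavg π G x + ∫ h, excess D G' t h ∂π) (nhdsWithin 0 {0}ᶜ)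
      (nhds (lavg π G x + 0)) := htend.const_add _
  rw [add_zero] at h2
  refine le_of_tendsto_of_tendsto h1 h2 ?_
  filter_upwards [self_mem_nhdsWithin] with t ht
  have ht0 : t ≠ 0 := ht
  have ht' := abs_pos.2 ht0
  have hiu : ∀ y : Heis, Integrable (fun h => u (lmul (-h) y)) π := fun y =>
    integrable_of_abs_le (hum.comp
      (measurable_lmul_neg_uncurry.comp (measurable_id.prodMk measurable_const))) fun h => hB _
  have hiG : Integrable G' π := integrable_of_bounds hG'm (fun h => hG0 _) fun h => hGB _
  have hie : Integrable (excess D G' t) π :=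
    integrable_of_bounds (measurable_excess hDm hG'm t) (excess_nonneg _ _ _)
      (excess_le hu.nonneg (fun h => hG0 _) hD t)
  rw [slope_def_field, sub_zero, abs_div, div_le_iff₀ ht', flow_zero]
  have e : lavg π u (flow k t x) - lavg π u x
      = ∫ h, (u (flow k t (lmul (-h) x)) - u (lmul (-h) x)) ∂π := by
    have := integral_sub (hiu (flow k t x)) (hiu x)
    simp only [lmul_flow] at this
    rw [this, lavg, lavg]
    simp only [lmul_flow]
  rw [e]
  calc _ ≤ ∫ h, D t h ∂π := abs_integral_le_integral_abs
    _ ≤ ∫ h, (G' h + excess D G' t h) * |t| ∂π := by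
        refine integral_mono ?_ ((hiG.add hie).mul_const _) fun h => le_add_excess ht0 h
        exact integrable_of_bounds (hDm t) (fun h => abs_nonneg _) (hD t)
    _ = _ := by
        rw [integral_mul_const, integral_add hiG hie]
        rfl

/-! ### Smoothness of averages -/

section Bump

variable {E : Type*} [NormedAddCommGroup E] [NormedSpace ℝ E] [FiniteDimensional ℝ E]
  [MeasureSpace E] [BorelSpace E]

/-- The measure with a smooth density concentrated in a ball around the origin. -/
def bumpMeasure (b : ContDiffBump (0 : E)) : Measure E :=
  volume.withDensity fun h => ENNReal.ofReal (b.normed volume h)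

instance [(volume : Measure E).IsAddHaarMeasure] (b : ContDiffBump (0 : E)) : IsProbabilityMeasure (bumpMeasure b) := by
  constructor
  rw [bumpMeasure, withDensity_apply _ MeasurableSet.univ, Measure.restrict_univ,
    ← ofReal_integral_eq_lintegral_ofReal b.integrable_normed
      (Filter.Eventually.of_forall fun x => b.nonneg_normed x), b.integral_normed,
    ENNReal.ofReal_one]

theorem integral_bumpMeasure (b : ContDiffBump (0 : E)) (f : E → ℝ) :
    ∫ h, f h ∂(bumpMeasure b) = ∫ h, b.normed volume h * f h := by
  rw [bumpMeasure, integral_withDensity_eq_integral_toReal_smul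
    (f := fun h => ENNReal.ofReal (b.normed volume h))
    (ENNReal.measurable_ofReal.comp b.continuous_normed.measurable)
    (Filter.Eventually.of_forall fun x => ENNReal.ofReal_lt_top)]
  congr 1
  funext h
  rw [ENNReal.toReal_ofReal (b.nonneg_normed h), smul_eq_mul]

theorem ae_bumpMeasure [(volume : Measure E).IsAddHaarMeasure] (b : ContDiffBump (0 : E)) : ∀ᵐ h ∂(bumpMeasure b), ‖h‖ < b.rOut := by
  rw [bumpMeasure, ae_withDensity_iff (f := fun h => ENNReal.ofReal (b.normed volume h))
    (ENNReal.measurable_ofReal.comp b.continuous_normed.measurable)]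
  refine Filter.Eventually.of_forall fun h hh => ?_
  have h1 : h ∈ Function.support (b.normed volume) := fun h0 => hh (by rw [h0, ENNReal.ofReal_zero])
  rw [b.support_normed_eq] at h1
  simpa using h1

end Bump

/-- The substitution h = x y⁻¹ moves the dependence on x from u into the smooth kernel. -/
theorem lavg_bumpMeasure (b : ContDiffBump (0 : Heis)) {u : Heis → ℝ} (hu : Measurable u) (x : Heis) :
    lavg (bumpMeasure b) u x = ∫ y, b.normed volume (lmul x (-y)) * u y := by
  have hm : Measurable fun y => b.normed volume (lmul x (-y)) * u y :=
    (b.continuous_normed.comp ((continuous_lmul x).comp continuous_neg)).measurable.mul hu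
  rw [lavg, integral_bumpMeasure, ← integral_comp_of_measurePreserving (measurePreserving_lmul_neg x) hm]
  congr 1
  funext h
  have : lmul x (-lmul (-h) x) = h := by
    ext i; fin_cases i <;> simp [lmul]; ring
  rw [this]

theorem contDiff_lavg_bumpMeasure (b : ContDiffBump (0 : Heis)) {u : Heis → ℝ} (hu : Continuous u) :
    ContDiff ℝ ((⊤ : ℕ∞) : WithTop ℕ∞) (lavg (bumpMeasure b) u) := by
  rw [contDiff_iff_contDiffAt]
  intro x₀
  set R := ‖x₀‖ + 1
  have hR : 0 ≤ R := by positivity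
  -- A kernel with parameter p whose value at p = x, z = x - y is the density at x y⁻¹. The group
  -- average becomes a Euclidean convolution with a parameter, and for p in a ball the kernels are
  -- supported in one compact set.
  set g : Heis → Heis → ℝ := fun p z => b.normed volume (lmul p (z - p))
  have hb := b.rOut_pos
  have hlm : ContDiff ℝ ((⊤ : ℕ∞) : WithTop ℕ∞) fun q : Heis × Heis => lmul q.1 (q.2 - q.1) := by
    rw [contDiff_pi]
    intro i
    fin_cases i <;> simp [lmul] <;> fun_prop
  have hg : ContDiff ℝ ((⊤ : ℕ∞) : WithTop ℕ∞) (Function.HasUncurry.uncurry g) :=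
    b.contDiff_normed.comp hlm
  have hk : IsCompact (Metric.closedBall (0 : Heis) (b.rOut * (1 + R))) := isCompact_closedBall _ _
  have key := contDiffOn_convolution_right_with_param_comp (𝕜 := ℝ) (n := ⊤) (μ := volume)
    (ContinuousLinearMap.lsmul ℝ ℝ) (s := Metric.ball (0 : Heis) R) (v := fun x => x)
    contDiffOn_id (f := u) (g := g) Metric.isOpen_ball hk ?_ hu.locallyIntegrable hg.contDiffOn
  · have hmem : Metric.ball (0 : Heis) R ∈ nhds x₀ :=
      Metric.isOpen_ball.mem_nhds (by simp [R])
    have h1 := key.contDiffAt hmem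
    refine h1.congr_of_eventuallyEq (Filter.Eventually.of_forall fun x => ?_)
    simp only [convolution, ContinuousLinearMap.lsmul_apply, smul_eq_mul, g]
    rw [lavg_bumpMeasure b hu.measurable]
    congr 1
    funext y
    rw [mul_comm, show x - y - x = -y by abel]
  · intro p z hp hz
    by_contra hne
    apply hz
    have h1 : lmul p (z - p) ∈ Function.support (b.normed volume) := hne
    rw [b.support_normed_eq, mem_ball_zero_iff, pi_norm_lt_iff hb] at h1
    rw [mem_ball_zero_iff] at hp
    have hp0 : |p 0| ≤ R := (norm_le_pi_norm p 0).trans hp.le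
    have hp1 : |p 1| ≤ R := (norm_le_pi_norm p 1).trans hp.le
    have a0 := h1 0
    have a1 := h1 1
    have a2 := h1 2
    simp only [lmul, Matrix.cons_val_zero, Pi.sub_apply, add_sub_cancel, Real.norm_eq_abs,
      Matrix.cons_val_one, Matrix.cons_val] at a0 a1 a2
    rw [mem_closedBall_zero_iff, pi_norm_le_iff_of_nonneg (by positivity)]
    have hbR : b.rOut ≤ b.rOut * (1 + R) := by nlinarith
    intro i
    fin_cases i
    · exact a0.le.trans hbR
    · exact a1.le.trans hbR
    · simp only [Fin.reduceFinMk, Real.norm_eq_abs]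
      have e : z 2 = (z 2 + (p 0 * (z 1 - p 1) - p 1 * (z 0 - p 0)) / 2)
          - (p 0 * z 1 - p 1 * z 0) / 2 := by ring
      have m0 : |p 0 * z 1| ≤ R * b.rOut := by
        rw [abs_mul]; exact mul_le_mul hp0 a1.le (abs_nonneg _) hR
      have m1 : |p 1 * z 0| ≤ R * b.rOut := by
        rw [abs_mul]; exact mul_le_mul hp1 a0.le (abs_nonneg _) hR
      rw [abs_le] at m0 m1 ⊢
      rw [abs_lt] at a2
      constructor <;> linarith

end HeisGibbs

namespace HeisGibbs

/-! ### Extension of the single site inequality to Lipschitz functions -/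

theorem tendsto_lmul_neg (x : Heis) : Filter.Tendsto (fun h => lmul (-h) x) (nhds 0) (nhds x) := by
  have : Continuous fun h : Heis => lmul (-h) x :=
    continuous_lmul_uncurry.comp (by fun_prop : Continuous fun h : Heis => (-h, x))
  simpa using this.tendsto 0

theorem tendsto_lmul (x : Heis) : Filter.Tendsto (fun h => lmul h x) (nhds 0) (nhds x) := by
  have : Continuous fun h : Heis => lmul h x :=
    continuous_lmul_uncurry.comp (by fun_prop : Continuous fun h : Heis => (h, x))
  simpa using this.tendsto 0

/-- Scheffé's argument: m and its translate have the same mass, so their L¹ distance is twice the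
integral of the positive part of the difference, which m dominates. -/
theorem tendsto_integral_abs_translate_sub {m : Heis → ℝ} (hm : Continuous m) (h0 : ∀ x, 0 ≤ m x)
    (hi : Integrable m) :
    Filter.Tendsto (fun h => ∫ y, |m (lmul h y) - m y|) (nhds 0) (nhds 0) := by
  have hmt : ∀ h, Continuous fun y => m (lmul h y) := fun h => hm.comp (continuous_lmul h)
  have hit : ∀ h, Integrable fun y => m (lmul h y) := fun h =>
    (measurePreserving_lmul h).integrable_comp_of_integrable hi
  have e : ∀ h, ∫ y, |m (lmul h y) - m y| = 2 * ∫ y, max (m y - m (lmul h y)) 0 := fun h => by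
    have hmax : Integrable fun y => max (m y - m (lmul h y)) 0 := (hi.sub (hit h)).pos_part
    have h1 : ∀ y, |m (lmul h y) - m y|
        = 2 * max (m y - m (lmul h y)) 0 + (m (lmul h y) - m y) := fun y => by
      rcases le_total (m y) (m (lmul h y)) with h | h
      · rw [abs_of_nonneg (by linarith), max_eq_right (by linarith)]; ring
      · rw [abs_of_nonpos (by linarith), max_eq_left (by linarith)]; ring
    simp_rw [h1]
    have hsub : Integrable fun y => m (lmul h y) - m y := (hit h).sub hi
    rw [integral_add (hmax.const_mul 2) hsub, integral_sub (hit h) hi,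
      integral_comp_of_measurePreserving (measurePreserving_lmul h) hm.measurable, sub_self,
      add_zero, integral_const_mul]
  simp_rw [e]
  have h2 : Filter.Tendsto (fun h => ∫ y, max (m y - m (lmul h y)) 0) (nhds 0)
      (nhds (∫ _ : Heis, (0 : ℝ))) := by
    refine tendsto_integral_filter_of_dominated_convergence m
      (Filter.Eventually.of_forall fun h =>
        ((hm.sub (hmt h)).max continuous_const).aestronglyMeasurable)
      (Filter.Eventually.of_forall fun h => Filter.Eventually.of_forall fun y => ?_)
      hi (Filter.Eventually.of_forall fun y => ?_)
    · rw [Real.norm_eq_abs, abs_of_nonneg (le_max_right _ _)]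
      exact max_le (by linarith [h0 (lmul h y)]) (h0 y)
    · have h3 : Filter.Tendsto (fun h => m (lmul h y)) (nhds 0) (nhds (m y)) :=
        (hm.tendsto y).comp (tendsto_lmul y)
      simpa using (h3.const_sub (m y)).max (tendsto_const_nhds (x := (0 : ℝ)))
  simpa using h2.const_mul 2

/-- G is only bounded and measurable, so the translation is moved onto the continuous density. -/
theorem tendsto_integral_translate {W : Heis → ℝ} (hW : Continuous W)
    (hi : Integrable fun x => Real.exp (W x)) {G : Heis → ℝ} (hG : Measurable G) {B : ℝ}
    (hB : ∀ x, |G x| ≤ B) :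
    Filter.Tendsto (fun h => ∫ x, G (lmul (-h) x) ∂(volume.tilted W)) (nhds 0)
      (nhds (∫ x, G x ∂(volume.tilted W))) := by
  set m : Heis → ℝ := fun x => Real.exp (W x) / ∫ x, Real.exp (W x)
  have hZ : 0 ≤ ∫ x, Real.exp (W x) := integral_nonneg fun x => (Real.exp_pos _).le
  have hmc : Continuous m := (Real.continuous_exp.comp hW).div_const _
  have hm0 : ∀ x, 0 ≤ m x := fun x => div_nonneg (Real.exp_pos _).le hZ
  have hmi : Integrable m := hi.div_const _
  have ht := (tendsto_integral_abs_translate_sub hmc hm0 hmi).const_mul B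
  rw [mul_zero] at ht
  rw [tendsto_iff_norm_sub_tendsto_zero]
  refine squeeze_zero (fun _ => norm_nonneg _) (fun h => ?_) ht
  simp only [integral_tilted, smul_eq_mul]
  have h1 : ∫ x, m x * G (lmul (-h) x) = ∫ y, m (lmul h y) * G y := by
    rw [← integral_comp_of_measurePreserving (f := fun x => m x * G (lmul (-h) x))
      (measurePreserving_lmul h) (hmc.measurable.mul (hG.comp (continuous_lmul (-h)).measurable))]
    simp only [lmul_neg_lmul]
  have hit : Integrable fun y => m (lmul h y) :=
    (measurePreserving_lmul h).integrable_comp_of_integrable hmi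
  have hb : ∀ᵐ x ∂(volume : Measure Heis), ‖G x‖ ≤ B := Filter.Eventually.of_forall hB
  change ‖(∫ x, m x * G (lmul (-h) x)) - ∫ x, m x * G x‖ ≤ _
  rw [h1, ← integral_sub (hit.mul_bdd hG.aestronglyMeasurable hb)
    (hmi.mul_bdd hG.aestronglyMeasurable hb), ← integral_const_mul]
  refine norm_integral_le_of_norm_le (((hit.sub hmi).abs).const_mul B)
    (Filter.Eventually.of_forall fun y => ?_)
  rw [← sub_mul, Real.norm_eq_abs, abs_mul, mul_comm]
  exact mul_le_mul_of_nonneg_right (hB y) (abs_nonneg _)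

/-- The inequality `(LS_q)` with slopes, for bounded Lipschitz functions. -/
def LSLip (μ : Measure Heis) (q C : ℝ) : Prop :=
  ∀ (u G : Heis → ℝ) (L B : ℝ), HLip L u → (∀ x, |u x| ≤ B) → Measurable G → (∀ x, 0 ≤ G x) →
    (∀ x, G x ≤ B) → HSlope u G → ent μ (fun x => |u x| ^ q) ≤ C * ∫ x, G x ^ q ∂μ

/-- Mollified functions are smooth, and each of the two horizontal derivatives is at most the
average of G. The Euclidean length costs √2, and (√2)^q ≤ 2 is the factor in the constant 2c.
Jensen's inequality puts the power q inside the average. -/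
theorem LSHeis.lsLip {W : Heis → ℝ} (hW : Continuous W) (hi : Integrable fun x => Real.exp (W x))
    {q c : ℝ} (hq₁ : 1 < q) (hq₂ : q ≤ 2) (hc : 0 ≤ c) (h : LSHeis (volume.tilted W) q c) :
    LSLip (volume.tilted W) q (2 * c) := by
  intro u G L B hu hB hGm hG0 hGB hs
  have hq0 : 0 < q := by linarith
  have hB0 : 0 ≤ B := (abs_nonneg _).trans (hB 0)
  have : IsProbabilityMeasure (volume.tilted W) := isProbabilityMeasure_tilted hi
  set μ := (volume : Measure Heis).tilted W
  have huc := hu.continuous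
  -- powers
  have hpow : ∀ {v : Heis → ℝ}, Measurable v → Measurable fun x => |v x| ^ q := fun hv =>
    hv.abs.pow_const q
  have hGq : Measurable fun x => G x ^ q := hGm.pow_const q
  have hGq0 : ∀ x, 0 ≤ G x ^ q := fun x => Real.rpow_nonneg (hG0 x) q
  have hGqB : ∀ x, G x ^ q ≤ B ^ q := fun x => Real.rpow_le_rpow (hG0 x) (hGB x) hq0.le
  let b : ℕ → ContDiffBump (0 : Heis) := fun n =>
    ⟨1 / (n + 1) / 2, 1 / (n + 1), by positivity, half_lt_self (by positivity)⟩
  have hbr : Filter.Tendsto (fun n => (b n).rOut) Filter.atTop (nhds 0) :=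
    tendsto_one_div_add_atTop_nhds_zero_nat
  set v : ℕ → Heis → ℝ := fun n => lavg (bumpMeasure (b n)) u
  have hvs : ∀ n, ContDiff ℝ ((⊤ : ℕ∞) : WithTop ℕ∞) (v n) := fun n =>
    contDiff_lavg_bumpMeasure (b n) huc
  have hvB : ∀ n x, |v n x| ≤ B := fun n x => by
    have := norm_integral_le_of_norm_le_const (μ := bumpMeasure (b n))
      (f := fun h => u (lmul (-h) x)) (C := B) (Filter.Eventually.of_forall fun h => hB _)
    simpa [v, lavg] using this
  have hvm : ∀ n, Measurable (v n) := fun n => (hvs n).continuous.measurable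
  have hlim : ∀ x, Filter.Tendsto (fun n => v n x) Filter.atTop (nhds (u x)) := fun x => by
    have h1 : Filter.Tendsto (fun h => u (lmul (-h) x)) (nhds 0) (nhds (u x)) :=
      (huc.tendsto x).comp (tendsto_lmul_neg x)
    rw [Metric.tendsto_nhds] at h1 ⊢
    intro ε hε
    obtain ⟨δ, hδ, hδ'⟩ := Metric.eventually_nhds_iff.1 (h1 (ε / 2) (half_pos hε))
    filter_upwards [hbr.eventually (gt_mem_nhds hδ)] with n hn
    refine lt_of_le_of_lt ?_ (half_lt_self hε)
    have hum : Integrable (fun h => u (lmul (-h) x)) (bumpMeasure (b n)) :=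
      integrable_of_abs_le (huc.measurable.comp
        (measurable_lmul_neg_uncurry.comp (measurable_id.prodMk measurable_const))) fun h => hB _
    have e : v n x - u x = ∫ h, (u (lmul (-h) x) - u x) ∂(bumpMeasure (b n)) := by
      rw [integral_sub hum (integrable_const _)]
      simp [v, lavg]
    rw [Real.dist_eq, e]
    have := norm_integral_le_of_norm_le_const (μ := bumpMeasure (b n))
      (f := fun h => u (lmul (-h) x) - u x) (C := ε / 2) (by
        filter_upwards [ae_bumpMeasure (b n)] with h hh
        have := hδ' (y := h) (by simpa using hh.trans hn)
        exact this.le)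
    simpa using this
  have hent : Filter.Tendsto (fun n => ent μ fun x => |v n x| ^ q) Filter.atTop
      (nhds (ent μ fun x => |u x| ^ q)) := by
    refine ent_tendsto (B := B ^ q) (fun n => hpow (hvm n))
      (fun n x => Real.rpow_nonneg (abs_nonneg _) _)
      (fun n x => Real.rpow_le_rpow (abs_nonneg _) (hvB n x) hq0.le)
      (Filter.Eventually.of_forall fun x => ?_)
    exact (hlim x).abs.rpow_const (Or.inr hq0.le)
  -- bound of the gradients
  have hgrad : ∀ n x, subgradNorm (v n) x ^ q ≤ 2 * lavg (bumpMeasure (b n)) (fun x => G x ^ q) x := by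
    intro n x
    have hX : ∀ k, |X k (v n) x| ≤ lavg (bumpMeasure (b n)) G x := fun k =>
      abs_X_lavg_le _ hu hB hGm hG0 hGB hs k x ((hvs n).differentiable (by simp) x)
    set g := lavg (bumpMeasure (b n)) G x
    have hg0 : 0 ≤ g := integral_nonneg fun h => hG0 _
    have h1 : subgradNorm (v n) x ≤ √2 * g := by
      rw [subgradNorm, Fin.sum_univ_two]
      calc √(X 0 (v n) x ^ 2 + X 1 (v n) x ^ 2) ≤ √(2 * g ^ 2) := by
            apply Real.sqrt_le_sqrt
            have h0 := sq_le_sq' (abs_le.1 (hX 0)).1 (abs_le.1 (hX 0)).2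
            have h1 := sq_le_sq' (abs_le.1 (hX 1)).1 (abs_le.1 (hX 1)).2
            linarith
        _ = √2 * g := by rw [Real.sqrt_mul (by norm_num), Real.sqrt_sq hg0]
    have h2 : (√2 : ℝ) ^ q ≤ 2 := by
      calc (√2 : ℝ) ^ q ≤ √2 ^ (2 : ℝ) :=
            Real.rpow_le_rpow_of_exponent_le (Real.one_le_sqrt.2 (by norm_num)) hq₂
        _ = 2 := by rw [Real.rpow_two]; exact Real.sq_sqrt (by norm_num)
    calc subgradNorm (v n) x ^ q ≤ (√2 * g) ^ q :=
          Real.rpow_le_rpow (Real.sqrt_nonneg _) h1 hq0.le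
      _ = √2 ^ q * g ^ q := Real.mul_rpow (Real.sqrt_nonneg _) hg0
      _ ≤ 2 * g ^ q := mul_le_mul_of_nonneg_right h2 (Real.rpow_nonneg hg0 q)
      _ ≤ _ := by
          gcongr
          exact rpow_integral_le hq₁.le (hGm.comp (measurable_lmul_neg_uncurry.comp
            (measurable_id.prodMk measurable_const))) (fun h => hG0 _) fun h => hGB _
  have hla : ∀ n, Measurable (lavg (bumpMeasure (b n)) fun x => G x ^ q) := fun n =>
    measurable_lavg _ hGq
  have hla0 : ∀ n x, 0 ≤ lavg (bumpMeasure (b n)) (fun x => G x ^ q) x := fun n x =>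
    integral_nonneg fun h => hGq0 _
  have hlaB : ∀ n x, lavg (bumpMeasure (b n)) (fun x => G x ^ q) x ≤ B ^ q := fun n x => by
    have := norm_integral_le_of_norm_le_const (μ := bumpMeasure (b n))
      (f := fun h => G (lmul (-h) x) ^ q) (C := B ^ q) (Filter.Eventually.of_forall fun h => by
        rw [Real.norm_eq_abs, abs_of_nonneg (hGq0 _)]; exact hGqB _)
    have h2 := le_of_abs_le this
    simpa [lavg] using h2
  have hlai : ∀ n, Integrable (lavg (bumpMeasure (b n)) fun x => G x ^ q) μ := fun n =>
    integrable_of_bounds (hla n) (hla0 n) (hlaB n)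
  have hineq : ∀ n, ent μ (fun x => |v n x| ^ q)
      ≤ 2 * c * ∫ x, lavg (bumpMeasure (b n)) (fun x => G x ^ q) x ∂μ := by
    intro n
    have i1 : Integrable (fun x => |v n x| ^ q) μ :=
      integrable_of_bounds (hpow (hvm n)) (fun x => Real.rpow_nonneg (abs_nonneg _) _)
        (fun x => Real.rpow_le_rpow (abs_nonneg _) (hvB n x) hq0.le)
    have i2 : Integrable (fun x => |v n x| ^ q * Real.log (|v n x| ^ q)) μ :=
      integrable_mul_log (hpow (hvm n)) (fun x => Real.rpow_nonneg (abs_nonneg _) _)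
        (fun x => Real.rpow_le_rpow (abs_nonneg _) (hvB n x) hq0.le)
    have h1 : ∫⁻ x, ENNReal.ofReal (subgradNorm (v n) x ^ q) ∂μ
        ≤ ENNReal.ofReal (2 * ∫ x, lavg (bumpMeasure (b n)) (fun x => G x ^ q) x ∂μ) := by
      rw [← integral_const_mul, ofReal_integral_eq_lintegral_ofReal ((hlai n).const_mul 2)
        (Filter.Eventually.of_forall fun x => mul_nonneg zero_le_two (hla0 n x))]
      exact lintegral_mono fun x => ENNReal.ofReal_le_ofReal (hgrad n x)
    have h2 := (h (v n) (hvs n) i1 (ne_top_of_le_ne_top ENNReal.ofReal_ne_top h1)).2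
    rw [← ent_eq_integral (fun x => Real.rpow_nonneg (abs_nonneg _) _) i1 i2] at h2
    have h3 := h2.trans (mul_le_mul_right h1 (ENNReal.ofReal c))
    rw [← ENNReal.ofReal_mul hc] at h3
    have hnn : 0 ≤ c * (2 * ∫ x, lavg (bumpMeasure (b n)) (fun x => G x ^ q) x ∂μ) :=
      mul_nonneg hc (mul_nonneg zero_le_two (integral_nonneg (hla0 n)))
    have h4 := (ENNReal.ofReal_le_ofReal_iff hnn).1 h3
    linarith
  refine le_of_forall_pos_le_add fun ε hε => ?_
  have htr := tendsto_integral_translate hW hi hGq (B := B ^ q) fun x => by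
    rw [abs_of_nonneg (hGq0 x)]; exact hGqB x
  obtain ⟨η, hη, hηε⟩ : ∃ η : ℝ, 0 < η ∧ 2 * c * η ≤ ε := by
    refine ⟨ε / (2 * c + 1), by positivity, ?_⟩
    rw [mul_div_assoc', div_le_iff₀ (by positivity)]
    nlinarith
  obtain ⟨δ, hδ, hδ'⟩ := Metric.eventually_nhds_iff.1 ((Metric.tendsto_nhds.1 htr) η hη)
  refine le_of_tendsto hent ?_
  filter_upwards [hbr.eventually (gt_mem_nhds hδ)] with n hn
  refine (hineq n).trans ?_
  -- The integral of the averaged G^q is an average of μ-integrals of translates of G^q, which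
  -- converge although G need not be continuous.
  have hswap : ∫ x, lavg (bumpMeasure (b n)) (fun x => G x ^ q) x ∂μ
      = ∫ h, ∫ x, G (lmul (-h) x) ^ q ∂μ ∂(bumpMeasure (b n)) := by
    unfold lavg
    refine integral_integral_swap (f := fun x h => G (lmul (-h) x) ^ q) ?_
    refine integrable_of_bounds (B := B ^ q) ?_ (fun p => hGq0 _) (fun p => hGqB _)
    exact hGq.comp (measurable_lmul_neg_uncurry.comp measurable_swap)
  have hle : ∫ x, lavg (bumpMeasure (b n)) (fun x => G x ^ q) x ∂μ ≤ ∫ x, G x ^ q ∂μ + η := by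
    rw [hswap]
    have hint : Integrable (fun h => ∫ x, G (lmul (-h) x) ^ q ∂μ) (bumpMeasure (b n)) := by
      refine integrable_of_bounds (B := B ^ q) ?_ (fun h => integral_nonneg fun x => hGq0 _) fun h => ?_
      · have hm : Measurable fun p : Heis × Heis => G (lmul (-p.1) p.2) ^ q :=
          hGq.comp measurable_lmul_neg_uncurry
        exact (hm.stronglyMeasurable.integral_prod_right (ν := μ)).measurable
      · have := norm_integral_le_of_norm_le_const (μ := μ)
          (f := fun x => G (lmul (-h) x) ^ q) (C := B ^ q) (Filter.Eventually.of_forall fun h => by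
            rw [Real.norm_eq_abs, abs_of_nonneg (hGq0 _)]; exact hGqB _)
        have h2 := le_of_abs_le this
        simpa using h2
    calc _ ≤ ∫ _ : Heis, (∫ x, G x ^ q ∂μ + η) ∂(bumpMeasure (b n)) := by
          refine integral_mono_ae hint (integrable_const _) ?_
          filter_upwards [ae_bumpMeasure (b n)] with h hh
          have := hδ' (y := h) (by simpa using hh.trans hn)
          rw [Real.dist_eq, abs_lt] at this
          linarith [this.2]
      _ = _ := by simp
  calc _ ≤ 2 * c * (∫ x, G x ^ q ∂μ + η) := by gcongr
    _ ≤ _ := by linarith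

end HeisGibbs

namespace HeisGibbs

/-! ### Exponential integrability of Lipschitz functions -/

theorem HLip.comp_lipschitz {L : ℝ} {u : Heis → ℝ} (hu : HLip L u) {f : ℝ → ℝ} {K : ℝ} (hK : 0 ≤ K)
    (hf : ∀ x y, |f (u x) - f (u y)| ≤ K * |u x - u y|) : HLip (K * L) fun x => f (u x) :=
  fun x k t => by
    have h1 := hu x k t
    calc _ ≤ K * |u (flow k t x) - u x| := hf _ _
      _ ≤ K * (L * |t|) := by gcongr
      _ = K * L * |t| := by ring

theorem HSlope.of_abs_le {u v G : Heis → ℝ} (hu : HSlope u G)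
    (h : ∀ x y, |v x - v y| ≤ |u x - u y|) : HSlope v G := fun x k ε hε => by
  filter_upwards [hu x k ε hε] with t ht
  exact (h _ _).trans ht

theorem HLip.tendsto_flow {L : ℝ} {u : Heis → ℝ} (hu : HLip L u) (k : Fin 2) (x : Heis) :
    Filter.Tendsto (fun t => u (flow k t x)) (nhds 0) (nhds (u x)) := by
  have := (hu.continuous.tendsto (flow k 0 x)).comp ((continuous_flow_time k x).tendsto 0)
  rwa [flow_zero] at this

theorem HLip.slope_comp {L : ℝ} {u : Heis → ℝ} (hu : HLip L u) {f f' : ℝ → ℝ}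
    (hf : ∀ x, HasDerivAt f (f' (u x)) (u x)) :
    HSlope (fun x => f (u x)) fun x => |f' (u x)| * L := by
  intro x k ε hε
  have hL := hu.nonneg
  obtain ⟨η, hη, hηε⟩ : ∃ η : ℝ, 0 < η ∧ η * L ≤ ε := by
    refine ⟨ε / (L + 1), by positivity, ?_⟩
    rw [div_mul_eq_mul_div, div_le_iff₀ (by positivity)]
    nlinarith
  have h1 := (hf x).isLittleO.def hη
  have h2 := (hu.tendsto_flow k x).eventually h1
  filter_upwards [h2] with t ht
  simp only [smul_eq_mul, Real.norm_eq_abs] at ht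
  have h3 := hu x k t
  have h4 : |f (u (flow k t x)) - f (u x)| ≤ (|f' (u x)| + η) * |u (flow k t x) - u x| := by
    have e : f (u (flow k t x)) - f (u x) = (f (u (flow k t x)) - f (u x)
      - (u (flow k t x) - u x) * f' (u x)) + (u (flow k t x) - u x) * f' (u x) := by ring
    rw [e]
    refine (abs_add_le _ _).trans ?_
    rw [abs_mul]
    linarith
  calc _ ≤ (|f' (u x)| + η) * |u (flow k t x) - u x| := h4
    _ ≤ (|f' (u x)| + η) * (L * |t|) := by gcongr
    _ = (|f' (u x)| * L + η * L) * |t| := by ring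
    _ ≤ _ := by gcongr

theorem abs_exp_sub_exp_le {a b B : ℝ} (ha : a ≤ B) (hb : b ≤ B) :
    |Real.exp a - Real.exp b| ≤ Real.exp B * |a - b| := by
  wlog h : b ≤ a generalizing a b
  · rw [abs_sub_comm, abs_sub_comm a]
    exact this hb ha (le_of_not_ge h)
  rw [abs_of_nonneg (by linarith [Real.exp_le_exp.2 h]), abs_of_nonneg (by linarith)]
  have h1 := Real.add_one_le_exp (b - a)
  have h2 : Real.exp b = Real.exp a * Real.exp (b - a) := by rw [← Real.exp_add]; ring_nf
  have h3 : Real.exp a ≤ Real.exp B := Real.exp_le_exp.2 ha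
  calc Real.exp a - Real.exp b = Real.exp a * (1 - Real.exp (b - a)) := by rw [h2]; ring
    _ ≤ Real.exp a * (a - b) := mul_le_mul_of_nonneg_left (by linarith) (Real.exp_pos a).le
    _ ≤ _ := mul_le_mul_of_nonneg_right h3 (by linarith)

variable {μ : Measure Heis} {q C : ℝ}

/-- Apply the inequality to exp(lU/q): its q-th power is exp(lU), and its slope is at most (l/q)
exp(lU/q). The gain from (l/q)^q ≤ l^q is not kept. -/
theorem LSLip.ent_exp_le (h : LSLip μ q C) (hq : 1 < q) (hC : 0 ≤ C) {U : Heis → ℝ}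
    (hU : HLip 1 U) {B : ℝ} (hB : ∀ x, |U x| ≤ B) {l : ℝ} (hl : 0 < l) :
    ent μ (fun x => Real.exp (l * U x)) ≤ C * l ^ q * ∫ x, Real.exp (l * U x) ∂μ := by
  have hq0 : 0 < q := by linarith
  have hUB : ∀ x, U x ≤ B := fun x => (le_abs_self _).trans (hB x)
  have h1 : HLip (Real.exp (l / q * B) * (l / q) * 1) fun x => Real.exp (l / q * U x) := by
    refine hU.comp_lipschitz (f := fun s => Real.exp (l / q * s)) (by positivity) fun x y => ?_
    refine (abs_exp_sub_exp_le (B := l / q * B) ?_ ?_).trans ?_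
    · exact mul_le_mul_of_nonneg_left (hUB x) (by positivity)
    · exact mul_le_mul_of_nonneg_left (hUB y) (by positivity)
    · rw [← mul_sub, abs_mul, abs_of_pos (by positivity : 0 < l / q), mul_assoc]
  have h2 := hU.slope_comp (f := fun s => Real.exp (l / q * s))
    (f' := fun s => Real.exp (l / q * s) * (l / q)) fun x => by
      simpa using ((hasDerivAt_id (U x)).const_mul (l / q)).exp
  have hUm : Measurable U := hU.continuous.measurable
  have hexpB : ∀ x, Real.exp (l / q * U x) ≤ Real.exp (l / q * B) := fun x =>
    Real.exp_le_exp.2 (mul_le_mul_of_nonneg_left (hUB x) (by positivity))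
  have key := h _ _ _ (max (Real.exp (l / q * B)) (Real.exp (l / q * B) * (l / q))) h1
    (fun x => by
      rw [abs_of_pos (Real.exp_pos _)]
      exact (hexpB x).trans (le_max_left _ _))
    (by fun_prop) (fun x => by positivity)
    (fun x => by
      rw [mul_one, abs_of_pos (by positivity)]
      exact (mul_le_mul_of_nonneg_right (hexpB x) (by positivity)).trans (le_max_right _ _)) h2
  have e1 : ∀ x, |Real.exp (l / q * U x)| ^ q = Real.exp (l * U x) := fun x => by
    rw [abs_of_pos (Real.exp_pos _), ← Real.exp_mul]
    congr 1
    field_simp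
  have e2 : ∀ x, (|Real.exp (l / q * U x) * (l / q)| * 1) ^ q
      = (l / q) ^ q * Real.exp (l * U x) := fun x => by
    rw [mul_one, abs_mul, Real.mul_rpow (abs_nonneg _) (abs_nonneg _), e1,
      abs_of_pos (by positivity), mul_comm]
  simp only [e1, e2] at key
  rw [integral_const_mul, ← mul_assoc] at key
  refine key.trans ?_
  have h3 : (l / q) ^ q ≤ l ^ q :=
    Real.rpow_le_rpow (by positivity) (div_le_self hl.le hq.le) hq0.le
  have h4 : 0 ≤ ∫ x, Real.exp (l * U x) ∂μ := integral_nonneg fun x => (Real.exp_pos _).le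
  gcongr

theorem integrableExpSet_of_bounded [IsProbabilityMeasure μ] {U : Heis → ℝ} (hUm : Measurable U) {B : ℝ}
    (hB : ∀ x, |U x| ≤ B) : ProbabilityTheory.integrableExpSet U μ = Set.univ := by
  refine Set.eq_univ_of_forall fun t => ?_
  refine integrable_of_bounds (B := Real.exp (|t| * B)) (by fun_prop) (fun x => (Real.exp_pos _).le)
    fun x => Real.exp_le_exp.2 ?_
  calc t * U x ≤ |t * U x| := le_abs_self _
    _ = |t| * |U x| := abs_mul _ _
    _ ≤ _ := by gcongr; exact hB x

/-- Herbst's argument. -/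
theorem LSLip.herbst_bounded [IsProbabilityMeasure μ] (h : LSLip μ q C) (hq : 1 < q) (hC : 0 ≤ C) {U : Heis → ℝ}
    (hU : HLip 1 U) {B : ℝ} (hB : ∀ x, |U x| ≤ B) {l : ℝ} (hl : 0 < l) :
    ∫ x, Real.exp (l * U x) ∂μ ≤ Real.exp (l * ∫ x, U x ∂μ + C / (q - 1) * l ^ q) := by
  have hUm : Measurable U := hU.continuous.measurable
  have hset : ∀ t, t ∈ interior (ProbabilityTheory.integrableExpSet U μ) := fun t => by
    rw [integrableExpSet_of_bounded hUm hB, interior_univ]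
    trivial
  have hint : ∀ t, Integrable (fun x => Real.exp (t * U x)) μ := fun t =>
    (interior_subset (hset t) : t ∈ ProbabilityTheory.integrableExpSet U μ)
  set φ : ℝ → ℝ := ProbabilityTheory.mgf U μ with hφ
  have hφe : ∀ t, φ t = ∫ x, Real.exp (t * U x) ∂μ := fun t => rfl
  have hφpos : ∀ t, 0 < φ t := fun t => integral_exp_pos (hint t)
  have hφ' : ∀ t, HasDerivAt φ (∫ x, U x * Real.exp (t * U x) ∂μ) t := fun t =>
    ProbabilityTheory.hasDerivAt_mgf (hset t)
  set ψ : ℝ → ℝ := fun t => Real.log (φ t)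
  have hψ' : ∀ t, HasDerivAt ψ ((∫ x, U x * Real.exp (t * U x) ∂μ) / φ t) t := fun t =>
    (hφ' t).log (hφpos t).ne'
  have hψ0 : ψ 0 = 0 := by simp [ψ, hφ]
  have hent : ∀ t, 0 < t → t * (∫ x, U x * Real.exp (t * U x) ∂μ) - φ t * ψ t ≤ C * t ^ q * φ t := by
    intro t ht
    have := h.ent_exp_le hq hC hU hB ht
    rw [← hφe] at this
    rw [ent] at this
    simp only [Real.log_exp] at this
    rw [← hφe, ← integral_const_mul] at *
    have e : ∫ x, Real.exp (t * U x) * (t * U x) ∂μ = ∫ x, t * (U x * Real.exp (t * U x)) ∂μ := by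
      congr 1; funext x; ring
    rw [e] at this
    exact this
  -- The entropy bound says (ψ/t)' ≤ C t^(q-2). This is integrable at 0 because q > 1, and
  -- subtracting its primitive leaves a nonincreasing function.
  set y : ℝ → ℝ := fun t => ψ t / t - C / (q - 1) * t ^ (q - 1)
  have hy' : ∀ t, 0 < t → HasDerivAt y
      (((∫ x, U x * Real.exp (t * U x) ∂μ) / φ t * t - ψ t * 1) / t ^ 2
        - C / (q - 1) * ((q - 1) * t ^ (q - 1 - 1))) t := fun t ht =>
    ((hψ' t).div (hasDerivAt_id t) ht.ne').sub
      ((Real.hasDerivAt_rpow_const (Or.inl ht.ne')).const_mul _)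
  have hanti : AntitoneOn y (Set.Ioi 0) := by
    refine antitoneOn_of_deriv_nonpos (convex_Ioi 0)
      (fun t ht => (hy' t ht).continuousAt.continuousWithinAt)
      (fun t ht => (hy' t (interior_subset ht)).differentiableAt.differentiableWithinAt) ?_
    intro t ht
    have ht : 0 < t := interior_subset ht
    rw [(hy' t ht).deriv]
    have h1 := hent t ht
    have h2 : (∫ x, U x * Real.exp (t * U x) ∂μ) / φ t * t - ψ t * 1 ≤ C * t ^ q := by
      have h3 := div_le_div_of_nonneg_right h1 (hφpos t).le
      have h4 := (hφpos t).ne'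
      calc _ = (t * (∫ x, U x * Real.exp (t * U x) ∂μ) - φ t * ψ t) / φ t := by
              generalize ∫ x, U x * Real.exp (t * U x) ∂μ = I
              field_simp
        _ ≤ C * t ^ q * φ t / φ t := h3
        _ = C * t ^ q := by field_simp
    have h5 : t ^ q = t ^ 2 * t ^ (q - 1 - 1) := by
      rw [← Real.rpow_natCast, ← Real.rpow_add ht]
      congr 1
      push_cast
      ring
    have h6 : C / (q - 1) * ((q - 1) * t ^ (q - 1 - 1)) = C * t ^ (q - 1 - 1) := by
      have : q - 1 ≠ 0 := by linarith
      field_simp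
    rw [h6, sub_nonpos, div_le_iff₀ (by positivity)]
    rw [h5] at h2
    linarith
  -- As t decreases to 0, ψ(t)/t tends to ψ'(0), the mean of U.
  have hlim : Filter.Tendsto y (nhdsWithin 0 (Set.Ioi 0)) (nhds (∫ x, U x ∂μ - 0)) := by
    have h1 := (hψ' 0).tendsto_slope.mono_left
      (nhdsWithin_mono 0 (fun t (ht : 0 < t) => ht.ne') : nhdsWithin 0 (Set.Ioi 0) ≤ nhdsWithin (0 : ℝ) {0}ᶜ)
    have e1 : (∫ x, U x * Real.exp (0 * U x) ∂μ) / φ 0 = ∫ x, U x ∂μ := by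
      simp [hφ]
    rw [e1] at h1
    have h2 : Filter.Tendsto (fun t : ℝ => C / (q - 1) * t ^ (q - 1)) (nhdsWithin 0 (Set.Ioi 0))
        (nhds 0) := by
      have h3 : Filter.Tendsto (fun t : ℝ => C / (q - 1) * t ^ (q - 1)) (nhds 0)
          (nhds (C / (q - 1) * 0 ^ (q - 1))) :=
        (Real.continuousAt_rpow_const _ _ (Or.inr (by linarith))).tendsto.const_mul _
      rw [Real.zero_rpow (by linarith), mul_zero] at h3
      exact h3.mono_left nhdsWithin_le_nhds
    refine (h1.sub h2).congr fun t => ?_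
    rw [slope_def_field, hψ0, sub_zero, sub_zero]
  rw [sub_zero] at hlim
  have hfin : y l ≤ ∫ x, U x ∂μ := by
    refine ge_of_tendsto hlim ?_
    filter_upwards [Ioo_mem_nhdsGT hl] with t ht
    exact hanti ht.1 hl ht.2.le
  have h7 : ψ l ≤ l * ∫ x, U x ∂μ + C / (q - 1) * l ^ q := by
    have h8 : ψ l / l ≤ ∫ x, U x ∂μ + C / (q - 1) * l ^ (q - 1) := by
      simp only [y] at hfin
      linarith
    rw [div_le_iff₀ hl] at h8
    have h9 : l ^ q = l ^ (q - 1) * l := by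
      rw [Real.rpow_sub_one hl.ne']
      field_simp
    rw [h9]
    linarith
  rw [← hφe]
  calc φ l = Real.exp (ψ l) := (Real.exp_log (hφpos l)).symm
    _ ≤ _ := Real.exp_le_exp.2 h7

theorem LSLip.herbst_abs_bounded [IsProbabilityMeasure μ] (h : LSLip μ q C) (hq : 1 < q) (hC : 0 ≤ C) {U : Heis → ℝ}
    (hU : HLip 1 U) {B : ℝ} (hB : ∀ x, |U x| ≤ B) {l : ℝ} (hl : 0 < l) :
    ∫ x, Real.exp (l * |U x - ∫ y, U y ∂μ|) ∂μ ≤ 2 * Real.exp (C / (q - 1) * l ^ q) := by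
  set a := ∫ y, U y ∂μ
  have hUm : Measurable U := hU.continuous.measurable
  have hneg : HLip 1 fun x => -U x := fun x k t => by
    have := hU x k t
    rwa [← abs_neg, neg_sub_neg, neg_sub]
  have h1 := h.herbst_bounded hq hC hU hB hl
  have h2 := h.herbst_bounded hq hC hneg (B := B) (fun x => by rw [abs_neg]; exact hB x) hl
  rw [integral_neg] at h2
  have hint : ∀ (c : ℝ) (V : Heis → ℝ), Measurable V → (∀ x, |V x| ≤ B) →
      Integrable (fun x => Real.exp (l * V x) * c) μ := fun c V hV hVB => by
    refine Integrable.mul_const (integrable_of_bounds (B := Real.exp (l * B)) (by fun_prop)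
      (fun x => (Real.exp_pos _).le) fun x => Real.exp_le_exp.2 ?_) c
    exact mul_le_mul_of_nonneg_left ((le_abs_self _).trans (hVB x)) hl.le
  have i1 := hint (Real.exp (-(l * a))) U hUm hB
  have i2 := hint (Real.exp (l * a)) (fun x => -U x) hUm.neg fun x => by rw [abs_neg]; exact hB x
  have hle : ∀ x, Real.exp (l * |U x - a|)
      ≤ Real.exp (l * U x) * Real.exp (-(l * a)) + Real.exp (l * -U x) * Real.exp (l * a) := fun x => by
    rw [← Real.exp_add, ← Real.exp_add]
    rcases abs_cases (U x - a) with ⟨e, -⟩ | ⟨e, -⟩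
    · rw [e, show l * (U x - a) = l * U x + -(l * a) by ring]
      linarith [Real.exp_pos (l * -U x + l * a)]
    · rw [e, show l * -(U x - a) = l * -U x + l * a by ring]
      linarith [Real.exp_pos (l * U x + -(l * a))]
  calc _ ≤ ∫ x, (Real.exp (l * U x) * Real.exp (-(l * a)) + Real.exp (l * -U x) * Real.exp (l * a)) ∂μ :=
        integral_mono_of_nonneg (Filter.Eventually.of_forall fun x => (Real.exp_pos _).le) (i1.add i2)
          (Filter.Eventually.of_forall hle)
    _ = (∫ x, Real.exp (l * U x) ∂μ) * Real.exp (-(l * a))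
        + (∫ x, Real.exp (l * -U x) ∂μ) * Real.exp (l * a) := by
        rw [integral_add i1 i2, integral_mul_const, integral_mul_const]
    _ ≤ Real.exp (l * a + C / (q - 1) * l ^ q) * Real.exp (-(l * a))
        + Real.exp (l * -a + C / (q - 1) * l ^ q) * Real.exp (l * a) := by gcongr
    _ = _ := by
        rw [← Real.exp_add, ← Real.exp_add]
        ring_nf

/-- Truncation at height `n`. -/
def trunc (n : ℕ) (s : ℝ) : ℝ := max (-n) (min n s)

theorem abs_trunc_sub_le (n : ℕ) (s t : ℝ) : |trunc n s - trunc n t| ≤ |s - t| := by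
  unfold trunc
  calc _ ≤ max |(-n : ℝ) - -n| |min (n : ℝ) s - min (n : ℝ) t| := abs_max_sub_max_le_max _ _ _ _
    _ ≤ max |(-n : ℝ) - -n| (max |(n : ℝ) - n| |s - t|) :=
        max_le_max le_rfl (abs_min_sub_min_le_max _ _ _ _)
    _ = _ := by simp

theorem abs_trunc_le (n : ℕ) (s : ℝ) : |trunc n s| ≤ n := by
  have hn : (0 : ℝ) ≤ n := n.cast_nonneg
  exact abs_le.2 ⟨le_max_left _ _, max_le (by linarith) (min_le_left _ _)⟩

theorem abs_trunc_le_abs (n : ℕ) (s : ℝ) : |trunc n s| ≤ |s| := by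
  have hn : (0 : ℝ) ≤ n := n.cast_nonneg
  have := abs_trunc_sub_le n s 0
  simpa [trunc, hn] using this

theorem tendsto_trunc (s : ℝ) : Filter.Tendsto (fun n => trunc n s) Filter.atTop (nhds s) := by
  refine tendsto_const_nhds.congr' ?_
  filter_upwards [Filter.eventually_ge_atTop ⌈|s|⌉₊] with n hn
  have h1 : |s| ≤ n := (Nat.le_ceil _).trans (by exact_mod_cast hn)
  rw [abs_le] at h1
  rw [trunc, min_eq_right h1.2, max_eq_right h1.1]

theorem LSLip.integrable_exp_abs [IsProbabilityMeasure μ] (h : LSLip μ q C) (hq : 1 < q) (hC : 0 ≤ C) {U : Heis → ℝ}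
    (hU : HLip 1 U) {l : ℝ} (hl : 0 < l) : Integrable (fun x => Real.exp (l * |U x|)) μ := by
  have hUm : Measurable U := hU.continuous.measurable
  have htm : ∀ n : ℕ, Measurable fun x => trunc n (U x) := fun n => by unfold trunc; fun_prop
  have hT : ∀ n : ℕ, HLip 1 fun x => trunc n (U x) := fun n => by
    have := hU.comp_lipschitz (f := trunc n) zero_le_one fun x y => by
      rw [one_mul]; exact abs_trunc_sub_le n _ _
    simpa using this
  have hTB : ∀ (n : ℕ) x, |trunc n (U x)| ≤ n := fun n x => abs_trunc_le n _
  set a : ℕ → ℝ := fun n => ∫ x, trunc n (U x) ∂μ with ha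
  set p := ∫ x, Real.exp (-|U x|) ∂μ
  have hpi : Integrable (fun x => Real.exp (-|U x|)) μ :=
    integrable_of_bounds (B := 1) (by fun_prop) (fun x => (Real.exp_pos _).le)
      fun x => Real.exp_le_one_iff.2 (neg_nonpos.2 (abs_nonneg _))
  have hp : 0 < p := integral_exp_pos hpi
  have hia : ∀ n, Integrable (fun x => Real.exp (1 * |trunc n (U x) - a n|)) μ := fun n => by
    refine integrable_of_bounds (B := Real.exp (n + |a n|)) (by have := htm n; fun_prop)
      (fun x => (Real.exp_pos _).le) fun x => Real.exp_le_exp.2 ?_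
    rw [one_mul]
    exact (abs_sub _ _).trans (by linarith [hTB n x])
  -- The truncated means are bounded without knowing that U is integrable: exp|a_n| exp(-|U|) ≤
  -- exp|U_n - a_n|, where U_n is the truncation. The right side has controlled mean, while the mean
  -- p of exp(-|U|) is positive and does not depend on n.
  have hab : ∀ n, Real.exp |a n| * p ≤ 2 * Real.exp (C / (q - 1)) := fun n => by
    have h1 := h.herbst_abs_bounded hq hC (hT n) (hTB n) one_pos
    rw [Real.one_rpow, mul_one] at h1
    refine le_trans ?_ h1
    rw [← integral_const_mul]
    refine integral_mono (hpi.const_mul _) (hia n) fun x => ?_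
    simp only
    rw [← Real.exp_add, Real.exp_le_exp, one_mul]
    have h2 := abs_trunc_le_abs n (U x)
    have h3 : |a n| ≤ |trunc n (U x)| + |trunc n (U x) - a n| := by
      have := abs_sub (trunc n (U x)) (trunc n (U x) - a n)
      simpa using this
    change |a n| + -|U x| ≤ |trunc n (U x) - a n|
    linarith
  obtain ⟨A, hA⟩ : ∃ A, ∀ n, |a n| ≤ A := by
    refine ⟨Real.log (2 * Real.exp (C / (q - 1)) / p), fun n => ?_⟩
    rw [Real.le_log_iff_exp_le (by positivity), le_div_iff₀ hp]
    exact hab n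
  have hbound : ∀ n : ℕ, ∫⁻ x, ENNReal.ofReal (Real.exp (l * |trunc n (U x)|)) ∂μ
      ≤ ENNReal.ofReal (Real.exp (l * A) * (2 * Real.exp (C / (q - 1) * l ^ q))) := fun n => by
    have hi : Integrable (fun x => Real.exp (l * A) * Real.exp (l * |trunc n (U x) - a n|)) μ := by
      refine Integrable.const_mul ?_ _
      refine integrable_of_bounds (B := Real.exp (l * (n + |a n|))) (by have := htm n; fun_prop)
        (fun x => (Real.exp_pos _).le) fun x => Real.exp_le_exp.2 ?_
      gcongr
      exact (abs_sub _ _).trans (by linarith [hTB n x])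
    calc _ ≤ ∫⁻ x, ENNReal.ofReal (Real.exp (l * A) * Real.exp (l * |trunc n (U x) - a n|)) ∂μ := by
          refine lintegral_mono fun x => ENNReal.ofReal_le_ofReal ?_
          rw [← Real.exp_add, Real.exp_le_exp, ← mul_add]
          gcongr
          have := abs_add_le (trunc n (U x) - a n) (a n)
          rw [sub_add_cancel] at this
          linarith [hA n]
      _ = ENNReal.ofReal (∫ x, Real.exp (l * A) * Real.exp (l * |trunc n (U x) - a n|) ∂μ) :=
          (ofReal_integral_eq_lintegral_ofReal hi
            (Filter.Eventually.of_forall fun x => by positivity)).symm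
      _ ≤ _ := by
          refine ENNReal.ofReal_le_ofReal ?_
          rw [integral_const_mul]
          gcongr
          exact h.herbst_abs_bounded hq hC (hT n) (hTB n) hl
  refine ⟨by fun_prop, ?_⟩
  rw [hasFiniteIntegral_iff_ofReal (Filter.Eventually.of_forall fun x => (Real.exp_pos _).le)]
  have hlim : ∀ x, Filter.Tendsto (fun n => ENNReal.ofReal (Real.exp (l * |trunc n (U x)|)))
      Filter.atTop (nhds (ENNReal.ofReal (Real.exp (l * |U x|)))) := fun x =>
    (ENNReal.continuous_ofReal.tendsto _).comp
      ((Real.continuous_exp.tendsto _).comp ((tendsto_trunc (U x)).abs.const_mul l))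
  calc ∫⁻ x, ENNReal.ofReal (Real.exp (l * |U x|)) ∂μ
      = ∫⁻ x, Filter.liminf (fun n => ENNReal.ofReal (Real.exp (l * |trunc n (U x)|))) Filter.atTop ∂μ := by
        congr 1; funext x; exact (hlim x).liminf_eq.symm
    _ ≤ Filter.liminf (fun n => ∫⁻ x, ENNReal.ofReal (Real.exp (l * |trunc n (U x)|)) ∂μ) Filter.atTop :=
        lintegral_liminf_le fun n => by have := htm n; fun_prop
    _ ≤ ENNReal.ofReal (Real.exp (l * A) * (2 * Real.exp (C / (q - 1) * l ^ q))) := by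
        refine Filter.liminf_le_of_le (by isBoundedDefault) fun b hb => ?_
        obtain ⟨n, hn⟩ := hb.exists
        exact hn.trans (hbound n)
    _ < ∞ := ENNReal.ofReal_lt_top

theorem LSLip.integrable [IsProbabilityMeasure μ] (h : LSLip μ q C) (hq : 1 < q) (hC : 0 ≤ C) {U : Heis → ℝ}
    (hU : HLip 1 U) : Integrable U μ := by
  refine (h.integrable_exp_abs hq hC hU one_pos).mono' hU.continuous.aestronglyMeasurable
    (Filter.Eventually.of_forall fun x => ?_)
  rw [one_mul, Real.norm_eq_abs]
  linarith [Real.add_one_le_exp |U x|]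

theorem LSLip.integrable_exp_abs_sub [IsProbabilityMeasure μ] (h : LSLip μ q C) (hq : 1 < q) (hC : 0 ≤ C) {U : Heis → ℝ}
    (hU : HLip 1 U) (a : ℝ) {l : ℝ} (hl : 0 < l) :
    Integrable (fun x => Real.exp (l * |U x - a|)) μ := by
  refine h.integrable_exp_abs (U := fun x => U x - a) hq hC ?_ hl
  intro x k t
  simpa using hU x k t

/-- Removes the boundedness assumption from Herbst's bound: truncate, and let the exponential
integrability already obtained dominate the limit. -/
theorem LSLip.herbst_abs [IsProbabilityMeasure μ] (h : LSLip μ q C) (hq : 1 < q) (hC : 0 ≤ C) {U : Heis → ℝ}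
    (hU : HLip 1 U) {l : ℝ} (hl : 0 < l) :
    ∫ x, Real.exp (l * |U x - ∫ y, U y ∂μ|) ∂μ ≤ 2 * Real.exp (C / (q - 1) * l ^ q) := by
  have hUm : Measurable U := hU.continuous.measurable
  have htm : ∀ n : ℕ, Measurable fun x => trunc n (U x) := fun n => by unfold trunc; fun_prop
  have hT : ∀ n : ℕ, HLip 1 fun x => trunc n (U x) := fun n => by
    have := hU.comp_lipschitz (f := trunc n) zero_le_one fun x y => by
      rw [one_mul]; exact abs_trunc_sub_le n _ _
    simpa using this
  have hTB : ∀ (n : ℕ) x, |trunc n (U x)| ≤ n := fun n x => abs_trunc_le n _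
  have hUi := h.integrable hq hC hU
  have h1 : Filter.Tendsto (fun n : ℕ => ∫ x, trunc n (U x) ∂μ) Filter.atTop (nhds (∫ x, U x ∂μ)) :=
    tendsto_integral_of_dominated_convergence (fun x => |U x|)
      (fun n => (htm n).aestronglyMeasurable) hUi.abs
      (fun n => Filter.Eventually.of_forall fun x => abs_trunc_le_abs n _)
      (Filter.Eventually.of_forall fun x => tendsto_trunc (U x))
  obtain ⟨A, hA⟩ : ∃ A, ∀ n : ℕ, |∫ x, trunc n (U x) ∂μ| ≤ A :=
    ⟨∫ x, |U x| ∂μ, fun n => abs_integral_le_integral_abs.trans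
      (integral_mono_of_nonneg (Filter.Eventually.of_forall fun x => abs_nonneg _) hUi.abs
        (Filter.Eventually.of_forall fun x => abs_trunc_le_abs n _))⟩
  refine le_of_tendsto (f := fun n : ℕ => ∫ x, Real.exp (l * |trunc n (U x) - ∫ y, trunc n (U y) ∂μ|) ∂μ)
    (x := Filter.atTop) ?_ (Filter.Eventually.of_forall fun n => h.herbst_abs_bounded hq hC (hT n) (hTB n) hl)
  refine tendsto_integral_of_dominated_convergence
    (fun x => Real.exp (l * |U x|) * Real.exp (l * A))
    (fun n => Measurable.aestronglyMeasurable (by have := htm n; fun_prop)) ((h.integrable_exp_abs hq hC hU hl).mul_const _)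
    (fun n => Filter.Eventually.of_forall fun x => ?_)
    (Filter.Eventually.of_forall fun x => ?_)
  · rw [Real.norm_eq_abs, abs_of_pos (Real.exp_pos _), ← Real.exp_add, Real.exp_le_exp, ← mul_add]
    gcongr
    exact (abs_sub _ _).trans (add_le_add (abs_trunc_le_abs n _) (hA n))
  · exact (Real.continuous_exp.tendsto _).comp (((tendsto_trunc (U x)).sub h1).abs.const_mul l)

end HeisGibbs

namespace HeisGibbs

/-! ### Spectral gap and covariance bounds -/

section Median

variable {S : Type*} [MeasurableSpace S] {μ : Measure S}

/-- The infimum of the levels exceeded with probability at most 1/2. Continuity of the measure from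
below transfers both inequalities to the infimum. -/
theorem exists_median [IsProbabilityMeasure μ] {u : S → ℝ} (hu : Measurable u) {B : ℝ}
    (h0 : ∀ x, 0 ≤ u x) (hB : ∀ x, u x ≤ B) :
    ∃ m : ℝ, 0 ≤ m ∧ μ {x | m < u x} ≤ 1 / 2 ∧ μ {x | u x < m} ≤ 1 / 2 := by
  set T : Set ℝ := {t | μ {x | t < u x} ≤ 1 / 2}
  have hBT : B ∈ T := by
    have : {x | B < u x} = ∅ := by
      ext x; simpa using hB x
    simp [T, this]
  have hT0 : ∀ t ∈ T, 0 ≤ t := fun t ht => by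
    by_contra! hlt
    have : {x | t < u x} = Set.univ := Set.eq_univ_of_forall fun x => hlt.trans_le (h0 x)
    simp only [T, Set.mem_ofPred_eq, this, measure_univ] at ht
    exact absurd ht (by simp)
  have hup : ∀ t ∈ T, ∀ s, t ≤ s → s ∈ T := fun t ht s hs =>
    (measure_mono fun x (hx : s < u x) => lt_of_le_of_lt hs hx).trans ht
  have hbdd : BddBelow T := ⟨0, hT0⟩
  have hne : T.Nonempty := ⟨B, hBT⟩
  refine ⟨sInf T, le_csInf hne hT0, ?_, ?_⟩
  · have e : {x | sInf T < u x} = ⋃ n : ℕ, {x | sInf T + 1 / (n + 1) < u x} := by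
      ext x
      simp only [Set.mem_ofPred_eq, Set.mem_iUnion]
      constructor
      · intro hx
        obtain ⟨n, hn⟩ := exists_nat_one_div_lt (sub_pos.2 hx)
        exact ⟨n, by linarith⟩
      · rintro ⟨n, hn⟩
        have : (0 : ℝ) < 1 / (n + 1) := by positivity
        linarith
    rw [e]
    have hmono : Monotone fun n : ℕ => {x | sInf T + 1 / (n + 1) < u x} := by
      intro a b hab x hx
      simp only [Set.mem_ofPred_eq] at hx ⊢
      have : (1 : ℝ) / (b + 1) ≤ 1 / (a + 1) := Nat.one_div_le_one_div hab
      linarith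
    rw [hmono.measure_iUnion]
    refine iSup_le fun n => ?_
    obtain ⟨t, ht, htlt⟩ := exists_lt_of_csInf_lt hne
      (show sInf T < sInf T + 1 / (n + 1) by have : (0 : ℝ) < 1 / (n + 1) := by positivity
                                             linarith)
    exact hup t ht _ htlt.le
  · have e : {x | u x < sInf T} = ⋃ n : ℕ, {x | u x ≤ sInf T - 1 / (n + 1)} := by
      ext x
      simp only [Set.mem_ofPred_eq, Set.mem_iUnion]
      constructor
      · intro hx
        obtain ⟨n, hn⟩ := exists_nat_one_div_lt (sub_pos.2 hx)
        exact ⟨n, by linarith⟩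
      · rintro ⟨n, hn⟩
        have : (0 : ℝ) < 1 / (n + 1) := by positivity
        linarith
    rw [e]
    have hmono : Monotone fun n : ℕ => {x | u x ≤ sInf T - 1 / (n + 1)} := by
      intro a b hab x hx
      simp only [Set.mem_ofPred_eq] at hx ⊢
      have : (1 : ℝ) / (b + 1) ≤ 1 / (a + 1) := Nat.one_div_le_one_div hab
      linarith
    rw [hmono.measure_iUnion]
    refine iSup_le fun n => ?_
    have hnot : sInf T - 1 / (n + 1) ∉ T := fun hmem => by
      have h1 := csInf_le hbdd hmem
      have : (0 : ℝ) < 1 / (n + 1) := by positivity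
      linarith
    have h1 : 1 / 2 < μ {x | sInf T - 1 / (n + 1) < u x} := not_le.1 hnot
    have h2 : {x | u x ≤ sInf T - 1 / (n + 1)} = {x | sInf T - 1 / (n + 1) < u x}ᶜ := by
      ext x; simp
    rw [h2, prob_compl_eq_one_sub (measurableSet_lt measurable_const hu)]
    refine (tsub_le_tsub_left h1.le 1).trans ?_
    rw [one_div, ENNReal.one_sub_inv_two]

/-- The entropy inequality tested with log 2 on {F > 0} and 0 elsewhere. As that set has mass at
most 1/2, the exponential moment is at most 3/2, which leaves log 2 - log(3/2) = log(4/3). An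
entropy bound thus becomes a bound on the integral. -/
theorem log_mul_integral_le_ent [IsProbabilityMeasure μ] {F : S → ℝ} (hF : Measurable F) {B : ℝ}
    (h0 : ∀ x, 0 ≤ F x) (hB : ∀ x, F x ≤ B) (hs : μ {x | 0 < F x} ≤ 1 / 2) :
    Real.log (4 / 3) * ∫ x, F x ∂μ ≤ ent μ F := by
  set A := {x | 0 < F x}
  have hA : MeasurableSet A := measurableSet_lt measurable_const hF
  set ψ : S → ℝ := A.indicator fun _ => Real.log 2
  have hψm : Measurable ψ := measurable_const.indicator hA
  have e1 : ∀ x, Real.exp (ψ x) = 1 + A.indicator (fun _ => (1 : ℝ)) x := fun x => by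
    by_cases hx : x ∈ A
    · simp only [ψ, Set.indicator_of_mem hx]
      rw [Real.exp_log (by norm_num)]; norm_num
    · simp [ψ, Set.indicator_of_notMem hx]
  have e2 : ∀ x, F x * ψ x = Real.log 2 * F x := fun x => by
    by_cases hx : x ∈ A
    · simp only [ψ, Set.indicator_of_mem hx, mul_comm]
    · have : F x = 0 := le_antisymm (not_lt.1 hx) (h0 x)
      simp [this]
  have hi := integrable_of_bounds (μ := μ) hF h0 hB
  have hind : Integrable (A.indicator fun _ => (1 : ℝ)) μ := (integrable_const 1).indicator hA
  have h1 := integral_mul_le_ent (μ := μ) (ψ := ψ) hF h0 hB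
    (by simp_rw [e1]; exact (integrable_const 1).add hind)
    (by simp_rw [e2]; exact hi.const_mul _)
  simp_rw [e1, e2] at h1
  rw [integral_const_mul, integral_add (integrable_const 1) hind, integral_indicator_const _ hA] at h1
  simp only [integral_const, probReal_univ, smul_eq_mul, mul_one] at h1
  have h2 : μ.real A ≤ 1 / 2 := by
    rw [measureReal_def]
    have := ENNReal.toReal_mono (by simp) hs
    simpa using this
  have h3 : Real.log (1 + μ.real A) ≤ Real.log (3 / 2) :=
    Real.log_le_log (by positivity) (by linarith)
  have h4 : Real.log (4 / 3) = Real.log 2 - Real.log (3 / 2) := by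
    rw [← Real.log_div (by norm_num) (by norm_num)]; norm_num
  have h5 : 0 ≤ ∫ x, F x ∂μ := integral_nonneg h0
  rw [h4]
  nlinarith

end Median

variable {μ : Measure Heis} [IsProbabilityMeasure μ] {q C : ℝ}

theorem rpow_le_mul_exp {s p : ℝ} (hs : 0 ≤ s) (hp : 0 < p) : s ^ p ≤ p ^ p * Real.exp s := by
  have h1 : s / p ≤ Real.exp (s / p) := by linarith [Real.add_one_le_exp (s / p)]
  have h2 := Real.rpow_le_rpow (by positivity) h1 hp.le
  rw [Real.div_rpow hs hp.le, ← Real.exp_mul, div_mul_cancel₀ _ hp.ne',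
    div_le_iff₀ (by positivity)] at h2
  linarith

theorem memLp_of_bdd {S : Type*} [MeasurableSpace S] {μ : Measure S} [IsFiniteMeasure μ] {g : S → ℝ}
    (hg : Measurable g) {B : ℝ} (hB : ∀ x, |g x| ≤ B) (p : ℝ≥0∞) : MemLp g p μ :=
  MemLp.of_bound hg.aestronglyMeasurable B (Filter.Eventually.of_forall hB)

theorem LSLip.memLp_sub (h : LSLip μ q C) (hq : 1 < q) (hC : 0 ≤ C) {U : Heis → ℝ} (hU : HLip 1 U)
    (a : ℝ) {p : ℝ} (hp : 0 < p) : MemLp (fun x => |U x - a|) (ENNReal.ofReal p) μ := by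
  have hUm := hU.continuous
  rw [← integrable_norm_rpow_iff (by fun_prop) (by simpa using hp) (by simp)]
  rw [ENNReal.toReal_ofReal hp.le]
  refine ((h.integrable_exp_abs_sub hq hC hU a one_pos).const_mul (p ^ p)).mono' ?_ ?_
  · exact (Continuous.rpow_const (by fun_prop) fun x => Or.inr hp.le).aestronglyMeasurable
  · refine Filter.Eventually.of_forall fun x => ?_
    simp only [norm_abs_eq_norm, Real.norm_eq_abs]
    rw [abs_of_nonneg (Real.rpow_nonneg (abs_nonneg _) _), one_mul]
    exact rpow_le_mul_exp (abs_nonneg _) hp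

theorem LSLip.integral_rpow_le (h : LSLip μ q C) (hq : 1 < q) (hC : 0 ≤ C) {U : Heis → ℝ}
    (hU : HLip 1 U) {p : ℝ} (hp : 0 < p) :
    ∫ x, |U x - ∫ y, U y ∂μ| ^ p ∂μ ≤ p ^ p * (2 * Real.exp (C / (q - 1))) := by
  have h1 := h.herbst_abs hq hC hU one_pos
  rw [Real.one_rpow, mul_one] at h1
  calc _ ≤ ∫ x, p ^ p * Real.exp (1 * |U x - ∫ y, U y ∂μ|) ∂μ := by
        refine integral_mono_of_nonneg (Filter.Eventually.of_forall fun x => by positivity)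
          ((h.integrable_exp_abs_sub hq hC hU _ one_pos).const_mul _)
          (Filter.Eventually.of_forall fun x => ?_)
        simp only [one_mul]
        exact rpow_le_mul_exp (abs_nonneg _) hp
    _ ≤ _ := by
        rw [integral_const_mul]
        gcongr

/-- Convexity of x^q together with subadditivity of x^(q-1), valid as q ≤ 2. The form is dictated by
the covariance estimate: the first term is treated by the entropy inequality, and the terms linear
in u - m by Hölder's inequality. -/
theorem abs_rpow_sub_rpow_le {u m q : ℝ} (hq₁ : 1 < q) (hq₂ : q ≤ 2) (hu : 0 ≤ u) (hm : 0 ≤ m) :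
    |u ^ q - m ^ q| ≤ q * max (u - m) 0 ^ q + q * m ^ (q - 1) * (max (u - m) 0 + max (m - u) 0) := by
  have hq0 : 0 < q := by linarith
  have key : ∀ a b : ℝ, 0 ≤ b → b ≤ a → a ^ q - b ^ q ≤ q * a ^ (q - 1) * (a - b) := fun a b hb hab => by
    rcases hab.eq_or_lt with rfl | hlt
    · simp
    have ha : 0 < a := hb.trans_lt hlt
    have h1 := (convexOn_rpow hq₁.le).slope_le_deriv (x := b) (y := a) hb ha.le hlt
      (Real.hasDerivAt_rpow_const (Or.inl ha.ne')).differentiableAt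
    rw [(Real.hasDerivAt_rpow_const (Or.inl ha.ne')).deriv, slope_def_field,
      div_le_iff₀ (by linarith)] at h1
    exact h1
  rcases le_total m u with h | h
  · rw [max_eq_left (by linarith), max_eq_right (by linarith : m - u ≤ 0), add_zero,
      abs_of_nonneg (by have := Real.rpow_le_rpow hm h hq0.le; linarith)]
    have h1 := key u m hm h
    have h2 : u ^ (q - 1) ≤ (u - m) ^ (q - 1) + m ^ (q - 1) := by
      have := Real.rpow_add_le_add_rpow (p := q - 1) (by linarith : 0 ≤ u - m) hm (by linarith)
        (by linarith)
      simpa using this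
    rcases h.eq_or_lt with rfl | hlt
    · simp [Real.zero_rpow hq0.ne']
    have h3 : (u - m) ^ q = (u - m) ^ (q - 1) * (u - m) := by
      rw [Real.rpow_sub_one (by linarith)]
      have : u - m ≠ 0 := by linarith
      field_simp
    rw [h3]
    have h4 : 0 ≤ u - m := by linarith
    calc _ ≤ q * u ^ (q - 1) * (u - m) := h1
      _ ≤ q * ((u - m) ^ (q - 1) + m ^ (q - 1)) * (u - m) := by gcongr
      _ = _ := by ring
  · rw [max_eq_right (by linarith), max_eq_left (by linarith : 0 ≤ m - u), zero_add,
      Real.zero_rpow hq0.ne', mul_zero, zero_add, abs_sub_comm,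
      abs_of_nonneg (by have := Real.rpow_le_rpow hu h hq0.le; linarith)]
    exact key m u hu h

/-- A 1-Lipschitz g keeps the slope bound G, and g∘u vanishes on half of the mass, so the
logarithmic Sobolev inequality also bounds its q-th moment. Used for the two parts of u - m at a
median m. -/
theorem LSLip.ent_and_gap (h : LSLip μ q C) (hq : 1 < q) {u G : Heis → ℝ} {L B m : ℝ}
    (hu : HLip L u) (hB : ∀ x, |u x| ≤ B) (hGm : Measurable G) (hG0 : ∀ x, 0 ≤ G x)
    (hGB : ∀ x, G x ≤ B) (hs : HSlope u G) {g : ℝ → ℝ} (hg0 : ∀ s, 0 ≤ g s)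
    (hg : ∀ s t, |g s - g t| ≤ |s - t|) (hgm : g m = 0)
    (hsupp : μ {x | 0 < g (u x)} ≤ 1 / 2) :
    ent μ (fun x => g (u x) ^ q) ≤ C * ∫ x, G x ^ q ∂μ ∧
      ∫ x, g (u x) ^ q ∂μ ≤ C / Real.log (4 / 3) * ∫ x, G x ^ q ∂μ := by
  have hq0 : 0 < q := by linarith
  have hlog : 0 < Real.log (4 / 3) := Real.log_pos (by norm_num)
  have hgB : ∀ x, |g (u x)| ≤ B + |m| := fun x => by
    have h1 := hg (u x) m
    rw [hgm, sub_zero] at h1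
    exact h1.trans ((abs_sub _ _).trans (by linarith [hB x]))
  have hgl : HLip (1 * L) fun x => g (u x) := hu.comp_lipschitz zero_le_one fun x y => by
    rw [one_mul]; exact hg _ _
  have h1 := h _ G _ (B + |m|) hgl hgB hGm hG0 (fun x => (hGB x).trans (by linarith [abs_nonneg m]))
    (hs.of_abs_le fun x y => hg _ _)
  simp_rw [abs_of_nonneg (hg0 _)] at h1
  refine ⟨h1, ?_⟩
  have h2 := log_mul_integral_le_ent (μ := μ) (F := fun x => g (u x) ^ q) (B := (B + |m|) ^ q)
    (hgl.continuous.measurable.pow_const q) (fun x => Real.rpow_nonneg (hg0 _) _)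
    (fun x => Real.rpow_le_rpow (hg0 _) ((le_abs_self _).trans (hgB x)) hq0.le) (by
      refine (measure_mono fun x hx => ?_).trans hsupp
      simp only [Set.mem_ofPred_eq] at hx ⊢
      refine (hg0 _).lt_of_ne fun he => ?_
      rw [← he, Real.zero_rpow hq0.ne'] at hx
      exact lt_irrefl _ hx)
  rw [div_mul_eq_mul_div, le_div_iff₀ hlog]
  linarith

/-- The constant of the covariance inequality. -/
def covConst (q C : ℝ) : ℝ :=
  q * (C + (C / Real.log (4 / 3) + 1) * (1 + C / (q - 1)))
    + 4 * q * (C / Real.log (4 / 3) + 1)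
      * ((q / (q - 1)) ^ (q / (q - 1)) * (2 * Real.exp (C / (q - 1)))) ^ (1 / (q / (q - 1)))

/-- Since U - μU is centred, u^q may be replaced by u^q - m^q with m a median of u. The part of this
difference that is linear in u - m is handled by Hölder's inequality, the gap inequality and the
moments of U; the part ((u-m)₊)^q by the entropy inequality and Herbst's bound. The homogeneity
A^(q-1) D, with A the norm of u and D that of G, is what survives division by A^(q-1) when this
becomes an estimate for norms. -/
theorem LSLip.cov_le (h : LSLip μ q C) (hq₁ : 1 < q) (hq₂ : q ≤ 2) (hC : 0 ≤ C) {u G U : Heis → ℝ}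
    {L B δ : ℝ} (hu : HLip L u) (hδ : 0 < δ) (hδu : ∀ x, δ ≤ u x) (hB : ∀ x, u x ≤ B)
    (hGm : Measurable G) (hG0 : ∀ x, 0 ≤ G x) (hGB : ∀ x, G x ≤ B) (hs : HSlope u G)
    (hU : HLip 1 U) :
    |∫ x, u x ^ q * (U x - ∫ y, U y ∂μ) ∂μ|
      ≤ covConst q C * ((∫ x, u x ^ q ∂μ) ^ (1 / q)) ^ (q - 1) * (∫ x, G x ^ q ∂μ) ^ (1 / q) := by
  have hq0 : 0 < q := by linarith
  have hu0 : ∀ x, 0 ≤ u x := fun x => hδ.le.trans (hδu x)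
  have hB0 : 0 ≤ B := (hu0 0).trans (hB 0)
  have hum : Measurable u := hu.continuous.measurable
  have hUm : Measurable U := hU.continuous.measurable
  have habs : ∀ x, |u x| ≤ B := fun x => by rw [abs_of_nonneg (hu0 x)]; exact hB x
  obtain ⟨m, hm0, hm1, hm2⟩ := exists_median (μ := μ) hum hu0 hB
  have hmax : ∀ a b : ℝ, |max a 0 - max b 0| ≤ |a - b| := fun a b =>
    (abs_max_sub_max_le_max _ _ _ _).trans (by simp)
  obtain ⟨ep, gp⟩ := h.ent_and_gap hq₁ (m := m) hu habs hGm hG0 hGB hs (g := fun s => max (s - m) 0)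
    (fun s => le_max_right _ _) (fun s t => (hmax _ _).trans (by simp)) (by simp) (by
      refine (measure_mono fun x hx => ?_).trans hm1
      simp only [Set.mem_ofPred_eq] at hx ⊢
      by_contra! hle
      rw [max_eq_right (by linarith)] at hx
      exact lt_irrefl _ hx)
  obtain ⟨-, gm⟩ := h.ent_and_gap hq₁ (m := m) hu habs hGm hG0 hGB hs (g := fun s => max (m - s) 0)
    (fun s => le_max_right _ _) (fun s t => (hmax _ _).trans (by simp [abs_sub_comm])) (by simp) (by
      refine (measure_mono fun x hx => ?_).trans hm2
      simp only [Set.mem_ofPred_eq] at hx ⊢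
      by_contra! hle
      rw [max_eq_right (by linarith)] at hx
      exact lt_irrefl _ hx)
  set a := ∫ y, U y ∂μ with ha
  set K := C / (q - 1) with hK
  have hK0 : 0 ≤ K := div_nonneg hC (by linarith)
  set C' := C / Real.log (4 / 3) + 1 with hC'
  have hlog : 0 < Real.log (4 / 3) := Real.log_pos (by norm_num)
  have hC'1 : 1 ≤ C' := by have : 0 ≤ C / Real.log (4 / 3) := by positivity
                           linarith
  set D := (∫ x, G x ^ q ∂μ) ^ (1 / q) with hD
  set A := (∫ x, u x ^ q ∂μ) ^ (1 / q) with hA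
  have hIG : 0 ≤ ∫ x, G x ^ q ∂μ := integral_nonneg fun x => Real.rpow_nonneg (hG0 x) q
  have hIu : 0 ≤ ∫ x, u x ^ q ∂μ := integral_nonneg fun x => Real.rpow_nonneg (hu0 x) q
  have hD0 : 0 ≤ D := Real.rpow_nonneg hIG _
  have hDq : D ^ q = ∫ x, G x ^ q ∂μ := by
    rw [hD, ← Real.rpow_mul hIG, one_div_mul_cancel hq0.ne', Real.rpow_one]
  have hAq : A ^ q = ∫ x, u x ^ q ∂μ := by
    rw [hA, ← Real.rpow_mul hIu, one_div_mul_cancel hq0.ne', Real.rpow_one]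
  have huq : Integrable (fun x => u x ^ q) μ :=
    integrable_of_bounds (hum.pow_const q) (fun x => Real.rpow_nonneg (hu0 x) q)
      (fun x => Real.rpow_le_rpow (hu0 x) (hB x) hq0.le)
  have hApos : 0 < A := by
    refine Real.rpow_pos_of_pos ?_ _
    have h1 : δ ^ q ≤ ∫ x, u x ^ q ∂μ := by
      have := integral_mono (integrable_const (δ ^ q)) huq
        fun x => Real.rpow_le_rpow hδ.le (hδu x) hq0.le
      simpa using this
    exact (Real.rpow_pos_of_pos hδ q).trans_le h1
  rw [← hDq] at ep gp gm
  -- the median is bounded by the norm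
  have hmA : m ^ (q - 1) ≤ 2 * A ^ (q - 1) := by
    have h1 : m ^ q ≤ 2 * A ^ q := by
      have hset : MeasurableSet {x | u x < m} := measurableSet_lt hum measurable_const
      have hreal : μ.real {x | u x < m}ᶜ ≥ 1 / 2 := by
        rw [probReal_compl_eq_one_sub hset]
        have : μ.real {x | u x < m} ≤ 1 / 2 := by
          rw [measureReal_def]
          have := ENNReal.toReal_mono (by simp) hm2
          simpa using this
        linarith
      have h2 : ∫ x, ({x | u x < m}ᶜ).indicator (fun _ => m ^ q) x ∂μ ≤ ∫ x, u x ^ q ∂μ := by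
        refine integral_mono ((integrable_const _).indicator hset.compl) huq fun x => ?_
        by_cases hx : u x < m
        · rw [Set.indicator_of_notMem (by simpa using hx)]
          exact Real.rpow_nonneg (hu0 x) q
        · rw [Set.indicator_of_mem (by simpa using hx)]
          exact Real.rpow_le_rpow hm0 (not_lt.1 hx) hq0.le
      rw [integral_indicator_const _ hset.compl, smul_eq_mul, ← hAq] at h2
      have := Real.rpow_nonneg hm0 q
      nlinarith
    have h2 : m ≤ 2 * A := by
      rw [← Real.rpow_le_rpow_iff hm0 (by positivity) hq0]
      refine h1.trans ?_
      rw [Real.mul_rpow zero_le_two hApos.le]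
      have : (2 : ℝ) ^ (1 : ℝ) ≤ 2 ^ q := Real.rpow_le_rpow_of_exponent_le one_le_two hq₁.le
      rw [Real.rpow_one] at this
      gcongr
    calc m ^ (q - 1) ≤ (2 * A) ^ (q - 1) := Real.rpow_le_rpow hm0 h2 (by linarith)
      _ = 2 ^ (q - 1) * A ^ (q - 1) := Real.mul_rpow zero_le_two hApos.le
      _ ≤ 2 ^ (1 : ℝ) * A ^ (q - 1) := by
          gcongr
          · norm_num
          · linarith
      _ = _ := by rw [Real.rpow_one]
  -- the two parts of `u - m`
  set gP : Heis → ℝ := fun x => max (u x - m) 0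
  set gM : Heis → ℝ := fun x => max (m - u x) 0
  have hgP0 : ∀ x, 0 ≤ gP x := fun x => le_max_right _ _
  have hgM0 : ∀ x, 0 ≤ gM x := fun x => le_max_right _ _
  have hgPm : Measurable gP := by fun_prop
  have hgMm : Measurable gM := by fun_prop
  have hgPB : ∀ x, gP x ≤ B := fun x => max_le (by linarith [hB x]) hB0
  have hgMB : ∀ x, gM x ≤ m := fun x => max_le (by linarith [hu0 x]) hm0
  have hgPu : ∀ x, gP x ≤ u x := fun x => max_le (by linarith) (hu0 x)
  have hgPqm : Measurable fun x => gP x ^ q := hgPm.pow_const q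
  have hgPq0 : ∀ x, 0 ≤ gP x ^ q := fun x => Real.rpow_nonneg (hgP0 x) q
  have hgPqB : ∀ x, gP x ^ q ≤ B ^ q := fun x => Real.rpow_le_rpow (hgP0 x) (hgPB x) hq0.le
  have hUi : Integrable (fun x => |U x - a|) μ :=
    ((h.integrable hq₁ hC hU).sub (integrable_const a)).abs
  -- Hölder
  set p := q / (q - 1) with hp
  have hpq : q.HolderConjugate p := Real.HolderConjugate.conjExponent hq₁
  have hp0 : 0 < p := hpq.symm.pos
  set E := (p ^ p * (2 * Real.exp K)) ^ (1 / p) with hE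
  have hE0 : 0 ≤ E := by positivity
  have holder : ∀ g : Heis → ℝ, Measurable g → (∀ x, 0 ≤ g x) → (∃ B', ∀ x, g x ≤ B') →
      ∫ x, g x ^ q ∂μ ≤ C / Real.log (4 / 3) * D ^ q →
      ∫ x, g x * |U x - a| ∂μ ≤ C' * D * E := by
    rintro g hgm hg0 ⟨B', hB'⟩ hgD
    refine (integral_mul_le_Lp_mul_Lq_of_nonneg hpq (Filter.Eventually.of_forall hg0)
      (Filter.Eventually.of_forall fun x => abs_nonneg _)
      (memLp_of_bdd hgm (B := B') (fun x => by rw [abs_of_nonneg (hg0 x)]; exact hB' x) _)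
      (h.memLp_sub hq₁ hC hU a hp0)).trans ?_
    have h1 : (∫ x, g x ^ q ∂μ) ^ (1 / q) ≤ C' * D := by
      have h2 : ∫ x, g x ^ q ∂μ ≤ (C' * D) ^ q := by
        rw [Real.mul_rpow (by linarith) hD0]
        refine hgD.trans ?_
        gcongr
        calc C / Real.log (4 / 3) ≤ C' := by linarith
          _ = C' ^ (1 : ℝ) := (Real.rpow_one _).symm
          _ ≤ C' ^ q := Real.rpow_le_rpow_of_exponent_le hC'1 hq₁.le
      calc _ ≤ ((C' * D) ^ q) ^ (1 / q) := Real.rpow_le_rpow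
            (integral_nonneg fun x => Real.rpow_nonneg (hg0 x) q) h2 (by positivity)
        _ = C' * D := by
            rw [← Real.rpow_mul (by positivity), mul_one_div_cancel hq0.ne', Real.rpow_one]
    have h3 : (∫ x, |U x - a| ^ p ∂μ) ^ (1 / p) ≤ E :=
      Real.rpow_le_rpow (integral_nonneg fun x => by positivity)
        (h.integral_rpow_le hq₁ hC hU hp0) (by positivity)
    have h4 : 0 ≤ (∫ x, |U x - a| ^ p ∂μ) ^ (1 / p) :=
      Real.rpow_nonneg (integral_nonneg fun x => by positivity) _
    gcongr
  have hP := holder gP hgPm hgP0 ⟨B, hgPB⟩ gp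
  have hM := holder gM hgMm hgM0 ⟨m, hgMB⟩ gm
  -- entropy inequality
  have hiF : Integrable (fun x => gP x ^ q * |U x - a|) μ :=
    hUi.bdd_mul hgPqm.aestronglyMeasurable (Filter.Eventually.of_forall fun x => by
      rw [Real.norm_eq_abs, abs_of_nonneg (hgPq0 x)]; exact hgPqB x)
  have entineq : ∀ l : ℝ, 0 < l → l * ∫ x, gP x ^ q * |U x - a| ∂μ
      ≤ C * D ^ q + (∫ x, gP x ^ q ∂μ) * (1 + K * l ^ q) := by
    intro l hl
    have h1 := integral_mul_le_ent (μ := μ) (F := fun x => gP x ^ q) (ψ := fun x => l * |U x - a|)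
      hgPqm hgPq0 hgPqB (h.integrable_exp_abs_sub hq₁ hC hU a hl)
      (by
        have := hiF.const_mul l
        refine this.congr (Filter.Eventually.of_forall fun x => ?_)
        simp only
        ring)
    have e : ∫ x, gP x ^ q * (l * |U x - a|) ∂μ = l * ∫ x, gP x ^ q * |U x - a| ∂μ := by
      rw [← integral_const_mul]; congr 1; funext x; ring
    rw [e] at h1
    have h2 : Real.log (∫ x, Real.exp (l * |U x - a|) ∂μ) ≤ 1 + K * l ^ q := by
      have h3 := h.herbst_abs hq₁ hC hU hl
      calc _ ≤ Real.log (2 * Real.exp (K * l ^ q)) :=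
            Real.log_le_log (integral_exp_pos (h.integrable_exp_abs_sub hq₁ hC hU a hl)) h3
        _ = Real.log 2 + K * l ^ q := by
            rw [Real.log_mul (by norm_num) (Real.exp_pos _).ne', Real.log_exp]
        _ ≤ _ := by linarith [Real.log_two_lt_d9]
    have h4 : 0 ≤ ∫ x, gP x ^ q ∂μ := integral_nonneg hgPq0
    calc _ ≤ _ := h1
      _ ≤ _ := by gcongr
  have hpowD : D ^ q = D ^ (q - 1) * D := by
    rcases hD0.eq_or_lt with h0 | h0
    · rw [← h0, Real.zero_rpow hq0.ne', mul_zero]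
    · rw [Real.rpow_sub_one h0.ne']; field_simp
  -- The parameter l of the entropy inequality depends on the size of D. If D ≤ A, take l = 1 and
  -- use the gap inequality, so that everything is of order D^q ≤ A^(q-1) D. If D > A, take l = D/A
  -- and bound the mass of gP^q by A^q, for then A^q l^q = D^q.
  have hFbound : ∫ x, gP x ^ q * |U x - a| ∂μ ≤ (C + C' * (1 + K)) * (A ^ (q - 1) * D) := by
    rcases le_or_gt D A with hDA | hDA
    · have h1 := entineq 1 one_pos
      rw [one_mul, Real.one_rpow, mul_one] at h1
      have h2 : D ^ (q - 1) ≤ A ^ (q - 1) := Real.rpow_le_rpow hD0 hDA (by linarith)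
      have h3 : D ^ q ≤ A ^ (q - 1) * D := by rw [hpowD]; gcongr
      have h4 : ∫ x, gP x ^ q ∂μ ≤ C' * D ^ q := by
        refine gp.trans ?_
        gcongr
        linarith
      calc _ ≤ C * D ^ q + C' * D ^ q * (1 + K) := h1.trans (by gcongr)
        _ = (C + C' * (1 + K)) * D ^ q := by ring
        _ ≤ _ := by gcongr
    · have hDpos : 0 < D := hApos.trans hDA
      have h1 := entineq (D / A) (by positivity)
      have h2 : ∫ x, gP x ^ q ∂μ ≤ A ^ q := by
        rw [hAq]
        exact integral_mono (integrable_of_bounds hgPqm hgPq0 hgPqB) huq fun x =>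
          Real.rpow_le_rpow (hgP0 x) (hgPu x) hq0.le
      have h3 : A ^ q ≤ D ^ q := Real.rpow_le_rpow hApos.le hDA.le hq0.le
      have h4 : A ^ q * (D / A) ^ q = D ^ q := by
        rw [← Real.mul_rpow hApos.le (by positivity), mul_div_cancel₀ _ hApos.ne']
      have h5 : D / A * ∫ x, gP x ^ q * |U x - a| ∂μ ≤ (C + C' * (1 + K)) * D ^ q := by
        calc _ ≤ C * D ^ q + A ^ q * (1 + K * (D / A) ^ q) := h1.trans (by gcongr)
          _ = C * D ^ q + (A ^ q + K * (A ^ q * (D / A) ^ q)) := by ring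
          _ ≤ C * D ^ q + (D ^ q + K * D ^ q) := by rw [h4]; gcongr
          _ = (C + 1 * (1 + K)) * D ^ q := by ring
          _ ≤ _ := by gcongr
      -- Equivalent to A^(2-q) ≤ D^(2-q), hence the need for q ≤ 2.
      have h6 : A * D ^ (q - 1) ≤ A ^ (q - 1) * D := by
        have h7 : A ^ (2 - q) ≤ D ^ (2 - q) := Real.rpow_le_rpow hApos.le hDA.le (by linarith)
        calc A * D ^ (q - 1) = A ^ (q - 1) * A ^ (2 - q) * D ^ (q - 1) := by
              rw [← Real.rpow_add hApos, show q - 1 + (2 - q) = 1 by ring, Real.rpow_one]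
          _ ≤ A ^ (q - 1) * D ^ (2 - q) * D ^ (q - 1) := by gcongr
          _ = A ^ (q - 1) * D := by
              rw [mul_assoc, ← Real.rpow_add hDpos, show 2 - q + (q - 1) = 1 by ring, Real.rpow_one]
      have h8 : ∫ x, gP x ^ q * |U x - a| ∂μ ≤ (C + C' * (1 + K)) * D ^ q / (D / A) := by
        rw [le_div_iff₀ (by positivity)]
        linarith
      calc _ ≤ _ := h8
        _ = (C + C' * (1 + K)) * (A * D ^ (q - 1)) := by rw [hpowD]; field_simp
        _ ≤ _ := by gcongr
  -- conclusion
  have hUi' : Integrable (fun x => U x - a) μ := (h.integrable hq₁ hC hU).sub (integrable_const a)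
  have hz : ∫ x, (U x - a) ∂μ = 0 := by
    rw [integral_sub (h.integrable hq₁ hC hU) (integrable_const a)]
    simp [← ha]
  have iu : Integrable (fun x => u x ^ q * (U x - a)) μ :=
    hUi'.bdd_mul (c := B ^ q) (hum.pow_const q).aestronglyMeasurable
      (Filter.Eventually.of_forall fun x => by
      rw [Real.norm_eq_abs, abs_of_nonneg (Real.rpow_nonneg (hu0 x) q)]
      exact Real.rpow_le_rpow (hu0 x) (hB x) hq0.le)
  have e : ∫ x, u x ^ q * (U x - a) ∂μ = ∫ x, (u x ^ q - m ^ q) * (U x - a) ∂μ := by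
    simp_rw [sub_mul]
    rw [integral_sub iu (hUi'.const_mul _), integral_const_mul, hz, mul_zero, sub_zero]
  have iP : Integrable (fun x => gP x * |U x - a|) μ :=
    hUi.bdd_mul (c := B) hgPm.aestronglyMeasurable (Filter.Eventually.of_forall fun x => by
      rw [Real.norm_eq_abs, abs_of_nonneg (hgP0 x)]; exact hgPB x)
  have iM : Integrable (fun x => gM x * |U x - a|) μ :=
    hUi.bdd_mul (c := m) hgMm.aestronglyMeasurable (Filter.Eventually.of_forall fun x => by
      rw [Real.norm_eq_abs, abs_of_nonneg (hgM0 x)]; exact hgMB x)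
  have iPM : Integrable (fun x => gP x * |U x - a| + gM x * |U x - a|) μ := iP.add iM
  have hmq : 0 ≤ m ^ (q - 1) := Real.rpow_nonneg hm0 _
  rw [e]
  have hA1 : 0 ≤ A ^ (q - 1) := Real.rpow_nonneg hApos.le _
  calc _ ≤ ∫ x, (q * (gP x ^ q * |U x - a|) + q * m ^ (q - 1) * (gP x * |U x - a| + gM x * |U x - a|)) ∂μ := by
        rw [← Real.norm_eq_abs]
        refine norm_integral_le_of_norm_le
          ((hiF.const_mul q).add (iPM.const_mul _)) (Filter.Eventually.of_forall fun x => ?_)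
        rw [Real.norm_eq_abs, abs_mul]
        have := mul_le_mul_of_nonneg_right (abs_rpow_sub_rpow_le hq₁ hq₂ (hu0 x) hm0)
          (abs_nonneg (U x - a))
        refine this.trans (le_of_eq ?_)
        ring
    _ = q * ∫ x, gP x ^ q * |U x - a| ∂μ
        + q * m ^ (q - 1) * (∫ x, gP x * |U x - a| ∂μ + ∫ x, gM x * |U x - a| ∂μ) := by
        rw [integral_add (hiF.const_mul q) (iPM.const_mul _), integral_const_mul,
          integral_const_mul, integral_add iP iM]
    _ ≤ q * ((C + C' * (1 + K)) * (A ^ (q - 1) * D))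
        + q * (2 * A ^ (q - 1)) * (C' * D * E + C' * D * E) := by gcongr
    _ = covConst q C * A ^ (q - 1) * D := by
        simp only [covConst, ← hK, ← hC', ← hp, ← hE]
        ring

end HeisGibbs

namespace HeisGibbs

/-! ### Perturbation of a measure by a Lipschitz density -/

theorem abs_exp_sub_one_le_mul (y : ℝ) : |Real.exp y - 1| ≤ |y| * Real.exp |y| := by
  have := abs_exp_sub_exp_le (le_abs_self y) (abs_nonneg y)
  rw [Real.exp_zero, sub_zero] at this
  linarith

theorem abs_exp_sub_one_sub_le (y : ℝ) : |Real.exp y - 1 - y| ≤ |y| ^ 2 * Real.exp |y| := by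
  have h1 := Real.add_one_le_exp y
  have h2 : Real.exp y - 1 ≤ y * Real.exp y := by
    have h3 := Real.add_one_le_exp (-y)
    have h4 : Real.exp y * Real.exp (-y) = 1 := by rw [← Real.exp_add]; simp
    nlinarith [Real.exp_pos y]
  rw [abs_of_nonneg (by linarith)]
  calc Real.exp y - 1 - y ≤ y * (Real.exp y - 1) := by linarith
    _ ≤ |y| * |Real.exp y - 1| := by rw [← abs_mul]; exact le_abs_self _
    _ ≤ |y| * (|y| * Real.exp |y|) := by
        gcongr
        exact abs_exp_sub_one_le_mul y
    _ = _ := by ring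

theorem sq_le_eight_mul_exp {s : ℝ} (hs : 0 ≤ s) : s ^ 2 ≤ 8 * Real.exp (s / 2) := by
  have := Real.quadratic_le_exp_of_nonneg (by positivity : 0 ≤ s / 2)
  nlinarith

variable {μ : Measure Heis} [IsProbabilityMeasure μ] {q C : ℝ}

theorem HLip.div_const {L : ℝ} (hL : 0 < L) {H : Heis → ℝ} (hH : HLip L H) :
    HLip 1 fun x => H x / L := fun x k t => by
  rw [← sub_div, abs_div, abs_of_pos hL, div_le_iff₀ hL]
  linarith [hH x k t]

theorem HLip.eq_of_zero {H : Heis → ℝ} (hH : HLip 0 H) (x y : Heis) : H x = H y := by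
  have := hH.abs_sub_le y x
  rw [zero_mul] at this
  exact sub_eq_zero.1 (abs_nonpos_iff.1 this)

/-- The second moment of U/L read off from Herbst's bound, 8 being 2²·2. The case L = 0 is separate
because of the division. -/
theorem LSLip.variance_le (h : LSLip μ q C) (hq : 1 < q) (hC : 0 ≤ C) {U : Heis → ℝ} {L : ℝ}
    (hU : HLip L U) :
    ∫ x, (U x - ∫ y, U y ∂μ) ^ 2 ∂μ ≤ (8 * Real.exp (C / (q - 1)) * L ^ 2) := by
  have hL := hU.nonneg
  rcases hL.eq_or_lt with h0 | hLpos
  · rw [← h0] at hU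
    have e : ∀ x, U x - ∫ y, U y ∂μ = 0 := fun x => by
      have : ∀ y, U y = U x := fun y => hU.eq_of_zero y x
      simp [this]
    simp only [e, ← h0]
    simp
  · have h1 := h.integral_rpow_le hq hC (hU.div_const hLpos) (p := 2) two_pos
    have e : ∀ x, (U x - ∫ y, U y ∂μ) ^ 2 = L ^ 2 * |U x / L - ∫ y, U y / L ∂μ| ^ (2 : ℝ) := fun x => by
      rw [integral_div, ← sub_div, abs_div, Real.rpow_two, div_pow, sq_abs, sq_abs]
      field_simp
    simp_rw [e]
    rw [integral_const_mul]
    have h2 : (2 : ℝ) ^ (2 : ℝ) = 4 := by rw [Real.rpow_two]; norm_num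
    rw [h2] at h1
    nlinarith [sq_nonneg L]

/-- Estimates for the density `exp (H - μ H)`. -/
theorem LSLip.density_bounds (h : LSLip μ q C) (hq : 1 < q) (hC : 0 ≤ C) {H : Heis → ℝ} {ε : ℝ}
    (hε : 0 < ε) (hε' : ε ≤ 1 / 4) (hH : HLip ε H) :
    ∃ Y : Heis → ℝ, Measurable Y ∧ Integrable Y μ ∧ (∀ x, 0 ≤ Y x) ∧
      ∫ x, Y x ∂μ ≤ 16 * Real.exp (C / (q - 1)) ∧
      Integrable (fun x => Real.exp (H x - ∫ y, H y ∂μ)) μ ∧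
      (∀ x, (Real.exp (H x - ∫ y, H y ∂μ) - 1) ^ 2 ≤ ε ^ 2 * Y x) ∧
      (∀ x, |Real.exp (H x - ∫ y, H y ∂μ) - 1 - (H x - ∫ y, H y ∂μ)| ≤ ε ^ 2 * Y x) := by
  have hU := hH.div_const hε
  set U : Heis → ℝ := fun x => H x / ε
  have hHm : Measurable H := hH.continuous.measurable
  have hexp := h.integrable_exp_abs_sub hq hC hU (∫ y, U y ∂μ) one_pos
  have hb := h.herbst_abs hq hC hU one_pos
  rw [Real.one_rpow, mul_one] at hb
  have hHU : ∀ x, H x - ∫ y, H y ∂μ = ε * (U x - ∫ y, U y ∂μ) := fun x => by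
    simp only [U]
    rw [integral_div]
    field_simp
  set T : Heis → ℝ := fun x => |U x - ∫ y, U y ∂μ| with hT
  have habs : ∀ x, |H x - ∫ y, H y ∂μ| = ε * T x := fun x => by
    rw [hHU, abs_mul, abs_of_pos hε]
  have hT0 : ∀ x, 0 ≤ T x := fun x => abs_nonneg _
  have hsq : ∀ x, T x ^ 2 * Real.exp (T x / 2) ≤ 8 * Real.exp (1 * T x) := fun x => by
    have h1 := sq_le_eight_mul_exp (hT0 x)
    calc _ ≤ 8 * Real.exp (T x / 2) * Real.exp (T x / 2) := by gcongr
      _ = _ := by rw [mul_assoc, ← Real.exp_add]; ring_nf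
  -- With H - μH = ±εT, both errors are at most ε²T² times exp(2εT) or exp(εT). As ε ≤ 1/4 these
  -- exponentials are at most exp(T/2), and T² exp(T/2) ≤ 8 exp(T), whose mean is at most 16
  -- exp(C/(q-1)).
  refine ⟨fun x => 8 * Real.exp (1 * T x), by fun_prop, hexp.const_mul 8, fun x => by positivity, ?_, ?_,
    fun x => ?_, fun x => ?_⟩
  · rw [integral_const_mul]
    linarith
  · refine hexp.mono' (by fun_prop) (Filter.Eventually.of_forall fun x => ?_)
    rw [Real.norm_eq_abs, abs_of_pos (Real.exp_pos _), Real.exp_le_exp]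
    refine (le_abs_self _).trans ?_
    rw [habs]
    have := hT0 x
    change ε * T x ≤ 1 * T x
    nlinarith
  · have h1 := abs_exp_sub_one_le_mul (H x - ∫ y, H y ∂μ)
    rw [habs] at h1
    have h2 : (Real.exp (H x - ∫ y, H y ∂μ) - 1) ^ 2 ≤ (ε * T x * Real.exp (ε * T x)) ^ 2 := by
      rw [← sq_abs]
      exact pow_le_pow_left₀ (abs_nonneg _) h1 2
    refine h2.trans ?_
    have h3 : Real.exp (ε * T x) ^ 2 ≤ Real.exp (T x / 2) := by
      rw [← Real.exp_nat_mul, Real.exp_le_exp]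
      have := hT0 x
      push_cast
      nlinarith
    calc _ = ε ^ 2 * (T x ^ 2 * Real.exp (ε * T x) ^ 2) := by ring
      _ ≤ ε ^ 2 * (T x ^ 2 * Real.exp (T x / 2)) := by gcongr
      _ ≤ _ := by gcongr; exact hsq x
  · have h1 := abs_exp_sub_one_sub_le (H x - ∫ y, H y ∂μ)
    rw [habs] at h1
    refine h1.trans ?_
    have h3 : Real.exp (ε * T x) ≤ Real.exp (T x / 2) := by
      rw [Real.exp_le_exp]
      have := hT0 x
      nlinarith
    calc _ = ε ^ 2 * (T x ^ 2 * Real.exp (ε * T x)) := by ring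
      _ ≤ ε ^ 2 * (T x ^ 2 * Real.exp (T x / 2)) := by gcongr
      _ ≤ _ := by gcongr; exact hsq x

theorem HLip.integrable_of_LSLip (h : LSLip μ q C) (hq : 1 < q) (hC : 0 ≤ C) {H : Heis → ℝ} {ε : ℝ}
    (hε : 0 < ε) (hH : HLip ε H) : Integrable H μ := by
  have := (h.integrable hq hC (hH.div_const hε)).mul_const ε
  refine this.congr (Filter.Eventually.of_forall fun x => ?_)
  simp only
  field_simp

/-- The change of a mean under a perturbation is bounded by a covariance. -/
theorem abs_integral_tilted_sub_le {H : Heis → ℝ}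
    (hHi : Integrable H μ) (hexp : Integrable (fun x => Real.exp (H x - ∫ y, H y ∂μ)) μ)
    {g : Heis → ℝ} (hg : Measurable g) {B : ℝ} (hB : ∀ x, |g x| ≤ B) :
    |∫ x, g x ∂(μ.tilted H) - ∫ x, g x ∂μ|
      ≤ |∫ x, (g x - ∫ y, g y ∂μ) * (Real.exp (H x - ∫ y, H y ∂μ) - 1) ∂μ| := by
  set a := ∫ y, H y ∂μ with ha
  set b := ∫ y, g y ∂μ with hb
  set Z := ∫ x, Real.exp (H x - a) ∂μ with hZ
  have hgi := integrable_of_abs_le (μ := μ) hg hB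
  -- Jensen's inequality for the centred exponent, so the normalisation of the density can only
  -- help.
  have hZ1 : 1 ≤ Z := by
    have h1 : ∫ x, (H x - a + 1) ∂μ ≤ Z :=
      integral_mono ((hHi.sub (integrable_const a)).add (integrable_const 1)) hexp fun x =>
        Real.add_one_le_exp _
    have h2 : ∫ x, (H x - a + 1) ∂μ = 1 := by
      have h3 : Integrable (fun x => H x - a) μ := hHi.sub (integrable_const a)
      rw [integral_add h3 (integrable_const 1), integral_sub hHi (integrable_const a)]
      simp [← ha]
    linarith
  have hZ0 : 0 < Z := by linarith
  have hge : Integrable (fun x => g x * Real.exp (H x - a)) μ :=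
    hexp.bdd_mul hg.aestronglyMeasurable (Filter.Eventually.of_forall hB)
  have e1 : ∫ x, g x ∂(μ.tilted H) = (∫ x, g x * Real.exp (H x - a) ∂μ) / Z := by
    rw [integral_tilted]
    have e2 : ∀ x, Real.exp (H x) = Real.exp a * Real.exp (H x - a) := fun x => by
      rw [← Real.exp_add]; ring_nf
    simp_rw [e2]
    rw [integral_const_mul, ← hZ, ← integral_div]
    congr 1
    funext x
    have := Real.exp_pos a
    rw [smul_eq_mul]
    field_simp
  have e3 : ∫ x, (g x - b) * (Real.exp (H x - a) - 1) ∂μ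
      = (∫ x, g x * Real.exp (H x - a) ∂μ) - b * Z := by
    have : ∀ x, (g x - b) * (Real.exp (H x - a) - 1)
        = g x * Real.exp (H x - a) - b * Real.exp (H x - a) - g x + b := fun x => by ring
    simp_rw [this]
    rw [integral_sub_sub_add hge (hexp.const_mul b) hgi (integrable_const b), integral_const_mul,
      ← hZ, ← hb]
    simp
  have e4 : ∫ x, g x ∂(μ.tilted H) - b = (∫ x, (g x - b) * (Real.exp (H x - a) - 1) ∂μ) / Z := by
    rw [e1, e3]
    field_simp
  rw [e4, abs_div, abs_of_pos hZ0]
  exact div_le_self (abs_nonneg _) hZ1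

/-- Cauchy–Schwarz: the centred density differs from 1 by O(ε) in L². The standard deviation of g on
the right is what makes the Lipschitz constant at the averaged site appear later. -/
theorem LSLip.abs_tilted_sub_le (h : LSLip μ q C) (hq : 1 < q) (hC : 0 ≤ C) {H : Heis → ℝ} {ε : ℝ}
    (hε : 0 < ε) (hε' : ε ≤ 1 / 4) (hH : HLip ε H) {g : Heis → ℝ} (hg : Measurable g) {B : ℝ}
    (hB : ∀ x, |g x| ≤ B) :
    |∫ x, g x ∂(μ.tilted H) - ∫ x, g x ∂μ|
      ≤ 4 * Real.exp (C / (q - 1)) * ε * √(∫ x, (g x - ∫ y, g y ∂μ) ^ 2 ∂μ) := by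
  obtain ⟨Y, hYm, hYi, hY0, hYB, hexp, hsq, -⟩ := h.density_bounds hq hC hε hε' hH
  have hHm : Measurable H := hH.continuous.measurable
  refine (abs_integral_tilted_sub_le (HLip.integrable_of_LSLip h hq hC hε hH) hexp hg hB).trans ?_
  set b := ∫ y, g y ∂μ
  set w : Heis → ℝ := fun x => Real.exp (H x - ∫ y, H y ∂μ) - 1
  have hwm : Measurable w := by fun_prop
  have hw2 : Integrable (fun x => w x ^ 2) μ :=
    (hYi.const_mul (ε ^ 2)).mono' (by fun_prop) (Filter.Eventually.of_forall fun x => by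
      rw [Real.norm_eq_abs, abs_of_nonneg (sq_nonneg _)]; exact hsq x)
  have hgb : Measurable fun x => |g x - b| := (hg.sub_const b).abs
  have hgbB : ∀ x, |(|g x - b|)| ≤ B + |b| := fun x => by
    rw [abs_abs]; exact (abs_sub _ _).trans (by linarith [hB x])
  have hmem : MemLp (fun x => |w x|) (ENNReal.ofReal 2) μ := by
    rw [← integrable_norm_rpow_iff hwm.abs.aestronglyMeasurable (by simp) (by simp)]
    simpa using hw2
  have hH2 := integral_mul_le_Lp_mul_Lq_of_nonneg (μ := μ) Real.HolderConjugate.two_two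
    (f := fun x => |g x - b|) (g := fun x => |w x|) (Filter.Eventually.of_forall fun x => abs_nonneg _)
    (Filter.Eventually.of_forall fun x => abs_nonneg _) (memLp_of_bdd hgb hgbB _) hmem
  simp only [Real.rpow_two, sq_abs, ← Real.sqrt_eq_rpow] at hH2
  have h2 : √(∫ x, w x ^ 2 ∂μ) ≤ 4 * Real.exp (C / (q - 1)) * ε := by
    rw [Real.sqrt_le_left (by positivity)]
    calc _ ≤ ∫ x, ε ^ 2 * Y x ∂μ := integral_mono hw2 (hYi.const_mul _) hsq
      _ ≤ ε ^ 2 * (16 * Real.exp (C / (q - 1))) := by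
          rw [integral_const_mul]; gcongr
      _ ≤ ε ^ 2 * (16 * Real.exp (C / (q - 1)) ^ 2) := by
          have : 1 ≤ Real.exp (C / (q - 1)) :=
            Real.one_le_exp (div_nonneg hC (by linarith))
          gcongr
          nlinarith
      _ = _ := by ring
  calc _ ≤ ∫ x, |g x - b| * |w x| ∂μ := by
        refine abs_integral_le_integral_abs.trans (le_of_eq ?_)
        congr 1; funext x; exact abs_mul _ _
    _ ≤ √(∫ x, (g x - b) ^ 2 ∂μ) * √(∫ x, w x ^ 2 ∂μ) := hH2
    _ ≤ √(∫ x, (g x - b) ^ 2 ∂μ) * (4 * Real.exp (C / (q - 1)) * ε) := by gcongr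
    _ = _ := by ring

theorem abs_integral_le_of_abs_le {S : Type*} [MeasurableSpace S] {μ : Measure S}
    [IsProbabilityMeasure μ] {g : S → ℝ} {B : ℝ} (hB : ∀ x, |g x| ≤ B) : |∫ x, g x ∂μ| ≤ B := by
  have := norm_integral_le_of_norm_le_const (μ := μ) (f := g) (C := B)
    (Filter.Eventually.of_forall hB)
  simpa using this

/-- Expanding the density to first order, the linear term is a covariance of u^q with H, bounded by
`LSLip.cov_le`. The remainder is O(ε²) with a crude constant; since ε will be κ|t|, it disappears in
the slope as t tends to 0. -/
theorem LSLip.abs_tilted_rpow_sub_le (h : LSLip μ q C) (hq₁ : 1 < q) (hq₂ : q ≤ 2) (hC : 0 ≤ C)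
    {H : Heis → ℝ} {ε : ℝ} (hε : 0 < ε) (hε' : ε ≤ 1 / 4) (hH : HLip ε H) {u G : Heis → ℝ}
    {L B δ : ℝ} (hu : HLip L u) (hδ : 0 < δ) (hδu : ∀ x, δ ≤ u x) (hB : ∀ x, u x ≤ B)
    (hGm : Measurable G) (hG0 : ∀ x, 0 ≤ G x) (hGB : ∀ x, G x ≤ B) (hs : HSlope u G) :
    |∫ x, u x ^ q ∂(μ.tilted H) - ∫ x, u x ^ q ∂μ|
      ≤ ε * (covConst q C * ((∫ x, u x ^ q ∂μ) ^ (1 / q)) ^ (q - 1) * (∫ x, G x ^ q ∂μ) ^ (1 / q))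
        + ε ^ 2 * (32 * Real.exp (C / (q - 1)) * B ^ q) := by
  have hq0 : 0 < q := by linarith
  obtain ⟨Y, hYm, hYi, hY0, hYB, hexp, -, hsq⟩ := h.density_bounds hq₁ hC hε hε' hH
  have hu0 : ∀ x, 0 ≤ u x := fun x => hδ.le.trans (hδu x)
  have hum : Measurable u := hu.continuous.measurable
  have huqm : Measurable fun x => u x ^ q := hum.pow_const q
  have huq0 : ∀ x, 0 ≤ u x ^ q := fun x => Real.rpow_nonneg (hu0 x) q
  have huqB : ∀ x, u x ^ q ≤ B ^ q := fun x => Real.rpow_le_rpow (hu0 x) (hB x) hq0.le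
  have huqB' : ∀ x, |u x ^ q| ≤ B ^ q := fun x => by rw [abs_of_nonneg (huq0 x)]; exact huqB x
  have hHi := HLip.integrable_of_LSLip h hq₁ hC hε hH
  have hHm : Measurable H := hH.continuous.measurable
  refine (abs_integral_tilted_sub_le hHi hexp huqm huqB').trans ?_
  set b := ∫ y, u y ^ q ∂μ with hb
  set a := ∫ y, H y ∂μ with ha
  have hbB : |b| ≤ B ^ q := abs_integral_le_of_abs_le huqB'
  have hHa : Integrable (fun x => H x - a) μ := hHi.sub (integrable_const a)
  have hdiff : Measurable fun x => u x ^ q - b := huqm.sub_const b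
  have hdiffB : ∀ x, |u x ^ q - b| ≤ 2 * B ^ q := fun x =>
    (abs_sub _ _).trans (by linarith [huqB' x])
  have i1 : Integrable (fun x => (u x ^ q - b) * (H x - a)) μ :=
    hHa.bdd_mul hdiff.aestronglyMeasurable (Filter.Eventually.of_forall hdiffB)
  have i2 : Integrable (fun x => (u x ^ q - b) * (Real.exp (H x - a) - 1 - (H x - a))) μ :=
    ((hexp.sub (integrable_const 1)).sub hHa).bdd_mul hdiff.aestronglyMeasurable
      (Filter.Eventually.of_forall hdiffB)
  have e1 : ∫ x, (u x ^ q - b) * (Real.exp (H x - a) - 1) ∂μ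
      = ∫ x, (u x ^ q - b) * (H x - a) ∂μ
        + ∫ x, (u x ^ q - b) * (Real.exp (H x - a) - 1 - (H x - a)) ∂μ := by
    rw [← integral_add i1 i2]
    congr 1; funext x; ring
  have e2 : ∫ x, (u x ^ q - b) * (H x - a) ∂μ
      = ε * ∫ x, u x ^ q * (H x / ε - ∫ y, H y / ε ∂μ) ∂μ := by
    have i3 : Integrable (fun x => u x ^ q * (H x - a)) μ :=
      hHa.bdd_mul huqm.aestronglyMeasurable (Filter.Eventually.of_forall huqB')
    have hz : ∫ x, (H x - a) ∂μ = 0 := by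
      rw [integral_sub hHi (integrable_const a)]; simp [← ha]
    simp_rw [sub_mul]
    rw [integral_sub i3 (hHa.const_mul b), integral_const_mul, hz, mul_zero, sub_zero,
      ← integral_const_mul]
    congr 1; funext x
    rw [integral_div, ← ha]
    field_simp
  have hcov := h.cov_le hq₁ hq₂ hC hu hδ hδu hB hGm hG0 hGB hs (hH.div_const hε)
  have e3 : |∫ x, (u x ^ q - b) * (Real.exp (H x - a) - 1 - (H x - a)) ∂μ|
      ≤ ε ^ 2 * (32 * Real.exp (C / (q - 1)) * B ^ q) := by
    calc _ ≤ ∫ x, 2 * B ^ q * (ε ^ 2 * Y x) ∂μ := by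
          rw [← Real.norm_eq_abs]
          refine norm_integral_le_of_norm_le ((hYi.const_mul _).const_mul _)
            (Filter.Eventually.of_forall fun x => ?_)
          rw [Real.norm_eq_abs, abs_mul]
          exact mul_le_mul (hdiffB x) (hsq x) (abs_nonneg _) ((abs_nonneg _).trans (hdiffB x))
      _ = 2 * B ^ q * (ε ^ 2 * ∫ x, Y x ∂μ) := by rw [integral_const_mul, integral_const_mul]
      _ ≤ 2 * B ^ q * (ε ^ 2 * (16 * Real.exp (C / (q - 1)))) := by
          have : 0 ≤ B ^ q := (huq0 0).trans (huqB 0)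
          gcongr
      _ = _ := by ring
  rw [e1]
  refine (abs_add_le _ _).trans (add_le_add ?_ e3)
  rw [e2, abs_mul, abs_of_pos hε]
  gcongr

end HeisGibbs

/-! ### The lattice: the specification, and the effect of a single site average on derivatives. -/

namespace HeisGibbs

/-! ### The specification as a family of kernels -/

variable {N : ℕ} {φ : Heis → ℝ} {V : Heis → Heis → ℝ} {J : Site N → Site N → ℝ}

theorem latDist_self (i : Site N) : latDist i i = 0 := by simp [latDist]

theorem not_mem_nbrs_self (i : Site N) : i ∉ nbrs i := by
  rw [mem_nbrs, latDist_self]; norm_num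

theorem mem_nbrs_comm {i j : Site N} : j ∈ nbrs i ↔ i ∈ nbrs j := by
  rw [mem_nbrs, mem_nbrs, latDist_comm]

theorem mem_bonds_singleton {i : Site N} {e : Site N × Site N} :
    e ∈ bonds {i} ↔ (e.1 = i ∧ e.2 ∈ nbrs i) ∨ (e.2 = i ∧ e.1 ∈ nbrs i) := by
  rw [mem_bonds]
  simp only [Finset.mem_singleton, mem_nbrs]
  constructor
  · rintro ⟨h, rfl | rfl⟩
    · exact Or.inl ⟨rfl, h⟩
    · exact Or.inr ⟨rfl, by rw [latDist_comm]; exact h⟩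
  · rintro (⟨rfl, h⟩ | ⟨rfl, h⟩)
    · exact ⟨h, Or.inl rfl⟩
    · exact ⟨by rw [latDist_comm]; exact h, Or.inr rfl⟩

theorem glue_update (Λ : Finset (Site N)) (ω : Config N) (x : Λ → Heis) (i : Λ) (y : Heis) :
    glue Λ ω (Function.update x i y) = Function.update (glue Λ ω x) i y := by
  funext j
  by_cases hj : j = i
  · subst hj
    simp [glue]
  · rw [Function.update_of_ne hj]
    simp only [glue]
    split_ifs with h
    · rw [Function.update_of_ne]
      exact fun h' => hj (congrArg Subtype.val h')
    · rfl

theorem glue_singleton (i : Site N) (ω : Config N) (x : ({i} : Finset (Site N)) → Heis) :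
    glue {i} ω x = Function.update ω i (x ⟨i, Finset.mem_singleton_self i⟩) := by
  funext j
  by_cases hj : j = i
  · subst hj
    simp [glue]
  · rw [Function.update_of_ne hj]
    simp [glue, hj]

theorem measurable_glue_uncurry (Λ : Finset (Site N)) :
    Measurable fun p : Config N × (Λ → Heis) => glue Λ p.1 p.2 := by
  rw [measurable_pi_iff]
  intro j
  by_cases h : j ∈ Λ
  · simp only [glue, h, dif_pos]
    exact (measurable_pi_apply _).comp measurable_snd
  · simp only [glue, h, dif_neg, not_false_iff]
    exact (measurable_pi_apply _).comp measurable_fst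

theorem measurable_glue (Λ : Finset (Site N)) (ω : Config N) : Measurable (glue Λ ω) :=
  (measurable_glue_uncurry Λ).comp measurable_prodMk_left

theorem continuous_energy (hφ : Continuous φ) (hV : Continuous fun p : Heis × Heis => V p.1 p.2)
    (Λ : Finset (Site N)) : Continuous (energy φ V J Λ) := by
  unfold energy
  refine (continuous_finsetSum _ fun i _ => hφ.comp (continuous_apply i)).add
    (continuous_finsetSum _ fun e _ => continuous_const.mul ?_)
  exact hV.comp (f := fun η : Config N => (η e.1, η e.2))
    ((continuous_apply e.1).prodMk (continuous_apply e.2))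

/-- Continuous potentials with finite partition functions. -/
structure Regular (φ : Heis → ℝ) (V : Heis → Heis → ℝ) (J : Site N → Site N → ℝ) : Prop where
  cont_phi : Continuous φ
  cont_V : Continuous fun p : Heis × Heis => V p.1 p.2
  fin : FinitePartition φ V J

theorem Regular.measurable_energy (h : Regular φ V J) (Λ : Finset (Site N)) :
    Measurable (energy φ V J Λ) := (continuous_energy h.cont_phi h.cont_V Λ).measurable

theorem Regular.prob_localSpec (h : Regular φ V J) (Λ : Finset (Site N)) (ω : Config N) :
    IsProbabilityMeasure (localSpec φ V J Λ ω) := by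
  have := isProbabilityMeasure_tilted (h.fin Λ ω)
  exact Measure.isProbabilityMeasure_map (measurable_glue Λ ω).aemeasurable

theorem lintegral_localSpec (Λ : Finset (Site N)) (ω : Config N) {f : Config N → ℝ≥0∞}
    (hf : Measurable f) :
    ∫⁻ η, f η ∂(localSpec φ V J Λ ω)
      = ∫⁻ x : Λ → Heis, ENNReal.ofReal (Real.exp (-energy φ V J Λ (glue Λ ω x))
          / ∫ y : Λ → Heis, Real.exp (-energy φ V J Λ (glue Λ ω y))) * f (glue Λ ω x) := by
  rw [localSpec, lintegral_map hf (measurable_glue Λ ω), lintegral_tilted]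

theorem Regular.measurable_density (h : Regular φ V J) (Λ : Finset (Site N)) :
    Measurable fun p : Config N × (Λ → Heis) =>
      Real.exp (-energy φ V J Λ (glue Λ p.1 p.2))
          / ∫ y : Λ → Heis, Real.exp (-energy φ V J Λ (glue Λ p.1 y)) := by
  have h1 : Measurable fun p : Config N × (Λ → Heis) =>
      Real.exp (-energy φ V J Λ (glue Λ p.1 p.2)) :=
    ((h.measurable_energy Λ).comp (measurable_glue_uncurry Λ)).neg.exp
  refine h1.div ?_
  have h2 : Measurable fun ω : Config N => ∫ y : Λ → Heis, Real.exp (-energy φ V J Λ (glue Λ ω y)) :=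
    (StronglyMeasurable.integral_prod_right (ν := (volume : Measure (Λ → Heis)))
      (f := fun ω y => Real.exp (-energy φ V J Λ (glue Λ ω y))) h1.stronglyMeasurable).measurable
  exact h2.comp measurable_fst

theorem Regular.measurable_localSpec (h : Regular φ V J) (Λ : Finset (Site N)) :
    Measurable (localSpec φ V J Λ) := by
  refine Measure.measurable_of_measurable_coe _ fun s hs => ?_
  have : ∀ ω, localSpec φ V J Λ ω s
      = ∫⁻ x : Λ → Heis, ENNReal.ofReal (Real.exp (-energy φ V J Λ (glue Λ ω x))
          / ∫ y : Λ → Heis, Real.exp (-energy φ V J Λ (glue Λ ω y))) * s.indicator 1 (glue Λ ω x) :=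
    fun ω => by
      rw [← lintegral_localSpec Λ ω (measurable_one.indicator hs), lintegral_indicator_one hs]
  simp_rw [this]
  refine Measurable.lintegral_prod_right' (f := fun p : Config N × (Λ → Heis) =>
    ENNReal.ofReal (Real.exp (-energy φ V J Λ (glue Λ p.1 p.2))
          / ∫ y : Λ → Heis, Real.exp (-energy φ V J Λ (glue Λ p.1 y)))
          * s.indicator 1 (glue Λ p.1 p.2)) ?_
  exact (h.measurable_density Λ).ennreal_ofReal.mul
    ((measurable_one.indicator hs).comp (measurable_glue_uncurry Λ))

/-- The log-density of the single site measure. -/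
def siteW (φ : Heis → ℝ) (V : Heis → Heis → ℝ) (J : Site N → Site N → ℝ) (i : Site N)
    (ω : Config N) (x : Heis) : ℝ := -energy φ V J {i} (Function.update ω i x)

theorem map_tilted_equiv {α β : Type*} [MeasurableSpace α] [MeasurableSpace β] {μ : Measure α}
    {ν : Measure β} (e : α ≃ᵐ β) (he : MeasurePreserving e μ ν) (W : β → ℝ) :
    (μ.tilted fun x => W (e x)).map e = ν.tilted W := by
  ext s hs
  rw [Measure.map_apply e.measurable hs, tilted_apply' _ _ (e.measurable hs), tilted_apply' _ _ hs,
    he.integral_comp' (fun y => Real.exp (W y)),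
    ← he.setLIntegral_comp_preimage_emb e.measurableEmbedding]

theorem map_eval_tilted (i : Site N) (ω : Config N) :
    ((volume : Measure (({i} : Finset (Site N)) → Heis)).tilted
      fun x => -energy φ V J {i} (glue {i} ω x)).map (fun x => x ⟨i, Finset.mem_singleton_self i⟩)
      = volume.tilted (siteW φ V J i ω) := by
  have : Unique (({i} : Finset (Site N)) : Type) := 
    { default := ⟨i, Finset.mem_singleton_self i⟩
      uniq := fun x => Subtype.ext (Finset.mem_singleton.1 x.2) }
  have e := map_tilted_equiv (MeasurableEquiv.piUnique fun _ : (({i} : Finset (Site N)) : Type) => Heis)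
    (volume_preserving_piUnique _) (siteW φ V J i ω)
  have h1 : ∀ x : ({i} : Finset (Site N)) → Heis,
      (MeasurableEquiv.piUnique fun _ : (({i} : Finset (Site N)) : Type) => Heis) x
        = x ⟨i, Finset.mem_singleton_self i⟩ := fun x =>
    congrArg x (Subsingleton.elim _ _)
  have h2 : (⇑(MeasurableEquiv.piUnique fun _ : (({i} : Finset (Site N)) : Type) => Heis))
      = fun x => x ⟨i, Finset.mem_singleton_self i⟩ := funext h1
  rw [h2] at e
  rw [← e]
  congr 2
  funext x
  rw [glue_singleton]
  rfl

theorem singleSite_eq (i : Site N) (ω : Config N) :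
    singleSite φ V J i ω = volume.tilted (siteW φ V J i ω) := by
  rw [singleSite, localSpec, Measure.map_map (measurable_pi_apply i) (measurable_glue _ _),
    ← map_eval_tilted]
  congr 1
  funext x
  simp [glue_singleton]

theorem localSpec_singleton (i : Site N) (ω : Config N) :
    localSpec φ V J {i} ω = (singleSite φ V J i ω).map (Function.update ω i) := by
  rw [singleSite_eq, ← map_eval_tilted, Measure.map_map (measurable_update ω) (measurable_pi_apply _),
    localSpec]
  congr 1
  funext x
  simp [glue_singleton]

theorem Regular.prob_singleSite (h : Regular φ V J) (i : Site N) (ω : Config N) :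
    IsProbabilityMeasure (singleSite φ V J i ω) := by
  have := h.prob_localSpec {i} ω
  exact Measure.isProbabilityMeasure_map (measurable_pi_apply i).aemeasurable

theorem Regular.measurable_singleSite (h : Regular φ V J) (i : Site N) :
    Measurable (singleSite φ V J i) :=
  (Measure.measurable_map _ (measurable_pi_apply i)).comp (h.measurable_localSpec {i})

theorem Regular.continuous_siteW (h : Regular φ V J) (i : Site N) (ω : Config N) :
    Continuous (siteW φ V J i ω) :=
  ((continuous_energy h.cont_phi h.cont_V {i}).comp (by fun_prop)).neg

/-- A tilt by a non-integrable density is the zero measure by convention, whereas the single site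
measure has mass one. -/
theorem Regular.integrable_exp_siteW (h : Regular φ V J) (i : Site N) (ω : Config N) :
    Integrable fun x => Real.exp (siteW φ V J i ω x) := by
  by_contra hi
  have h1 : volume.tilted (siteW φ V J i ω) = 0 := tilted_of_not_integrable hi
  have h2 := h.prob_singleSite i ω
  rw [singleSite_eq, h1] at h2
  exact h2.ne_zero _ rfl

theorem Regular.lsLip (h : Regular φ V J) {q c : ℝ} (hq₁ : 1 < q) (hq₂ : q ≤ 2) (hc : 0 ≤ c)
    (h0 : H0 φ V J q c) (i : Site N) (ω : Config N) : LSLip (singleSite φ V J i ω) q (2 * c) := by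
  have := h0 i ω
  rw [singleSite_eq] at this ⊢
  exact this.lsLip (h.continuous_siteW i ω) (h.integrable_exp_siteW i ω) hq₁ hq₂ hc

theorem siteW_congr {i : Site N} {ω ω' : Config N} (h : ∀ j ∈ nbrs i, ω j = ω' j) :
    siteW φ V J i ω = siteW φ V J i ω' := by
  funext x
  simp only [siteW, energy, Finset.sum_singleton, Function.update_self]
  congr 2
  refine Finset.sum_congr rfl fun e he => ?_
  have key : ∀ j, j = i ∨ j ∈ nbrs i → Function.update ω i x j = Function.update ω' i x j := by
    rintro j (rfl | hj)
    · simp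
    · have : j ≠ i := fun hh => not_mem_nbrs_self i (hh ▸ hj)
      rw [Function.update_of_ne this, Function.update_of_ne this, h j hj]
  rcases mem_bonds_singleton.1 he with ⟨h1, h2⟩ | ⟨h1, h2⟩
  · rw [key e.1 (Or.inl h1), key e.2 (Or.inr h2)]
  · rw [key e.2 (Or.inl h1), key e.1 (Or.inr h2)]

theorem singleSite_congr {i : Site N} {ω ω' : Config N} (h : ∀ j ∈ nbrs i, ω j = ω' j) :
    singleSite φ V J i ω = singleSite φ V J i ω' := by
  rw [singleSite_eq, singleSite_eq, siteW_congr h]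

theorem singleSite_update_self (i : Site N) (ω : Config N) (y : Heis) :
    singleSite φ V J i (Function.update ω i y) = singleSite φ V J i ω :=
  singleSite_congr fun j hj => by
    rw [Function.update_of_ne]; exact fun hh => not_mem_nbrs_self i (hh ▸ hj)

/-- The configuration `ω` moved in the coordinate `j` along the field `X k` for the time `t`. -/
def shift {ι : Type*} [DecidableEq ι] (ω : ι → Heis) (j : ι) (k : Fin 2) (t : ℝ) : ι → Heis :=
  Function.update ω j (flow k t (ω j))

/-- H is the change of the log-density at i. Its increments along a flow are sums of mixed
differences of V, and only the ordered pairs (i,j) and (j,i) contribute; this explains the 2. The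
self-potential φ cancels, and (H1) enters the lattice argument only here. -/
theorem Regular.singleSite_shift (h : Regular φ V J) {M J₀ : ℝ} (h1 : H1 V M)
    (hJ : ∀ i j, |J i j| ≤ J₀) {i j : Site N} (hij : j ≠ i) (ω : Config N) (k : Fin 2) (t : ℝ) :
    ∃ H : Heis → ℝ, HLip (2 * J₀ * M * |t|) H ∧
      singleSite φ V J i (shift ω j k t) = (singleSite φ V J i ω).tilted H := by
  have hM := h1.nonneg
  have hJ0 : 0 ≤ J₀ := (abs_nonneg _).trans (hJ i i)
  refine ⟨siteW φ V J i (shift ω j k t) - siteW φ V J i ω, fun x l s => ?_, ?_⟩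
  · simp only [Pi.sub_apply, siteW, energy, Finset.sum_singleton, Function.update_self]
    have e0 : ∀ a b c d p r : ℝ, -(a + b) - -(a + c) - (-(p + d) - -(p + r)) = -(b - c - d + r) :=
      fun a b c d p r => by ring
    rw [e0, abs_neg, ← Finset.sum_sub_distrib, ← Finset.sum_sub_distrib, ← Finset.sum_add_distrib]
    refine (Finset.abs_sum_le_sum_abs _ _).trans ?_
    have key : ∀ e ∈ bonds {i},
        |J e.1 e.2 * V (Function.update (shift ω j k t) i (flow l s x) e.1)
              (Function.update (shift ω j k t) i (flow l s x) e.2)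
          - J e.1 e.2 * V (Function.update ω i (flow l s x) e.1)
              (Function.update ω i (flow l s x) e.2)
          - J e.1 e.2 * V (Function.update (shift ω j k t) i x e.1)
              (Function.update (shift ω j k t) i x e.2)
          + J e.1 e.2 * V (Function.update ω i x e.1) (Function.update ω i x e.2)|
          ≤ if e ∈ ({(i, j), (j, i)} : Finset (Site N × Site N)) then J₀ * (M * |t| * |s|) else 0 := by
      intro e he
      by_cases hej : e ∈ ({(i, j), (j, i)} : Finset (Site N × Site N))
      · rw [if_pos hej]
        rw [Finset.mem_insert, Finset.mem_singleton] at hej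
        rcases hej with rfl | rfl
        · simp only [Function.update_self, Function.update_of_ne hij, shift]
          rw [show ∀ a b c d p : ℝ, a * b - a * c - a * d + a * p = a * (b - c - d + p) from
            fun a b c d p => by ring, abs_mul]
          have := abs_mixedDiff_le h1 h.cont_V l k s t x (ω j)
          rw [mixedDiff] at this
          refine mul_le_mul (hJ _ _) ?_ (abs_nonneg _) hJ0
          linarith
        · simp only [Function.update_self, Function.update_of_ne hij, shift]
          rw [show ∀ a b c d p : ℝ, a * b - a * c - a * d + a * p = a * (b - d - c + p) from
            fun a b c d p => by ring, abs_mul]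
          have := abs_mixedDiff_le h1 h.cont_V k l t s (ω j) x
          rw [mixedDiff] at this
          exact mul_le_mul (hJ _ _) this (abs_nonneg _) hJ0
      · rw [if_neg hej]
        rw [Finset.mem_insert, Finset.mem_singleton, not_or] at hej
        have ne : e.1 ≠ j ∧ e.2 ≠ j := by
          constructor
          · intro h2
            rcases mem_bonds_singleton.1 he with ⟨h3, -⟩ | ⟨h3, -⟩
            · exact hij (h2.symm.trans h3)
            · exact hej.2 (Prod.ext h2 h3)
          · intro h2
            rcases mem_bonds_singleton.1 he with ⟨h3, -⟩ | ⟨h3, -⟩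
            · exact hej.1 (Prod.ext h3 h2)
            · exact hij (h2.symm.trans h3)
        have e1 : ∀ y m, m ≠ j → Function.update (shift ω j k t) i y m = Function.update ω i y m := by
          intro y m hm
          by_cases hmi : m = i
          · subst hmi; simp
          · rw [Function.update_of_ne hmi, Function.update_of_ne hmi, shift, Function.update_of_ne hm]
        rw [e1 _ _ ne.1, e1 _ _ ne.2, e1 _ _ ne.1, e1 _ _ ne.2]
        apply le_of_eq
        rw [abs_eq_zero]
        ring
    refine (Finset.sum_le_sum key).trans ?_
    rw [← Finset.sum_filter]
    have hcard : ((bonds {i}).filter fun e => e ∈ ({(i, j), (j, i)} : Finset (Site N × Site N))).card ≤ 2 :=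
      (Finset.card_le_card fun e he => (Finset.mem_filter.1 he).2).trans Finset.card_le_two
    rw [Finset.sum_const, nsmul_eq_mul]
    have h2 : (0 : ℝ) ≤ J₀ * (M * |t| * |s|) := by positivity
    calc _ ≤ (2 : ℝ) * (J₀ * (M * |t| * |s|)) := by
          gcongr
          exact_mod_cast hcard
      _ = _ := by ring
  · rw [singleSite_eq, singleSite_eq, tilted_tilted (h.integrable_exp_siteW i ω)]
    congr 1
    abel

/-! ### Consistency -/

theorem energy_eq_singleton_add {Λ : Finset (Site N)} {i : Site N} (hi : i ∈ Λ) (η : Config N) :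
    ∃ r : ℝ, ∀ y, energy φ V J Λ (Function.update η i y)
      = energy φ V J {i} (Function.update η i y) + r := by
  refine ⟨∑ j ∈ Λ.erase i, φ (η j) + ∑ e ∈ bonds Λ \ bonds {i}, J e.1 e.2 * V (η e.1) (η e.2),
    fun y => ?_⟩
  have hsub : bonds {i} ⊆ bonds Λ := fun e he => by
    rw [mem_bonds] at he ⊢
    refine ⟨he.1, he.2.imp (fun h => ?_) fun h => ?_⟩ <;> rwa [Finset.mem_singleton.1 h]
  have e1 : ∑ j ∈ Λ.erase i, φ (Function.update η i y j) = ∑ j ∈ Λ.erase i, φ (η j) :=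
    Finset.sum_congr rfl fun j hj => by rw [Function.update_of_ne (Finset.ne_of_mem_erase hj)]
  have e2 : ∑ e ∈ bonds Λ \ bonds {i}, J e.1 e.2 * V (Function.update η i y e.1) (Function.update η i y e.2)
      = ∑ e ∈ bonds Λ \ bonds {i}, J e.1 e.2 * V (η e.1) (η e.2) := by
    refine Finset.sum_congr rfl fun e he => ?_
    rw [Finset.mem_sdiff, mem_bonds, mem_bonds, not_and, not_or] at he
    have := he.2 he.1.1
    simp only [Finset.mem_singleton] at this
    rw [Function.update_of_ne this.1, Function.update_of_ne this.2]
  rw [← e1, ← e2, energy, energy, ← Finset.add_sum_erase Λ _ hi, ← Finset.sum_sdiff hsub,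
    Finset.sum_singleton]
  ring

/-- Consistency of the specification. It suffices to compare the two integrands after integrating
out the coordinate i. In that coordinate the density for Λ is a constant times the single site
density, because energy terms not involving i are constants. -/
theorem Regular.localSpec_bind (h : Regular φ V J) {Λ : Finset (Site N)} {i : Site N} (hi : i ∈ Λ)
    (ω : Config N) : (localSpec φ V J Λ ω).bind (localSpec φ V J {i}) = localSpec φ V J Λ ω := by
  ext s hs
  have hf : Measurable (s.indicator (1 : Config N → ℝ≥0∞)) := measurable_one.indicator hs
  set f := s.indicator (1 : Config N → ℝ≥0∞)
  rw [← lintegral_indicator_one hs, ← lintegral_indicator_one hs,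
    Measure.lintegral_bind (h.measurable_localSpec {i}).aemeasurable hf.aemeasurable]
  have hEf : Measurable fun η => ∫⁻ x, f x ∂(localSpec φ V J {i} η) :=
    (Measure.measurable_lintegral hf).comp (h.measurable_localSpec {i})
  rw [lintegral_localSpec Λ ω hEf, lintegral_localSpec Λ ω hf]
  have hd := (h.measurable_density Λ).comp (measurable_prodMk_left (x := ω))
  refine lintegral_eq_of_lmarginal_eq (μ := fun _ : Λ => (volume : Measure Heis)) {⟨i, hi⟩}
    (hd.ennreal_ofReal.mul (hEf.comp (measurable_glue Λ ω)))
    (hd.ennreal_ofReal.mul (hf.comp (measurable_glue Λ ω))) ?_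
  rw [lmarginal_singleton, lmarginal_singleton]
  funext x
  simp only [glue_update]
  set η := glue Λ ω x
  set Z := ∫ y : Λ → Heis, Real.exp (-energy φ V J Λ (glue Λ ω y))
  obtain ⟨r, hr⟩ := energy_eq_singleton_add (φ := φ) (V := V) (J := J) hi η
  set Z₁ := ∫ x, Real.exp (siteW φ V J i η x)
  have hZ₁ : 0 < Z₁ := integral_exp_pos (h.integrable_exp_siteW i η)
  have hE : ∀ y, ENNReal.ofReal (Real.exp (-energy φ V J Λ (Function.update η i y)) / Z)
      = ENNReal.ofReal (Real.exp (-r) * Z₁ / Z) * ENNReal.ofReal (Real.exp (siteW φ V J i η y) / Z₁) :=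
    fun y => by
      rw [← ENNReal.ofReal_mul' (by positivity), hr y, siteW]
      congr 1
      rw [neg_add, Real.exp_add]
      field_simp
  have hl : ∀ y, localSpec φ V J {i} (Function.update η i y) = localSpec φ V J {i} η := fun y => by
    rw [localSpec_singleton, localSpec_singleton, singleSite_update_self]
    congr 1
    funext z
    simp
  simp only [hE, hl]
  have hWm := (h.continuous_siteW i η).measurable
  have hm1 : Measurable fun y => ENNReal.ofReal (Real.exp (siteW φ V J i η y) / Z₁) := by fun_prop
  have hfu : Measurable fun y => f (Function.update η i y) := hf.comp (measurable_update η)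
  have hm2 : Measurable fun y => ENNReal.ofReal (Real.exp (siteW φ V J i η y) / Z₁)
      * f (Function.update η i y) := hm1.mul hfu
  rw [lintegral_mul_const _ (hm1.const_mul _), lintegral_const_mul _ hm1]
  simp only [mul_assoc]
  rw [lintegral_const_mul _ (hm2)]
  congr 1
  have h1 : ∫⁻ y, ENNReal.ofReal (Real.exp (siteW φ V J i η y) / Z₁) = 1 := by
    have := h.prob_singleSite i η
    have h2 : (singleSite φ V J i η) Set.univ = 1 := measure_univ
    rwa [singleSite_eq, tilted_apply' _ _ MeasurableSet.univ, Measure.restrict_univ] at h2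
  rw [h1, one_mul, localSpec_singleton, lintegral_map hf (measurable_update η), singleSite_eq,
    lintegral_tilted]

end HeisGibbs

namespace HeisGibbs

/-! ### The norm of `L^q` for bounded nonnegative functions -/

section Lq

variable {S : Type*} [MeasurableSpace S] {μ : Measure S} {q : ℝ}

/-- The norm `(∫ f ^ q) ^ (1 / q)` of a nonnegative function. -/
def lqn (μ : Measure S) (q : ℝ) (f : S → ℝ) : ℝ := (∫ x, f x ^ q ∂μ) ^ (1 / q)

theorem lqn_nonneg {f : S → ℝ} (h0 : ∀ x, 0 ≤ f x) : 0 ≤ lqn μ q f :=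
  Real.rpow_nonneg (integral_nonneg fun x => Real.rpow_nonneg (h0 x) q) _

theorem integrable_rpow_of_bounds [IsFiniteMeasure μ] (hq : 0 ≤ q) {f : S → ℝ} (hf : Measurable f) (h0 : ∀ x, 0 ≤ f x)
    {B : ℝ} (hB : ∀ x, f x ≤ B) : Integrable (fun x => f x ^ q) μ :=
  integrable_of_bounds (hf.pow_const q) (fun x => Real.rpow_nonneg (h0 x) q)
    fun x => Real.rpow_le_rpow (h0 x) (hB x) hq

theorem lqn_rpow (hq : 0 < q) {f : S → ℝ} (h0 : ∀ x, 0 ≤ f x) :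
    lqn μ q f ^ q = ∫ x, f x ^ q ∂μ := by
  rw [lqn, ← Real.rpow_mul (integral_nonneg fun x => Real.rpow_nonneg (h0 x) q),
    one_div_mul_cancel hq.ne', Real.rpow_one]

theorem lqn_mono [IsFiniteMeasure μ] (hq : 0 < q) {f g : S → ℝ} (hf : Measurable f) (hg : Measurable g)
    (h0 : ∀ x, 0 ≤ f x) (hfg : ∀ x, f x ≤ g x) {B : ℝ} (hB : ∀ x, g x ≤ B) :
    lqn μ q f ≤ lqn μ q g := by
  refine Real.rpow_le_rpow (integral_nonneg fun x => Real.rpow_nonneg (h0 x) q) ?_ (by positivity)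
  refine integral_mono (integrable_rpow_of_bounds hq.le hf h0 fun x => (hfg x).trans (hB x))
    (integrable_rpow_of_bounds hq.le hg (fun x => (h0 x).trans (hfg x)) hB) fun x =>
    Real.rpow_le_rpow (h0 x) (hfg x) hq.le

theorem lqn_const_mul (hq : 0 < q) {f : S → ℝ} (h0 : ∀ x, 0 ≤ f x) {a : ℝ} (ha : 0 ≤ a) :
    lqn μ q (fun x => a * f x) = a * lqn μ q f := by
  have : ∀ x, (a * f x) ^ q = a ^ q * f x ^ q := fun x => Real.mul_rpow ha (h0 x)
  simp only [lqn, this]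
  rw [integral_const_mul, Real.mul_rpow (Real.rpow_nonneg ha q)
    (integral_nonneg fun x => Real.rpow_nonneg (h0 x) q), ← Real.rpow_mul ha,
    mul_one_div_cancel hq.ne', Real.rpow_one]

theorem ofReal_lqn [IsFiniteMeasure μ] (hq : 0 < q) {f : S → ℝ} (hf : Measurable f) (h0 : ∀ x, 0 ≤ f x) {B : ℝ}
    (hB : ∀ x, f x ≤ B) :
    ENNReal.ofReal (lqn μ q f) = (∫⁻ x, ENNReal.ofReal (f x) ^ q ∂μ) ^ (1 / q) := by
  have h1 : ∀ x, 0 ≤ f x ^ q := fun x => Real.rpow_nonneg (h0 x) q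
  rw [lqn, ← ENNReal.ofReal_rpow_of_nonneg (integral_nonneg h1) (by positivity),
    ofReal_integral_eq_lintegral_ofReal (integrable_rpow_of_bounds hq.le hf h0 hB)
      (Filter.Eventually.of_forall h1)]
  congr 2
  funext x
  rw [ENNReal.ofReal_rpow_of_nonneg (h0 x) hq.le]

theorem lqn_add_le [IsFiniteMeasure μ] (hq : 1 ≤ q) {f g : S → ℝ} (hf : Measurable f) (hg : Measurable g)
    (hf0 : ∀ x, 0 ≤ f x) (hg0 : ∀ x, 0 ≤ g x) {B : ℝ} (hfB : ∀ x, f x ≤ B) (hgB : ∀ x, g x ≤ B) :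
    lqn μ q (fun x => f x + g x) ≤ lqn μ q f + lqn μ q g := by
  have hq0 : 0 < q := by linarith
  rw [← ENNReal.ofReal_le_ofReal_iff (add_nonneg (lqn_nonneg hf0) (lqn_nonneg hg0)),
    ENNReal.ofReal_add (lqn_nonneg hf0) (lqn_nonneg hg0), ofReal_lqn hq0 hf hf0 hfB,
    ofReal_lqn hq0 hg hg0 hgB, ofReal_lqn (f := fun x => f x + g x) hq0 (hf.add hg) (fun x => add_nonneg (hf0 x) (hg0 x))
      (fun x => add_le_add (hfB x) (hgB x))]
  have := ENNReal.lintegral_Lp_add_le (μ := μ) hf.ennreal_ofReal.aemeasurable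
    hg.ennreal_ofReal.aemeasurable hq
  refine le_trans (le_of_eq ?_) this
  congr 2
  funext x
  rw [Pi.add_apply, ENNReal.ofReal_add (hf0 x) (hg0 x)]

/-- The reverse form of Minkowski's inequality. -/
theorem abs_lqn_sub_le [IsFiniteMeasure μ] (hq : 1 ≤ q) {f g : S → ℝ} (hf : Measurable f) (hg : Measurable g)
    (hf0 : ∀ x, 0 ≤ f x) (hg0 : ∀ x, 0 ≤ g x) {B : ℝ} (hfB : ∀ x, f x ≤ B) (hgB : ∀ x, g x ≤ B) :
    |lqn μ q f - lqn μ q g| ≤ lqn μ q fun x => |f x - g x| := by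
  have hd : Measurable fun x => |f x - g x| := (hf.sub hg).abs
  have hdB : ∀ x, |f x - g x| ≤ B := fun x =>
    abs_le.2 ⟨by linarith [hgB x, hf0 x], by linarith [hfB x, hg0 x]⟩
  have key : ∀ a b : S → ℝ, Measurable a → Measurable b → (∀ x, 0 ≤ a x) → (∀ x, 0 ≤ b x) →
      (∀ x, b x ≤ B) → (∀ x, |a x - b x| = |f x - g x|) →
      lqn μ q a ≤ lqn μ q b + lqn μ q fun x => |f x - g x| := by
    intro a b ha hb ha0 hb0 hbB e
    refine le_trans ?_ (lqn_add_le hq hb hd hb0 (fun x => abs_nonneg _) hbB hdB)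
    refine lqn_mono (by linarith) ha (hb.add hd) ha0 (fun x => ?_)
      (fun x => add_le_add (hbB x) (hdB x))
    rw [← e x]
    linarith [le_abs_self (a x - b x)]
  rw [abs_le]
  constructor
  · linarith [key g f hg hf hg0 hf0 hfB fun x => abs_sub_comm _ _]
  · linarith [key f g hf hg hf0 hg0 hgB fun x => rfl]

end Lq

/-! ### Single site averages -/

variable {N : ℕ}

/-- A family of single site measures which satisfy a common inequality `LSLip` and depend on the
neighbouring coordinates through a density with a small horizontal Lipschitz constant. -/
structure SiteFamily (μ : Site N → Config N → Measure Heis) (q C κ : ℝ) : Prop where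
  one_lt : 1 < q
  le_two : q ≤ 2
  nonneg : 0 ≤ C
  pos : 0 < κ
  prob : ∀ i ω, IsProbabilityMeasure (μ i ω)
  meas : ∀ i, Measurable (μ i)
  ls : ∀ i ω, LSLip (μ i ω) q C
  congr : ∀ i ω ω', (∀ j ∈ nbrs i, ω j = ω' j) → μ i ω = μ i ω'
  tilt_shift : ∀ i j ω k t, j ≠ i → ∃ H, HLip (κ * |t|) H ∧ μ i (shift ω j k t) = (μ i ω).tilted H

/-- The average of `f` over the coordinate `i`. -/
def siteAvg (μ : Site N → Config N → Measure Heis) (i : Site N) (f : Config N → ℝ) (ω : Config N) : ℝ :=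
  ∫ x, f (Function.update ω i x) ∂(μ i ω)

theorem shift_shift {ι : Type*} [DecidableEq ι] (ω : ι → Heis) (j : ι) (k : Fin 2) (s t : ℝ) :
    shift (shift ω j k s) j k t = shift ω j k (s + t) := by
  simp [shift, flow_flow]

theorem shift_zero {ι : Type*} [DecidableEq ι] (ω : ι → Heis) (j : ι) (k : Fin 2) : shift ω j k 0 = ω := by
  simp [shift]

theorem shift_update_self {ι : Type*} [DecidableEq ι] (ω : ι → Heis) (j : ι) (k : Fin 2) (t : ℝ) (x : Heis) :
    shift (Function.update ω j x) j k t = Function.update ω j (flow k t x) := by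
  simp [shift]

theorem update_shift {ι : Type*} [DecidableEq ι] {i j : ι} (h : j ≠ i) (ω : ι → Heis) (k : Fin 2) (t : ℝ) (x : Heis) :
    Function.update (shift ω j k t) i x = shift (Function.update ω i x) j k t := by
  simp only [shift, Function.update_of_ne h]
  rw [Function.update_comm h.symm]

theorem measurable_shift {ι : Type*} [DecidableEq ι] (j : ι) (k : Fin 2) (t : ℝ) :
    Measurable fun ω : ι → Heis => shift ω j k t := by
  rw [measurable_pi_iff]
  intro m
  by_cases h : m = j
  · subst h
    simp only [shift, Function.update_self]
    exact (continuous_flow k t).measurable.comp (measurable_pi_apply m)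
  · simp only [shift, Function.update_of_ne h]
    exact measurable_pi_apply m

theorem measurable_update_uncurry (i : Site N) :
    Measurable fun p : Config N × Heis => Function.update p.1 i p.2 := by
  rw [measurable_pi_iff]
  intro m
  by_cases h : m = i
  · subst h
    simp only [Function.update_self]
    exact measurable_snd
  · simp only [Function.update_of_ne h]
    exact (measurable_pi_apply m).comp measurable_fst

/-- `f` is Lipschitz in each coordinate `j` along the horizontal flows, with constant `v j`. -/
def SLip (v : Site N → ℝ) (f : Config N → ℝ) : Prop :=
  ∀ ω j k t, |f (shift ω j k t) - f ω| ≤ v j * |t|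

theorem SLip.hLip {v : Site N → ℝ} {f : Config N → ℝ} (h : SLip v f) (ω : Config N) (i : Site N) :
    HLip (v i) fun x => f (Function.update ω i x) := fun x k t => by
  have := h (Function.update ω i x) i k t
  rwa [shift_update_self] at this

theorem SLip.nonneg {v : Site N → ℝ} {f : Config N → ℝ} (h : SLip v f) (j : Site N) : 0 ≤ v j := by
  have := (abs_nonneg _).trans (h 0 j 0 1)
  simpa using this

/-- Subdivision into short steps. The perturbation estimates require κ|t| ≤ 1/4, while Lipschitz
bounds are wanted for all times. -/
theorem abs_sub_le_of_local {g : ℝ → ℝ} {L τ : ℝ} (hτ : 0 < τ)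
    (h : ∀ s t, |t| ≤ τ → |g (s + t) - g s| ≤ L * |t|) (t : ℝ) : |g t - g 0| ≤ L * |t| := by
  obtain ⟨n, hn⟩ := exists_nat_gt (|t| / τ)
  have hn0 : (0 : ℝ) < n := lt_of_le_of_lt (by positivity) hn
  have hs : |t / n| ≤ τ := by
    rw [abs_div, Nat.abs_cast, div_le_iff₀ hn0]
    rw [div_lt_iff₀ hτ] at hn
    linarith
  have key : ∀ m : ℕ, |g (m * (t / n)) - g 0| ≤ m * (L * |t / n|) := by
    intro m
    induction m with
    | zero => simp
    | succ m ih =>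
      have h1 := h (m * (t / n)) (t / n) hs
      have e : ((m + 1 : ℕ) : ℝ) * (t / n) = m * (t / n) + t / n := by push_cast; ring
      rw [e]
      push_cast
      calc _ ≤ |g (m * (t / n) + t / n) - g (m * (t / n))| + |g (m * (t / n)) - g 0| :=
            abs_sub_le _ _ _
        _ ≤ _ := by linarith
  have := key n
  rw [mul_div_cancel₀ _ hn0.ne', abs_div, Nat.abs_cast] at this
  refine this.trans (le_of_eq ?_)
  field_simp

namespace SiteFamily

variable {μ : Site N → Config N → Measure Heis} {q C κ : ℝ}

theorem update_self (h : SiteFamily μ q C κ) (i : Site N) (ω : Config N) (y : Heis) :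
    μ i (Function.update ω i y) = μ i ω :=
  h.congr i _ _ fun j hj => by
    rw [Function.update_of_ne]; exact fun hh => not_mem_nbrs_self i (hh ▸ hj)

theorem siteAvg_update_self (h : SiteFamily μ q C κ) (i : Site N) (f : Config N → ℝ) (ω : Config N)
    (y : Heis) : siteAvg μ i f (Function.update ω i y) = siteAvg μ i f ω := by
  simp [siteAvg, h.update_self i ω y]

theorem measurable_integral (h : SiteFamily μ q C κ) (i : Site N) {g : Config N → Heis → ℝ}
    (hg : Measurable (Function.uncurry g)) : Measurable fun ω => ∫ x, g ω x ∂(μ i ω) := by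
  let K : ProbabilityTheory.Kernel (Config N) Heis := ⟨μ i, h.meas i⟩
  have : ProbabilityTheory.IsMarkovKernel K := ⟨fun ω => h.prob i ω⟩
  exact (StronglyMeasurable.integral_kernel_prod_right' (κ := K) hg.stronglyMeasurable).measurable

theorem measurable_siteAvg (h : SiteFamily μ q C κ) (i : Site N) {f : Config N → ℝ}
    (hf : Measurable f) : Measurable (siteAvg μ i f) :=
  h.measurable_integral i (g := fun ω x => f (Function.update ω i x))
    (hf.comp (measurable_update_uncurry i))

theorem siteAvg_mem (h : SiteFamily μ q C κ) (i : Site N) {f : Config N → ℝ}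
    (hf : Measurable f) {a b : ℝ} (ha : ∀ ω, a ≤ f ω) (hb : ∀ ω, f ω ≤ b) (ω : Config N) :
    a ≤ siteAvg μ i f ω ∧ siteAvg μ i f ω ≤ b := by
  have := h.prob i ω
  have hi : Integrable (fun x => f (Function.update ω i x)) (μ i ω) :=
    integrable_of_abs_le (B := max |a| |b|) (hf.comp (measurable_update ω)) fun x =>
      abs_le_max_abs_abs (ha _) (hb _)
  constructor
  · have := integral_mono (integrable_const a) hi fun x => ha _
    simpa [siteAvg] using this
  · have := integral_mono hi (integrable_const b) fun x => hb _
    simpa [siteAvg] using this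

theorem abs_siteAvg_le (h : SiteFamily μ q C κ) (i : Site N) {f : Config N → ℝ} {B : ℝ}
    (hB : ∀ ω, |f ω| ≤ B) (ω : Config N) : |siteAvg μ i f ω| ≤ B := by
  have := h.prob i ω
  exact abs_integral_le_of_abs_le fun x => hB _

/-- The factor in the propagation of Lipschitz constants. -/
def lipFactor (q C κ : ℝ) : ℝ := 12 * Real.exp (C / (q - 1)) ^ 2 * κ

/-- The Lipschitz constants of the average over the coordinate `i`. -/
def lipUpdate (θ : ℝ) (i : Site N) (v : Site N → ℝ) (j : Site N) : ℝ :=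
  if j = i then 0 else if j ∈ nbrs i then v j + θ * v i else v j

theorem abs_integral_shift_sub_le (h : SiteFamily μ q C κ) {i j : Site N} (hij : j ≠ i)
    (ω : Config N) (k : Fin 2) {t : ℝ} (ht0 : t ≠ 0) (ht : κ * |t| ≤ 1 / 4) {g : Heis → ℝ}
    (hg : Measurable g) {B : ℝ} (hB : ∀ x, |g x| ≤ B) :
    |∫ x, g x ∂(μ i (shift ω j k t)) - ∫ x, g x ∂(μ i ω)|
      ≤ 4 * Real.exp (C / (q - 1)) * (κ * |t|)
        * √(∫ x, (g x - ∫ y, g y ∂(μ i ω)) ^ 2 ∂(μ i ω)) := by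
  have := h.prob i ω
  obtain ⟨H, hH, he⟩ := h.tilt_shift i j ω k t hij
  rw [he]
  exact (h.ls i ω).abs_tilted_sub_le h.one_lt h.nonneg (mul_pos h.pos (abs_pos.2 ht0)) ht hH hg hB

/-- Moving the coordinate j changes the integrand, at cost v_j, and the measure at i, at cost
proportional to κ times the standard deviation of f in the coordinate i, hence to κ v_i. The second
effect is present only for neighbours of i, and the average no longer depends on the coordinate i.
-/
theorem slip_siteAvg (h : SiteFamily μ q C κ) (i : Site N) {f : Config N → ℝ} {v : Site N → ℝ}
    (hf : Measurable f) {B : ℝ} (hB : ∀ ω, |f ω| ≤ B) (hv : SLip v f) :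
    SLip (lipUpdate (lipFactor q C κ) i v) (siteAvg μ i f) := by
  intro ω j k t
  by_cases hij : j = i
  · subst hij
    rw [shift, h.siteAvg_update_self]
    simp [lipUpdate]
  have hloc : ∀ s : ℝ, κ * |s| ≤ 1 / 4 → ∀ ω : Config N,
      |siteAvg μ i f (shift ω j k s) - siteAvg μ i f ω|
        ≤ lipUpdate (lipFactor q C κ) i v j * |s| := by
    intro s hs ω
    rcases eq_or_ne s 0 with rfl | hs0
    · rw [shift_zero]; simp
    have hp := h.prob i ω
    have hp' := h.prob i (shift ω j k s)
    set g : Heis → ℝ := fun x => f (Function.update ω i x) with hg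
    have hgm : Measurable g := hf.comp (measurable_update ω)
    have hfm : Measurable fun x => f (Function.update (shift ω j k s) i x) :=
      hf.comp (measurable_update _)
    have h1 : |siteAvg μ i f (shift ω j k s) - ∫ x, g x ∂(μ i (shift ω j k s))| ≤ v j * |s| := by
      rw [siteAvg, ← integral_sub (integrable_of_abs_le hfm fun x => hB _)
        (integrable_of_abs_le hgm fun x => hB _)]
      refine abs_integral_le_of_abs_le fun x => ?_
      rw [update_shift hij]
      exact hv _ j k s
    have h2 : |∫ x, g x ∂(μ i (shift ω j k s)) - siteAvg μ i f ω|
        ≤ (if j ∈ nbrs i then lipFactor q C κ * v i else 0) * |s| := by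
      split_ifs with hj
      · refine (h.abs_integral_shift_sub_le hij ω k hs0 hs hgm fun x => hB _).trans ?_
        have hvar := (h.ls i ω).variance_le h.one_lt h.nonneg (hv.hLip ω i)
        have hvi := hv.nonneg i
        have he : 1 ≤ Real.exp (C / (q - 1)) :=
          Real.one_le_exp (div_nonneg h.nonneg (by linarith [h.one_lt]))
        -- The variance 8 exp(C/(q-1)) v² is at most (3 exp(C/(q-1)) v)². With the 4 of the
        -- perturbation bound this gives the 12 of `lipFactor`.
        have h3 : √(∫ x, (g x - ∫ y, g y ∂(μ i ω)) ^ 2 ∂(μ i ω))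
            ≤ 3 * Real.exp (C / (q - 1)) * v i := by
          rw [Real.sqrt_le_left (by positivity)]
          refine hvar.trans ?_
          have : Real.exp (C / (q - 1)) ≤ Real.exp (C / (q - 1)) ^ 2 := by nlinarith
          nlinarith [sq_nonneg (v i)]
        have hk := h.pos
        calc _ ≤ 4 * Real.exp (C / (q - 1)) * (κ * |s|) * (3 * Real.exp (C / (q - 1)) * v i) := by
              gcongr
          _ = _ := by rw [lipFactor]; ring
      · have : μ i (shift ω j k s) = μ i ω := h.congr i _ _ fun m hm => by
          rw [shift, Function.update_of_ne]
          exact fun hh => hj (hh ▸ hm)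
        rw [this]
        simp [siteAvg, hg]
    have e : lipUpdate (lipFactor q C κ) i v j
        = v j + if j ∈ nbrs i then lipFactor q C κ * v i else 0 := by
      rw [lipUpdate, if_neg hij]
      split_ifs <;> simp
    rw [e, add_mul]
    exact (abs_sub_le _ _ _).trans (add_le_add h1 h2)
  have hk := h.pos
  have := abs_sub_le_of_local (g := fun s => siteAvg μ i f (shift ω j k s))
    (L := lipUpdate (lipFactor q C κ) i v j) (τ := 1 / (4 * κ)) (by positivity)
    (fun s t ht => by
      rw [← shift_shift]
      refine hloc t ?_ _
      rw [le_div_iff₀ (by positivity)] at ht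
      linarith) t
  simpa [shift_zero] using this

end SiteFamily

end HeisGibbs

namespace HeisGibbs

/-! ### Propagation of slopes -/

variable {N : ℕ} {μ : Site N → Config N → Measure Heis} {q C κ : ℝ}

/-- `G` bounds the slopes of `f` in the coordinate `j` along the horizontal flows. -/
def SSlope (f : Config N → ℝ) (j : Site N) (G : Config N → ℝ) : Prop :=
  ∀ ω k ε, 0 < ε → ∀ᶠ t in nhds (0 : ℝ), |f (shift ω j k t) - f ω| ≤ (G ω + ε) * |t|

theorem SSlope.hSlope {f : Config N → ℝ} {j : Site N} {G : Config N → ℝ} (h : SSlope f j G)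
    (ω : Config N) :
    HSlope (fun x => f (Function.update ω j x)) fun x => G (Function.update ω j x) :=
  fun x k ε hε => by
    have := h (Function.update ω j x) k ε hε
    simpa only [shift_update_self] using this

/-- The norm of `f` in `L^q` of the single site measure. -/
def siteLq (μ : Site N → Config N → Measure Heis) (q : ℝ) (i : Site N) (f : Config N → ℝ)
    (ω : Config N) : ℝ := lqn (μ i ω) q fun x => f (Function.update ω i x)

theorem siteLq_rpow (hq : 0 < q) {i : Site N} {f : Config N → ℝ} (h0 : ∀ ω, 0 ≤ f ω)
    (ω : Config N) : siteLq μ q i f ω ^ q = siteAvg μ i (fun ω => f ω ^ q) ω :=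
  lqn_rpow hq fun _ => h0 _

/-- Converts increments of q-th powers into increments of the functions or norms themselves, by
monotonicity of x^(q-1). -/
theorem abs_sub_mul_rpow_le (hq : 1 ≤ q) {a b : ℝ} (ha : 0 < a) (hb : 0 ≤ b) :
    |b - a| * a ^ (q - 1) ≤ |b ^ q - a ^ q| := by
  have e : ∀ x : ℝ, 0 ≤ x → x * x ^ (q - 1) = x ^ q := fun x hx => by
    rcases hx.eq_or_lt with rfl | hx
    · rw [zero_mul, Real.zero_rpow (by linarith)]
    · rw [mul_comm, Real.rpow_sub_one hx.ne', div_mul_cancel₀ _ hx.ne']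
  rcases le_total a b with hab | hab
  · have h1 : a ^ (q - 1) ≤ b ^ (q - 1) := Real.rpow_le_rpow ha.le hab (by linarith)
    have h2 : a ^ q ≤ b ^ q := Real.rpow_le_rpow ha.le hab (by linarith)
    rw [abs_of_nonneg (by linarith), abs_of_nonneg (by linarith), ← e a ha.le, ← e b hb]
    nlinarith
  · have h1 : b ^ (q - 1) ≤ a ^ (q - 1) := Real.rpow_le_rpow hb hab (by linarith)
    have h2 : b ^ q ≤ a ^ q := Real.rpow_le_rpow hb hab (by linarith)
    rw [abs_of_nonpos (by linarith), abs_of_nonpos (by linarith), ← e a ha.le, ← e b hb]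
    nlinarith

theorem sqrt_integral_sub_sq_le {S : Type*} [MeasurableSpace S] {m : Measure S}
    [IsProbabilityMeasure m] {g : S → ℝ} {R : ℝ} (hR : ∀ x, |g x| ≤ R) :
    √(∫ x, (g x - ∫ y, g y ∂m) ^ 2 ∂m) ≤ 2 * R := by
  obtain ⟨x₀⟩ : Nonempty S := (nonempty_of_isProbabilityMeasure m)
  have hR0 : 0 ≤ R := (abs_nonneg _).trans (hR x₀)
  rw [Real.sqrt_le_left (by positivity)]
  have hb : |∫ y, g y ∂m| ≤ R := abs_integral_le_of_abs_le hR
  refine (le_abs_self _).trans (abs_integral_le_of_abs_le fun x => ?_)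
  rw [abs_of_nonneg (sq_nonneg _), ← sq_abs]
  refine pow_le_pow_left₀ (abs_nonneg _) ?_ 2
  exact (abs_sub _ _).trans (by linarith [hR x])

namespace SiteFamily

theorem abs_integral_shift_sub_le_of_bdd (h : SiteFamily μ q C κ) {i j : Site N} (hij : j ≠ i)
    (ω : Config N) (k : Fin 2) {t : ℝ} (ht0 : t ≠ 0) (ht : κ * |t| ≤ 1 / 4) {g : Heis → ℝ}
    (hg : Measurable g) {R : ℝ} (hR : ∀ x, |g x| ≤ R) :
    |∫ x, g x ∂(μ i (shift ω j k t)) - ∫ x, g x ∂(μ i ω)|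
      ≤ 4 * Real.exp (C / (q - 1)) * (κ * |t|) * (2 * R) := by
  have := h.prob i ω
  have hk := h.pos
  refine (h.abs_integral_shift_sub_le hij ω k ht0 ht hg hR).trans ?_
  gcongr
  exact sqrt_integral_sub_sq_le hR

theorem measurable_siteLq (h : SiteFamily μ q C κ) (i : Site N) {f : Config N → ℝ}
    (hf : Measurable f) : Measurable (siteLq μ q i f) :=
  (h.measurable_siteAvg i (hf.pow_const q)).pow_const (1 / q)

theorem siteLq_mem (h : SiteFamily μ q C κ) (i : Site N) {f : Config N → ℝ}
    (hf : Measurable f) {a b : ℝ} (ha0 : 0 ≤ a) (ha : ∀ ω, a ≤ f ω) (hb : ∀ ω, f ω ≤ b)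
    (ω : Config N) : a ≤ siteLq μ q i f ω ∧ siteLq μ q i f ω ≤ b := by
  have hq : 0 < q := by linarith [h.one_lt]
  have h1 := h.siteAvg_mem i (hf.pow_const q) (fun ω => Real.rpow_le_rpow ha0 (ha ω) hq.le)
    (fun ω => Real.rpow_le_rpow (ha0.trans (ha ω)) (hb ω) hq.le) ω
  have hb0 : 0 ≤ b := ha0.trans ((ha ω).trans (hb ω))
  have e : ∀ x : ℝ, 0 ≤ x → (x ^ q) ^ (1 / q) = x := fun x hx => by
    rw [← Real.rpow_mul hx, mul_one_div_cancel hq.ne', Real.rpow_one]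
  constructor
  · rw [← e a ha0]
    exact Real.rpow_le_rpow (Real.rpow_nonneg ha0 q) h1.1 (by positivity)
  · rw [← e b hb0]
    exact Real.rpow_le_rpow ((Real.rpow_nonneg ha0 q).trans h1.1) h1.2 (by positivity)

/-- The factor in the propagation of slopes. -/
def slopeFactor (q C κ : ℝ) : ℝ := κ * covConst q C

/-- Passing from the q-th power to the norm divides by a^(q-1), with a the norm of u. This cancels
exactly the same factor in the covariance bound, and the lower bound δ keeps the quadratic remainder
finite. -/
theorem abs_lqn_shift_sub_le (h : SiteFamily μ q C κ) {i j : Site N} (hij : j ≠ i)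
    (ω : Config N) (k : Fin 2) {t : ℝ} (ht0 : t ≠ 0) (ht : κ * |t| ≤ 1 / 4) {u G : Heis → ℝ}
    {L B δ : ℝ} (hu : HLip L u) (hδ : 0 < δ) (hδu : ∀ x, δ ≤ u x) (hB : ∀ x, u x ≤ B)
    (hGm : Measurable G) (hG0 : ∀ x, 0 ≤ G x) (hGB : ∀ x, G x ≤ B) (hs : HSlope u G) :
    |lqn (μ i (shift ω j k t)) q u - lqn (μ i ω) q u|
      ≤ (slopeFactor q C κ * lqn (μ i ω) q G
        + (κ ^ 2 * (32 * Real.exp (C / (q - 1)) * B ^ q) / δ ^ (q - 1)) * |t|) * |t| := by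
  have hq1 := h.one_lt
  have hq0 : 0 < q := by linarith
  have hp := h.prob i ω
  have hu0 : ∀ x, 0 ≤ u x := fun x => hδ.le.trans (hδu x)
  have hum : Measurable u := hu.continuous.measurable
  obtain ⟨H, hH, he⟩ := h.tilt_shift i j ω k t hij
  have h1 := (h.ls i ω).abs_tilted_rpow_sub_le h.one_lt h.le_two h.nonneg
    (mul_pos h.pos (abs_pos.2 ht0)) ht hH hu hδ hδu hB hGm hG0 hGB hs
  rw [← he, ← lqn_rpow hq0 hu0, ← lqn_rpow hq0 hu0] at h1
  set a := lqn (μ i ω) q u with ha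
  set b := lqn (μ i (shift ω j k t)) q u
  have hδa : δ ≤ a := by
    have e : lqn (μ i ω) q (fun _ => δ) = δ := by
      simp only [lqn, integral_const, probReal_univ, one_smul]
      rw [← Real.rpow_mul hδ.le, mul_one_div_cancel hq0.ne', Real.rpow_one]
    rw [← e]
    exact lqn_mono hq0 measurable_const hum (fun _ => hδ.le) hδu hB
  have ha0 : 0 < a := hδ.trans_le hδa
  have hb0 : 0 ≤ b := lqn_nonneg hu0
  have h2 := (abs_sub_mul_rpow_le hq1.le ha0 hb0).trans h1
  have hap : 0 < a ^ (q - 1) := Real.rpow_pos_of_pos ha0 _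
  have hdp : 0 < δ ^ (q - 1) := Real.rpow_pos_of_pos hδ _
  have hda : δ ^ (q - 1) ≤ a ^ (q - 1) := Real.rpow_le_rpow hδ.le hδa (by linarith)
  have e1 : (a ^ q) ^ (1 / q) = a := by
    rw [← Real.rpow_mul ha0.le, mul_one_div_cancel hq0.ne', Real.rpow_one]
  rw [e1] at h2
  have e2 : (∫ x, G x ^ q ∂(μ i ω)) ^ (1 / q) = lqn (μ i ω) q G := rfl
  rw [e2] at h2
  have hB0 : 0 ≤ B := (hu0 0).trans (hB 0)
  have hK : 0 ≤ κ ^ 2 * (32 * Real.exp (C / (q - 1)) * B ^ q) := by positivity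
  refine le_of_mul_le_mul_right ?_ hap
  refine h2.trans ?_
  have h3 : κ ^ 2 * (32 * Real.exp (C / (q - 1)) * B ^ q)
      ≤ κ ^ 2 * (32 * Real.exp (C / (q - 1)) * B ^ q) / δ ^ (q - 1) * a ^ (q - 1) := by
    rw [div_mul_eq_mul_div, le_div_iff₀ hdp]
    exact mul_le_mul_of_nonneg_left hda hK
  have h4 := mul_le_mul_of_nonneg_right h3 (sq_nonneg |t|)
  rw [slopeFactor]
  nlinarith

/-- The increment splits into a change of f under the shifted measure, estimated by Minkowski's
inequality, and a change of the measure with f fixed, estimated by `abs_lqn_shift_sub_le`. The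
former contributes the norm of Gj, the latter, for neighbours, a multiple of the norm of Gi. -/
theorem sslope_siteLq (h : SiteFamily μ q C κ) {i j : Site N} (hij : j ≠ i) {f Gi Gj : Config N → ℝ}
    {v : Site N → ℝ} {δ B : ℝ} (hf : Measurable f) (hv : SLip v f) (hδ : 0 < δ)
    (hδf : ∀ ω, δ ≤ f ω) (hfB : ∀ ω, f ω ≤ B)
    (hGi : Measurable Gi) (hGi0 : ∀ ω, 0 ≤ Gi ω) (hGiB : ∀ ω, Gi ω ≤ B) (hsi : SSlope f i Gi)
    (hGj : Measurable Gj) (hGj0 : ∀ ω, 0 ≤ Gj ω) (hGjB : ∀ ω, Gj ω ≤ B) (hsj : SSlope f j Gj) :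
    SSlope (siteLq μ q i f) j fun ω => siteLq μ q i Gj ω
      + if j ∈ nbrs i then slopeFactor q C κ * siteLq μ q i Gi ω else 0 := by
  intro ω k ε hε
  have hq1 := h.one_lt
  have hq0 : 0 < q := by linarith
  have hk := h.pos
  have hp := h.prob i ω
  have hp' : ∀ t, IsProbabilityMeasure (μ i (shift ω j k t)) := fun t => h.prob i _
  have hvj := hv.nonneg j
  have hf0 : ∀ ω, 0 ≤ f ω := fun ω => hδ.le.trans (hδf ω)
  have hB0 : 0 ≤ B := (hf0 0).trans (hfB 0)
  set u : Heis → ℝ := fun x => f (Function.update ω i x) with hu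
  set g : Heis → ℝ := fun x => Gj (Function.update ω i x) with hg
  set D : ℝ → Heis → ℝ := fun t x =>
    |f (shift (Function.update ω i x) j k t) - f (Function.update ω i x)| with hD
  have hum : Measurable u := hf.comp (measurable_update ω)
  have hgm : Measurable g := hGj.comp (measurable_update ω)
  have hDm : ∀ t, Measurable (D t) := fun t =>
    ((hf.comp ((measurable_shift j k t).comp (measurable_update ω))).sub hum).abs
  have hDL : ∀ t x, D t x ≤ v j * |t| := fun t x => hv _ j k t
  have hg0 : ∀ x, 0 ≤ g x := fun x => hGj0 _
  have hgB : ∀ x, g x ≤ B := fun x => hGjB _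
  set e : ℝ → Heis → ℝ := excess D g with he
  have hem : ∀ t, Measurable (e t) := measurable_excess hDm hgm
  have he0 : ∀ t x, 0 ≤ e t x := excess_nonneg D g
  have heL : ∀ t x, e t x ≤ v j := excess_le hvj hg0 hDL
  have htend : Filter.Tendsto (fun t => lqn (μ i ω) q (e t)) (nhdsWithin 0 {0}ᶜ) (nhds 0) := by
    have := (tendsto_excess (μ := μ i ω) hq0 hvj hDm hgm hg0 hDL
      (fun x ε hε => hsj (Function.update ω i x) k ε hε)).rpow_const
        (p := 1 / q) (Or.inr (by positivity))
    rwa [Real.zero_rpow (by positivity)] at this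
  set a := lqn (μ i ω) q g with ha
  have ha0 : 0 ≤ a := lqn_nonneg hg0
  set R := (B + v j) ^ q with hR
  set K := 4 * Real.exp (C / (q - 1)) * κ * (2 * R) with hK
  have hge0 : ∀ t x, 0 ≤ g x + e t x := fun t x => add_nonneg (hg0 x) (he0 t x)
  have hgeB : ∀ t x, g x + e t x ≤ B + v j := fun t x => add_le_add (hgB x) (heL t x)
  have hgem : ∀ t, Measurable fun x => g x + e t x := fun t => hgm.add (hem t)
  have hmain : Filter.Tendsto (fun t => ((a + lqn (μ i ω) q (e t)) ^ q + K * |t|) ^ (1 / q))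
      (nhdsWithin 0 {0}ᶜ) (nhds a) := by
    have h1 : Filter.Tendsto (fun t : ℝ => K * |t|) (nhdsWithin 0 {0}ᶜ) (nhds 0) := by
      have h2 : Continuous fun t : ℝ => K * |t| := by fun_prop
      have h3 := h2.tendsto 0
      simp only [abs_zero, mul_zero] at h3
      exact h3.mono_left nhdsWithin_le_nhds
    have h4 := ((((tendsto_const_nhds (x := a)).add htend).rpow_const
      (p := q) (Or.inr hq0.le)).add h1).rpow_const (p := 1 / q) (Or.inr (by positivity))
    rwa [add_zero, add_zero, ← Real.rpow_mul ha0, mul_one_div_cancel hq0.ne', Real.rpow_one] at h4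
  -- Minkowski's inequality leaves the norm of g plus the excess under the measure that itself moves
  -- with t. Returning to the fixed measure costs only K|t| in the q-th power, since the integrand
  -- is bounded.
  have hcore : ∀ t, t ≠ 0 → κ * |t| ≤ 1 / 4 →
      lqn (μ i (shift ω j k t)) q (fun x => g x + e t x)
        ≤ ((a + lqn (μ i ω) q (e t)) ^ q + K * |t|) ^ (1 / q) := by
    intro t ht0 ht
    have hq' : ∀ x, |(g x + e t x) ^ q| ≤ R := fun x => by
      rw [abs_of_nonneg (Real.rpow_nonneg (hge0 t x) q)]
      exact Real.rpow_le_rpow (hge0 t x) (hgeB t x) hq0.le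
    have h1 := h.abs_integral_shift_sub_le_of_bdd hij ω k ht0 ht ((hgem t).pow_const q) hq'
    have h2 : ∫ x, (g x + e t x) ^ q ∂(μ i ω) ≤ (a + lqn (μ i ω) q (e t)) ^ q := by
      rw [← lqn_rpow hq0 (hge0 t)]
      exact Real.rpow_le_rpow (lqn_nonneg (hge0 t)) (lqn_add_le hq1.le hgm (hem t) hg0 (he0 t)
        (B := B + v j) (fun x => by linarith [hgB x]) (fun x => by linarith [heL t x])) hq0.le
    refine Real.rpow_le_rpow (integral_nonneg fun x => Real.rpow_nonneg (hge0 t x) q) ?_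
      (by positivity)
    have h3 := (abs_le.1 h1).2
    rw [hK]
    linarith
  have hfirst : ∀ t, t ≠ 0 → |siteLq μ q i f (shift ω j k t) - lqn (μ i (shift ω j k t)) q u|
      ≤ lqn (μ i (shift ω j k t)) q (fun x => g x + e t x) * |t| := by
    intro t ht0
    have h1 := abs_lqn_sub_le (μ := μ i (shift ω j k t)) hq1.le
      (f := fun x => f (Function.update (shift ω j k t) i x)) (g := u)
      (hf.comp (measurable_update _)) hum (fun x => hf0 _) (fun x => hf0 _) (fun x => hfB _)
      (fun x => hfB _)
    refine h1.trans ?_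
    rw [mul_comm, ← lqn_const_mul hq0 (hge0 t) (abs_nonneg t)]
    refine lqn_mono hq0 ((hf.comp (measurable_update _)).sub hum).abs ((hgem t).const_mul _)
      (fun x => abs_nonneg _) (fun x => ?_)
      (fun x => mul_le_mul_of_nonneg_left (hgeB t x) (abs_nonneg t))
    rw [update_shift hij, mul_comm]
    exact le_add_excess (D := D) ht0 x
  have hsmall : ∀ A : ℝ, ∀ η > 0, ∀ᶠ t in nhdsWithin (0 : ℝ) {0}ᶜ, A * |t| ≤ η := by
    intro A η hη
    have h2 : Continuous fun t : ℝ => A * |t| := by fun_prop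
    have h3 := h2.tendsto 0
    simp only [abs_zero, mul_zero] at h3
    exact ((h3.mono_left nhdsWithin_le_nhds).eventually (gt_mem_nhds hη)).mono fun _ h => le_of_lt h
  set A := κ ^ 2 * (32 * Real.exp (C / (q - 1)) * B ^ q) / δ ^ (q - 1) with hA
  have hev : ∀ᶠ t in nhdsWithin (0 : ℝ) {0}ᶜ,
      |siteLq μ q i f (shift ω j k t) - siteLq μ q i f ω| ≤ (siteLq μ q i Gj ω
      + (if j ∈ nbrs i then slopeFactor q C κ * siteLq μ q i Gi ω else 0) + ε) * |t| := by
    filter_upwards [self_mem_nhdsWithin, hsmall κ (1 / 4) (by norm_num), hsmall A (ε / 2) (half_pos hε),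
      hmain.eventually (gt_mem_nhds (lt_add_of_pos_right a (half_pos hε)))] with t ht0 ht hA' hm
    have ht0' : t ≠ 0 := ht0
    have h1 := hfirst t ht0'
    have h2 := (hcore t ht0' ht).trans hm.le
    have h3 : |lqn (μ i (shift ω j k t)) q u - siteLq μ q i f ω|
        ≤ ((if j ∈ nbrs i then slopeFactor q C κ * siteLq μ q i Gi ω else 0) + ε / 2) * |t| := by
      split_ifs with hj
      · refine (h.abs_lqn_shift_sub_le hij ω k ht0' ht (hv.hLip ω i) hδ (fun x => hδf _)
          (fun x => hfB _) (hGi.comp (measurable_update ω)) (fun x => hGi0 _) (fun x => hGiB _)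
          (hsi.hSlope ω)).trans ?_
        refine mul_le_mul_of_nonneg_right ?_ (abs_nonneg t)
        exact add_le_add le_rfl hA'
      · have : μ i (shift ω j k t) = μ i ω := h.congr i _ _ fun m hm => by
          rw [shift, Function.update_of_ne]
          exact fun hh => hj (hh ▸ hm)
        rw [this, siteLq, sub_self, abs_zero]
        positivity
    have h4 := mul_le_mul_of_nonneg_right h2 (abs_nonneg t)
    have e1 : siteLq μ q i Gj ω = a := rfl
    rw [e1]
    calc _ ≤ _ := abs_sub_le _ (lqn (μ i (shift ω j k t)) q u) _
      _ ≤ (a + ε / 2) * |t| + ((if j ∈ nbrs i then slopeFactor q C κ * siteLq μ q i Gi ω else 0) + ε / 2) * |t| :=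
          add_le_add (h1.trans h4) h3
      _ = _ := by ring
  -- The perturbation bounds need a positive constant κ|t|, so t = 0 is treated apart.
  rw [eventually_nhdsWithin_iff] at hev
  filter_upwards [hev] with t ht
  by_cases ht0 : t = 0
  · subst ht0
    rw [shift_zero]
    simp
  · exact ht ht0

end SiteFamily

end HeisGibbs

/-! ### Finite volume: iterated single site averages. -/

namespace HeisGibbs

/-! ### Successive averages over the sites of a finite set -/

variable {N : ℕ}

theorem card_nbrs_le (i : Site N) : (nbrs i).card ≤ 3 ^ N := by
  refine (Finset.card_filter_le _ _).trans ?_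
  rw [Pi.card_Icc]
  have : ∀ l : Fin N, (Finset.Icc ((i - 1) l) ((i + 1) l)).card = 3 := fun l => by
    rw [Int.card_Icc]
    simp only [Pi.add_apply, Pi.sub_apply, Pi.one_apply]
    have : i l + 1 + 1 - (i l - 1) = 3 := by ring
    rw [this]; rfl
  rw [Finset.prod_congr rfl fun l _ => this l]
  simp

theorem covConst_nonneg {q C : ℝ} (hq : 1 < q) (hC : 0 ≤ C) : 0 ≤ covConst q C := by
  have h1 : 0 < Real.log (4 / 3) := Real.log_pos (by norm_num)
  have h2 : 0 < q - 1 := by linarith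
  have h3 : 0 < q := by linarith
  unfold covConst
  positivity

/-- Telescoping: the coordinates in B are changed one at a time, each along horizontal paths through
the origin. -/
theorem SLip.abs_sub_le {v : Site N → ℝ} {f : Config N → ℝ} (h : SLip v f) (B : Finset (Site N)) :
    ∀ η ω : Config N, (∀ j, j ∉ B → η j = ω j) →
      |f η - f ω| ≤ ∑ j ∈ B, v j * (8 + 12 * ‖ω j‖ + 12 * ‖η j‖) := by
  induction B using Finset.induction_on with
  | empty =>
    intro η ω h1
    have : η = ω := funext fun j => h1 j (Finset.notMem_empty j)
    simp [this]
  | insert b B hb ih =>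
    intro η ω h1
    set ω₁ := Function.update η b (ω b) with hω₁
    have h2 := (h.hLip η b).abs_sub_le_norm (ω b) (η b)
    simp only [Function.update_eq_self] at h2
    have h3 := ih ω₁ ω fun j hj => by
      by_cases hjb : j = b
      · subst hjb; simp [hω₁]
      · rw [hω₁, Function.update_of_ne hjb]
        exact h1 j (by simp [hj, hjb])
    have h4 : ∀ j ∈ B, ω₁ j = η j := fun j hj => by
      rw [hω₁, Function.update_of_ne]; exact fun hh => hb (hh ▸ hj)
    rw [Finset.sum_insert hb]
    refine (_root_.abs_sub_le _ (f ω₁) _).trans (add_le_add h2 (h3.trans (le_of_eq ?_)))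
    exact Finset.sum_congr rfl fun j hj => by rw [h4 j hj]

/-- Lipschitz constants are tracked for f^q, on which the averages act linearly. The lower bound on
f recovers some finite constants for f itself; their size plays no role. -/
theorem SLip.of_rpow {q δ : ℝ} (hq : 1 ≤ q) (hδ : 0 < δ) {f : Config N → ℝ} (hf : ∀ ω, δ ≤ f ω)
    {w : Site N → ℝ} (h : SLip w fun ω => f ω ^ q) : SLip (fun j => w j / δ ^ (q - 1)) f := by
  intro ω j k t
  have h0 : 0 < δ ^ (q - 1) := Real.rpow_pos_of_pos hδ _
  have hp : 0 < f ω := hδ.trans_le (hf ω)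
  have h1 := abs_sub_mul_rpow_le hq hp (hδ.le.trans (hf (shift ω j k t)))
  have h2 : δ ^ (q - 1) ≤ f ω ^ (q - 1) := Real.rpow_le_rpow hδ.le (hf ω) (by linarith)
  rw [div_mul_eq_mul_div, le_div_iff₀ h0]
  calc _ ≤ |f (shift ω j k t) - f ω| * f ω ^ (q - 1) := by gcongr
    _ ≤ _ := h1.trans (h ω j k t)

open SiteFamily

/-- Successive averages over the sites of a list. -/
def avgList (μ : Site N → Config N → Measure Heis) (l : List (Site N)) (F : Config N → ℝ) :
    Config N → ℝ := l.foldl (fun F i => siteAvg μ i F) F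

/-- The Lipschitz constants of successive averages. -/
def lipList (θ : ℝ) (l : List (Site N)) (w : Site N → ℝ) : Site N → ℝ :=
  l.foldl (fun w i => lipUpdate θ i w) w

theorem lipUpdate_nonneg {θ : ℝ} (hθ : 0 ≤ θ) {w : Site N → ℝ} (hw : ∀ j, 0 ≤ w j) (i j : Site N) :
    0 ≤ lipUpdate θ i w j := by
  have h1 := hw j
  have h2 := hw i
  rw [lipUpdate]
  split_ifs <;> positivity

theorem lipList_nonneg {θ : ℝ} (hθ : 0 ≤ θ) (l : List (Site N)) : ∀ {w : Site N → ℝ}, (∀ j, 0 ≤ w j) →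
    ∀ j, 0 ≤ lipList θ l w j := by
  induction l with
  | nil => exact fun hw => hw
  | cons i l ih => exact fun hw => ih (lipUpdate_nonneg hθ hw i)

/-- A visit to i removes p_i w_i from the weighted sum and returns at most θ P p_i w_i to the
neighbours, that is, at most half. -/
theorem potential_update_le {θ P : ℝ} (hθ : 0 ≤ θ) (hP : θ * P ≤ 1 / 2) {B : Finset (Site N)}
    {p : Site N → ℝ} {i : Site N} (hi : i ∈ B) (hp : 0 ≤ p i)
    (hpi : ∑ j ∈ B with j ∈ nbrs i, p j ≤ P * p i) {w : Site N → ℝ} (hw : ∀ j, 0 ≤ w j) :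
    ∑ j ∈ B, p j * lipUpdate θ i w j ≤ ∑ j ∈ B, p j * w j - p i * w i / 2 := by
  have e : ∀ j ∈ B, p j * lipUpdate θ i w j
      = p j * w j - (if j = i then p j * w j else 0) + if j ∈ nbrs i then p j * (θ * w i) else 0 := by
    intro j _
    by_cases h : j = i
    · subst h; simp [lipUpdate, not_mem_nbrs_self]
    · simp only [lipUpdate, if_neg h]
      split_ifs <;> ring
  rw [Finset.sum_congr rfl e, Finset.sum_add_distrib, Finset.sum_sub_distrib, Finset.sum_ite_eq',
    if_pos hi, ← Finset.sum_filter, ← Finset.sum_mul]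
  have h1 := mul_le_mul_of_nonneg_right hpi (mul_nonneg hθ (hw i))
  have h2 : P * p i * (θ * w i) ≤ 1 / 2 * (p i * w i) := by
    calc P * p i * (θ * w i) = θ * P * (p i * w i) := by ring
      _ ≤ _ := mul_le_mul_of_nonneg_right hP (mul_nonneg hp (hw i))
  linarith

theorem potential_list_le {θ P : ℝ} (hθ : 0 ≤ θ) (hP : θ * P ≤ 1 / 2) {Λ B : Finset (Site N)}
    (hΛ : Λ ⊆ B) {p : Site N → ℝ} (hp : ∀ j, 0 ≤ p j)
    (hpi : ∀ i ∈ Λ, ∑ j ∈ B with j ∈ nbrs i, p j ≤ P * p i) (l : List (Site N)) :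
    ∀ {w : Site N → ℝ}, (∀ j, 0 ≤ w j) → (∀ i ∈ l, i ∈ Λ) →
      ∑ j ∈ B, p j * lipList θ l w j ≤ ∑ j ∈ B, p j * w j := by
  induction l with
  | nil => exact fun _ _ => le_rfl
  | cons i l ih =>
    intro w hw hl
    have hi := hl i List.mem_cons_self
    refine (ih (lipUpdate_nonneg hθ hw i) fun m hm => hl m (List.mem_cons_of_mem _ hm)).trans ?_
    refine (potential_update_le hθ hP (hΛ hi) (hp i) (hpi i hi) hw).trans ?_
    have := mul_nonneg (hp i) (hw i)
    linarith

/-- Choose a list whose weighted sum is within ε/2 of the infimum over all lists in Λ. One more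
visit to i lowers the sum by at least p_i w_i / 2 but cannot go below the infimum, so p_i w_i ≤ ε
for every i in Λ. No explicit sweeping order is needed. -/
theorem exists_lipList_small {θ P : ℝ} (hθ : 0 ≤ θ) (hP : θ * P ≤ 1 / 2) {Λ B : Finset (Site N)}
    (hΛ : Λ ⊆ B) {p : Site N → ℝ} (hp : ∀ j, 0 ≤ p j)
    (hpi : ∀ i ∈ Λ, ∑ j ∈ B with j ∈ nbrs i, p j ≤ P * p i) {w : Site N → ℝ} (hw : ∀ j, 0 ≤ w j)
    {ε : ℝ} (hε : 0 < ε) :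
    ∃ l : List (Site N), (∀ i ∈ l, i ∈ Λ) ∧ ∀ i ∈ Λ, p i * lipList θ l w i ≤ ε := by
  set S : Set ℝ := {s | ∃ l : List (Site N), (∀ i ∈ l, i ∈ Λ) ∧ ∑ j ∈ B, p j * lipList θ l w j = s}
    with hS
  have hne : S.Nonempty := ⟨_, [], by simp, rfl⟩
  have hbd : BddBelow S := ⟨0, by
    rintro s ⟨l, -, rfl⟩
    exact Finset.sum_nonneg fun j _ => mul_nonneg (hp j) (lipList_nonneg hθ l hw j)⟩
  obtain ⟨s, ⟨l, hl, rfl⟩, hs⟩ := exists_lt_of_csInf_lt hne (lt_add_of_pos_right (sInf S) (half_pos hε))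
  refine ⟨l, hl, fun i hi => ?_⟩
  have h1 := potential_update_le hθ hP (hΛ hi) (hp i) (hpi i hi) (lipList_nonneg hθ l hw)
  have h2 : sInf S ≤ ∑ j ∈ B, p j * lipUpdate θ i (lipList θ l w) j := by
    refine csInf_le hbd ⟨l ++ [i], ?_, ?_⟩
    · intro m hm
      rcases List.mem_append.1 hm with hm | hm
      · exact hl m hm
      · rw [List.mem_singleton.1 hm]; exact hi
    · simp [lipList, List.foldl_append]
  linarith

variable {μ : Site N → Config N → Measure Heis} {q C κ : ℝ}

theorem SiteFamily.lipFactor_nonneg (h : SiteFamily μ q C κ) : 0 ≤ lipFactor q C κ := by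
  have := h.pos
  rw [lipFactor]; positivity

theorem SiteFamily.slopeFactor_nonneg (h : SiteFamily μ q C κ) : 0 ≤ slopeFactor q C κ :=
  mul_nonneg h.pos.le (covConst_nonneg h.one_lt h.nonneg)

theorem SiteFamily.measurable_avgList (h : SiteFamily μ q C κ) (l : List (Site N)) :
    ∀ {F : Config N → ℝ}, Measurable F → Measurable (avgList μ l F) := by
  induction l with
  | nil => exact fun hF => hF
  | cons i l ih => exact fun hF => ih (h.measurable_siteAvg i hF)

theorem SiteFamily.avgList_mem (h : SiteFamily μ q C κ) (l : List (Site N)) {a b : ℝ} :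
    ∀ {F : Config N → ℝ}, Measurable F → (∀ ω, a ≤ F ω) → (∀ ω, F ω ≤ b) →
      ∀ ω, a ≤ avgList μ l F ω ∧ avgList μ l F ω ≤ b := by
  induction l with
  | nil => exact fun _ h1 h2 ω => ⟨h1 ω, h2 ω⟩
  | cons i l ih =>
    exact fun hF h1 h2 => ih (h.measurable_siteAvg i hF) (fun ω => (h.siteAvg_mem i hF h1 h2 ω).1)
      fun ω => (h.siteAvg_mem i hF h1 h2 ω).2

theorem SiteFamily.slip_avgList (h : SiteFamily μ q C κ) (l : List (Site N)) {B : ℝ} :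
    ∀ {F : Config N → ℝ} {w : Site N → ℝ}, Measurable F → (∀ ω, |F ω| ≤ B) → SLip w F →
      SLip (lipList (lipFactor q C κ) l w) (avgList μ l F) := by
  induction l with
  | nil => exact fun _ _ h3 => h3
  | cons i l ih =>
    exact fun h1 h2 h3 => ih (h.measurable_siteAvg i h1) (h.abs_siteAvg_le i h2)
      (h.slip_siteAvg i h1 h2 h3)

/-- `γ` is invariant under the averages over the sites of `Λ`. -/
def Invariant (μ : Site N → Config N → Measure Heis) (Λ : Finset (Site N)) (γ : Measure (Config N)) :
    Prop :=
  ∀ i ∈ Λ, ∀ g : Config N → ℝ, Measurable g → (∃ B, ∀ ω, |g ω| ≤ B) →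
    ∫ ω, siteAvg μ i g ω ∂γ = ∫ ω, g ω ∂γ

variable {Λ : Finset (Site N)} {γ : Measure (Config N)}

theorem SiteFamily.integral_avgList (h : SiteFamily μ q C κ) (hγ : Invariant μ Λ γ)
    (l : List (Site N)) {B : ℝ} : ∀ {F : Config N → ℝ}, Measurable F → (∀ ω, |F ω| ≤ B) →
      (∀ i ∈ l, i ∈ Λ) → ∫ ω, avgList μ l F ω ∂γ = ∫ ω, F ω ∂γ := by
  induction l with
  | nil => exact fun _ _ _ => rfl
  | cons i l ih =>
    intro F hF hB hl
    rw [← hγ i (hl i List.mem_cons_self) F hF ⟨B, hB⟩]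
    exact ih (h.measurable_siteAvg i hF) (h.abs_siteAvg_le i hB)
      fun m hm => hl m (List.mem_cons_of_mem _ hm)

/-- The data propagated by the averages: `f` is bounded away from zero and infinity, `f ^ q` is
Lipschitz with constants `w`, and `G j` bounds the slopes of `f` in the coordinate `j`. -/
structure Slopes (q δ : ℝ) (Λ : Finset (Site N)) (f : Config N → ℝ) (G : Site N → Config N → ℝ)
    (w : Site N → ℝ) (B : ℝ) : Prop where
  meas : Measurable f
  lower : ∀ ω, δ ≤ f ω
  upper : ∀ ω, f ω ≤ B
  lip : SLip w fun ω => f ω ^ q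
  gmeas : ∀ j ∈ Λ, Measurable (G j)
  gnonneg : ∀ j ∈ Λ, ∀ ω, 0 ≤ G j ω
  gupper : ∀ j ∈ Λ, ∀ ω, G j ω ≤ B
  slope : ∀ j ∈ Λ, SSlope f j (G j)

/-- The slopes after an average over the coordinate `i`. -/
def slopeUpdate (μ : Site N → Config N → Measure Heis) (q θ : ℝ) (i : Site N)
    (G : Site N → Config N → ℝ) (j : Site N) (ω : Config N) : ℝ :=
  if j = i then 0 else siteLq μ q i (G j) ω + if j ∈ nbrs i then θ * siteLq μ q i (G i) ω else 0

/-- The hypotheses are stable under f ↦ (E_i f^q)^(1/q). The common upper bound grows, but it never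
enters an estimate. -/
theorem SiteFamily.slopes_siteLq (h : SiteFamily μ q C κ) {δ : ℝ} (hδ : 0 < δ) {f : Config N → ℝ}
    {G : Site N → Config N → ℝ} {w : Site N → ℝ} {B : ℝ} (hs : Slopes q δ Λ f G w B) {i : Site N}
    (hi : i ∈ Λ) :
    Slopes q δ Λ (siteLq μ q i f) (slopeUpdate μ q (slopeFactor q C κ) i G)
      (lipUpdate (lipFactor q C κ) i w) (B + slopeFactor q C κ * B) := by
  have hq : 0 < q := by linarith [h.one_lt]
  have hθ := h.slopeFactor_nonneg
  have hf0 : ∀ ω, 0 ≤ f ω := fun ω => hδ.le.trans (hs.lower ω)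
  have hB0 : 0 ≤ B := (hf0 0).trans (hs.upper 0)
  have hmem := h.siteLq_mem i hs.meas hδ.le hs.lower hs.upper
  have hG : ∀ j ∈ Λ, ∀ ω, 0 ≤ siteLq μ q i (G j) ω ∧ siteLq μ q i (G j) ω ≤ B := fun j hj ω =>
    h.siteLq_mem i (hs.gmeas j hj) le_rfl (hs.gnonneg j hj) (hs.gupper j hj) ω
  refine ⟨h.measurable_siteLq i hs.meas, fun ω => (hmem ω).1, fun ω => ?_, ?_, fun j hj => ?_,
    fun j hj ω => ?_, fun j hj ω => ?_, fun j hj => ?_⟩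
  · have := (hmem ω).2
    nlinarith [mul_nonneg hθ hB0]
  · have e : (fun ω => siteLq μ q i f ω ^ q) = siteAvg μ i fun ω => f ω ^ q :=
      funext fun ω => siteLq_rpow hq hf0 ω
    rw [e]
    refine h.slip_siteAvg i (hs.meas.pow_const q) (B := B ^ q) (fun ω => ?_) hs.lip
    rw [abs_of_nonneg (Real.rpow_nonneg (hf0 ω) q)]
    exact Real.rpow_le_rpow (hf0 ω) (hs.upper ω) hq.le
  · unfold slopeUpdate
    split_ifs
    · exact measurable_const
    · exact (h.measurable_siteLq i (hs.gmeas j hj)).add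
        ((h.measurable_siteLq i (hs.gmeas i hi)).const_mul _)
    · exact (h.measurable_siteLq i (hs.gmeas j hj)).add measurable_const
  · have h1 := (hG j hj ω).1
    have h2 := (hG i hi ω).1
    unfold slopeUpdate
    split_ifs <;> positivity
  · have h1 := hG j hj ω
    have h2 := hG i hi ω
    have h3 := mul_le_mul_of_nonneg_left h2.2 hθ
    have h4 := mul_nonneg hθ hB0
    unfold slopeUpdate
    split_ifs <;> linarith
  · by_cases hij : j = i
    · subst hij
      intro ω k ε hε
      refine Filter.Eventually.of_forall fun t => ?_
      have e : siteLq μ q j f (shift ω j k t) = siteLq μ q j f ω := by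
        simp [siteLq, shift, h.update_self]
      rw [e]
      simp only [slopeUpdate, if_true, sub_self, abs_zero]
      positivity
    · have e : slopeUpdate μ q (slopeFactor q C κ) i G j = fun ω => siteLq μ q i (G j) ω
          + if j ∈ nbrs i then slopeFactor q C κ * siteLq μ q i (G i) ω else 0 := by
        funext ω; rw [slopeUpdate, if_neg hij]
      rw [e]
      exact h.sslope_siteLq hij hs.meas (hs.lip.of_rpow h.one_lt.le hδ hs.lower) hδ hs.lower hs.upper
        (hs.gmeas i hi) (hs.gnonneg i hi) (hs.gupper i hi) (hs.slope i hi)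
        (hs.gmeas j hj) (hs.gnonneg j hj) (hs.gupper j hj) (hs.slope j hj)

/-- Chain rule for entropy: by invariance of γ, the entropy of f^q is the mean of its entropies in
the coordinate i plus the entropy of E_i f^q. The single site inequality bounds the former. -/
theorem SiteFamily.ent_le_step [IsProbabilityMeasure γ] (h : SiteFamily μ q C κ) (hγ : Invariant μ Λ γ) {δ : ℝ} (hδ : 0 < δ)
    {f : Config N → ℝ} {G : Site N → Config N → ℝ} {w : Site N → ℝ} {B : ℝ}
    (hs : Slopes q δ Λ f G w B) {i : Site N} (hi : i ∈ Λ) :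
    ent γ (fun ω => f ω ^ q) ≤ C * lqn γ q (G i) ^ q + ent γ (fun ω => siteLq μ q i f ω ^ q) := by
  have hq : 0 < q := by linarith [h.one_lt]
  have hf0 : ∀ ω, 0 ≤ f ω := fun ω => hδ.le.trans (hs.lower ω)
  have hB0 : 0 ≤ B := (hf0 0).trans (hs.upper 0)
  rw [lqn_rpow hq (hs.gnonneg i hi)]
  simp_rw [siteLq_rpow hq hf0]
  set F : Config N → ℝ := fun ω => f ω ^ q with hF
  have hFm : Measurable F := hs.meas.pow_const q
  have hF0 : ∀ ω, 0 ≤ F ω := fun ω => Real.rpow_nonneg (hf0 ω) q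
  have hFB : ∀ ω, F ω ≤ B ^ q := fun ω => Real.rpow_le_rpow (hf0 ω) (hs.upper ω) hq.le
  have hGm : Measurable fun ω => G i ω ^ q := (hs.gmeas i hi).pow_const q
  have hG0 : ∀ ω, 0 ≤ G i ω ^ q := fun ω => Real.rpow_nonneg (hs.gnonneg i hi ω) q
  have hGB : ∀ ω, G i ω ^ q ≤ B ^ q := fun ω =>
    Real.rpow_le_rpow (hs.gnonneg i hi ω) (hs.gupper i hi ω) hq.le
  obtain ⟨K, -, hK⟩ := exists_mul_log_bound (B ^ q)
  have hlm := measurable_mul_log hFm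
  have hlB : ∀ ω, |F ω * Real.log (F ω)| ≤ K := fun ω => hK _ (hF0 ω) (hFB ω)
  have hAm := h.measurable_siteAvg i hFm
  have hAmem := h.siteAvg_mem i hFm hF0 hFB
  have hpt : ∀ ω, siteAvg μ i (fun ω => F ω * Real.log (F ω)) ω
      - siteAvg μ i F ω * Real.log (siteAvg μ i F ω) ≤ C * siteAvg μ i (fun ω => G i ω ^ q) ω := by
    intro ω
    have := h.ls i ω (fun x => f (Function.update ω i x)) (fun x => G i (Function.update ω i x)) _ B
      ((hs.lip.of_rpow h.one_lt.le hδ hs.lower).hLip ω i)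
      (fun x => by rw [abs_of_nonneg (hf0 _)]; exact hs.upper _)
      ((hs.gmeas i hi).comp (measurable_update ω)) (fun x => hs.gnonneg i hi _)
      (fun x => hs.gupper i hi _) ((hs.slope i hi).hSlope ω)
    simp only [abs_of_nonneg (hf0 _)] at this
    exact this
  have e1 := hγ i hi _ hlm ⟨K, hlB⟩
  have e2 := hγ i hi _ hFm ⟨B ^ q, fun ω => by rw [abs_of_nonneg (hF0 ω)]; exact hFB ω⟩
  have e3 := hγ i hi _ hGm ⟨B ^ q, fun ω => by rw [abs_of_nonneg (hG0 ω)]; exact hGB ω⟩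
  have i1 : Integrable (siteAvg μ i fun ω => F ω * Real.log (F ω)) γ :=
    integrable_of_abs_le (h.measurable_siteAvg i hlm) (h.abs_siteAvg_le i hlB)
  have i2 : Integrable (fun ω => siteAvg μ i F ω * Real.log (siteAvg μ i F ω)) γ :=
    integrable_mul_log hAm (fun ω => (hAmem ω).1) fun ω => (hAmem ω).2
  have i3 : Integrable (siteAvg μ i fun ω => G i ω ^ q) γ :=
    integrable_of_bounds (h.measurable_siteAvg i hGm)
      (fun ω => (h.siteAvg_mem i hGm hG0 hGB ω).1) fun ω => (h.siteAvg_mem i hGm hG0 hGB ω).2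
  have hint := integral_mono (f := fun ω => siteAvg μ i (fun ω => F ω * Real.log (F ω)) ω
      - siteAvg μ i F ω * Real.log (siteAvg μ i F ω)) (i1.sub i2) (i3.const_mul C) hpt
  rw [integral_sub i1 i2, integral_const_mul, e1, e3] at hint
  rw [ent, ent, e2]
  linarith

theorem rpow_add_rpow_le_add_rpow (hq : 1 ≤ q) {a b : ℝ} (ha : 0 ≤ a) (hb : 0 ≤ b) :
    a ^ q + b ^ q ≤ (a + b) ^ q := by
  lift a to NNReal using ha
  lift b to NNReal using hb
  exact_mod_cast NNReal.add_rpow_le_rpow_add a b hq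

/-- Here t_j is the sum of the slope norms found at j over all visits to j. A visit resets the slope
at j to 0, so every amount found there was present initially or was received from a neighbour, which
passes on the fraction θ of what is found at its own visits. This closed inequality holds for every
list, whatever its length. -/
theorem SiteFamily.ent_le_run [IsProbabilityMeasure γ] (h : SiteFamily μ q C κ) (hγ : Invariant μ Λ γ) {δ : ℝ} (hδ : 0 < δ)
    (l : List (Site N)) : ∀ {f : Config N → ℝ} {G : Site N → Config N → ℝ} {w : Site N → ℝ} {B : ℝ},
    Slopes q δ Λ f G w B → (∀ i ∈ l, i ∈ Λ) →
    ∃ t : Site N → ℝ, (∀ j, 0 ≤ t j) ∧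
      (∀ j ∈ Λ, t j ≤ lqn γ q (G j) + slopeFactor q C κ * ∑ m ∈ Λ with m ∈ nbrs j, t m) ∧
      ent γ (fun ω => f ω ^ q)
        ≤ C * ∑ j ∈ Λ, t j ^ q + ent γ (avgList μ l fun ω => f ω ^ q) := by
  have hq : 0 < q := by linarith [h.one_lt]
  have hθ := h.slopeFactor_nonneg
  induction l with
  | nil =>
    intro f G w B hs _
    refine ⟨0, fun _ => le_rfl, fun j hj => ?_, ?_⟩
    · have := lqn_nonneg (μ := γ) (q := q) (hs.gnonneg j hj)
      simpa using this
    · simp [avgList, Real.zero_rpow hq.ne']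
  | cons i l ih =>
    intro f G w B hs hl
    have hi := hl i List.mem_cons_self
    have hf0 : ∀ ω, 0 ≤ f ω := fun ω => hδ.le.trans (hs.lower ω)
    have hB0 : 0 ≤ B := (hf0 0).trans (hs.upper 0)
    obtain ⟨t, ht0, ht, hent⟩ := ih (h.slopes_siteLq hδ hs hi)
      fun m hm => hl m (List.mem_cons_of_mem _ hm)
    have hstep := h.ent_le_step hγ hδ hs hi
    set b := lqn γ q (G i) with hb
    have hb0 : 0 ≤ b := lqn_nonneg (hs.gnonneg i hi)
    -- Averaging the q-th power does not change its γ-integral, so slope norms are transported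
    -- without loss.
    have hnorm : ∀ j ∈ Λ, lqn γ q (siteLq μ q i (G j)) = lqn γ q (G j) := fun j hj => by
      rw [lqn, lqn]
      congr 1
      simp_rw [siteLq_rpow hq (hs.gnonneg j hj)]
      refine hγ i hi _ ((hs.gmeas j hj).pow_const q) ⟨B ^ q, fun ω => ?_⟩
      rw [abs_of_nonneg (Real.rpow_nonneg (hs.gnonneg j hj ω) q)]
      exact Real.rpow_le_rpow (hs.gnonneg j hj ω) (hs.gupper j hj ω) hq.le
    refine ⟨fun j => t j + if j = i then b else 0, fun j => ?_, fun j hj => ?_, ?_⟩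
    · have := ht0 j
      dsimp only
      split_ifs <;> positivity
    · have h1 := ht j hj
      have e : ∑ m ∈ Λ with m ∈ nbrs j, (t m + if m = i then b else 0)
          = ∑ m ∈ Λ with m ∈ nbrs j, t m + if i ∈ nbrs j then b else 0 := by
        rw [Finset.sum_add_distrib, Finset.sum_ite_eq']
        congr 1
        simp [hi]
      rw [e]
      by_cases hij : j = i
      · subst hij
        have e2 : lqn γ q (slopeUpdate μ q (slopeFactor q C κ) j G j) = 0 := by
          simp only [slopeUpdate, if_true, lqn]
          simp [Real.zero_rpow hq.ne', Real.zero_rpow (inv_ne_zero hq.ne')]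
        rw [e2] at h1
        simp only [if_true, if_neg (not_mem_nbrs_self j), add_zero]
        linarith
      · simp only [if_neg hij, add_zero]
        refine h1.trans ?_
        have hsub : lqn γ q (slopeUpdate μ q (slopeFactor q C κ) i G j)
            ≤ lqn γ q (G j) + slopeFactor q C κ * if i ∈ nbrs j then b else 0 := by
          have hm1 := h.measurable_siteLq i (hs.gmeas j hj)
          have hm2 := h.measurable_siteLq i (hs.gmeas i hi)
          have hmem1 := h.siteLq_mem i (hs.gmeas j hj) le_rfl (hs.gnonneg j hj) (hs.gupper j hj)
          have hmem2 := h.siteLq_mem i (hs.gmeas i hi) le_rfl (hs.gnonneg i hi) (hs.gupper i hi)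
          have e3 : slopeUpdate μ q (slopeFactor q C κ) i G j = fun ω => siteLq μ q i (G j) ω
              + if j ∈ nbrs i then slopeFactor q C κ * siteLq μ q i (G i) ω else 0 := by
            funext ω; rw [slopeUpdate, if_neg hij]
          rw [e3]
          by_cases hn : j ∈ nbrs i
          · simp only [if_pos hn, if_pos (mem_nbrs_comm.1 hn)]
            have := lqn_add_le (μ := γ) h.one_lt.le hm1 (hm2.const_mul (slopeFactor q C κ))
              (fun ω => (hmem1 ω).1) (fun ω => mul_nonneg hθ (hmem2 ω).1)
              (B := B + slopeFactor q C κ * B)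
              (fun ω => by nlinarith [(hmem1 ω).2, mul_nonneg hθ hB0])
              (fun ω => by nlinarith [(hmem2 ω).2, mul_nonneg hθ hB0])
            rwa [lqn_const_mul hq (fun ω => (hmem2 ω).1) hθ, hnorm j hj, hnorm i hi] at this
          · simp only [if_neg hn, if_neg (fun hh => hn (mem_nbrs_comm.1 hh)), add_zero, mul_zero]
            rw [hnorm j hj]
        linarith
    · have h1 : b ^ q + ∑ j ∈ Λ, t j ^ q ≤ ∑ j ∈ Λ, (t j + if j = i then b else 0) ^ q := by
        have h2 : ∀ j ∈ Λ, (if j = i then b ^ q else 0) + t j ^ q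
            ≤ (t j + if j = i then b else 0) ^ q := fun j _ => by
          split_ifs
          · rw [add_comm]; exact rpow_add_rpow_le_add_rpow h.one_lt.le (ht0 j) hb0
          · simp
        have h3 := Finset.sum_le_sum h2
        rwa [Finset.sum_add_distrib, Finset.sum_ite_eq', if_pos hi] at h3
      have h4 := mul_le_mul_of_nonneg_left h1 h.nonneg
      have e : avgList μ (i :: l) (fun ω => f ω ^ q) = avgList μ l fun ω => siteLq μ q i f ω ^ q := by
        simp_rw [siteLq_rpow hq hf0]
        rfl
      rw [e]
      linarith

end HeisGibbs

namespace HeisGibbs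

open SiteFamily

/-! ### The inequality in finite volume for Lipschitz functions -/

variable {N : ℕ} {μ : Site N → Config N → Measure Heis} {q C κ : ℝ} {Λ : Finset (Site N)}
  {γ : Measure (Config N)}

/-- Convexity gives the factor 2 for a sum of two terms. Hölder's inequality over at most 3^N
neighbours, and the fact that each site is a neighbour of at most 3^N others, bound the interaction
by 2(θ 3^N)^q ∑ t^q ≤ ½ ∑ t^q, which is absorbed on the left. -/
theorem sum_rpow_le_of_recursive (hq₁ : 1 ≤ q) (hq₂ : q ≤ 2) {θ : ℝ} (hθ : 0 ≤ θ)
    (hθN : θ * 3 ^ N ≤ 1 / 4) {t b : Site N → ℝ} (ht0 : ∀ j, 0 ≤ t j) (hb0 : ∀ j ∈ Λ, 0 ≤ b j)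
    (h : ∀ j ∈ Λ, t j ≤ b j + θ * ∑ m ∈ Λ with m ∈ nbrs j, t m) :
    ∑ j ∈ Λ, t j ^ q ≤ 4 * ∑ j ∈ Λ, b j ^ q := by
  have hq0 : 0 < q := by linarith
  have h2q : (2 : ℝ) ^ (q - 1) ≤ 2 := by
    calc (2 : ℝ) ^ (q - 1) ≤ 2 ^ (1 : ℝ) := Real.rpow_le_rpow_of_exponent_le (by norm_num) (by linarith)
      _ = 2 := Real.rpow_one 2
  have hD : (1 : ℝ) ≤ 3 ^ N := one_le_pow₀ (by norm_num)
  have hpt : ∀ j ∈ Λ, t j ^ q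
      ≤ 2 * b j ^ q + 2 * (θ ^ q * ((3 ^ N : ℝ) ^ (q - 1) * ∑ m ∈ Λ with m ∈ nbrs j, t m ^ q)) := by
    intro j hj
    set s := ∑ m ∈ Λ with m ∈ nbrs j, t m with hs
    have hs0 : 0 ≤ s := Finset.sum_nonneg fun m _ => ht0 m
    have h1 : t j ^ q ≤ (b j + θ * s) ^ q := Real.rpow_le_rpow (ht0 j) (h j hj) hq0.le
    have h2 : (b j + θ * s) ^ q ≤ 2 ^ (q - 1) * (b j ^ q + (θ * s) ^ q) :=
      by
      have hb := hb0 j hj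
      have hs' := mul_nonneg hθ hs0
      generalize b j = x at hb ⊢
      generalize θ * s = y at hs' ⊢
      lift x to NNReal using hb
      lift y to NNReal using hs'
      exact_mod_cast NNReal.rpow_add_le_mul_rpow_add_rpow x y hq₁
    have h3 : s ^ q ≤ (3 ^ N : ℝ) ^ (q - 1) * ∑ m ∈ Λ with m ∈ nbrs j, t m ^ q := by
      have h4 := Real.rpow_sum_le_const_mul_sum_rpow_of_nonneg (s := Λ.filter fun m => m ∈ nbrs j)
        (f := t) hq₁ fun m _ => ht0 m
      refine h4.trans (mul_le_mul_of_nonneg_right ?_ (Finset.sum_nonneg fun m _ =>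
        Real.rpow_nonneg (ht0 m) q))
      refine Real.rpow_le_rpow (Nat.cast_nonneg _) ?_ (by linarith)
      have : (Λ.filter fun m => m ∈ nbrs j).card ≤ 3 ^ N :=
        (Finset.card_le_card fun m hm => (Finset.mem_filter.1 hm).2).trans (card_nbrs_le j)
      exact_mod_cast this
    have h5 : 0 ≤ b j ^ q + (θ * s) ^ q :=
      add_nonneg (Real.rpow_nonneg (hb0 j hj) q) (Real.rpow_nonneg (mul_nonneg hθ hs0) q)
    have h6 := mul_le_mul_of_nonneg_right h2q h5
    have h7 : (θ * s) ^ q ≤ θ ^ q * ((3 ^ N : ℝ) ^ (q - 1) * ∑ m ∈ Λ with m ∈ nbrs j, t m ^ q) := by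
      rw [Real.mul_rpow hθ hs0]
      exact mul_le_mul_of_nonneg_left h3 (Real.rpow_nonneg hθ q)
    linarith
  have hsum := Finset.sum_le_sum hpt
  rw [Finset.sum_add_distrib, ← Finset.mul_sum, ← Finset.mul_sum, ← Finset.mul_sum,
    ← Finset.mul_sum] at hsum
  have hswap : ∑ j ∈ Λ, ∑ m ∈ Λ with m ∈ nbrs j, t m ^ q ≤ 3 ^ N * ∑ m ∈ Λ, t m ^ q := by
    simp_rw [Finset.sum_filter]
    rw [Finset.sum_comm, Finset.mul_sum]
    refine Finset.sum_le_sum fun m _ => ?_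
    rw [← Finset.sum_filter, Finset.sum_const, nsmul_eq_mul]
    refine mul_le_mul_of_nonneg_right ?_ (Real.rpow_nonneg (ht0 m) q)
    have : (Λ.filter fun j => m ∈ nbrs j).card ≤ 3 ^ N :=
      (Finset.card_le_card fun j hj => mem_nbrs_comm.1 (Finset.mem_filter.1 hj).2).trans
        (card_nbrs_le m)
    exact_mod_cast this
  set T := ∑ j ∈ Λ, t j ^ q with hT
  have hT0 : 0 ≤ T := Finset.sum_nonneg fun m _ => Real.rpow_nonneg (ht0 m) q
  have hDq : (0 : ℝ) ≤ (3 ^ N : ℝ) ^ (q - 1) := by positivity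
  have hθq : 0 ≤ θ ^ q := Real.rpow_nonneg hθ q
  have h8 : θ ^ q * ((3 ^ N : ℝ) ^ (q - 1) * (3 ^ N * T)) ≤ 1 / 4 * T := by
    have e : θ ^ q * ((3 ^ N : ℝ) ^ (q - 1) * (3 ^ N * T)) = (θ * 3 ^ N) ^ q * T := by
      rw [Real.mul_rpow hθ (by positivity), Real.rpow_sub_one (by positivity)]
      field_simp
    rw [e]
    refine mul_le_mul_of_nonneg_right ?_ hT0
    have hx : 0 ≤ θ * 3 ^ N := by positivity
    rcases hx.eq_or_lt with h0 | h0
    · rw [← h0, Real.zero_rpow hq0.ne']; norm_num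
    · calc (θ * 3 ^ N) ^ q ≤ (θ * 3 ^ N) ^ (1 : ℝ) :=
            Real.rpow_le_rpow_of_exponent_ge h0 (by linarith) hq₁
        _ ≤ 1 / 4 := by rw [Real.rpow_one]; exact hθN
  have h9 := mul_le_mul_of_nonneg_left (mul_le_mul_of_nonneg_left hswap hDq) hθq
  linarith

/-- The cap R makes dominated convergence available with no moment of Y. It is used with Y a
function of the norms of the coordinates. -/
theorem tendsto_integral_min_zero {S : Type*} [MeasurableSpace S] {γ : Measure S}
    [IsFiniteMeasure γ] {Y : S → ℝ} (hY : Measurable Y) (hY0 : ∀ x, 0 ≤ Y x) {R : ℝ} (hR : 0 ≤ R) :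
    Filter.Tendsto (fun n : ℕ => ∫ x, min R (Y x / (n + 1)) ∂γ) Filter.atTop (nhds 0) := by
  have h0 : ∫ _ : S, (0 : ℝ) ∂γ = 0 := by simp
  rw [← h0]
  refine tendsto_integral_of_dominated_convergence (fun _ => R)
    (fun n => (measurable_const.min (hY.div_const _)).aestronglyMeasurable) (integrable_const R)
    (fun n => Filter.Eventually.of_forall fun x => ?_) (Filter.Eventually.of_forall fun x => ?_)
  · have : 0 ≤ Y x / (n + 1) := div_nonneg (hY0 x) (by positivity)
    rw [Real.norm_eq_abs, abs_of_nonneg (le_min hR this)]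
    exact min_le_left _ _
  · have h1 : Filter.Tendsto (fun n : ℕ => Y x / (n + 1)) Filter.atTop (nhds 0) := by
      have := (tendsto_one_div_add_atTop_nhds_zero_nat (𝕜 := ℝ)).const_mul (Y x)
      simpa [div_eq_mul_inv] using this
    have h2 := (tendsto_const_nhds (x := R)).min h1
    rwa [min_eq_right hR] at h2

/-- Under γ the configuration differs from ω only in Λ. If all Lipschitz constants in Λ are small,
the average is close to its value at ω except where the coordinates are large, and there boundedness
suffices. The lower bound δ turns mean square closeness into small entropy. -/
theorem SiteFamily.exists_ent_avgList_le [IsProbabilityMeasure γ] (h : SiteFamily μ q C κ)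
    (hκ : lipFactor q C κ * 3 ^ N ≤ 1 / 2) {ω : Config N}
    (hω : ∀ᵐ η ∂γ, ∀ j, j ∉ Λ → η j = ω j) {F : Config N → ℝ} {w : Site N → ℝ} {δ B : ℝ}
    (hF : Measurable F) (hδ : 0 < δ) (hδF : ∀ η, δ ≤ F η) (hFB : ∀ η, F η ≤ B) (hw : SLip w F)
    {ε : ℝ} (hε : 0 < ε) :
    ∃ l : List (Site N), (∀ i ∈ l, i ∈ Λ) ∧ ent γ (avgList μ l F) ≤ ε := by
  set Y : Config N → ℝ := fun η => (∑ j ∈ Λ, (8 + 12 * ‖ω j‖ + 12 * ‖η j‖)) ^ 2 with hY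
  have hB0 : 0 ≤ B := hδ.le.trans ((hδF ω).trans (hFB ω))
  have hYm : Measurable Y := by
    refine (Finset.measurable_fun_sum _ fun j _ => ?_).pow_const 2
    exact measurable_const.add ((measurable_pi_apply j).norm.const_mul 12)
  have htend := tendsto_integral_min_zero (γ := γ) hYm (fun η => sq_nonneg _) (sq_nonneg B)
  obtain ⟨n, hn⟩ := (htend.eventually (gt_mem_nhds (mul_pos hδ hε))).exists
  have hn1 : (0 : ℝ) < n + 1 := by positivity
  obtain ⟨l, hl, hsmall⟩ := exists_lipList_small h.lipFactor_nonneg hκ (Λ := Λ) (B := Λ)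
    (fun _ h => h) (p := fun _ => 1) (fun _ => zero_le_one) (fun i _ => by
      rw [Finset.sum_const, nsmul_eq_mul, mul_one, mul_one]
      have : (Λ.filter fun m => m ∈ nbrs i).card ≤ 3 ^ N :=
        (Finset.card_le_card fun m hm => (Finset.mem_filter.1 hm).2).trans (card_nbrs_le i)
      exact_mod_cast this) hw.nonneg (ε := 1 / (n + 1)) (by positivity)
  refine ⟨l, hl, ?_⟩
  have hmem := h.avgList_mem l hF hδF hFB
  have hm := h.measurable_avgList l hF
  have hlip := h.slip_avgList l hF (B := B) (fun η => by
    rw [abs_of_nonneg (hδ.le.trans (hδF η))]; exact hFB η) hw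
  refine (ent_le_of_lower_bound hm hδ (fun η => (hmem η).1) (fun η => (hmem η).2)
    (avgList μ l F ω)).trans ?_
  rw [inv_mul_le_iff₀ hδ]
  refine le_trans ?_ hn.le
  have hsqB : ∀ η, (avgList μ l F η - avgList μ l F ω) ^ 2 ≤ B ^ 2 := fun η => by
    rw [← sq_abs]
    refine pow_le_pow_left₀ (abs_nonneg _) (abs_le.2 ⟨?_, ?_⟩) 2 <;>
      linarith [(hmem η).1, (hmem η).2, (hmem ω).1, (hmem ω).2]
  refine integral_mono_ae (integrable_of_bounds ((hm.sub_const _).pow_const 2)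
    (fun η => sq_nonneg _) hsqB) (integrable_of_bounds (measurable_const.min (hYm.div_const _))
    (B := B ^ 2) (fun η => le_min (sq_nonneg B) (div_nonneg (sq_nonneg _) hn1.le))
    (fun η => min_le_left _ _)) ?_
  filter_upwards [hω] with η hη
  refine le_min (hsqB η) ?_
  have h1 := hlip.abs_sub_le Λ η ω hη
  have h2 : |avgList μ l F η - avgList μ l F ω|
      ≤ 1 / (n + 1) * ∑ j ∈ Λ, (8 + 12 * ‖ω j‖ + 12 * ‖η j‖) := by
    refine h1.trans ?_
    rw [Finset.mul_sum]
    refine Finset.sum_le_sum fun j hj => mul_le_mul_of_nonneg_right ?_ (by positivity)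
    have := hsmall j hj
    rwa [one_mul] at this
  have h3 : (avgList μ l F η - avgList μ l F ω) ^ 2
      ≤ (1 / (n + 1) * ∑ j ∈ Λ, (8 + 12 * ‖ω j‖ + 12 * ‖η j‖)) ^ 2 := by
    rw [← sq_abs]
    exact pow_le_pow_left₀ (abs_nonneg _) h2 2
  refine h3.trans ?_
  rw [mul_pow, hY, div_eq_mul_inv, mul_comm]
  refine mul_le_mul_of_nonneg_left ?_ (sq_nonneg _)
  rw [one_mul]
  have : ((n : ℝ) + 1)⁻¹ ≤ 1 := inv_le_one_of_one_le₀ (by linarith [Nat.cast_nonneg (α := ℝ) n])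
  have h0 : 0 ≤ ((n : ℝ) + 1)⁻¹ := by positivity
  nlinarith

theorem SiteFamily.ent_le_of_slopes [IsProbabilityMeasure γ] (h : SiteFamily μ q C κ)
    (hκ₁ : lipFactor q C κ * 3 ^ N ≤ 1 / 2) (hκ₂ : slopeFactor q C κ * 3 ^ N ≤ 1 / 4)
    (hγ : Invariant μ Λ γ) {ω : Config N}
    (hω : ∀ᵐ η ∂γ, ∀ j, j ∉ Λ → η j = ω j) {δ : ℝ} (hδ : 0 < δ) {f : Config N → ℝ}
    {G : Site N → Config N → ℝ} {w : Site N → ℝ} {B : ℝ} (hs : Slopes q δ Λ f G w B) :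
    ent γ (fun η => f η ^ q) ≤ 4 * C * ∑ j ∈ Λ, ∫ η, G j η ^ q ∂γ := by
  have hq : 0 < q := by linarith [h.one_lt]
  refine le_of_forall_pos_le_add fun ε hε => ?_
  have hf0 : ∀ η, 0 ≤ f η := fun η => hδ.le.trans (hs.lower η)
  obtain ⟨l, hl, hent⟩ := h.exists_ent_avgList_le hκ₁ hω (hs.meas.pow_const q)
    (Real.rpow_pos_of_pos hδ q) (fun η => Real.rpow_le_rpow hδ.le (hs.lower η) hq.le)
    (fun η => Real.rpow_le_rpow (hf0 η) (hs.upper η) hq.le) hs.lip hε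
  obtain ⟨t, ht0, ht, hle⟩ := h.ent_le_run hγ hδ l hs hl
  have h1 := sum_rpow_le_of_recursive h.one_lt.le h.le_two h.slopeFactor_nonneg hκ₂ ht0
    (fun j hj => lqn_nonneg (hs.gnonneg j hj)) ht
  have h2 : ∑ j ∈ Λ, lqn γ q (G j) ^ q = ∑ j ∈ Λ, ∫ η, G j η ^ q ∂γ :=
    Finset.sum_congr rfl fun j hj => lqn_rpow hq (hs.gnonneg j hj)
  rw [h2] at h1
  have h3 := mul_le_mul_of_nonneg_left h1 h.nonneg
  linarith

end HeisGibbs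

/-! ### Finite volume: from Lipschitz functions to functions that are C¹ in each coordinate. -/

namespace HeisGibbs

/-! ### Mollification on a product of Heisenberg groups -/

theorem rpow_lintegral_le {S : Type*} [MeasurableSpace S] {π : Measure S} [IsProbabilityMeasure π]
    {q : ℝ} (hq : 1 < q) {f : S → ℝ≥0∞} (hf : Measurable f) :
    (∫⁻ x, f x ∂π) ^ q ≤ ∫⁻ x, f x ^ q ∂π := by
  have hq0 : 0 < q := by linarith
  have h := ENNReal.lintegral_mul_le_Lp_mul_Lq π (Real.HolderConjugate.conjExponent hq)
    hf.aemeasurable (aemeasurable_const (b := (1 : ℝ≥0∞)))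
  simp only [Pi.mul_apply, mul_one, ENNReal.one_rpow, lintegral_const, measure_univ] at h
  calc (∫⁻ x, f x ∂π) ^ q ≤ ((∫⁻ x, f x ^ q ∂π) ^ (1 / q)) ^ q := ENNReal.rpow_le_rpow h hq0.le
    _ = _ := by rw [← ENNReal.rpow_mul, one_div_mul_cancel hq0.ne', ENNReal.rpow_one]

variable {ι : Type*}

/-- The group law on a product of Heisenberg groups. -/
def pmul (h x : ι → Heis) : ι → Heis := fun i => lmul (h i) (x i)

theorem continuous_pmul_uncurry : Continuous fun p : (ι → Heis) × (ι → Heis) => pmul p.1 p.2 :=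
  continuous_pi fun i => continuous_lmul_uncurry.comp
    (f := fun p : (ι → Heis) × (ι → Heis) => (p.1 i, p.2 i)) (by fun_prop)

theorem continuous_pmul (h : ι → Heis) : Continuous (pmul h) :=
  continuous_pmul_uncurry.comp (f := fun x : ι → Heis => (h, x)) (by fun_prop)

theorem pmul_neg_pmul (h x : ι → Heis) : pmul (-h) (pmul h x) = x :=
  funext fun i => lmul_neg_lmul (h i) (x i)

theorem pmul_zero_left (x : ι → Heis) : pmul 0 x = x := funext fun i => lmul_zero_left (x i)

theorem pmul_neg_pmul_neg (h x : ι → Heis) : pmul x (-pmul (-h) x) = h := by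
  funext i
  ext m
  fin_cases m <;> simp [pmul, lmul]
  ring

theorem shift_pmul [DecidableEq ι] (h x : ι → Heis) (j : ι) (k : Fin 2) (t : ℝ) :
    shift (pmul h x) j k t = pmul h (shift x j k t) := by
  funext i
  by_cases hi : i = j
  · subst hi
    simp [shift, pmul, lmul_flow]
  · simp [shift, pmul, Function.update_of_ne hi]

theorem measurable_shift_time [DecidableEq ι] (y : ι → Heis) (j : ι) (k : Fin 2) :
    Measurable fun s : ℝ => shift y j k s := by
  rw [measurable_pi_iff]
  intro m
  by_cases h : m = j
  · subst h
    simp only [shift, Function.update_self]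
    exact (continuous_flow_time k (y m)).measurable
  · simp only [shift, Function.update_of_ne h]
    exact measurable_const

theorem continuous_shift_time [DecidableEq ι] (y : ι → Heis) (j : ι) (k : Fin 2) :
    Continuous fun s : ℝ => shift y j k s :=
  continuous_const.update j (continuous_flow_time k (y j))

variable [Fintype ι]

instance : (volume : Measure (ι → Heis)).IsAddHaarMeasure :=
  have : (volume : Measure Heis).IsAddHaarMeasure := isAddHaarMeasure_volume_pi (Fin 3)
  have (_ : ι) : (volume : Measure Heis).IsAddHaarMeasure := this
  Measure.pi.isAddHaarMeasure (fun _ : ι => (volume : Measure Heis))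

theorem measurePreserving_pmul (h : ι → Heis) : MeasurePreserving (pmul h) volume volume :=
  volume_preserving_pi fun i => measurePreserving_lmul (h i)

theorem measurePreserving_pmul_neg (x : ι → Heis) :
    MeasurePreserving (fun h => pmul (-h) x) volume volume :=
  volume_preserving_pi (f := fun i h => lmul (-h) (x i)) fun i => measurePreserving_lmul_neg (x i)

theorem lintegral_bumpMeasure (b : ContDiffBump (0 : ι → Heis)) {f : (ι → Heis) → ℝ≥0∞}
    (hf : Measurable f) :
    ∫⁻ h, f h ∂(bumpMeasure b) = ∫⁻ h, ENNReal.ofReal (b.normed volume h) * f h := by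
  rw [bumpMeasure, lintegral_withDensity_eq_lintegral_mul _
    b.continuous_normed.measurable.ennreal_ofReal hf]
  rfl

/-- The average of `g` over small left translations. -/
def pavg (b : ContDiffBump (0 : ι → Heis)) (g : (ι → Heis) → ℝ) (x : ι → Heis) : ℝ :=
  ∫ y, b.normed volume (pmul x (-y)) * g y

section

variable (b : ContDiffBump (0 : ι → Heis)) {g : (ι → Heis) → ℝ}

theorem exists_normed_bound : ∃ D : ℝ, 0 ≤ D ∧ ∀ x, b.normed volume x ≤ D :=
  ⟨_, by positivity, b.normed_le_div_measure_closedBall_rIn volume⟩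

theorem continuous_normed_pmul_neg (y : ι → Heis) :
    Continuous fun x => b.normed volume (pmul x (-y)) :=
  b.continuous_normed.comp (continuous_pmul_uncurry.comp
    (f := fun x : ι → Heis => (x, -y)) (by fun_prop))

theorem continuous_normed_pmul_neg' (x : ι → Heis) :
    Continuous fun y => b.normed volume (pmul x (-y)) :=
  b.continuous_normed.comp ((continuous_pmul x).comp continuous_neg)

theorem integrable_normed_mul (hg : Integrable g) (x : ι → Heis) :
    Integrable fun y => b.normed volume (pmul x (-y)) * g y := by
  obtain ⟨D, -, hD⟩ := exists_normed_bound b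
  refine hg.bdd_mul (c := D) (continuous_normed_pmul_neg' b x).aestronglyMeasurable
    (Filter.Eventually.of_forall fun y => ?_)
  rw [Real.norm_eq_abs, abs_of_nonneg (b.nonneg_normed _)]
  exact hD _

theorem continuous_pavg (hg : Integrable g) : Continuous (pavg b g) := by
  obtain ⟨D, -, hD⟩ := exists_normed_bound b
  refine continuous_of_dominated (bound := fun y => D * ‖g y‖)
    (fun x => (integrable_normed_mul b hg x).aestronglyMeasurable)
    (fun x => Filter.Eventually.of_forall fun y => ?_) (hg.norm.const_mul D)
    (Filter.Eventually.of_forall fun y => (continuous_normed_pmul_neg b y).mul continuous_const)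
  rw [norm_mul, Real.norm_eq_abs, abs_of_nonneg (b.nonneg_normed _)]
  gcongr
  exact hD _

theorem exists_pavg_bound (hg : Integrable g) : ∃ K, ∀ x, pavg b g x ≤ K := by
  obtain ⟨D, -, hD⟩ := exists_normed_bound b
  refine ⟨∫ y, D * ‖g y‖, fun x => integral_mono (integrable_normed_mul b hg x)
    (hg.norm.const_mul D) fun y => ?_⟩
  refine (mul_le_mul_of_nonneg_left (Real.le_norm_self (g y)) (b.nonneg_normed _)).trans ?_
  gcongr
  exact hD _

theorem pavg_nonneg (h0 : ∀ x, 0 ≤ g x) (x : ι → Heis) : 0 ≤ pavg b g x :=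
  integral_nonneg fun y => mul_nonneg (b.nonneg_normed _) (h0 y)

theorem ofReal_pavg (hgm : Measurable g) (hg : Integrable g) (h0 : ∀ x, 0 ≤ g x) (x : ι → Heis) :
    ENNReal.ofReal (pavg b g x) = ∫⁻ h, ENNReal.ofReal (g (pmul (-h) x)) ∂(bumpMeasure b) := by
  have hm : Measurable fun h => ENNReal.ofReal (g (pmul (-h) x)) :=
    (hgm.comp (measurePreserving_pmul_neg x).measurable).ennreal_ofReal
  rw [pavg, ofReal_integral_eq_lintegral_ofReal (integrable_normed_mul b hg x)
    (Filter.Eventually.of_forall fun y => mul_nonneg (b.nonneg_normed _) (h0 y)),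
    lintegral_bumpMeasure b hm,
    ← (measurePreserving_pmul_neg x).lintegral_comp
      (f := fun y => ENNReal.ofReal (b.normed volume (pmul x (-y)) * g y))
      ((continuous_normed_pmul_neg' b x).measurable.mul hgm).ennreal_ofReal]
  congr 1
  funext h
  rw [pmul_neg_pmul_neg, ENNReal.ofReal_mul (b.nonneg_normed _)]

theorem pavg_eq (hgm : Measurable g) (x : ι → Heis) :
    pavg b g x = ∫ h, g (pmul (-h) x) ∂(bumpMeasure b) := by
  rw [pavg, integral_bumpMeasure, ← integral_comp_of_measurePreserving
    (f := fun y => b.normed volume (pmul x (-y)) * g y) (measurePreserving_pmul_neg x)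
    ((continuous_normed_pmul_neg' b x).measurable.mul hgm)]
  simp_rw [pmul_neg_pmul_neg]

end

section Slope

variable [DecidableEq ι] (b : ContDiffBump (0 : ι → Heis)) {g G : (ι → Heis) → ℝ} {B : ℝ} {j : ι}

/-- Averaging commutes with shifts, so an integral bound for increments along flow lines is
inherited by the averages. G may be unbounded and merely integrable; its average is bounded and
continuous, which yields the Lipschitz and slope bounds that follow. -/
theorem ofReal_abs_pavg_shift_sub_le (hgm : Measurable g) (hgB : ∀ x, |g x| ≤ B)
    (hGm : Measurable G) (hG : Integrable G) (hG0 : ∀ x, 0 ≤ G x)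
    (h : ∀ y k t, ENNReal.ofReal |g (shift y j k t) - g y|
      ≤ ∫⁻ s in Set.uIoc 0 t, ENNReal.ofReal (G (shift y j k s))) (x : ι → Heis) (k : Fin 2) (t : ℝ) :
    ENNReal.ofReal |pavg b g (shift x j k t) - pavg b g x|
      ≤ ∫⁻ s in Set.uIoc 0 t, ENNReal.ofReal (pavg b G (shift x j k s)) := by
  have hmeas : ∀ z : ι → Heis, Measurable fun h => g (pmul (-h) z) := fun z =>
    hgm.comp (measurePreserving_pmul_neg z).measurable
  have hint : ∀ z : ι → Heis, Integrable (fun h => g (pmul (-h) z)) (bumpMeasure b) := fun z =>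
    integrable_of_abs_le (hmeas z) fun h => hgB _
  rw [pavg_eq b hgm, pavg_eq b hgm, ← integral_sub (hint _) (hint _)]
  have e : ∀ r : ℝ, ENNReal.ofReal |r| = ‖r‖ₑ := fun r => by
    rw [← Real.norm_eq_abs, ofReal_norm]
  rw [e]
  refine (enorm_integral_le_lintegral_enorm _).trans ?_
  simp_rw [← e, ← shift_pmul]
  refine (lintegral_mono fun h' => h _ k t).trans ?_
  rw [lintegral_lintegral_swap]
  · simp_rw [ofReal_pavg b hGm hG hG0, shift_pmul]
    exact le_rfl
  · refine (hGm.comp ?_).ennreal_ofReal.aemeasurable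
    have h1 : Measurable fun p : (ι → Heis) × ℝ => pmul (-p.1) (shift x j k p.2) :=
      continuous_pmul_uncurry.measurable.comp
        (f := fun p : (ι → Heis) × ℝ => (-p.1, shift x j k p.2))
        (measurable_fst.neg.prodMk ((measurable_shift_time x j k).comp measurable_snd))
    have e2 : (fun p : (ι → Heis) × ℝ => shift (pmul (-p.1) x) j k p.2)
        = fun p => pmul (-p.1) (shift x j k p.2) := funext fun p => shift_pmul _ _ _ _ _
    rw [e2]
    exact h1

theorem lintegral_uIoc_le {f : ℝ → ℝ≥0∞} {t a : ℝ} (ha : 0 ≤ a)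
    (h : ∀ s ∈ Set.uIoc 0 t, f s ≤ ENNReal.ofReal a) :
    ∫⁻ s in Set.uIoc 0 t, f s ≤ ENNReal.ofReal (a * |t|) := by
  calc _ ≤ ∫⁻ _ in Set.uIoc 0 t, ENNReal.ofReal a :=
        setLIntegral_mono' measurableSet_uIoc h
    _ = _ := by
      rw [setLIntegral_const, Real.volume_uIoc, sub_zero, ENNReal.ofReal_mul ha]

theorem abs_pavg_shift_sub_le (hgm : Measurable g) (hgB : ∀ x, |g x| ≤ B)
    (hGm : Measurable G) (hG : Integrable G) (hG0 : ∀ x, 0 ≤ G x)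
    (h : ∀ y k t, ENNReal.ofReal |g (shift y j k t) - g y|
      ≤ ∫⁻ s in Set.uIoc 0 t, ENNReal.ofReal (G (shift y j k s))) {K : ℝ}
    (hK : ∀ x, pavg b G x ≤ K) (x : ι → Heis) (k : Fin 2) (t : ℝ) :
    |pavg b g (shift x j k t) - pavg b g x| ≤ K * |t| := by
  have hK0 : 0 ≤ K := (pavg_nonneg b hG0 0).trans (hK 0)
  rw [← ENNReal.ofReal_le_ofReal_iff (by positivity)]
  exact (ofReal_abs_pavg_shift_sub_le b hgm hgB hGm hG hG0 h x k t).trans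
    (lintegral_uIoc_le hK0 fun s _ => ENNReal.ofReal_le_ofReal (hK _))

theorem pavg_slope (hgm : Measurable g) (hgB : ∀ x, |g x| ≤ B)
    (hGm : Measurable G) (hG : Integrable G) (hG0 : ∀ x, 0 ≤ G x)
    (h : ∀ y k t, ENNReal.ofReal |g (shift y j k t) - g y|
      ≤ ∫⁻ s in Set.uIoc 0 t, ENNReal.ofReal (G (shift y j k s))) (x : ι → Heis) (k : Fin 2) {ε : ℝ}
    (hε : 0 < ε) :
    ∀ᶠ t in nhds (0 : ℝ), |pavg b g (shift x j k t) - pavg b g x| ≤ (pavg b G x + ε) * |t| := by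
  have hc : Continuous fun s : ℝ => pavg b G (shift x j k s) :=
    (continuous_pavg b hG).comp (continuous_shift_time x j k)
  have h1 := hc.tendsto 0
  rw [shift_zero] at h1
  obtain ⟨r, hr, hr'⟩ := Metric.eventually_nhds_iff.1
    (h1.eventually (gt_mem_nhds (lt_add_of_pos_right _ hε)))
  have h0 := pavg_nonneg b hG0 x
  filter_upwards [Metric.ball_mem_nhds (0 : ℝ) hr] with t ht
  rw [← ENNReal.ofReal_le_ofReal_iff (by positivity)]
  refine (ofReal_abs_pavg_shift_sub_le b hgm hgB hGm hG hG0 h x k t).trans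
    (lintegral_uIoc_le (by positivity) fun s hs => ENNReal.ofReal_le_ofReal (hr' ?_).le)
  rw [Real.dist_eq, sub_zero]
  rw [Metric.mem_ball, Real.dist_eq, sub_zero] at ht
  refine lt_of_le_of_lt ?_ ht
  rcases Set.mem_uIoc.1 hs with ⟨h2, h3⟩ | ⟨h2, h3⟩
  · rw [abs_of_pos h2, abs_of_pos (h2.trans_le h3)]; exact h3
  · rw [abs_of_nonpos h3, abs_of_neg (h2.trans_le h3)]; linarith

end Slope

/-- Jensen's inequality and a change of variables. -/
theorem lintegral_pavg_rpow_le (b : ContDiffBump (0 : ι → Heis)) {G m : (ι → Heis) → ℝ} {q : ℝ}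
    (hq : 1 < q) (hGm : Measurable G) (hG : Integrable G) (hG0 : ∀ x, 0 ≤ G x) (hm : Measurable m)
    (h : ∀ h y, ‖h‖ < b.rOut → G y ≠ 0 → m (pmul h y) ≤ 2 * m y) :
    ∫⁻ x, ENNReal.ofReal (m x) * ENNReal.ofReal (pavg b G x) ^ q
      ≤ 2 * ∫⁻ x, ENNReal.ofReal (m x) * ENNReal.ofReal (G x) ^ q := by
  have hq0 : 0 < q := by linarith
  have hpm : Measurable fun p : (ι → Heis) × (ι → Heis) => pmul (-p.2) p.1 :=
    (continuous_pmul_uncurry.comp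
      (f := fun p : (ι → Heis) × (ι → Heis) => (-p.2, p.1)) (by fun_prop)).measurable
  have hF : Measurable fun p : (ι → Heis) × (ι → Heis) =>
      ENNReal.ofReal (m p.1) * ENNReal.ofReal (G (pmul (-p.2) p.1)) ^ q :=
    (hm.comp measurable_fst).ennreal_ofReal.mul ((hGm.comp hpm).ennreal_ofReal.pow_const q)
  calc ∫⁻ x, ENNReal.ofReal (m x) * ENNReal.ofReal (pavg b G x) ^ q
      ≤ ∫⁻ x, ∫⁻ h, ENNReal.ofReal (m x) * ENNReal.ofReal (G (pmul (-h) x)) ^ q ∂(bumpMeasure b) := by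
        refine lintegral_mono fun x => ?_
        have hmx : Measurable fun h => ENNReal.ofReal (G (pmul (-h) x)) :=
          (hGm.comp (measurePreserving_pmul_neg x).measurable).ennreal_ofReal
        rw [lintegral_const_mul _ (hmx.pow_const q), ofReal_pavg b hGm hG hG0]
        gcongr
        exact rpow_lintegral_le hq hmx
    _ = ∫⁻ h, (∫⁻ x, ENNReal.ofReal (m x) * ENNReal.ofReal (G (pmul (-h) x)) ^ q) ∂(bumpMeasure b) :=
        lintegral_lintegral_swap hF.aemeasurable
    _ ≤ ∫⁻ _, (2 * ∫⁻ x, ENNReal.ofReal (m x) * ENNReal.ofReal (G x) ^ q) ∂(bumpMeasure b) := by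
        refine lintegral_mono_ae ?_
        filter_upwards [ae_bumpMeasure b] with h' hh
        have e : ∫⁻ x, ENNReal.ofReal (m x) * ENNReal.ofReal (G (pmul (-h') x)) ^ q
            = ∫⁻ y, ENNReal.ofReal (m (pmul h' y)) * ENNReal.ofReal (G y) ^ q := by
          rw [← (measurePreserving_pmul h').lintegral_comp
            (f := fun x => ENNReal.ofReal (m x) * ENNReal.ofReal (G (pmul (-h') x)) ^ q) (hm.ennreal_ofReal.mul
            ((hGm.comp (continuous_pmul (-h')).measurable).ennreal_ofReal.pow_const q))]
          simp_rw [pmul_neg_pmul]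
        have hmG : Measurable fun x => ENNReal.ofReal (m x) * ENNReal.ofReal (G x) ^ q :=
          hm.ennreal_ofReal.mul (hGm.ennreal_ofReal.pow_const q)
        rw [e, ← lintegral_const_mul _ hmG]
        refine lintegral_mono fun y => ?_
        rw [← mul_assoc]
        by_cases hy : G y = 0
        · simp [hy, hq0]
        -- The comparison of the density with its translate is needed only on the support of G,
        -- hence only on a compact set.
        · gcongr
          have h2 : (2 : ℝ≥0∞) = ENNReal.ofReal 2 := by simp
          rw [h2, ← ENNReal.ofReal_mul two_pos.le]
          exact ENNReal.ofReal_le_ofReal (h h' y hh hy)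
    _ = _ := by simp

/-- Left translations are continuous in `L¹`. -/
theorem tendsto_lintegral_pmul_sub {g : (ι → Heis) → ℝ} (hg : Integrable g) :
    Filter.Tendsto (fun h => ∫⁻ x, ‖g (pmul (-h) x) - g x‖ₑ) (nhds 0) (nhds 0) := by
  have hmem : MemLp g 1 volume := memLp_one_iff_integrable.2 hg
  have hc : Continuous fun p : (ι → Heis) × (ι → Heis) => pmul (-p.1) p.2 :=
    continuous_pmul_uncurry.comp
      (f := fun p : (ι → Heis) × (ι → Heis) => (-p.1, p.2)) (by fun_prop)
  let T : C(ι → Heis, C(ι → Heis, ι → Heis)) := ContinuousMap.curry ⟨_, hc⟩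
  have hT : ∀ h, MeasurePreserving (T h) volume volume := fun h => measurePreserving_pmul (-h)
  have h1 := Filter.Tendsto.compMeasurePreservingLp (p := 1)
    (tendsto_const_nhds (x := hmem.toLp g) (f := nhds (0 : ι → Heis))) (T.continuous.tendsto 0) hT (hT 0)
    ENNReal.one_ne_top
  rw [tendsto_iff_edist_tendsto_0] at h1
  refine h1.congr fun h => ?_
  rw [Lp.edist_def, eLpNorm_one_eq_lintegral_enorm]
  refine lintegral_congr_ae ?_
  have a1 := Lp.coeFn_compMeasurePreserving (hmem.toLp g) (hT h)
  have a2 := Lp.coeFn_compMeasurePreserving (hmem.toLp g) (hT 0)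
  have a3 := (hT h).quasiMeasurePreserving.ae (hmem.coeFn_toLp)
  have a4 := (hT 0).quasiMeasurePreserving.ae (hmem.coeFn_toLp)
  filter_upwards [a1, a2, a3, a4] with x b1 b2 b3 b4
  rw [Pi.sub_apply, b1, b2, Function.comp_apply, Function.comp_apply, b3, b4]
  have e0 : T 0 x = x := by
    change pmul (-0) x = x
    rw [neg_zero, pmul_zero_left]
  rw [e0]
  rfl

theorem lintegral_enorm_pavg_sub_le (b : ContDiffBump (0 : ι → Heis)) {g : (ι → Heis) → ℝ} {B : ℝ}
    (hgm : Measurable g) (hgB : ∀ x, |g x| ≤ B) {η : ℝ≥0∞}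
    (hη : ∀ h, ‖h‖ < b.rOut → ∫⁻ x, ‖g (pmul (-h) x) - g x‖ₑ ≤ η) :
    ∫⁻ x, ‖pavg b g x - g x‖ₑ ≤ η := by
  have hpm : Measurable fun p : (ι → Heis) × (ι → Heis) => pmul (-p.2) p.1 :=
    (continuous_pmul_uncurry.comp
      (f := fun p : (ι → Heis) × (ι → Heis) => (-p.2, p.1)) (by fun_prop)).measurable
  calc ∫⁻ x, ‖pavg b g x - g x‖ₑ ≤ ∫⁻ x, ∫⁻ h, ‖g (pmul (-h) x) - g x‖ₑ ∂(bumpMeasure b) := by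
        refine lintegral_mono fun x => ?_
        have hi : Integrable (fun h => g (pmul (-h) x)) (bumpMeasure b) :=
          integrable_of_abs_le (hgm.comp (measurePreserving_pmul_neg x).measurable) fun h => hgB _
        have e : pavg b g x - g x = ∫ h, (g (pmul (-h) x) - g x) ∂(bumpMeasure b) := by
          rw [integral_sub hi (integrable_const _), pavg_eq b hgm]
          simp
        rw [e]
        exact enorm_integral_le_lintegral_enorm _
    _ = ∫⁻ h, (∫⁻ x, ‖g (pmul (-h) x) - g x‖ₑ) ∂(bumpMeasure b) :=
        lintegral_lintegral_swap (((hgm.comp hpm).sub (hgm.comp measurable_fst)).enorm.aemeasurable)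
    _ ≤ ∫⁻ _, η ∂(bumpMeasure b) := by
        refine lintegral_mono_ae ?_
        filter_upwards [ae_bumpMeasure b] with h' hh
        exact hη h' hh
    _ = η := by simp

end HeisGibbs

namespace HeisGibbs

/-! ### Functions that are continuously differentiable in each coordinate -/

section Grad

variable {ι : Type*} [DecidableEq ι] {g : (ι → Heis) → ℝ}

/-- The length of the sub-gradient in the coordinate `i`. -/
def pgrad (g : (ι → Heis) → ℝ) (i : ι) (x : ι → Heis) : ℝ :=
  subgradNorm (fun z => g (Function.update x i z)) (x i)

/-- `g` is continuously differentiable in each coordinate. -/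
def SepC1 (g : (ι → Heis) → ℝ) : Prop := ∀ i x, ContDiff ℝ 1 fun z => g (Function.update x i z)

theorem pgrad_nonneg (i : ι) (x : ι → Heis) : 0 ≤ pgrad g i x := Real.sqrt_nonneg _

theorem abs_X_le_subgradNorm (f : Heis → ℝ) (k : Fin 2) (x : Heis) : |X k f x| ≤ subgradNorm f x := by
  rw [subgradNorm, ← Real.sqrt_sq_eq_abs]
  exact Real.sqrt_le_sqrt (Finset.single_le_sum (f := fun k => X k f x ^ 2)
    (fun _ _ => sq_nonneg _) (Finset.mem_univ k))

theorem SepC1.hasDerivAt_shift (hg : SepC1 g) (x : ι → Heis) (j : ι) (k : Fin 2) (t : ℝ) :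
    HasDerivAt (fun s => g (shift x j k s))
      (X k (fun z => g (Function.update x j z)) (flow k t (x j))) t :=
  hasDerivAt_comp_flow (f := fun z => g (Function.update x j z)) k t
    ((hg j x).differentiable one_ne_zero _)

/-- Joint measurability is not automatic for separately C¹ functions; the derivatives are limits of
difference quotients of the measurable g. -/
theorem SepC1.measurable_pgrad (hg : SepC1 g) (hgm : Measurable g) (i : ι) :
    Measurable (pgrad g i) := by
  have h1 : ∀ k : Fin 2, Measurable fun x => X k (fun z => g (Function.update x i z)) (x i) := by
    intro k
    refine measurable_of_tendsto_metrizable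
      (f := fun (n : ℕ) x => (((1 : ℝ) / (n + 1)))⁻¹ • (g (shift x i k (0 + 1 / (n + 1))) - g (shift x i k 0)))
      (fun n => ?_) ?_
    · simp only [smul_eq_mul]
      exact ((hgm.comp (measurable_shift i k _)).sub (hgm.comp (measurable_shift i k _))).const_mul _
    · rw [tendsto_pi_nhds]
      intro x
      have h2 := (hg.hasDerivAt_shift x i k 0).tendsto_slope_zero
      rw [flow_zero] at h2
      refine h2.comp (tendsto_nhdsWithin_iff.2 ⟨tendsto_one_div_add_atTop_nhds_zero_nat, ?_⟩)
      exact Filter.Eventually.of_forall fun n => (by positivity : (0 : ℝ) < 1 / (n + 1)).ne'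
  exact (Finset.measurable_fun_sum _ fun k _ => (h1 k).pow_const 2).sqrt

theorem continuous_X {f : Heis → ℝ} (hf : ContDiff ℝ 1 f) (k : Fin 2) : Continuous (X k f) :=
  (hf.continuous_fderiv one_ne_zero).clm_apply (continuous_frame k)

/-- The fundamental theorem of calculus along a flow line in one coordinate, where continuity of the
derivative is available. -/
theorem SepC1.ofReal_abs_sub_le (hg : SepC1 g) (y : ι → Heis) (j : ι) (k : Fin 2) (t : ℝ) :
    ENNReal.ofReal |g (shift y j k t) - g y|
      ≤ ∫⁻ s in Set.uIoc 0 t, ENNReal.ofReal (pgrad g j (shift y j k s)) := by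
  set a : ℝ → ℝ := fun s => X k (fun z => g (Function.update y j z)) (flow k s (y j)) with ha
  have hac : Continuous a := (continuous_X (hg j y) k).comp (continuous_flow_time k (y j))
  have h1 := intervalIntegral.integral_eq_sub_of_hasDerivAt
    (fun s _ => hg.hasDerivAt_shift y j k s) (hac.intervalIntegrable 0 t)
  rw [shift_zero] at h1
  have e : ∀ r : ℝ, ENNReal.ofReal |r| = ‖r‖ₑ := fun r => by
    rw [← Real.norm_eq_abs, ofReal_norm]
  rw [← h1, ← Real.norm_eq_abs, intervalIntegral.norm_integral_eq_norm_integral_uIoc, Real.norm_eq_abs, e]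
  refine (enorm_integral_le_lintegral_enorm _).trans (lintegral_mono fun s => ?_)
  rw [← e]
  refine ENNReal.ofReal_le_ofReal ?_
  have h2 := abs_X_le_subgradNorm (fun z => g (Function.update y j z)) k (flow k s (y j))
  rw [pgrad]
  simpa [shift] using h2

theorem pgrad_eq_zero {K : Set (ι → Heis)} (hK : IsClosed K) (h : ∀ x, x ∉ K → g x = 0) {x : ι → Heis}
    (hx : x ∉ K) (i : ι) : pgrad g i x = 0 := by
  have hc : Continuous fun z : Heis => Function.update x i z := continuous_const.update i continuous_id
  have h1 : (fun z => g (Function.update x i z)) =ᶠ[nhds (x i)] fun _ => 0 := by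
    have : (fun z => Function.update x i z) ⁻¹' Kᶜ ∈ nhds (x i) :=
      (hK.isOpen_compl.preimage hc).mem_nhds (by simpa using hx)
    filter_upwards [this] with z hz
    exact h _ hz
  have h2 : fderiv ℝ (fun z => g (Function.update x i z)) (x i) = 0 := by
    rw [h1.fderiv_eq]; simp
  simp [pgrad, subgradNorm, X, h2]

end Grad

theorem abs_rpow_sub_rpow_le_mul {q B a b : ℝ} (hq : 1 ≤ q) (ha : 0 ≤ a) (hb : 0 ≤ b) (haB : a ≤ B)
    (hbB : b ≤ B) : |a ^ q - b ^ q| ≤ q * B ^ (q - 1) * |a - b| := by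
  have hB : 0 ≤ B := ha.trans haB
  have := (convex_Icc (0 : ℝ) B).norm_image_sub_le_of_norm_hasDerivWithin_le
    (f := fun x => x ^ q) (f' := fun x => q * x ^ (q - 1)) (C := q * B ^ (q - 1)) (x := b) (y := a)
    (fun x _ => (Real.hasDerivAt_rpow_const (Or.inr hq)).hasDerivWithinAt)
    (fun x hx => by
      rw [Real.norm_eq_abs, abs_of_nonneg (mul_nonneg (by linarith) (Real.rpow_nonneg hx.1 _))]
      exact mul_le_mul_of_nonneg_left (Real.rpow_le_rpow hx.1 hx.2 (by linarith)) (by linarith))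
    ⟨hb, hbB⟩ ⟨ha, haB⟩
  simpa [Real.norm_eq_abs] using this

variable {ι : Type*} [Fintype ι]

/-- The inequality `(LS_q)` on a product with slopes, for Lipschitz functions bounded away from
zero and infinity. -/
def PLSLip [DecidableEq ι] (m : Measure (ι → Heis)) (q C : ℝ) : Prop :=
  ∀ (u : (ι → Heis) → ℝ) (A : ι → (ι → Heis) → ℝ) (L B δ : ℝ), 0 < δ → Measurable u →
    (∀ x, δ ≤ u x) → (∀ x, u x ≤ B) → (∀ x j k t, |u (shift x j k t) - u x| ≤ L * |t|) →
    (∀ j, Measurable (A j)) → (∀ j x, 0 ≤ A j x) → (∀ j x, A j x ≤ B) →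
    (∀ j x k ε, 0 < ε → ∀ᶠ t in nhds (0 : ℝ), |u (shift x j k t) - u x| ≤ (A j x + ε) * |t|) →
    ent m (fun x => u x ^ q) ≤ C * ∑ j, ∫ x, A j x ^ q ∂m

section Compact

variable {W : (ι → Heis) → ℝ} {q C : ℝ}

/-- Compactness makes the comparison of the positive continuous density with its small translates
uniform on K. -/
theorem exists_bump_radius {m : (ι → Heis) → ℝ} (hm : Continuous m) (hm0 : ∀ x, 0 < m x)
    {K : Set (ι → Heis)} (hK : IsCompact K) {g : (ι → Heis) → ℝ} (hg : Integrable g) {η : ℝ≥0∞}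
    (hη : 0 < η) :
    ∃ r > 0, ∀ h : ι → Heis, ‖h‖ < r →
      (∀ y ∈ K, m (pmul h y) ≤ 2 * m y) ∧ ∫⁻ x, ‖g (pmul (-h) x) - g x‖ₑ ≤ η := by
  have h1 : ∀ᶠ h in nhds (0 : ι → Heis), ∀ y ∈ K, m (pmul h y) ≤ 2 * m y := by
    refine hK.eventually_forall_of_forall_eventually fun y _ => ?_
    have hc : Continuous fun p : (ι → Heis) × (ι → Heis) => 2 * m p.2 - m (pmul p.1 p.2) :=
      ((hm.comp continuous_snd).const_mul 2).sub (hm.comp continuous_pmul_uncurry)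
    have hp : 0 < 2 * m y - m (pmul 0 y) := by
      rw [pmul_zero_left]; linarith [hm0 y]
    filter_upwards [(hc.tendsto (0, y)).eventually (lt_mem_nhds hp)] with p hp'
    linarith
  have h2 : ∀ᶠ h in nhds (0 : ι → Heis), ∫⁻ x, ‖g (pmul (-h) x) - g x‖ₑ ≤ η :=
    ((tendsto_lintegral_pmul_sub hg).eventually (gt_mem_nhds hη)).mono fun _ h => le_of_lt h
  obtain ⟨r, hr, hr'⟩ := Metric.eventually_nhds_iff.1 (h1.and h2)
  exact ⟨r, hr, fun h hh => hr' (by simpa using hh)⟩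

/-- The density is bounded below on K, and G ≤ 1 + G^q there. -/
theorem integrable_of_lintegral_rpow {m G : (ι → Heis) → ℝ} (hm : Continuous m) (hm0 : ∀ x, 0 < m x)
    {K : Set (ι → Heis)} (hK : IsCompact K) (hq : 1 ≤ q) (hGm : Measurable G) (hG0 : ∀ x, 0 ≤ G x)
    (hGK : ∀ x, x ∉ K → G x = 0)
    (hfin : ∫⁻ x, ENNReal.ofReal (m x) * ENNReal.ofReal (G x) ^ q ≠ ∞) : Integrable G := by
  obtain ⟨m₀, hm₀, hle⟩ : ∃ m₀ > 0, ∀ x ∈ K, m₀ ≤ m x := by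
    rcases K.eq_empty_or_nonempty with rfl | hne
    · exact ⟨1, one_pos, by simp⟩
    · obtain ⟨x₀, -, hx₀⟩ := hK.exists_isMinOn hne hm.continuousOn
      exact ⟨m x₀, hm0 x₀, fun x hx => hx₀ hx⟩
  refine ⟨hGm.aestronglyMeasurable, ?_⟩
  rw [hasFiniteIntegral_iff_ofReal (Filter.Eventually.of_forall hG0)]
  have hp : ∀ x, ENNReal.ofReal (G x) ≤ K.indicator 1 x
      + (ENNReal.ofReal m₀)⁻¹ * (ENNReal.ofReal (m x) * ENNReal.ofReal (G x) ^ q) := by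
    intro x
    by_cases hx : x ∈ K
    · rw [Set.indicator_of_mem hx, Pi.one_apply, ← mul_assoc]
      have h1 : 1 ≤ (ENNReal.ofReal m₀)⁻¹ * ENNReal.ofReal (m x) := by
        rw [← ENNReal.inv_mul_cancel (ENNReal.ofReal_pos.2 hm₀).ne' ENNReal.ofReal_ne_top]
        gcongr
        exact hle x hx
      have h2 : ENNReal.ofReal (G x) ≤ 1 + ENNReal.ofReal (G x) ^ q := by
        rcases le_total (ENNReal.ofReal (G x)) 1 with h3 | h3
        · exact h3.trans le_self_add
        · refine le_trans ?_ le_add_self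
          calc ENNReal.ofReal (G x) = ENNReal.ofReal (G x) ^ (1 : ℝ) := (ENNReal.rpow_one _).symm
            _ ≤ _ := ENNReal.rpow_le_rpow_of_exponent_le h3 hq
      calc _ ≤ 1 + 1 * ENNReal.ofReal (G x) ^ q := by rwa [one_mul]
        _ ≤ _ := by gcongr
    · rw [hGK x hx]; simp
  have hKm : MeasurableSet K := hK.measurableSet
  calc _ ≤ _ := lintegral_mono hp
    _ = volume K + (ENNReal.ofReal m₀)⁻¹
        * ∫⁻ x, ENNReal.ofReal (m x) * ENNReal.ofReal (G x) ^ q := by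
        have hmG : Measurable fun x => ENNReal.ofReal (m x) * ENNReal.ofReal (G x) ^ q :=
          hm.measurable.ennreal_ofReal.mul (hGm.ennreal_ofReal.pow_const q)
        rw [lintegral_add_left (measurable_one.indicator hKm), lintegral_indicator_one hKm,
          lintegral_const_mul _ hmG]
    _ < ∞ := by
        refine ENNReal.add_lt_top.2 ⟨hK.measure_lt_top, ENNReal.mul_lt_top ?_ hfin.lt_top⟩
        rw [ENNReal.inv_lt_top]
        exact ENNReal.ofReal_pos.2 hm₀

/-- Mollify g and add 1/(n+1) to its absolute value to obtain a lower bound. Jensen's inequality and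
the density comparison m(hy) ≤ 2m(y) double the constant. The mollifications converge in L¹, hence
almost everywhere along a subsequence, and the entropy of uniformly bounded functions is continuous
under that convergence. -/
theorem PLSLip.of_compact [DecidableEq ι] (hW : Continuous W) (hi : Integrable fun x => Real.exp (W x))
    (hq : 1 < q) (hC : 0 < C) (h : PLSLip (volume.tilted W) q C) {g : (ι → Heis) → ℝ} {B r : ℝ}
    (hgm : Measurable g) (hgB : ∀ x, |g x| ≤ B) (hg : SepC1 g)
    (hgK : ∀ x, x ∉ Metric.closedBall (0 : ι → Heis) r → g x = 0) :
    ENNReal.ofReal (ent (volume.tilted W) fun x => |g x| ^ q)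
      ≤ ENNReal.ofReal (2 * C) * ∑ j, ∫⁻ x, ENNReal.ofReal (pgrad g j x) ^ q ∂(volume.tilted W) := by
  have hq0 : 0 < q := by linarith
  have hprob : IsProbabilityMeasure (volume.tilted W) := isProbabilityMeasure_tilted hi
  set Z := ∫ x, Real.exp (W x) with hZ
  have hZ0 : 0 < Z := integral_exp_pos hi
  set m : (ι → Heis) → ℝ := fun x => Real.exp (W x) / Z with hm
  have hmc : Continuous m := (Real.continuous_exp.comp hW).div_const _
  have hm0 : ∀ x, 0 < m x := fun x => div_pos (Real.exp_pos _) hZ0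
  have hlin : ∀ f : (ι → Heis) → ℝ≥0∞, ∫⁻ x, f x ∂(volume.tilted W)
      = ∫⁻ x, ENNReal.ofReal (m x) * f x := fun f => lintegral_tilted W f
  set T := ∑ j, ∫⁻ x, ENNReal.ofReal (pgrad g j x) ^ q ∂(volume.tilted W) with hT
  by_cases hTtop : T = ∞
  · rw [hTtop, ENNReal.mul_top (ENNReal.ofReal_pos.2 (by positivity)).ne']
    exact le_top
  have hTj : ∀ j, ∫⁻ x, ENNReal.ofReal (m x) * ENNReal.ofReal (pgrad g j x) ^ q ≠ ∞ := fun j hj => by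
    apply hTtop
    rw [hT, ENNReal.sum_eq_top]
    exact ⟨j, Finset.mem_univ j, by rw [hlin]; exact hj⟩
  set K := Metric.closedBall (0 : ι → Heis) r with hK
  have hKc : IsCompact K := isCompact_closedBall 0 r
  have hGm := hg.measurable_pgrad hgm
  have hGK : ∀ j x, x ∉ K → pgrad g j x = 0 := fun j x hx => pgrad_eq_zero hKc.isClosed hgK hx j
  have hGi : ∀ j, Integrable (pgrad g j) := fun j =>
    integrable_of_lintegral_rpow hmc hm0 hKc hq.le (hGm j) (pgrad_nonneg j) (hGK j) (hTj j)
  have hB0 : 0 ≤ B := (abs_nonneg _).trans (hgB 0)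
  have hgi : Integrable g := by
    have h1 : IntegrableOn g K := Measure.integrableOn_of_bounded hKc.measure_lt_top.ne
      hgm.aestronglyMeasurable (M := B) (Filter.Eventually.of_forall hgB)
    exact (integrableOn_iff_integrable_of_support_subset fun x hx => by
      by_contra hxK; exact hx (hgK x hxK)).1 h1
  have hstep : ∀ n : ℕ, ∃ u : (ι → Heis) → ℝ, Measurable u ∧ (∀ x, |u x| ≤ B) ∧
      ∫⁻ x, ‖u x - g x‖ₑ ≤ ENNReal.ofReal (1 / (n + 1)) ∧
      ENNReal.ofReal (ent (volume.tilted W) fun x => (|u x| + 1 / (n + 1)) ^ q)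
        ≤ ENNReal.ofReal (2 * C) * T := by
    intro n
    have hn : (0 : ℝ) < 1 / (n + 1) := by positivity
    obtain ⟨ρ, hρ, hρ'⟩ := exists_bump_radius hmc hm0 hKc hgi (ENNReal.ofReal_pos.2 hn)
    let b : ContDiffBump (0 : ι → Heis) := ⟨ρ / 2, ρ, by positivity, by linarith⟩
    have huB : ∀ x, |pavg b g x| ≤ B := fun x => by
      rw [pavg_eq b hgm]; exact abs_integral_le_of_abs_le fun h => hgB _
    have hum : Measurable (pavg b g) := (continuous_pavg b hgi).measurable
    refine ⟨pavg b g, hum, huB,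
      lintegral_enorm_pavg_sub_le b hgm hgB fun h hh => (hρ' h hh).2, ?_⟩
    choose D hD using fun j => exists_pavg_bound b (hGi j)
    have hD0 : ∀ j, 0 ≤ D j := fun j => (pavg_nonneg b (pgrad_nonneg j) 0).trans (hD j 0)
    have hDs : ∀ j, D j ≤ ∑ j, D j := fun j =>
      Finset.single_le_sum (fun j _ => hD0 j) (Finset.mem_univ j)
    have hDs0 : 0 ≤ ∑ j, D j := Finset.sum_nonneg fun j _ => hD0 j
    have habs : ∀ x y : ι → Heis, |(|pavg b g x| + 1 / ((n : ℝ) + 1)) - (|pavg b g y| + 1 / (n + 1))|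
        ≤ |pavg b g x - pavg b g y| := fun x y => by
      rw [add_sub_add_right_eq_sub]; exact abs_abs_sub_abs_le _ _
    have hAm : ∀ j, Measurable (pavg b (pgrad g j)) := fun j => (continuous_pavg b (hGi j)).measurable
    have hA0 : ∀ j x, 0 ≤ pavg b (pgrad g j) x := fun j => pavg_nonneg b (pgrad_nonneg j)
    have hmain := h (fun x => |pavg b g x| + 1 / (n + 1)) (fun j => pavg b (pgrad g j)) (∑ j, D j)
      (B + 1 / (n + 1) + ∑ j, D j) (1 / (n + 1)) hn (hum.abs.add_const _)
      (fun x => by linarith [abs_nonneg (pavg b g x)]) (fun x => by linarith [huB x])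
      (fun x j k t => (habs _ _).trans (abs_pavg_shift_sub_le b hgm hgB (hGm j) (hGi j)
        (pgrad_nonneg j) (fun y => hg.ofReal_abs_sub_le y j) (fun x => (hD j x).trans (hDs j)) x k t))
      hAm hA0 (fun j x => by linarith [hD j x, hDs j])
      (fun j x k ε hε => (pavg_slope b hgm hgB (hGm j) (hGi j) (pgrad_nonneg j)
        (fun y => hg.ofReal_abs_sub_le y j) x k hε).mono fun t ht => (habs _ _).trans ht)
    refine (ENNReal.ofReal_le_ofReal hmain).trans ?_
    rw [ENNReal.ofReal_mul hC.le, ENNReal.ofReal_mul two_pos.le, ENNReal.ofReal_ofNat,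
      mul_comm (2 : ℝ≥0∞), mul_assoc, hT, Finset.mul_sum,
      ENNReal.ofReal_sum_of_nonneg fun j _ => integral_nonneg fun x => Real.rpow_nonneg (hA0 j x) q]
    gcongr with j
    rw [ofReal_integral_eq_lintegral_ofReal (integrable_rpow_of_bounds hq0.le (hAm j) (hA0 j) (hD j))
      (Filter.Eventually.of_forall fun x => Real.rpow_nonneg (hA0 j x) q), hlin, hlin]
    simp_rw [← ENNReal.ofReal_rpow_of_nonneg (hA0 j _) hq0.le]
    refine lintegral_pavg_rpow_le b hq (hGm j) (hGi j) (pgrad_nonneg j) hmc.measurable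
      fun h y hh hy => (hρ' h hh).1 y ?_
    by_contra hyK
    exact hy (hGK j y hyK)
  choose u hum huB hu1 hu2 using hstep
  have hconv : TendstoInMeasure volume u Filter.atTop g := by
    refine tendstoInMeasure_of_tendsto_eLpNorm one_ne_zero (fun n => (hum n).aestronglyMeasurable)
      hgm.aestronglyMeasurable ?_
    have h0 : Filter.Tendsto (fun n : ℕ => ENNReal.ofReal (1 / ((n : ℝ) + 1))) Filter.atTop (nhds 0) := by
      have := ENNReal.tendsto_ofReal (tendsto_one_div_add_atTop_nhds_zero_nat (𝕜 := ℝ))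
      rwa [ENNReal.ofReal_zero] at this
    refine tendsto_of_tendsto_of_tendsto_of_le_of_le tendsto_const_nhds h0 (fun _ => zero_le) fun n => ?_
    rw [eLpNorm_one_eq_lintegral_enorm]
    exact hu1 n
  obtain ⟨ns, hns, hae⟩ := hconv.exists_seq_tendsto_ae
  have hae' : ∀ᵐ x ∂(volume.tilted W), Filter.Tendsto
      (fun i => (|u (ns i) x| + 1 / ((ns i : ℝ) + 1)) ^ q) Filter.atTop (nhds (|g x| ^ q)) := by
    refine (tilted_absolutelyContinuous volume W).ae_le ?_
    filter_upwards [hae] with x hx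
    have h1 : Filter.Tendsto (fun i => 1 / ((ns i : ℝ) + 1)) Filter.atTop (nhds 0) :=
      (tendsto_one_div_add_atTop_nhds_zero_nat (𝕜 := ℝ)).comp hns.tendsto_atTop
    have h2 := (hx.abs.add h1).rpow_const (p := q) (Or.inr hq0.le)
    rwa [add_zero] at h2
  have hn0 : ∀ n : ℕ, (0 : ℝ) ≤ 1 / ((n : ℝ) + 1) := fun n => by positivity
  have hn1 : ∀ n : ℕ, 1 / ((n : ℝ) + 1) ≤ 1 := fun n => by
    rw [div_le_one (by positivity)]; linarith [Nat.cast_nonneg (α := ℝ) n]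
  have hent := ent_tendsto (μ := volume.tilted W)
    (F := fun i x => (|u (ns i) x| + 1 / ((ns i : ℝ) + 1)) ^ q) (B := (B + 1) ^ q)
    (fun i => ((hum _).abs.add_const _).pow_const q)
    (fun i x => Real.rpow_nonneg (add_nonneg (abs_nonneg _) (hn0 _)) q)
    (fun i x => Real.rpow_le_rpow (add_nonneg (abs_nonneg _) (hn0 _))
      (add_le_add (huB _ x) (hn1 _)) hq0.le) hae'
  exact le_of_tendsto' (ENNReal.tendsto_ofReal hent) fun i => hu2 (ns i)

end Compact

end HeisGibbs

namespace HeisGibbs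

/-! ### Cutoff functions with small sub-gradients -/

/-- A proper smooth function with bounded sub-gradient. -/
def logGauge (x : Heis) : ℝ := Real.log (1 + x 0 ^ 2 + x 1 ^ 2 + x 2 ^ 2)

/-- Along a flow the derivative of the argument of the logarithm has the form 2a ± bc, while the
argument itself is 1 + a² + b² + c² in the same quantities and so dominates it. -/
theorem hLip_logGauge : HLip 1 logGauge := by
  intro x k t
  have key : ∀ s, ∃ d, HasDerivAt (fun s => logGauge (flow k s x)) d s ∧ ‖d‖ ≤ 1 := by
    intro s
    by_cases hk : k = 0
    · subst hk
      have h1 : HasDerivAt (fun s : ℝ => 1 + (x 0 + s) ^ 2 + x 1 ^ 2 + (x 2 - s * x 1 / 2) ^ 2)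
          (2 * (x 0 + s) - x 1 * (x 2 - s * x 1 / 2)) s := by
        have a1 : HasDerivAt (fun s : ℝ => x 0 + s) 1 s := (hasDerivAt_id s).const_add _
        have a2 : HasDerivAt (fun s : ℝ => x 2 - s * x 1 / 2) (-(1 * x 1 / 2)) s :=
          (((hasDerivAt_id s).mul_const (x 1)).div_const 2).const_sub _
        have a3 := (((a1.pow 2).const_add 1).add_const (x 1 ^ 2)).add (a2.pow 2)
        refine a3.congr_deriv ?_
        push_cast
        ring
      have hpos : 0 < 1 + (x 0 + s) ^ 2 + x 1 ^ 2 + (x 2 - s * x 1 / 2) ^ 2 := by positivity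
      have h2 := h1.log hpos.ne'
      refine ⟨_, by simpa [logGauge, flow_coord] using h2, ?_⟩
      rw [Real.norm_eq_abs, abs_div, abs_of_pos hpos, div_le_one hpos, abs_le]
      constructor <;> nlinarith [sq_nonneg (x 0 + s - 1), sq_nonneg (x 0 + s + 1),
        sq_nonneg (x 1 - (x 2 - s * x 1 / 2)), sq_nonneg (x 1 + (x 2 - s * x 1 / 2)),
        sq_nonneg (x 1), sq_nonneg (x 2 - s * x 1 / 2)]
    · have hk1 : k = 1 := by omega
      subst hk1
      have h1 : HasDerivAt (fun s : ℝ => 1 + x 0 ^ 2 + (x 1 + s) ^ 2 + (x 2 + s * x 0 / 2) ^ 2)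
          (2 * (x 1 + s) + x 0 * (x 2 + s * x 0 / 2)) s := by
        have a1 : HasDerivAt (fun s : ℝ => x 1 + s) 1 s := (hasDerivAt_id s).const_add _
        have a2 : HasDerivAt (fun s : ℝ => x 2 + s * x 0 / 2) (1 * x 0 / 2) s :=
          (((hasDerivAt_id s).mul_const (x 0)).div_const 2).const_add _
        have a3 := ((a1.pow 2).const_add (1 + x 0 ^ 2)).add (a2.pow 2)
        refine a3.congr_deriv ?_
        push_cast
        ring
      have hpos : 0 < 1 + x 0 ^ 2 + (x 1 + s) ^ 2 + (x 2 + s * x 0 / 2) ^ 2 := by positivity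
      have h2 := h1.log hpos.ne'
      refine ⟨_, by simpa [logGauge, flow_coord] using h2, ?_⟩
      rw [Real.norm_eq_abs, abs_div, abs_of_pos hpos, div_le_one hpos, abs_le]
      constructor <;> nlinarith [sq_nonneg (x 1 + s - 1), sq_nonneg (x 1 + s + 1),
        sq_nonneg (x 0 - (x 2 + s * x 0 / 2)), sq_nonneg (x 0 + (x 2 + s * x 0 / 2)),
        sq_nonneg (x 0), sq_nonneg (x 2 + s * x 0 / 2)]
  choose d hd hd1 using key
  have := convex_univ.norm_image_sub_le_of_norm_hasDerivWithin_le
    (f := fun s => logGauge (flow k s x)) (f' := d) (C := 1) (x := 0) (y := t)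
    (fun s _ => (hd s).hasDerivWithinAt) (fun s _ => hd1 s) trivial trivial
  simpa using this

theorem contDiff_logGauge : ContDiff ℝ 1 logGauge := by
  refine ContDiff.log (by fun_prop) fun x => ?_
  positivity

theorem le_logGauge {R : ℝ} {x : Heis} (h : Real.exp R < ‖x‖) : 2 * R ≤ logGauge x := by
  have h0 := Real.exp_pos R
  obtain ⟨i, hi⟩ : ∃ i, Real.exp R < ‖x i‖ := by
    by_contra hne
    push Not at hne
    exact absurd ((pi_norm_le_iff_of_nonneg h0.le).2 hne) (not_le.2 h)
  rw [logGauge, Real.le_log_iff_exp_le (by positivity)]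
  have h1 : Real.exp (2 * R) = Real.exp R ^ 2 := by rw [← Real.exp_nat_mul]; norm_num
  have h2 : Real.exp R ^ 2 ≤ x i ^ 2 := by
    rw [← sq_abs (x i)]
    exact pow_le_pow_left₀ h0.le hi.le 2
  rw [h1]
  refine h2.trans ?_
  fin_cases i <;> simp <;> nlinarith [sq_nonneg (x 0), sq_nonneg (x 1), sq_nonneg (x 2)]

theorem exists_lipschitz_smoothTransition :
    ∃ K : ℝ, 0 ≤ K ∧ ∀ a b, |Real.smoothTransition a - Real.smoothTransition b| ≤ K * |a - b| := by
  have hc : ContDiff ℝ ((1 : ℕ∞) : WithTop ℕ∞) Real.smoothTransition := Real.smoothTransition.contDiff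
  have hd : Continuous (deriv Real.smoothTransition) := hc.continuous_deriv le_rfl
  obtain ⟨K, hK⟩ := (isCompact_Icc (a := (0 : ℝ)) (b := 1)).exists_bound_of_continuousOn hd.continuousOn
  have hbound : ∀ x, ‖deriv Real.smoothTransition x‖ ≤ max K 0 := by
    intro x
    rcases lt_or_ge x 0 with h0 | h0
    · have : Real.smoothTransition =ᶠ[nhds x] fun _ => 0 := by
        filter_upwards [gt_mem_nhds h0] with y hy
        exact Real.smoothTransition.zero_of_nonpos hy.le
      rw [this.deriv_eq]; simp
    · rcases le_or_gt x 1 with h1 | h1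
      · exact (hK x ⟨h0, h1⟩).trans (le_max_left _ _)
      · have : Real.smoothTransition =ᶠ[nhds x] fun _ => 1 := by
          filter_upwards [lt_mem_nhds h1] with y hy
          exact Real.smoothTransition.one_of_one_le hy.le
        rw [this.deriv_eq]; simp
  refine ⟨max K 0, le_max_right _ _, fun a b => ?_⟩
  have := convex_univ.norm_image_sub_le_of_norm_deriv_le (𝕜 := ℝ) (f := Real.smoothTransition)
    (C := max K 0) (x := b) (y := a)
    (fun x _ => (hc.differentiable (by simp)).differentiableAt) (fun x _ => hbound x) trivial trivial
  simpa [Real.norm_eq_abs] using this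

variable {ι : Type*} [Fintype ι]

/-- A cutoff function equal to one on a large ball. -/
def cutoff (R : ℝ) (x : ι → Heis) : ℝ := ∏ i, Real.smoothTransition (2 - logGauge (x i) / R)

theorem contDiff_cutoff (R : ℝ) : ContDiff ℝ 1 (cutoff (ι := ι) R) := by
  unfold cutoff
  refine contDiff_prod fun i _ => ?_
  have h1 : ContDiff ℝ ((1 : ℕ∞) : WithTop ℕ∞) Real.smoothTransition := Real.smoothTransition.contDiff
  have h2 : ContDiff ℝ 1 fun x : ι → Heis => logGauge (x i) :=
    contDiff_logGauge.comp (contDiff_apply ℝ Heis i)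
  exact h1.comp (contDiff_const.sub (h2.div_const R))

theorem cutoff_nonneg (R : ℝ) (x : ι → Heis) : 0 ≤ cutoff R x :=
  Finset.prod_nonneg fun _ _ => Real.smoothTransition.nonneg _

theorem cutoff_le_one (R : ℝ) (x : ι → Heis) : cutoff R x ≤ 1 :=
  Finset.prod_le_one (fun _ _ => Real.smoothTransition.nonneg _) fun _ _ =>
    Real.smoothTransition.le_one _

theorem cutoff_eq_zero {R : ℝ} (hR : 0 < R) {x : ι → Heis}
    (hx : x ∉ Metric.closedBall (0 : ι → Heis) (Real.exp R)) : cutoff R x = 0 := by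
  rw [mem_closedBall_zero_iff, pi_norm_le_iff_of_nonneg (Real.exp_pos R).le, not_forall] at hx
  obtain ⟨i, hi⟩ := hx
  refine Finset.prod_eq_zero (Finset.mem_univ i) (Real.smoothTransition.zero_of_nonpos ?_)
  have := le_logGauge (not_le.1 hi)
  have h2 : 2 ≤ logGauge (x i) / R := by rwa [le_div_iff₀ hR]
  linarith

theorem tendsto_cutoff (x : ι → Heis) :
    Filter.Tendsto (fun n : ℕ => cutoff ((n : ℝ) + 1) x) Filter.atTop (nhds 1) := by
  have h1 : ∀ i, ∀ᶠ n : ℕ in Filter.atTop,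
      Real.smoothTransition (2 - logGauge (x i) / ((n : ℝ) + 1)) = 1 := fun i => by
    obtain ⟨n₀, hn₀⟩ := exists_nat_ge (logGauge (x i))
    filter_upwards [Filter.eventually_ge_atTop n₀] with n hn
    refine Real.smoothTransition.one_of_one_le ?_
    have : logGauge (x i) / ((n : ℝ) + 1) ≤ 1 := by
      rw [div_le_one (by positivity)]
      have : (n₀ : ℝ) ≤ n := by exact_mod_cast hn
      linarith
    linarith
  refine tendsto_const_nhds.congr' ?_
  filter_upwards [Filter.eventually_all.2 h1] with n hn
  exact (Finset.prod_eq_one fun i _ => hn i).symm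

/-- Moving one coordinate changes one factor, and the other factors lie in [0,1]. The logarithmic
gauge has bounded sub-gradient although it is proper, so rescaling by R makes the sub-gradient of
the cutoff O(1/R). -/
theorem abs_cutoff_sub_le [DecidableEq ι] {K : ℝ}
    (hK : ∀ a b, |Real.smoothTransition a - Real.smoothTransition b| ≤ K * |a - b|) (hK0 : 0 ≤ K)
    {R : ℝ} (hR : 0 < R) (x : ι → Heis) (j : ι) (k : Fin 2) (t : ℝ) :
    |cutoff R (shift x j k t) - cutoff R x| ≤ K / R * |t| := by
  have e : ∀ y : ι → Heis, cutoff R y = Real.smoothTransition (2 - logGauge (y j) / R)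
      * ∏ i ∈ Finset.univ.erase j, Real.smoothTransition (2 - logGauge (y i) / R) := fun y =>
    (Finset.mul_prod_erase _ _ (Finset.mem_univ j)).symm
  have e2 : ∏ i ∈ Finset.univ.erase j, Real.smoothTransition (2 - logGauge (shift x j k t i) / R)
      = ∏ i ∈ Finset.univ.erase j, Real.smoothTransition (2 - logGauge (x i) / R) :=
    Finset.prod_congr rfl fun i hi => by
      rw [shift, Function.update_of_ne (Finset.ne_of_mem_erase hi)]
  set P := ∏ i ∈ Finset.univ.erase j, Real.smoothTransition (2 - logGauge (x i) / R) with hP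
  have hP0 : 0 ≤ P := Finset.prod_nonneg fun _ _ => Real.smoothTransition.nonneg _
  have hP1 : P ≤ 1 := Finset.prod_le_one (fun _ _ => Real.smoothTransition.nonneg _) fun _ _ =>
    Real.smoothTransition.le_one _
  rw [e, e x, e2, ← sub_mul, abs_mul, abs_of_nonneg hP0]
  refine (mul_le_of_le_one_right (abs_nonneg _) hP1).trans ((hK _ _).trans ?_)
  have h1 := hLip_logGauge (x j) k t
  rw [one_mul] at h1
  have e3 : |2 - logGauge (shift x j k t j) / R - (2 - logGauge (x j) / R)|
      = |logGauge (flow k t (x j)) - logGauge (x j)| / R := by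
    rw [shift, Function.update_self, ← abs_of_pos hR, ← abs_div, abs_of_pos hR, ← abs_neg]
    congr 1
    ring
  rw [e3, div_mul_eq_mul_div, ← mul_div_assoc]
  gcongr

theorem subgradNorm_mul_le {f χ : Heis → ℝ} {x : Heis} (hf : DifferentiableAt ℝ f x)
    (hχ : DifferentiableAt ℝ χ x) {B β : ℝ} (hB : |f x| ≤ B) (hχ1 : |χ x| ≤ 1)
    (hβ : ∀ k, |X k χ x| ≤ β) :
    subgradNorm (fun z => f z * χ z) x ≤ subgradNorm f x + 2 * (B * β) := by
  have e : ∀ k, X k (fun z => f z * χ z) x = f x * X k χ x + χ x * X k f x := fun k => by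
    simp only [X]
    rw [fderiv_fun_mul hf hχ]
    simp
  have hB0 : 0 ≤ B := (abs_nonneg _).trans hB
  have hβ0 : 0 ≤ β := (abs_nonneg _).trans (hβ 0)
  have hb : ∀ k, |X k (fun z => f z * χ z) x| ≤ B * β + |X k f x| := fun k => by
    rw [e k]
    refine (abs_add_le _ _).trans (add_le_add ?_ ?_)
    · rw [abs_mul]; exact mul_le_mul hB (hβ k) (abs_nonneg _) hB0
    · rw [abs_mul]; exact mul_le_of_le_one_left (abs_nonneg _) hχ1
  have hS := Real.sqrt_nonneg (∑ k, X k f x ^ 2)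
  have hs : √(∑ k, X k f x ^ 2) ^ 2 = ∑ k, X k f x ^ 2 :=
    Real.sq_sqrt (Finset.sum_nonneg fun k _ => sq_nonneg _)
  have h0 := abs_X_le_subgradNorm f 0 x
  have h1 := abs_X_le_subgradNorm f 1 x
  have hBβ := mul_nonneg hB0 hβ0
  rw [subgradNorm] at h0 h1
  rw [subgradNorm, subgradNorm, Real.sqrt_le_left (by positivity)]
  have s0 := pow_le_pow_left₀ (abs_nonneg _) (hb 0) 2
  have s1 := pow_le_pow_left₀ (abs_nonneg _) (hb 1) 2
  rw [sq_abs] at s0 s1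
  simp only [Fin.sum_univ_two] at hs hS h0 h1 ⊢
  rw [add_sq, sq_abs] at s0 s1
  set S := √(X 0 f x ^ 2 + X 1 f x ^ 2)
  nlinarith [mul_le_mul_of_nonneg_left h0 hBβ, mul_le_mul_of_nonneg_left h1 hBβ]

/-- The inequality `(LS_q)` for bounded functions that are continuously differentiable in each
coordinate. -/
theorem PLSLip.of_bounded [DecidableEq ι] {W : (ι → Heis) → ℝ} {q C : ℝ} (hW : Continuous W)
    (hi : Integrable fun x => Real.exp (W x)) (hq₁ : 1 < q) (hq₂ : q ≤ 2) (hC : 0 < C)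
    (h : PLSLip (volume.tilted W) q C) {g : (ι → Heis) → ℝ} {B : ℝ}
    (hgm : Measurable g) (hgB : ∀ x, |g x| ≤ B) (hg : SepC1 g) :
    ENNReal.ofReal (ent (volume.tilted W) fun x => |g x| ^ q)
      ≤ ENNReal.ofReal (4 * C) * ∑ j, ∫⁻ x, ENNReal.ofReal (pgrad g j x) ^ q ∂(volume.tilted W) := by
  have hq0 : 0 < q := by linarith
  have hprob : IsProbabilityMeasure (volume.tilted W) := isProbabilityMeasure_tilted hi
  obtain ⟨K, hK0, hK⟩ := exists_lipschitz_smoothTransition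
  have hB0 : 0 ≤ B := (abs_nonneg _).trans (hgB 0)
  set u : ℕ → (ι → Heis) → ℝ := fun n x => g x * cutoff ((n : ℝ) + 1) x with hu
  have hχm : ∀ n : ℕ, Measurable (cutoff (ι := ι) ((n : ℝ) + 1)) := fun n =>
    (contDiff_cutoff _).continuous.measurable
  have hχabs : ∀ (n : ℕ) (x : ι → Heis), |cutoff ((n : ℝ) + 1) x| ≤ 1 := fun n x => by
    rw [abs_of_nonneg (cutoff_nonneg _ x)]; exact cutoff_le_one _ x
  have hum : ∀ n, Measurable (u n) := fun n => hgm.mul (hχm n)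
  have huB : ∀ n x, |u n x| ≤ B := fun n x => by
    rw [hu, abs_mul]
    exact (mul_le_of_le_one_right (abs_nonneg _) (hχabs n x)).trans (hgB x)
  have hχs : ∀ (n : ℕ) j (x : ι → Heis), ContDiff ℝ 1 fun z => cutoff ((n : ℝ) + 1) (Function.update x j z) :=
    fun n j x => (contDiff_cutoff _).comp (contDiff_update 1 x j)
  have hus : ∀ n, SepC1 (u n) := fun n j x => (hg j x).mul (hχs n j x)
  have hn : ∀ n : ℕ, (0 : ℝ) < n + 1 := fun n => by positivity
  set β : ℕ → ℝ := fun n => 2 * (B * (K / ((n : ℝ) + 1))) with hβ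
  have hβ0 : ∀ n, 0 ≤ β n := fun n => by
    have := hn n
    simp only [hβ]; positivity
  have hgrad : ∀ n j x, pgrad (u n) j x ≤ pgrad g j x + β n := by
    intro n j x
    refine subgradNorm_mul_le ((hg j x).differentiable one_ne_zero _)
      ((hχs n j x).differentiable one_ne_zero _) (hgB _) (hχabs n _) fun k => ?_
    have hsep : SepC1 (cutoff (ι := ι) ((n : ℝ) + 1)) := hχs n
    have hd := hsep.hasDerivAt_shift x j k 0
    rw [flow_zero] at hd
    have := hd.le_of_lipschitz (C := ⟨K / ((n : ℝ) + 1), div_nonneg hK0 (hn n).le⟩)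
      (LipschitzWith.of_dist_le_mul fun s t => by
        rw [Real.dist_eq, Real.dist_eq]
        have e : shift x j k s = shift (shift x j k t) j k (s - t) := by
          rw [shift_shift]; congr 1; ring
        rw [e]
        exact abs_cutoff_sub_le hK hK0 (hn n) _ j k (s - t))
    exact this
  have hlim : Filter.Tendsto (fun n => ent (volume.tilted W) fun x => |u n x| ^ q) Filter.atTop
      (nhds (ent (volume.tilted W) fun x => |g x| ^ q)) := by
    refine ent_tendsto (B := B ^ q) (fun n => (hum n).abs.pow_const q)
      (fun n x => Real.rpow_nonneg (abs_nonneg _) q)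
      (fun n x => Real.rpow_le_rpow (abs_nonneg _) (huB n x) hq0.le)
      (Filter.Eventually.of_forall fun x => ?_)
    have h1 := (tendsto_cutoff x).const_mul (g x)
    rw [mul_one] at h1
    exact h1.abs.rpow_const (Or.inr hq0.le)
  set T := ∑ j, ∫⁻ x, ENNReal.ofReal (pgrad g j x) ^ q ∂(volume.tilted W) with hT
  -- The product rule adds the constant β_n to each slope, and (x+y)^q ≤ 2(x^q + y^q) for q ≤ 2.
  -- This doubles the constant 2C, while the error, proportional to the number of coordinates,
  -- vanishes with β_n.
  have hstep : ∀ n, ENNReal.ofReal (ent (volume.tilted W) fun x => |u n x| ^ q)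
      ≤ ENNReal.ofReal (2 * C) * (2 * T + Fintype.card ι * (2 * ENNReal.ofReal (β n) ^ q)) := by
    intro n
    refine (h.of_compact hW hi hq₁ hC (hum n) (huB n) (hus n) (r := Real.exp ((n : ℝ) + 1))
      fun x hx => by rw [hu]; simp only; rw [cutoff_eq_zero (hn n) hx, mul_zero]).trans ?_
    gcongr
    have hj : ∀ j, ∫⁻ x, ENNReal.ofReal (pgrad (u n) j x) ^ q ∂(volume.tilted W)
        ≤ 2 * ∫⁻ x, ENNReal.ofReal (pgrad g j x) ^ q ∂(volume.tilted W)
          + 2 * ENNReal.ofReal (β n) ^ q := by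
      intro j
      have hm := ((hg.measurable_pgrad hgm j).ennreal_ofReal.pow_const q)
      calc _ ≤ ∫⁻ x, (2 * ENNReal.ofReal (pgrad g j x) ^ q + 2 * ENNReal.ofReal (β n) ^ q)
            ∂(volume.tilted W) := by
            refine lintegral_mono fun x => ?_
            calc ENNReal.ofReal (pgrad (u n) j x) ^ q
                ≤ (ENNReal.ofReal (pgrad g j x) + ENNReal.ofReal (β n)) ^ q := by
                  rw [← ENNReal.ofReal_add (pgrad_nonneg j x) (hβ0 n)]
                  exact ENNReal.rpow_le_rpow (ENNReal.ofReal_le_ofReal (hgrad n j x)) hq0.le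
              _ ≤ 2 ^ (q - 1) * (ENNReal.ofReal (pgrad g j x) ^ q + ENNReal.ofReal (β n) ^ q) :=
                  ENNReal.rpow_add_le_mul_rpow_add_rpow _ _ hq₁.le
              _ ≤ 2 * (ENNReal.ofReal (pgrad g j x) ^ q + ENNReal.ofReal (β n) ^ q) := by
                  gcongr
                  calc (2 : ℝ≥0∞) ^ (q - 1) ≤ 2 ^ (1 : ℝ) :=
                        ENNReal.rpow_le_rpow_of_exponent_le (by norm_num) (by linarith)
                    _ = 2 := ENNReal.rpow_one 2
              _ = _ := mul_add _ _ _
        _ = _ := by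
            rw [lintegral_add_left (hm.const_mul 2), lintegral_const_mul _ hm]
            simp
    calc _ ≤ _ := Finset.sum_le_sum fun j _ => hj j
      _ = _ := by
        rw [Finset.sum_add_distrib, ← Finset.mul_sum, Finset.sum_const, Finset.card_univ, nsmul_eq_mul]
  have hβt : Filter.Tendsto (fun n => ENNReal.ofReal (2 * C)
      * (2 * T + Fintype.card ι * (2 * ENNReal.ofReal (β n) ^ q))) Filter.atTop
      (nhds (ENNReal.ofReal (2 * C) * (2 * T + Fintype.card ι * (2 * 0)))) := by
    have h1 : Filter.Tendsto β Filter.atTop (nhds 0) := by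
      have := (tendsto_one_div_add_atTop_nhds_zero_nat (𝕜 := ℝ)).const_mul (2 * (B * K))
      rw [mul_zero] at this
      refine this.congr fun n => ?_
      simp only [hβ]; ring
    have h2 : Filter.Tendsto (fun n => ENNReal.ofReal (β n) ^ q) Filter.atTop (nhds 0) := by
      have h3 := (ENNReal.tendsto_ofReal h1).ennrpow_const q
      rwa [ENNReal.ofReal_zero, ENNReal.zero_rpow_of_pos hq0] at h3
    have h4 := ENNReal.Tendsto.const_mul (a := 2) h2 (Or.inr (by norm_num))
    have h5 := ENNReal.Tendsto.const_mul (a := (Fintype.card ι : ℝ≥0∞)) h4 (Or.inr (by simp))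
    exact ENNReal.Tendsto.const_mul (h5.const_add (2 * T)) (Or.inr ENNReal.ofReal_ne_top)
  have hfin := le_of_tendsto_of_tendsto' (ENNReal.tendsto_ofReal hlim) hβt hstep
  refine hfin.trans (le_of_eq ?_)
  rw [mul_zero, mul_zero, add_zero, ← mul_assoc]
  congr 1
  rw [show 4 * C = 2 * C * 2 by ring, ENNReal.ofReal_mul (p := 2 * C) (by positivity), ENNReal.ofReal_ofNat]

end HeisGibbs

namespace HeisGibbs

open SiteFamily

/-! ### The inequality in finite volume -/

theorem ent_map {S T : Type*} [MeasurableSpace S] [MeasurableSpace T] {μ : Measure S} {f : S → T}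
    (hf : Measurable f) {F : T → ℝ} (hF : Measurable F) :
    ent (μ.map f) F = ent μ fun x => F (f x) := by
  rw [ent, ent, integral_map hf.aemeasurable hF.aestronglyMeasurable,
    integral_map hf.aemeasurable (measurable_mul_log hF).aestronglyMeasurable]

variable {N : ℕ} {φ : Heis → ℝ} {V : Heis → Heis → ℝ} {J : Site N → Site N → ℝ}

theorem Regular.siteFamily (h : Regular φ V J) {q c M J₀ κ : ℝ} (hq₁ : 1 < q) (hq₂ : q ≤ 2)
    (hc : 0 ≤ c) (h0 : H0 φ V J q c) (h1 : H1 V M) (hJ : ∀ i j, |J i j| ≤ J₀) (hκ : 0 < κ)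
    (hJκ : 2 * J₀ * M ≤ κ) : SiteFamily (singleSite φ V J) q (2 * c) κ where
  one_lt := hq₁
  le_two := hq₂
  nonneg := by linarith
  pos := hκ
  prob := h.prob_singleSite
  meas := h.measurable_singleSite
  ls := h.lsLip hq₁ hq₂ hc h0
  congr := fun _ _ _ hj => singleSite_congr hj
  tilt_shift := fun i j ω k t hij => by
    obtain ⟨H, hH, he⟩ := h.singleSite_shift h1 hJ hij ω k t
    exact ⟨H, hH.mono (mul_le_mul_of_nonneg_right hJκ (abs_nonneg t)), he⟩

theorem siteAvg_singleSite {i : Site N} {g : Config N → ℝ} (hg : Measurable g) (ω : Config N) :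
    siteAvg (singleSite φ V J) i g ω = ∫ η, g η ∂(localSpec φ V J {i} ω) := by
  rw [siteAvg, localSpec_singleton,
    integral_map (measurable_update ω).aemeasurable hg.aestronglyMeasurable]

theorem Regular.integral_integral_localSpec (h : Regular φ V J) {Λ : Finset (Site N)}
    {ν : Measure (Config N)} [IsProbabilityMeasure ν] {g : Config N → ℝ} (hg : Measurable g) {B : ℝ}
    (hB : ∀ ω, |g ω| ≤ B) (hν : ν.bind (localSpec φ V J Λ) = ν) :
    ∫ ω, (∫ η, g η ∂(localSpec φ V J Λ ω)) ∂ν = ∫ ω, g ω ∂ν := by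
  let K : ProbabilityTheory.Kernel (Config N) (Config N) := ⟨localSpec φ V J Λ, h.measurable_localSpec Λ⟩
  have hK : ProbabilityTheory.IsMarkovKernel K := ⟨fun ω => h.prob_localSpec Λ ω⟩
  have hν' : ν.bind K = ν := hν
  have hi : Integrable g (ν.bind K) := by rw [hν']; exact integrable_of_abs_le hg hB
  have hi' : Integrable g ((K.comp (ProbabilityTheory.Kernel.const Unit ν)) ()) := by
    rwa [ProbabilityTheory.Kernel.comp_apply, ProbabilityTheory.Kernel.const_apply]
  have := ProbabilityTheory.Kernel.integral_comp hi'
  rw [ProbabilityTheory.Kernel.comp_apply, ProbabilityTheory.Kernel.const_apply, hν'] at this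
  exact this.symm

theorem Regular.invariant_localSpec (h : Regular φ V J) (Λ : Finset (Site N)) (ω : Config N) :
    Invariant (singleSite φ V J) Λ (localSpec φ V J Λ ω) := by
  intro i hi g hg ⟨B, hB⟩
  have := h.prob_localSpec Λ ω
  simp_rw [siteAvg_singleSite hg]
  exact h.integral_integral_localSpec hg hB (h.localSpec_bind hi ω)

theorem ae_localSpec (Λ : Finset (Site N)) (ω : Config N) :
    ∀ᵐ η ∂(localSpec φ V J Λ ω), ∀ j, j ∉ Λ → η j = ω j := by
  have hm : MeasurableSet {η : Config N | ∀ j, j ∉ Λ → η j = ω j} := by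
    simp only [Set.ofPred_forall]
    exact MeasurableSet.iInter fun j => MeasurableSet.iInter fun _ =>
      measurableSet_eq_fun (measurable_pi_apply j) measurable_const
  rw [localSpec, ae_map_iff (measurable_glue Λ ω).aemeasurable hm]
  exact Filter.Eventually.of_forall fun x j hj => by simp [glue, hj]

/-- The coordinates in `Λ`. -/
def restr (Λ : Finset (Site N)) (η : Config N) : Λ → Heis := fun i => η i

theorem measurable_restr (Λ : Finset (Site N)) : Measurable (restr Λ) :=
  measurable_pi_lambda _ fun i => measurable_pi_apply (i : Site N)

theorem restr_glue (Λ : Finset (Site N)) (ω : Config N) (x : Λ → Heis) : restr Λ (glue Λ ω x) = x := by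
  funext i
  simp [restr, glue]

theorem restr_shift {Λ : Finset (Site N)} (η : Config N) {j : Site N} (hj : j ∈ Λ) (k : Fin 2) (t : ℝ) :
    restr Λ (shift η j k t) = shift (restr Λ η) ⟨j, hj⟩ k t := by
  funext i
  by_cases hi : i = ⟨j, hj⟩
  · subst hi
    simp [restr, shift]
  · have : (i : Site N) ≠ j := fun hh => hi (Subtype.ext hh)
    simp [restr, shift, Function.update_of_ne hi, Function.update_of_ne this]

theorem restr_shift_of_notMem {Λ : Finset (Site N)} (η : Config N) {j : Site N} (hj : j ∉ Λ) (k : Fin 2)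
    (t : ℝ) : restr Λ (shift η j k t) = restr Λ η := by
  funext i
  have : (i : Site N) ≠ j := fun hh => hj (hh ▸ i.2)
  simp [restr, shift, Function.update_of_ne this]

variable {q C κ : ℝ}

/-- Transfers the estimate on configurations to the coordinates in Λ: functions of these coordinates
are extended to configurations not depending on the others, where all Lipschitz constants are 0. -/
theorem Regular.plsLip (h : Regular φ V J) (hs : SiteFamily (singleSite φ V J) q C κ)
    (hκ₁ : lipFactor q C κ * 3 ^ N ≤ 1 / 2) (hκ₂ : slopeFactor q C κ * 3 ^ N ≤ 1 / 4)
    (Λ : Finset (Site N)) (ω : Config N) :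
    PLSLip ((volume : Measure (Λ → Heis)).tilted fun x => -energy φ V J Λ (glue Λ ω x)) q (4 * C) := by
  intro u A L B δ hδ hum hδu huB hL hAm hA0 hAB hA
  have hq0 : 0 < q := by linarith [hs.one_lt]
  have hprob := h.prob_localSpec Λ ω
  set G : Site N → Config N → ℝ := fun j η => if hj : j ∈ Λ then A ⟨j, hj⟩ (restr Λ η) else 0 with hG
  have hGe : ∀ j (hj : j ∈ Λ), G j = fun η => A ⟨j, hj⟩ (restr Λ η) := fun j hj => by
    funext η; simp [hG, hj]
  have hS : Slopes q δ Λ (fun η => u (restr Λ η)) G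
      (fun j => if j ∈ Λ then q * B ^ (q - 1) * L else 0) B := by
    refine ⟨hum.comp (measurable_restr Λ), fun η => hδu _, fun η => huB _, fun η j k t => ?_,
      fun j hj => ?_, fun j hj η => ?_, fun j hj η => ?_, fun j hj => ?_⟩
    · change |u (restr Λ (shift η j k t)) ^ q - u (restr Λ η) ^ q| ≤ (if j ∈ Λ then _ else 0) * |t|
      by_cases hj : j ∈ Λ
      · rw [if_pos hj, restr_shift η hj]
        refine (abs_rpow_sub_rpow_le_mul hs.one_lt.le (hδ.le.trans (hδu _)) (hδ.le.trans (hδu _))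
          (huB _) (huB _)).trans ?_
        have hB0 : 0 ≤ B := (hδ.le.trans (hδu 0)).trans (huB 0)
        rw [mul_assoc _ L]
        exact mul_le_mul_of_nonneg_left (hL _ _ _ _) (mul_nonneg hq0.le (Real.rpow_nonneg hB0 _))
      · rw [if_neg hj, restr_shift_of_notMem η hj]
        simp
    · rw [hGe j hj]; exact (hAm _).comp (measurable_restr Λ)
    · rw [hGe j hj]; exact hA0 _ _
    · rw [hGe j hj]; exact hAB _ _
    · intro η k ε hε
      rw [hGe j hj]
      simp only [restr_shift η hj]
      exact hA ⟨j, hj⟩ _ k ε hε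
  have := hs.ent_le_of_slopes hκ₁ hκ₂ (h.invariant_localSpec Λ ω) (ae_localSpec Λ ω) hδ hS
  have hg := measurable_glue Λ ω
  have huq : Measurable fun η => u (restr Λ η) ^ q := (hum.comp (measurable_restr Λ)).pow_const q
  rw [localSpec, ent_map hg huq] at this
  simp only [restr_glue] at this
  refine this.trans (le_of_eq ?_)
  congr 1
  rw [← Finset.sum_coe_sort]
  refine Finset.sum_congr rfl fun j _ => ?_
  have hAq : Measurable fun η => A j (restr Λ η) ^ q := ((hAm j).comp (measurable_restr Λ)).pow_const q
  rw [hGe j j.2, integral_map hg.aemeasurable hAq.aestronglyMeasurable]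
  simp only [restr_glue]

theorem Regular.ofReal_ent_localSpec_le (h : Regular φ V J) (hs : SiteFamily (singleSite φ V J) q C κ)
    (hC : 0 < C) (hκ₁ : lipFactor q C κ * 3 ^ N ≤ 1 / 2) (hκ₂ : slopeFactor q C κ * 3 ^ N ≤ 1 / 4)
    (Λ : Finset (Site N)) (ω : Config N) {f : Config N → ℝ} {B : ℝ} (hfm : Measurable f)
    (hfB : ∀ ω, |f ω| ≤ B) (hf : SepC1 f) :
    ENNReal.ofReal (ent (localSpec φ V J Λ ω) fun η => |f η| ^ q)
      ≤ ENNReal.ofReal (16 * C)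
        * ∑ j ∈ Λ, ∫⁻ η, ENNReal.ofReal (pgrad f j η) ^ q ∂(localSpec φ V J Λ ω) := by
  have hg := measurable_glue Λ ω
  have hglue : Continuous (glue Λ ω) := by
    refine continuous_pi fun j => ?_
    by_cases hj : j ∈ Λ
    · simpa [glue, hj] using continuous_apply (⟨j, hj⟩ : Λ)
    · simpa [glue, hj] using continuous_const
  have hup : ∀ (x : Λ → Heis) (j : Λ) z, glue Λ ω (Function.update x j z)
      = Function.update (glue Λ ω x) j z := fun x j z => glue_update Λ ω x j z
  have hgj : ∀ (x : Λ → Heis) (j : Λ), glue Λ ω x j = x j := fun x j => congrFun (restr_glue Λ ω x) j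
  have key := (h.plsLip hs hκ₁ hκ₂ Λ ω).of_bounded
    (((continuous_energy h.cont_phi h.cont_V Λ).comp hglue).neg) (h.fin Λ ω) hs.one_lt hs.le_two
    (by positivity) (g := fun x => f (glue Λ ω x)) (hfm.comp hg) (fun x => hfB _)
    (fun j x => by simp only [hup]; exact hf j (glue Λ ω x))
  rw [localSpec, ent_map hg (hfm.abs.pow_const q)]
  refine key.trans (le_of_eq ?_)
  rw [show 4 * (4 * C) = 16 * C by ring]
  congr 1
  refine Eq.trans (Finset.sum_congr rfl fun j _ => ?_) (Finset.sum_coe_sort Λ fun j =>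
    ∫⁻ η, ENNReal.ofReal (pgrad f j η) ^ q ∂Measure.map (glue Λ ω)
      ((volume : Measure (Λ → Heis)).tilted fun x => -energy φ V J Λ (glue Λ ω x)))
  rw [lintegral_map ((hf.measurable_pgrad hfm j).ennreal_ofReal.pow_const q) hg]
  congr 1
  funext x
  simp only [pgrad, hup, hgj]

end HeisGibbs

/-! ### Infinite volume: decay of correlations, uniqueness and the final inequality. -/

namespace HeisGibbs

open SiteFamily

/-! ### Local Lipschitz functions are dense -/

/-- Bounded functions of the coordinates in `S` which are horizontally Lipschitz in each of them. -/
structure LocalLip {N : ℕ} (S : Finset (Site N)) (v : Site N → ℝ) (B : ℝ) (g : Config N → ℝ) : Prop where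
  meas : Measurable g
  bound : ∀ ω, |g ω| ≤ B
  slip : SLip v g
  supp : ∀ j, j ∉ S → v j = 0
  loc : ∀ ω η : Config N, (∀ j ∈ S, ω j = η j) → g ω = g η

/-- The centred cube of side `2 n`. -/
def box (N n : ℕ) : Finset (Site N) := Finset.Icc (fun _ => -(n : ℤ)) (fun _ => (n : ℤ))

variable {N : ℕ}

theorem mem_box {n : ℕ} {i : Site N} : i ∈ box N n ↔ ∀ l, |i l| ≤ n := by
  simp only [box, Finset.mem_Icc, Pi.le_def, abs_le, forall_and]

theorem box_mono {m n : ℕ} (h : m ≤ n) : box N m ⊆ box N n := fun i hi => by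
  rw [mem_box] at hi ⊢
  exact fun l => (hi l).trans (by exact_mod_cast h)

theorem abs_le_latDist (i : Site N) (l : Fin N) : |i l| ≤ latDist i 0 := by
  have := Finset.single_le_sum (f := fun l => |i l - (0 : Site N) l|) (fun _ _ => abs_nonneg _)
    (Finset.mem_univ l)
  simpa [latDist] using this

theorem latDist_nonneg (i j : Site N) : 0 ≤ latDist i j :=
  Finset.sum_nonneg fun _ _ => abs_nonneg _

theorem mem_box_of_latDist_le {n : ℕ} {i : Site N} (h : latDist i 0 ≤ n) : i ∈ box N n :=
  mem_box.2 fun l => (abs_le_latDist i l).trans h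

theorem exists_subset_box (S : Finset (Site N)) : ∃ m, ∀ n, m ≤ n → S ⊆ box N n := by
  refine ⟨∑ i ∈ S, (latDist i 0).toNat, fun n hn i hi => mem_box_of_latDist_le ?_⟩
  have h1 : (latDist i 0).toNat ≤ n :=
    (Finset.single_le_sum (f := fun i => (latDist i 0).toNat) (fun _ _ => Nat.zero_le _) hi).trans hn
  have := latDist_nonneg i 0
  omega

theorem slip_of_contDiff {S : Finset (Site N)} {u : (S → Heis) → ℝ} (hu : ContDiff ℝ 1 u)
    (hc : HasCompactSupport u) :
    ∃ v B, LocalLip S v B fun ω => u (restr S ω) := by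
  obtain ⟨B, hB⟩ := hc.exists_bound_of_continuous hu.continuous
  have hD : ∀ j : S, ∃ L : ℝ, ∀ k (y : S → Heis),
      |fderiv ℝ u y (Pi.single j (frame k (y j)))| ≤ L := by
    intro j
    have : ∀ k : Fin 2, ∃ L : ℝ, ∀ y : S → Heis, ‖fderiv ℝ u y (Pi.single j (frame k (y j)))‖ ≤ L := by
      intro k
      refine HasCompactSupport.exists_bound_of_continuous ((hc.fderiv ℝ).mono fun y hy hy' => hy ?_) ?_
      · simp [hy']
      · refine (hu.continuous_fderiv one_ne_zero).clm_apply ?_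
        exact (continuous_single j).comp ((continuous_frame k).comp (continuous_apply j))
    choose L hL using this
    refine ⟨max (L 0) (L 1), fun k y => (hL k y).trans ?_⟩
    fin_cases k
    · exact le_max_left _ _
    · exact le_max_right _ _
  choose L hL using hD
  have hsep : ∀ (x : S → Heis) (j : S) k t, HasDerivAt (fun s => u (shift x j k s))
      (fderiv ℝ u (shift x j k t) (Pi.single j (frame k (shift x j k t j)))) t := by
    intro x j k t
    have h1 : HasFDerivAt (fun z => u (Function.update x j z))
        ((fderiv ℝ u (Function.update x j (flow k t (x j)))).comp
          (ContinuousLinearMap.pi (Pi.single j (ContinuousLinearMap.id ℝ Heis)))) (flow k t (x j)) :=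
      ((hu.differentiable one_ne_zero) _).hasFDerivAt.comp _ (hasFDerivAt_update x _)
    have h2 := hasDerivAt_comp_flow (f := fun z => u (Function.update x j z)) (x := x j) k t
      h1.differentiableAt
    rw [X, h1.fderiv] at h2
    have h3 : (ContinuousLinearMap.pi (Pi.single j (ContinuousLinearMap.id ℝ Heis)))
        (frame k (flow k t (x j))) = (Pi.single j (frame k (shift x j k t j)) : S → Heis) := by
      funext i
      by_cases hi : i = j
      · subst hi; simp [shift]
      · simp [hi]
    rw [ContinuousLinearMap.comp_apply, h3] at h2
    exact h2
  refine ⟨fun j => if hj : j ∈ S then L ⟨j, hj⟩ else 0, B, ⟨hu.continuous.measurable.comp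
    (measurable_restr S), fun ω => hB _, fun ω j k t => ?_, fun j hj => by simp [hj], fun ω η h => ?_⟩⟩
  · by_cases hj : j ∈ S
    · have := (convex_univ : Convex ℝ (Set.univ : Set ℝ)).norm_image_sub_le_of_norm_hasDerivWithin_le
        (fun s _ => (hsep (restr S ω) ⟨j, hj⟩ k s).hasDerivWithinAt) (fun s _ => hL ⟨j, hj⟩ k _)
        (Set.mem_univ 0) (Set.mem_univ t)
      rw [shift_zero, ← restr_shift ω hj, sub_zero] at this
      simpa [hj] using this
    · rw [restr_shift_of_notMem ω hj]
      simp [hj]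
  · have : restr S ω = restr S η := funext fun i => h i i.2
    simp only [this]

/-- Lévy's upward theorem along the boxes reduces to a function of finitely many coordinates, which
is then approximated in L¹ by a smooth function with compact support; the latter is horizontally
Lipschitz. -/
theorem exists_localLip_integral_sub_le {ν : Measure (Config N)} [IsFiniteMeasure ν]
    {F : Config N → ℝ} (hF : Measurable F) (hi : Integrable F ν) {ε : ℝ} (hε : 0 < ε) :
    ∃ S v B g, LocalLip S v B g ∧ ∫ ω, |F ω - g ω| ∂ν ≤ ε := by
  let ℱ : Filtration ℕ (MeasurableSpace.pi : MeasurableSpace (Config N)) :=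
    ⟨fun n => Filtration.piFinset (X := fun _ : Site N => Heis) (box N n),
      fun m n hmn => Filtration.piFinset.mono (box_mono hmn), fun n => Filtration.piFinset.le _⟩
  have hsup : (MeasurableSpace.pi : MeasurableSpace (Config N)) ≤ ⨆ n, ℱ n := by
    refine iSup_le fun i => ?_
    obtain ⟨m, hm⟩ := exists_subset_box ({i} : Finset (Site N))
    have him : i ∈ box N m := hm m le_rfl (by simp)
    refine le_trans ?_ (le_iSup (fun n => ℱ n) m)
    change MeasurableSpace.comap (fun ω : Config N => ω i) _ ≤ MeasurableSpace.comap (restr (box N m)) _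
    have : (fun ω : Config N => ω i) = (fun x : box N m → Heis => x ⟨i, him⟩) ∘ restr (box N m) := rfl
    rw [this, ← MeasurableSpace.comap_comp]
    exact MeasurableSpace.comap_mono (measurable_pi_apply _).comap_le
  have hlim := hi.tendsto_eLpNorm_condExp (ℱ := ℱ) (hF.mono hsup le_rfl).stronglyMeasurable
  obtain ⟨n, hn⟩ := ((ENNReal.tendsto_nhds_zero.1 hlim) (ENNReal.ofReal (ε / 2))
    (by simpa using hε)).exists
  obtain ⟨h, hm, hh⟩ := (stronglyMeasurable_condExp (μ := ν) (m := ℱ n) (f := F)).measurable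
    |>.exists_eq_measurable_comp (f := restr (box N n))
  have hr := measurable_restr (box N n)
  have hhi : Integrable (h ∘ restr (box N n)) ν := hh ▸ integrable_condExp
  obtain ⟨u, hc, hu, hue⟩ := (memLp_one_iff_integrable.2
    ((integrable_map_measure hm.aestronglyMeasurable hr.aemeasurable).2 hhi)).exist_eLpNorm_sub_le
      ENNReal.one_ne_top le_rfl (half_pos hε)
  have hu1 : ContDiff ℝ 1 u := hu.of_le (by exact_mod_cast le_top)
  obtain ⟨v, B, hg⟩ := slip_of_contDiff hu1 hc
  refine ⟨box N n, v, B, _, hg, ?_⟩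
  have hgi : Integrable (fun ω => u (restr (box N n) ω)) ν := integrable_of_abs_le hg.meas hg.bound
  have e1 : ∫ ω, |F ω - h (restr (box N n) ω)| ∂ν ≤ ε / 2 := by
    rw [hh, eLpNorm_sub_comm, eLpNorm_one_eq_lintegral_enorm] at hn
    rw [← ENNReal.ofReal_le_ofReal_iff (by linarith),
      ofReal_integral_eq_lintegral_ofReal (f := fun ω => |F ω - h (restr (box N n) ω)|) (hi.sub hhi).abs
        (Filter.Eventually.of_forall fun _ => abs_nonneg _)]
    refine le_trans (le_of_eq ?_) hn
    simp [Real.enorm_eq_ofReal_abs]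
  have e2 : ∫ ω, |h (restr (box N n) ω) - u (restr (box N n) ω)| ∂ν ≤ ε / 2 := by
    rw [eLpNorm_one_eq_lintegral_enorm, lintegral_map (hm.sub hu.continuous.measurable).enorm hr] at hue
    rw [← ENNReal.ofReal_le_ofReal_iff (by linarith),
      ofReal_integral_eq_lintegral_ofReal
        (f := fun ω => |h (restr (box N n) ω) - u (restr (box N n) ω)|) (hhi.sub hgi).abs
        (Filter.Eventually.of_forall fun _ => abs_nonneg _)]
    refine le_trans (le_of_eq ?_) hue
    simp [Real.enorm_eq_ofReal_abs]
  calc ∫ ω, |F ω - u (restr (box N n) ω)| ∂ν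
      ≤ ∫ ω, |F ω - h (restr (box N n) ω)| + |h (restr (box N n) ω) - u (restr (box N n) ω)| ∂ν :=
        integral_mono (hi.sub hgi).abs ((hi.sub hhi).abs.add (hhi.sub hgi).abs) fun ω =>
          _root_.abs_sub_le _ _ _
    _ = _ := integral_add (hi.sub hhi).abs (hhi.sub hgi).abs
    _ ≤ ε := by linarith

end HeisGibbs

namespace HeisGibbs

open SiteFamily

/-! ### Decay of correlations for tempered boundary conditions -/

variable {N : ℕ} {q C κ : ℝ}

theorem SiteFamily.avgList_congr {μ : Site N → Config N → Measure Heis} (h : SiteFamily μ q C κ)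
    {B : Finset (Site N)} (l : List (Site N)) : ∀ {F : Config N → ℝ}, (∀ i ∈ l, nbrs i ⊆ B) →
      (∀ ω η : Config N, (∀ j ∈ B, ω j = η j) → F ω = F η) →
      ∀ ω η : Config N, (∀ j ∈ B, ω j = η j) → avgList μ l F ω = avgList μ l F η := by
  induction l with
  | nil => exact fun _ hF => hF
  | cons i l ih =>
    intro F hl hF
    refine ih (fun j hj => hl j (List.mem_cons_of_mem _ hj)) fun ω η hωη => ?_
    change siteAvg μ i F ω = siteAvg μ i F η
    rw [siteAvg, siteAvg, h.congr i ω η fun j hj => hωη j (hl i List.mem_cons_self hj)]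
    congr 1
    funext x
    refine hF _ _ fun j hj => ?_
    by_cases hji : j = i
    · subst hji; simp
    · simp [hji, hωη j hj]

/-- The weight of a site in the decay estimate. -/
def decayWeight (b : ℝ) (j : Site N) : ℝ := Real.exp ((b + 1) * (latDist j 0 : ℝ))

theorem latDist_le_add_one {i j : Site N} (h : j ∈ nbrs i) : latDist j 0 ≤ latDist i 0 + 1 := by
  rw [mem_nbrs] at h
  rw [← h, latDist, latDist, latDist, ← Finset.sum_add_distrib]
  refine Finset.sum_le_sum fun l _ => ?_
  have := abs_sub_abs_le_abs_sub (j l) (i l)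
  rw [abs_sub_comm (j l)] at this
  simp only [Pi.zero_apply, sub_zero]
  linarith

/-- The weight varies by at most exp(b+1) across a bond, and a site has at most 3^N neighbours.
Through this factor the admissible coupling depends on the growth rate of tempered configurations.
-/
theorem sum_decayWeight_le {b : ℝ} (hb : 0 ≤ b) (B : Finset (Site N)) (i : Site N) :
    ∑ j ∈ B with j ∈ nbrs i, decayWeight b j ≤ 3 ^ N * Real.exp (b + 1) * decayWeight b i := by
  have h1 : ∀ j ∈ B.filter (· ∈ nbrs i), decayWeight b j ≤ Real.exp (b + 1) * decayWeight b i := by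
    intro j hj
    rw [decayWeight, decayWeight, ← Real.exp_add, Real.exp_le_exp]
    have h2 : (latDist j 0 : ℝ) ≤ latDist i 0 + 1 := by
      exact_mod_cast latDist_le_add_one (Finset.mem_filter.1 hj).2
    nlinarith
  refine (Finset.sum_le_card_nsmul _ _ _ h1).trans ?_
  rw [nsmul_eq_mul, mul_assoc]
  refine mul_le_mul_of_nonneg_right ?_ (mul_nonneg (Real.exp_nonneg _) (Real.exp_nonneg _))
  have h3 : (B.filter (· ∈ nbrs i)).card ≤ (nbrs i).card :=
    Finset.card_le_card fun j hj => (Finset.mem_filter.1 hj).2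
  exact_mod_cast h3.trans (card_nbrs_le i)

variable {φ : Heis → ℝ} {V : Heis → Heis → ℝ} {J : Site N → Site N → ℝ}

/-- The finite volume measure is invariant under averages over sites of Λ, so g may be replaced by
its iterated average. Once the Lipschitz constants in Λ are small, that average is nearly its value
at ω. Large coordinates are handled by the capped dominated convergence. -/
theorem Regular.abs_integral_sub_avgList_le (h : Regular φ V J)
    (hs : SiteFamily (singleSite φ V J) q C κ) {S : Finset (Site N)} {v : Site N → ℝ} {B : ℝ}
    {g : Config N → ℝ} (hg : LocalLip S v B g) (Λ : Finset (Site N)) (ω : Config N) {δ : ℝ} (hδ : 0 < δ) :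
    ∃ ε > 0, ∀ l : List (Site N), (∀ i ∈ l, i ∈ Λ) →
      (∀ i ∈ Λ, lipList (lipFactor q C κ) l v i ≤ ε) →
      |∫ η, g η ∂(localSpec φ V J Λ ω) - avgList (singleSite φ V J) l g ω| ≤ δ := by
  have hprob := h.prob_localSpec Λ ω
  set Y : Config N → ℝ := fun η => ∑ j ∈ Λ, (8 + 12 * ‖ω j‖ + 12 * ‖η j‖) with hY
  have hYm : Measurable Y := by
    refine Finset.measurable_sum _ fun j _ => ?_
    exact (((measurable_pi_apply j).norm).const_mul 12).const_add _
  have hY0 : ∀ η, 0 ≤ Y η := fun η => Finset.sum_nonneg fun j _ => by positivity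
  have hB0 : 0 ≤ B := (abs_nonneg _).trans (hg.bound 0)
  obtain ⟨n, hn⟩ := ((tendsto_integral_min_zero (γ := localSpec φ V J Λ ω) hYm hY0
    (mul_nonneg zero_le_two hB0)).eventually (ge_mem_nhds hδ)).exists
  refine ⟨1 / (n + 1), by positivity, fun l hl hε => ?_⟩
  set F := avgList (singleSite φ V J) l g with hF
  have hFm : Measurable F := hs.measurable_avgList l hg.meas
  have hFB : ∀ η, |F η| ≤ B := fun η => abs_le.2 (hs.avgList_mem l hg.meas
    (fun η => (abs_le.1 (hg.bound η)).1) (fun η => (abs_le.1 (hg.bound η)).2) η)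
  have hFs := hs.slip_avgList l hg.meas hg.bound hg.slip
  have hFi : Integrable F (localSpec φ V J Λ ω) := integrable_of_abs_le hFm hFB
  rw [← hs.integral_avgList (h.invariant_localSpec Λ ω) l hg.meas hg.bound hl, ← hF]
  have e1 : ∫ η, F η ∂(localSpec φ V J Λ ω) - F ω = ∫ η, (F η - F ω) ∂(localSpec φ V J Λ ω) := by
    rw [integral_sub hFi (integrable_const _)]
    simp
  rw [e1]
  refine (abs_integral_le_integral_abs).trans (le_trans (integral_mono_ae
    (hFi.sub (integrable_const _)).abs ?_ ?_) hn)
  · refine integrable_of_abs_le (B := 2 * B) (measurable_const.min (hYm.div_const _)) fun η => ?_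
    rw [abs_of_nonneg (le_min (by positivity) (div_nonneg (hY0 η) (by positivity)))]
    exact min_le_left _ _
  · filter_upwards [ae_localSpec (φ := φ) (V := V) (J := J) Λ ω] with η hη
    refine le_min ?_ ?_
    · have h1 := abs_sub (F η) (F ω)
      have h2 := hFB η
      have h3 := hFB ω
      linarith
    · refine (hFs.abs_sub_le Λ η ω hη).trans ?_
      rw [div_eq_mul_one_div, mul_comm, hY, Finset.mul_sum]
      exact Finset.sum_le_sum fun j hj => mul_le_mul_of_nonneg_right (hε j hj) (by positivity)

/-- Both expectations are nearly the values at ω and η of one iterated average F. F depends only on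
the box and its outer neighbours. Its Lipschitz constants inside the box are negligible, and outside
they are controlled by the initial weighted sum. There |j| ≥ n, and the extra 1 in the exponent
(b+1) of the weight provides exp(-n) after exp(b|j|) has absorbed the growth of the boundary
conditions. -/
theorem Regular.abs_integral_sub_integral_le (h : Regular φ V J)
    (hs : SiteFamily (singleSite φ V J) q C κ) {b : ℝ} (hb : 0 ≤ b)
    (hκ : lipFactor q C κ * (3 ^ N * Real.exp (b + 1)) ≤ 1 / 2) {S : Finset (Site N)}
    {v : Site N → ℝ} {B : ℝ} {g : Config N → ℝ} (hg : LocalLip S v B g) {K : ℝ} {ω η : Config N}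
    (hω : ∀ i, ‖ω i‖ ≤ K * Real.exp (b * (latDist i 0 : ℝ)))
    (hη : ∀ i, ‖η i‖ ≤ K * Real.exp (b * (latDist i 0 : ℝ))) {n : ℕ} (hn : S ⊆ box N n) :
    |∫ ξ, g ξ ∂(localSpec φ V J (box N n) ω) - ∫ ξ, g ξ ∂(localSpec φ V J (box N n) η)|
      ≤ (8 + 24 * K) * (∑ j ∈ S, decayWeight b j * v j) * Real.exp (-(n : ℝ)) := by
  set Λ := box N n with hΛ
  set D := Λ ∪ Λ.biUnion nbrs with hD
  have hΛD : Λ ⊆ D := Finset.subset_union_left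
  have hnD : ∀ i ∈ Λ, nbrs i ⊆ D := fun i hi =>
    (Finset.subset_biUnion_of_mem nbrs hi).trans Finset.subset_union_right
  set θ := lipFactor q C κ with hθ
  have hθ0 : 0 ≤ θ := hs.lipFactor_nonneg
  have hK : 0 ≤ K := nonneg_of_mul_nonneg_left ((norm_nonneg _).trans (hω 0)) (Real.exp_pos _)
  have hp : ∀ j : Site N, 0 ≤ decayWeight b j := fun j => Real.exp_nonneg _
  have hv : ∀ j, 0 ≤ v j := hg.slip.nonneg
  have hpi : ∀ i ∈ Λ, ∑ j ∈ D with j ∈ nbrs i, decayWeight b j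
      ≤ 3 ^ N * Real.exp (b + 1) * decayWeight b i := fun i _ => sum_decayWeight_le hb D i
  have hl0 : ∀ j : Site N, (0 : ℝ) ≤ (latDist j 0 : ℝ) := fun j => by exact_mod_cast latDist_nonneg j 0
  have hp1 : ∀ j : Site N, 1 ≤ decayWeight b j := fun j =>
    Real.one_le_exp (mul_nonneg (by linarith) (hl0 j))
  refine le_of_forall_pos_le_add fun δ hδ => ?_
  obtain ⟨ε₁, hε₁, h₁⟩ := h.abs_integral_sub_avgList_le hs hg Λ ω (δ := δ / 3) (by linarith)
  obtain ⟨ε₂, hε₂, h₂⟩ := h.abs_integral_sub_avgList_le hs hg Λ η (δ := δ / 3) (by linarith)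
  set A : ℝ := Λ.card * (8 + 24 * K) + 1 with hA
  have hA0 : 0 < A := by positivity
  set ε := min (min ε₁ ε₂) (δ / 3 / A) with hε
  have hε0 : 0 < ε := lt_min (lt_min hε₁ hε₂) (by positivity)
  obtain ⟨l, hl, hlε⟩ := exists_lipList_small hθ0 hκ hΛD hp hpi hv hε0
  set w := lipList θ l v with hw
  have hw0 : ∀ j, 0 ≤ w j := lipList_nonneg hθ0 l hv
  have hwε : ∀ i ∈ Λ, w i ≤ ε := fun i hi =>
    (le_mul_of_one_le_left (hw0 i) (hp1 i)).trans (hlε i hi)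
  have k₁ := h₁ l hl fun i hi => (hwε i hi).trans ((min_le_left _ _).trans (min_le_left _ _))
  have k₂ := h₂ l hl fun i hi => (hwε i hi).trans ((min_le_left _ _).trans (min_le_right _ _))
  set F := avgList (singleSite φ V J) l g with hF
  have hFs : SLip w F := hs.slip_avgList l hg.meas hg.bound hg.slip
  have hFloc := hs.avgList_congr (B := D) l (F := g) (fun i hi => hnD i (hl i hi))
    fun ω η hωη => hg.loc ω η fun j hj => hωη j (hΛD (hn hj))
  -- F does not see the coordinates off D, so η may be replaced by a configuration that differs from
  -- ω at finitely many sites only.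
  set η' : Config N := fun j => if j ∈ D then η j else ω j with hη'
  have hFη : F η = F η' := hFloc η η' fun j hj => by simp [hη', hj]
  have hdiff : |F η' - F ω| ≤ ∑ j ∈ D, w j * (8 + 12 * ‖ω j‖ + 12 * ‖η' j‖) :=
    hFs.abs_sub_le D η' ω fun j hj => by simp [hη', hj]
  have hterm : ∀ j ∈ D, w j * (8 + 12 * ‖ω j‖ + 12 * ‖η' j‖)
      ≤ (8 + 24 * K) * (decayWeight b j * w j * Real.exp (-(n : ℝ)))
        + if j ∈ Λ then (8 + 24 * K) * ε else 0 := by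
    intro j hj
    have he : 1 ≤ Real.exp (b * (latDist j 0 : ℝ)) := Real.one_le_exp (mul_nonneg hb (hl0 j))
    have h3 : 8 + 12 * ‖ω j‖ + 12 * ‖η' j‖ ≤ (8 + 24 * K) * Real.exp (b * (latDist j 0 : ℝ)) := by
      have h4 : η' j = η j := by simp [hη', hj]
      rw [h4]
      have h5 := hω j
      have h6 := hη j
      nlinarith
    have h7 : w j * (8 + 12 * ‖ω j‖ + 12 * ‖η' j‖)
        ≤ (8 + 24 * K) * (Real.exp (b * (latDist j 0 : ℝ)) * w j) := by
      calc _ ≤ w j * ((8 + 24 * K) * Real.exp (b * (latDist j 0 : ℝ))) :=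
            mul_le_mul_of_nonneg_left h3 (hw0 j)
        _ = _ := by ring
    by_cases hjΛ : j ∈ Λ
    · rw [if_pos hjΛ]
      have h8 : Real.exp (b * (latDist j 0 : ℝ)) * w j ≤ ε := by
        refine (mul_le_mul_of_nonneg_right ?_ (hw0 j)).trans (hlε j hjΛ)
        rw [decayWeight, Real.exp_le_exp]
        nlinarith [hl0 j]
      have h9 : 0 ≤ (8 + 24 * K) * (decayWeight b j * w j * Real.exp (-(n : ℝ))) :=
        mul_nonneg (by positivity) (mul_nonneg (mul_nonneg (hp j) (hw0 j)) (Real.exp_nonneg _))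
      have h10 := mul_le_mul_of_nonneg_left h8 (show 0 ≤ 8 + 24 * K by positivity)
      linarith
    · rw [if_neg hjΛ, add_zero]
      refine h7.trans (mul_le_mul_of_nonneg_left ?_ (by positivity))
      rw [mul_right_comm]
      refine mul_le_mul_of_nonneg_right ?_ (hw0 j)
      rw [decayWeight, ← Real.exp_add, Real.exp_le_exp]
      have h11 : (n : ℝ) ≤ (latDist j 0 : ℝ) := by
        have : (n : ℤ) ≤ latDist j 0 := by
          by_contra hlt
          exact hjΛ (mem_box_of_latDist_le (not_le.1 hlt).le)
        exact_mod_cast this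
      nlinarith
  have hsum : ∑ j ∈ D, w j * (8 + 12 * ‖ω j‖ + 12 * ‖η' j‖)
      ≤ (8 + 24 * K) * (∑ j ∈ S, decayWeight b j * v j) * Real.exp (-(n : ℝ)) + δ / 3 := by
    refine (Finset.sum_le_sum hterm).trans ?_
    rw [Finset.sum_add_distrib, ← Finset.mul_sum, ← Finset.sum_mul]
    refine add_le_add ?_ ?_
    · rw [mul_assoc]
      refine mul_le_mul_of_nonneg_left (mul_le_mul_of_nonneg_right ?_ (Real.exp_nonneg _)) (by positivity)
      refine (potential_list_le hθ0 hκ hΛD hp hpi l hv hl).trans (le_of_eq ?_)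
      refine (Finset.sum_subset (hn.trans hΛD) fun j _ hj => ?_).symm
      rw [hg.supp j hj, mul_zero]
    · rw [← Finset.sum_filter, Finset.sum_const, nsmul_eq_mul, Finset.filter_mem_eq_inter,
        Finset.inter_eq_right.2 hΛD]
      have h12 : ε * A ≤ δ / 3 := by
        rw [← le_div_iff₀ hA0]
        exact min_le_right _ _
      nlinarith
  rw [abs_le] at k₁ k₂ hdiff ⊢
  constructor <;> linarith

theorem IsTempered.exists_bound {a : ℝ} {ν : Measure (Config N)} (h : IsTempered a ν) :
    ∀ᵐ ω ∂ν, ∃ K : ℝ, 0 ≤ K ∧ ∀ i, ‖ω i‖ ≤ K * Real.exp (max a 0 * (latDist i 0 : ℝ)) := by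
  filter_upwards [h] with ω ⟨K, hK⟩
  refine ⟨|K|, abs_nonneg K, fun i => (hK i).trans ?_⟩
  have hl0 : (0 : ℝ) ≤ (latDist i 0 : ℝ) := by exact_mod_cast latDist_nonneg i 0
  refine mul_le_mul (le_abs_self K) (Real.exp_le_exp.2 ?_) (Real.exp_nonneg _) (abs_nonneg K)
  exact mul_le_mul_of_nonneg_right (le_max_left _ _) hl0

end HeisGibbs

namespace HeisGibbs

open SiteFamily

/-! ### Tempered Gibbs measures: uniqueness and convergence of the finite volume averages -/

variable {N : ℕ} {q C κ : ℝ} {φ : Heis → ℝ} {V : Heis → Heis → ℝ} {J : Site N → Site N → ℝ}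

theorem Regular.measurable_integral_localSpec (h : Regular φ V J) (Λ : Finset (Site N))
    {g : Config N → ℝ} (hg : Measurable g) :
    Measurable fun ω => ∫ η, g η ∂(localSpec φ V J Λ ω) := by
  let K : ProbabilityTheory.Kernel (Config N) (Config N) := ⟨localSpec φ V J Λ, h.measurable_localSpec Λ⟩
  have hK : ProbabilityTheory.IsMarkovKernel K := ⟨fun ω => h.prob_localSpec Λ ω⟩
  exact (hg.stronglyMeasurable.integral_kernel (κ := K)).measurable

theorem Regular.abs_integral_localSpec_le (h : Regular φ V J) (Λ : Finset (Site N)) {g : Config N → ℝ}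
    {B : ℝ} (hB : ∀ ω, |g ω| ≤ B) (ω : Config N) : |∫ η, g η ∂(localSpec φ V J Λ ω)| ≤ B := by
  have := h.prob_localSpec Λ ω
  exact abs_integral_le_of_abs_le hB

theorem Regular.bind_eq_of_isGibbs (h : Regular φ V J) {ν : Measure (Config N)} (hν : IsGibbs φ V J ν)
    (Λ : Finset (Site N)) : ν.bind (localSpec φ V J Λ) = ν := by
  have := hν.1
  ext s hs
  rw [Measure.bind_apply hs (h.measurable_localSpec Λ).aemeasurable]
  have h1 := hν.2 Λ (s.indicator 1) (measurable_one.indicator hs) ⟨1, fun ω => by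
    by_cases hω : ω ∈ s <;> simp [hω]⟩
  simp only [integral_indicator_one hs] at h1
  have h2 : ∫ ω, (localSpec φ V J Λ ω).real s ∂ν = (∫⁻ ω, localSpec φ V J Λ ω s ∂ν).toReal :=
    integral_toReal ((Measure.measurable_coe hs).comp (h.measurable_localSpec Λ)).aemeasurable
      (Filter.Eventually.of_forall fun ω => by
        have := h.prob_localSpec Λ ω
        exact measure_lt_top _ _)
  rw [h2, measureReal_def, ENNReal.toReal_eq_toReal_iff' _ (measure_ne_top _ _)] at h1
  · exact h1
  · refine ne_top_of_le_ne_top (ENNReal.one_ne_top) ?_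
    calc ∫⁻ ω, localSpec φ V J Λ ω s ∂ν ≤ ∫⁻ _, 1 ∂ν := lintegral_mono fun ω => by
          have := h.prob_localSpec Λ ω
          exact prob_le_one
      _ = 1 := by simp

/-- The reference boundary condition 0 satisfies every growth bound, so the comparison applies at
almost every ω with a constant depending on ω. Boundedness of g then gives convergence in L¹. -/
theorem Regular.tendsto_integral_abs_localLip (h : Regular φ V J)
    (hs : SiteFamily (singleSite φ V J) q C κ) {a : ℝ}
    (hκ : lipFactor q C κ * (3 ^ N * Real.exp (max a 0 + 1)) ≤ 1 / 2)
    {ν : Measure (Config N)} (hν : IsGibbs φ V J ν)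
    (ht : IsTempered a ν) {S : Finset (Site N)} {v : Site N → ℝ} {B : ℝ} {g : Config N → ℝ}
    (hg : LocalLip S v B g) :
    Filter.Tendsto (fun n => ∫ ω, |∫ ξ, g ξ ∂(localSpec φ V J (box N n) ω)
      - ∫ ξ, g ξ ∂(localSpec φ V J (box N n) 0)| ∂ν) Filter.atTop (nhds 0) := by
  have := hν.1
  have h0 : ∫ _ : Config N, (0 : ℝ) ∂ν = 0 := by simp
  rw [← h0]
  refine tendsto_integral_of_dominated_convergence (fun _ => 2 * B)
    (fun n => ((h.measurable_integral_localSpec _ hg.meas).sub_const _).abs.aestronglyMeasurable)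
    (integrable_const _) (fun n => Filter.Eventually.of_forall fun ω => ?_) ?_
  · have h1 := h.abs_integral_localSpec_le (box N n) hg.bound ω
    have h2 := h.abs_integral_localSpec_le (box N n) hg.bound 0
    have h3 := abs_sub (∫ ξ, g ξ ∂(localSpec φ V J (box N n) ω)) (∫ ξ, g ξ ∂(localSpec φ V J (box N n) 0))
    rw [Real.norm_eq_abs, abs_abs]
    linarith
  · filter_upwards [ht.exists_bound] with ω ⟨K, hK, hω⟩
    obtain ⟨m, hm⟩ := exists_subset_box S
    have hlim : Filter.Tendsto (fun n : ℕ => (8 + 24 * K) * (∑ j ∈ S, decayWeight (max a 0) j * v j)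
        * Real.exp (-(n : ℝ))) Filter.atTop (nhds 0) := by
      have := ((Real.tendsto_exp_neg_atTop_nhds_zero.comp tendsto_natCast_atTop_atTop).const_mul
        ((8 + 24 * K) * (∑ j ∈ S, decayWeight (max a 0) j * v j)))
      simpa using this
    refine squeeze_zero' (Filter.Eventually.of_forall fun n => abs_nonneg _) ?_ hlim
    filter_upwards [Filter.eventually_ge_atTop m] with n hn
    refine h.abs_integral_sub_integral_le hs (le_max_right _ _) hκ hg hω (fun i => ?_) (hm n hn)
    simp only [Pi.zero_apply, norm_zero]
    positivity

theorem Regular.tendsto_integral_localLip (h : Regular φ V J)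
    (hs : SiteFamily (singleSite φ V J) q C κ) {a : ℝ}
    (hκ : lipFactor q C κ * (3 ^ N * Real.exp (max a 0 + 1)) ≤ 1 / 2)
    {ν : Measure (Config N)} (hν : IsGibbs φ V J ν)
    (ht : IsTempered a ν) {S : Finset (Site N)} {v : Site N → ℝ} {B : ℝ} {g : Config N → ℝ}
    (hg : LocalLip S v B g) :
    Filter.Tendsto (fun n => ∫ ξ, g ξ ∂(localSpec φ V J (box N n) 0)) Filter.atTop
      (nhds (∫ ω, g ω ∂ν)) := by
  have := hν.1
  have h1 := h.tendsto_integral_abs_localLip hs hκ hν ht hg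
  rw [tendsto_iff_norm_sub_tendsto_zero]
  refine squeeze_zero (fun _ => norm_nonneg _) (fun n => ?_) h1
  have hi : Integrable (fun ω => ∫ ξ, g ξ ∂(localSpec φ V J (box N n) ω)) ν :=
    integrable_of_abs_le (h.measurable_integral_localSpec _ hg.meas) (h.abs_integral_localSpec_le _ hg.bound)
  have h2 : ∫ ω, g ω ∂ν - ∫ ξ, g ξ ∂(localSpec φ V J (box N n) 0)
      = ∫ ω, (∫ ξ, g ξ ∂(localSpec φ V J (box N n) ω) - ∫ ξ, g ξ ∂(localSpec φ V J (box N n) 0)) ∂ν := by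
    rw [integral_sub hi (integrable_const _), hν.2 _ _ hg.meas ⟨B, hg.bound⟩]
    simp
  rw [norm_sub_rev, Real.norm_eq_abs, h2]
  exact abs_integral_le_integral_abs

/-- Expectations of local Lipschitz functions are limits of finite volume expectations with boundary
condition 0, which do not refer to the Gibbs measure. -/
theorem Regular.isGibbs_unique (h : Regular φ V J)
    (hs : SiteFamily (singleSite φ V J) q C κ) {a : ℝ}
    (hκ : lipFactor q C κ * (3 ^ N * Real.exp (max a 0 + 1)) ≤ 1 / 2)
    {ν₁ ν₂ : Measure (Config N)} (hν₁ : IsGibbs φ V J ν₁) (ht₁ : IsTempered a ν₁)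
    (hν₂ : IsGibbs φ V J ν₂) (ht₂ : IsTempered a ν₂) : ν₁ = ν₂ := by
  have := hν₁.1
  have := hν₂.1
  ext s hs'
  rw [← ENNReal.toReal_eq_toReal_iff' (measure_ne_top _ _) (measure_ne_top _ _)]
  change ν₁.real s = ν₂.real s
  rw [← integral_indicator_one hs', ← integral_indicator_one hs']
  set F : Config N → ℝ := s.indicator 1 with hF
  have hFm : Measurable F := measurable_one.indicator hs'
  have hFB : ∀ ω, |F ω| ≤ 1 := fun ω => by by_cases hω : ω ∈ s <;> simp [hF, hω]
  refine eq_of_abs_sub_eq_zero (le_antisymm (le_of_forall_pos_le_add fun ε hε => ?_) (abs_nonneg _))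
  -- Approximating with respect to the sum gives one g that is good for both measures.
  obtain ⟨S, v, B, g, hg, hge⟩ := exists_localLip_integral_sub_le (ν := ν₁ + ν₂) hFm
    (integrable_of_abs_le hFm hFB) hε
  have hgi : ∀ (ν : Measure (Config N)) [IsFiniteMeasure ν], Integrable (fun ω => F ω - g ω) ν :=
    fun ν _ => (integrable_of_abs_le hFm hFB).sub (integrable_of_abs_le hg.meas hg.bound)
  rw [integral_add_measure (hgi ν₁).abs (hgi ν₂).abs] at hge
  have he : ∫ ω, g ω ∂ν₁ = ∫ ω, g ω ∂ν₂ := tendsto_nhds_unique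
    (h.tendsto_integral_localLip hs hκ hν₁ ht₁ hg) (h.tendsto_integral_localLip hs hκ hν₂ ht₂ hg)
  have hd : ∀ (ν : Measure (Config N)) [IsFiniteMeasure ν],
      |∫ ω, F ω ∂ν - ∫ ω, g ω ∂ν| ≤ ∫ ω, |F ω - g ω| ∂ν := fun ν _ => by
    rw [← integral_sub (integrable_of_abs_le hFm hFB) (integrable_of_abs_le hg.meas hg.bound)]
    exact abs_integral_le_integral_abs
  have h1 := hd ν₁
  have h2 := hd ν₂
  rw [abs_le] at h1 h2 ⊢
  constructor <;> linarith

/-- Approximate F by a local Lipschitz g in L¹(ν). The DLR equation turns the mean of the finite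
volume averages of |F - g| back into ν|F - g|, so the approximation is uniform in the volume. -/
theorem Regular.tendsto_integral_abs_sub (h : Regular φ V J)
    (hs : SiteFamily (singleSite φ V J) q C κ) {a : ℝ}
    (hκ : lipFactor q C κ * (3 ^ N * Real.exp (max a 0 + 1)) ≤ 1 / 2)
    {ν : Measure (Config N)} (hν : IsGibbs φ V J ν) (ht : IsTempered a ν)
    {F : Config N → ℝ} (hF : Measurable F) {B : ℝ} (hB : ∀ ω, |F ω| ≤ B) :
    Filter.Tendsto (fun n => ∫ ω, |∫ ξ, F ξ ∂(localSpec φ V J (box N n) ω) - ∫ ξ, F ξ ∂ν| ∂ν)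
      Filter.atTop (nhds 0) := by
  have := hν.1
  rw [Metric.tendsto_atTop]
  intro ε hε
  have hFi : Integrable F ν := integrable_of_abs_le hF hB
  obtain ⟨S, v, B', g, hg, hge⟩ := exists_localLip_integral_sub_le hF hFi (ε := ε / 5) (by linarith)
  have hgi : Integrable g ν := integrable_of_abs_le hg.meas hg.bound
  have hd : |∫ ω, F ω ∂ν - ∫ ω, g ω ∂ν| ≤ ε / 5 := by
    rw [← integral_sub hFi hgi]
    exact abs_integral_le_integral_abs.trans hge
  have hdm : Measurable fun ω => |F ω - g ω| := (hF.sub hg.meas).abs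
  have hdB : ∀ ω, |(|F ω - g ω|)| ≤ B + B' := fun ω => by
    rw [abs_abs]
    exact (abs_sub _ _).trans (add_le_add (hB ω) (hg.bound ω))
  have h1 := (h.tendsto_integral_abs_localLip hs hκ hν ht hg).eventually (gt_mem_nhds (show 0 < ε / 5 by linarith))
  have h2 := (h.tendsto_integral_localLip hs hκ hν ht hg).eventually
    (Metric.ball_mem_nhds _ (show 0 < ε / 5 by linarith))
  obtain ⟨n₀, hn₀⟩ := Filter.eventually_atTop.1 (h1.and h2)
  refine ⟨n₀, fun n hn => ?_⟩
  obtain ⟨k1, k2⟩ := hn₀ n hn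
  rw [Real.dist_eq] at k2
  rw [Real.dist_eq, sub_zero, abs_of_nonneg (integral_nonneg fun _ => abs_nonneg _)]
  set γ := localSpec φ V J (box N n) with hγ
  set cn := ∫ ξ, g ξ ∂(γ 0) with hcn
  have hprob : ∀ ω, IsProbabilityMeasure (γ ω) := h.prob_localSpec _
  have m1 : Measurable fun ω => ∫ ξ, F ξ ∂(γ ω) := h.measurable_integral_localSpec _ hF
  have m2 : Measurable fun ω => ∫ ξ, g ξ ∂(γ ω) := h.measurable_integral_localSpec _ hg.meas
  have m3 : Measurable fun ω => ∫ ξ, |F ξ - g ξ| ∂(γ ω) := h.measurable_integral_localSpec _ hdm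
  have i1 : Integrable (fun ω => ∫ ξ, F ξ ∂(γ ω)) ν :=
    integrable_of_abs_le m1 (h.abs_integral_localSpec_le _ hB)
  have i2 : Integrable (fun ω => ∫ ξ, g ξ ∂(γ ω)) ν :=
    integrable_of_abs_le m2 (h.abs_integral_localSpec_le _ hg.bound)
  have i3 : Integrable (fun ω => ∫ ξ, |F ξ - g ξ| ∂(γ ω)) ν :=
    integrable_of_abs_le m3 (h.abs_integral_localSpec_le _ hdB)
  have i4 : Integrable (fun ω => |∫ ξ, g ξ ∂(γ ω) - cn|) ν := (i2.sub (integrable_const _)).abs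
  have hle : ∀ ω, |∫ ξ, F ξ ∂(γ ω) - ∫ ξ, F ξ ∂ν|
      ≤ (∫ ξ, |F ξ - g ξ| ∂(γ ω) + |∫ ξ, g ξ ∂(γ ω) - cn|) + (ε / 5 + ε / 5) := by
    intro ω
    have e1 : |∫ ξ, F ξ ∂(γ ω) - ∫ ξ, g ξ ∂(γ ω)| ≤ ∫ ξ, |F ξ - g ξ| ∂(γ ω) := by
      rw [← integral_sub (integrable_of_abs_le hF hB) (integrable_of_abs_le hg.meas hg.bound)]
      exact abs_integral_le_integral_abs
    have e2 := abs_le.1 (le_refl |∫ ξ, g ξ ∂(γ ω) - cn|)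
    have e3 := abs_le.1 k2.le
    have e4 := abs_le.1 hd
    have e1 := abs_le.1 e1
    rw [abs_le]
    constructor <;> linarith [e1.1, e1.2, e2.1, e2.2, e3.1, e3.2, e4.1, e4.2]
  calc ∫ ω, |∫ ξ, F ξ ∂(γ ω) - ∫ ξ, F ξ ∂ν| ∂ν
      ≤ ∫ ω, ((∫ ξ, |F ξ - g ξ| ∂(γ ω) + |∫ ξ, g ξ ∂(γ ω) - cn|) + (ε / 5 + ε / 5)) ∂ν :=
        integral_mono (i1.sub (integrable_const _)).abs ((i3.add i4).add (integrable_const _)) hle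
    _ = ∫ ω, |F ω - g ω| ∂ν + ∫ ω, |∫ ξ, g ξ ∂(γ ω) - cn| ∂ν + (ε / 5 + ε / 5) := by
        rw [integral_add (f := fun ω => ∫ ξ, |F ξ - g ξ| ∂(γ ω) + |∫ ξ, g ξ ∂(γ ω) - cn|)
          (i3.add i4) (integrable_const _), integral_add i3 i4, hν.2 _ _ hdm ⟨_, hdB⟩]
        simp
    _ < ε := by linarith

end HeisGibbs

namespace HeisGibbs

open SiteFamily

/-! ### The inequality for tempered Gibbs measures -/

theorem ofReal_integral_le_lintegral {S : Type*} [MeasurableSpace S] {μ : Measure S} {F : S → ℝ}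
    (hF : Integrable F μ) : ENNReal.ofReal (∫ x, F x ∂μ) ≤ ∫⁻ x, ENNReal.ofReal (F x) ∂μ := by
  rw [integral_eq_lintegral_pos_part_sub_lintegral_neg_part hF]
  refine (ENNReal.ofReal_le_ofReal (sub_le_self _ ENNReal.toReal_nonneg)).trans ?_
  exact ENNReal.ofReal_toReal_le

/-- Again log y ≤ y - 1, now with the bound B to obtain an L¹ estimate, since finite volume averages
are only known to converge in L¹(ν). -/
theorem ent_le_integral_abs {S : Type*} [MeasurableSpace S] {μ : Measure S} [IsProbabilityMeasure μ]
    {G : S → ℝ} {B : ℝ} (hG : Measurable G) (h0 : ∀ x, 0 ≤ G x) (hB : ∀ x, G x ≤ B)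
    (hm : 0 < ∫ x, G x ∂μ) :
    ent μ G ≤ B / (∫ x, G x ∂μ) * ∫ x, |G x - ∫ y, G y ∂μ| ∂μ := by
  set m := ∫ x, G x ∂μ with hmd
  have hi : Integrable G μ := integrable_of_bounds hG h0 hB
  have hl := integrable_mul_log (μ := μ) hG h0 hB
  rw [ent_eq_integral h0 hi hl, ← integral_const_mul]
  refine integral_mono ?_ ((hi.sub (integrable_const m)).abs.const_mul _) fun x => ?_
  · simp only [← hmd, mul_log_div hm.ne']
    exact hl.sub (hi.mul_const _)
  · simp only [← hmd]
    have h1 : G x * Real.log (G x / m) ≤ G x * (G x / m - 1) := by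
      rcases (h0 x).eq_or_lt with hx | hx
      · simp [← hx]
      · exact mul_le_mul_of_nonneg_left (Real.log_le_sub_one_of_pos (div_pos hx hm)) hx.le
    refine h1.trans ?_
    have h2 : G x * (G x / m - 1) = G x / m * (G x - m) := by field_simp
    rw [h2]
    exact (mul_le_mul_of_nonneg_left (le_abs_self _) (div_nonneg (h0 x) hm.le)).trans
      (mul_le_mul_of_nonneg_right (div_le_div_of_nonneg_right (hB x) hm.le) (abs_nonneg _))

variable {N : ℕ} {q C κ : ℝ} {φ : Heis → ℝ} {V : Heis → Heis → ℝ} {J : Site N → Site N → ℝ}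

/-- The finite volume inequality holds with one constant for all boxes and boundary conditions.
Integrating it against ν and using the DLR equation replaces finite volume gradient integrals by
ν-integrals; the remaining entropy of the finite volume average of F vanishes in the limit. -/
theorem Regular.ofReal_ent_le (h : Regular φ V J) (hs : SiteFamily (singleSite φ V J) q C κ)
    (hC : 0 < C) (hκ₁ : lipFactor q C κ * 3 ^ N ≤ 1 / 2) (hκ₂ : slopeFactor q C κ * 3 ^ N ≤ 1 / 4)
    {a : ℝ} (hκ : lipFactor q C κ * (3 ^ N * Real.exp (max a 0 + 1)) ≤ 1 / 2)
    {ν : Measure (Config N)} (hν : IsGibbs φ V J ν) (ht : IsTempered a ν) {f : Config N → ℝ} {B : ℝ}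
    (hfm : Measurable f) (hfB : ∀ ω, |f ω| ≤ B) (hf : SepC1 f) :
    ENNReal.ofReal (ent ν fun ω => |f ω| ^ q)
      ≤ ENNReal.ofReal (16 * C) * ∫⁻ ω, ∑' j, ENNReal.ofReal (pgrad f j ω) ^ q ∂ν := by
  have := hν.1
  have hq0 : 0 ≤ q := by linarith [hs.one_lt]
  set F : Config N → ℝ := fun ω => |f ω| ^ q with hF
  have hFm : Measurable F := hfm.abs.pow_const q
  have hF0 : ∀ ω, 0 ≤ F ω := fun ω => Real.rpow_nonneg (abs_nonneg _) q
  have hFB : ∀ ω, F ω ≤ B ^ q := fun ω => Real.rpow_le_rpow (abs_nonneg _) (hfB ω) hq0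
  have hFa : ∀ ω, |F ω| ≤ B ^ q := fun ω => by rw [abs_of_nonneg (hF0 ω)]; exact hFB ω
  have hFi : Integrable F ν := integrable_of_bounds hFm hF0 hFB
  have hgm : ∀ j, Measurable fun ω => ENNReal.ofReal (pgrad f j ω) ^ q := fun j =>
    (hf.measurable_pgrad hfm j).ennreal_ofReal.pow_const q
  rcases (integral_nonneg hF0 : 0 ≤ ∫ ω, F ω ∂ν).eq_or_lt with hm | hm
  · have hz : F =ᵐ[ν] 0 := (integral_eq_zero_iff_of_nonneg hF0 hFi).1 hm.symm
    have : ent ν F = 0 := by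
      rw [ent, ← hm, zero_mul, sub_zero]
      refine integral_eq_zero_of_ae ?_
      filter_upwards [hz] with ω hω
      simp [hω]
    rw [this]
    simp
  obtain ⟨K, hK0, hK⟩ := exists_mul_log_bound (B ^ q)
  have hstep : ∀ n, ENNReal.ofReal (ent ν F)
      ≤ ENNReal.ofReal (16 * C) * ∫⁻ ω, ∑' j, ENNReal.ofReal (pgrad f j ω) ^ q ∂ν
        + ENNReal.ofReal (B ^ q / (∫ ω, F ω ∂ν)
          * ∫ ω, |∫ ξ, F ξ ∂(localSpec φ V J (box N n) ω) - ∫ ξ, F ξ ∂ν| ∂ν) := by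
    intro n
    set γ := localSpec φ V J (box N n) with hγ
    have hprob : ∀ ω, IsProbabilityMeasure (γ ω) := h.prob_localSpec _
    set G : Config N → ℝ := fun ω => ∫ ξ, F ξ ∂(γ ω) with hG
    have hGm : Measurable G := h.measurable_integral_localSpec _ hFm
    have hG0 : ∀ ω, 0 ≤ G ω := fun ω => integral_nonneg hF0
    have hGB : ∀ ω, G ω ≤ B ^ q := fun ω =>
      (le_abs_self _).trans (h.abs_integral_localSpec_le _ hFa ω)
    have hGF : ∫ ω, G ω ∂ν = ∫ ω, F ω ∂ν := hν.2 _ F hFm ⟨_, hFa⟩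
    have hLm := measurable_mul_log hFm
    have hLB : ∀ ω, |F ω * Real.log (F ω)| ≤ K := fun ω => hK _ (hF0 ω) (hFB ω)
    have hi₁ : Integrable (fun ω => ∫ ξ, F ξ * Real.log (F ξ) ∂(γ ω)) ν :=
      integrable_of_abs_le (h.measurable_integral_localSpec _ hLm) (h.abs_integral_localSpec_le _ hLB)
    have hi₂ := integrable_mul_log (μ := ν) hGm hG0 hGB
    -- Chain rule for entropy with respect to conditioning outside the box, by the DLR equation.
    have hdec : ent ν F = ∫ ω, ent (γ ω) F ∂ν + ent ν G := by
      have e1 : ∫ ω, ent (γ ω) F ∂ν = ∫ ω, F ω * Real.log (F ω) ∂ν - ∫ ω, G ω * Real.log (G ω) ∂ν := by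
        rw [← hν.2 (box N n) _ hLm ⟨K, hLB⟩, ← integral_sub hi₁ hi₂]
        rfl
      rw [e1, ent, ent, hGF]
      ring
    have hE : Integrable (fun ω => ent (γ ω) F) ν := hi₁.sub hi₂
    have hent : ent ν G ≤ B ^ q / (∫ ω, F ω ∂ν) * ∫ ω, |G ω - ∫ ξ, F ξ ∂ν| ∂ν := by
      have := ent_le_integral_abs (μ := ν) hGm hG0 hGB (by rw [hGF]; exact hm)
      rwa [hGF] at this
    rw [hdec]
    refine ENNReal.ofReal_add_le.trans (add_le_add ?_ (ENNReal.ofReal_le_ofReal hent))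
    refine (ofReal_integral_le_lintegral hE).trans ?_
    calc ∫⁻ ω, ENNReal.ofReal (ent (γ ω) F) ∂ν
        ≤ ∫⁻ ω, ENNReal.ofReal (16 * C)
            * ∑ j ∈ box N n, ∫⁻ η, ENNReal.ofReal (pgrad f j η) ^ q ∂(γ ω) ∂ν :=
          lintegral_mono fun ω => h.ofReal_ent_localSpec_le hs hC hκ₁ hκ₂ _ ω hfm hfB hf
      _ = ENNReal.ofReal (16 * C)
            * ∑ j ∈ box N n, ∫⁻ ω, (∫⁻ η, ENNReal.ofReal (pgrad f j η) ^ q ∂(γ ω)) ∂ν := by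
          have hmj : ∀ j, Measurable fun ω => ∫⁻ η, ENNReal.ofReal (pgrad f j η) ^ q ∂(γ ω) := fun j =>
            (Measure.measurable_lintegral (hgm j)).comp (h.measurable_localSpec _)
          rw [lintegral_const_mul _ (Finset.measurable_sum _ fun j _ => hmj j),
            lintegral_finsetSum _ fun j _ => hmj j]
      _ = ENNReal.ofReal (16 * C) * ∑ j ∈ box N n, ∫⁻ ω, ENNReal.ofReal (pgrad f j ω) ^ q ∂ν := by
          congr 1
          refine Finset.sum_congr rfl fun j _ => ?_
          rw [← Measure.lintegral_bind (h.measurable_localSpec _).aemeasurable (hgm j).aemeasurable,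
            h.bind_eq_of_isGibbs hν]
      _ ≤ ENNReal.ofReal (16 * C) * ∫⁻ ω, ∑' j, ENNReal.ofReal (pgrad f j ω) ^ q ∂ν := by
          rw [lintegral_tsum fun j => (hgm j).aemeasurable]
          gcongr
          exact ENNReal.sum_le_tsum _
  have hlim := ((h.tendsto_integral_abs_sub hs hκ hν ht hFm hFa).const_mul (B ^ q / ∫ ω, F ω ∂ν))
  rw [mul_zero] at hlim
  have hlim' := (ENNReal.tendsto_ofReal hlim).const_add
    (ENNReal.ofReal (16 * C) * ∫⁻ ω, ∑' j, ENNReal.ofReal (pgrad f j ω) ^ q ∂ν)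
  rw [ENNReal.ofReal_zero, add_zero] at hlim'
  exact ge_of_tendsto' hlim' hstep

/-- Bounded truncations of the identity of class `C¹`. -/
def arctanTrunc (n : ℕ) (y : ℝ) : ℝ := (n + 1) * Real.arctan (y / (n + 1))

theorem hasDerivAt_arctanTrunc (n : ℕ) (y : ℝ) :
    HasDerivAt (arctanTrunc n) (1 / (1 + (y / (n + 1)) ^ 2)) y := by
  have h1 : HasDerivAt (fun y : ℝ => y / (n + 1)) (1 / (n + 1)) y := (hasDerivAt_id y).div_const _
  have h2 := (h1.arctan).const_mul ((n : ℝ) + 1)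
  have hn : (n : ℝ) + 1 ≠ 0 := by positivity
  have h3 : ((n : ℝ) + 1) * (1 / (1 + (y / (n + 1)) ^ 2) * (1 / (n + 1)))
      = 1 / (1 + (y / (n + 1)) ^ 2) := by
    field_simp
  rw [h3] at h2
  exact h2

theorem abs_arctanTrunc_le (n : ℕ) (y : ℝ) : |arctanTrunc n y| ≤ (n + 1) * (Real.pi / 2) := by
  rw [arctanTrunc, abs_mul, abs_of_nonneg (by positivity : (0 : ℝ) ≤ n + 1)]
  refine mul_le_mul_of_nonneg_left ?_ (by positivity)
  exact abs_le.2 ⟨(Real.neg_pi_div_two_lt_arctan _).le, (Real.arctan_lt_pi_div_two _).le⟩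

theorem abs_arctanTrunc_le_abs (n : ℕ) (y : ℝ) : |arctanTrunc n y| ≤ |y| := by
  have h := (convex_univ : Convex ℝ (Set.univ : Set ℝ)).norm_image_sub_le_of_norm_hasDerivWithin_le
    (C := 1) (fun s _ => (hasDerivAt_arctanTrunc n s).hasDerivWithinAt) (fun s _ => by
      rw [Real.norm_eq_abs, abs_of_nonneg (by positivity), div_le_one (by positivity)]
      nlinarith [sq_nonneg (s / (n + 1))]) (Set.mem_univ 0) (Set.mem_univ y)
  simpa [arctanTrunc] using h

theorem tendsto_arctanTrunc (y : ℝ) :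
    Filter.Tendsto (fun n : ℕ => arctanTrunc n y) Filter.atTop (nhds y) := by
  have h1 : HasDerivAt (fun t : ℝ => Real.arctan (t * y)) y 0 := by
    have := ((hasDerivAt_id (0 : ℝ)).mul_const y).arctan
    simpa using this
  have h2 := h1.tendsto_slope_zero
  have h3 : Filter.Tendsto (fun n : ℕ => 1 / ((n : ℝ) + 1)) Filter.atTop (nhdsWithin 0 {0}ᶜ) :=
    tendsto_nhdsWithin_iff.2 ⟨tendsto_one_div_add_atTop_nhds_zero_nat,
      Filter.Eventually.of_forall fun n => by
        simp only [Set.mem_compl_iff, Set.mem_singleton_iff]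
        positivity⟩
  refine (h2.comp h3).congr fun n => ?_
  simp [arctanTrunc, div_eq_inv_mul]

theorem contDiff_arctanTrunc (n : ℕ) : ContDiff ℝ 1 (arctanTrunc n) :=
  contDiff_const.mul (Real.contDiff_arctan.comp (contDiff_id.div_const _))

theorem subgradNorm_arctanTrunc_le (n : ℕ) {u : Heis → ℝ} (hu : Differentiable ℝ u) (x : Heis) :
    subgradNorm (fun z => arctanTrunc n (u z)) x ≤ subgradNorm u x := by
  refine Real.sqrt_le_sqrt (Finset.sum_le_sum fun k _ => ?_)
  have h1 : HasFDerivAt (fun z => arctanTrunc n (u z)) _ x :=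
    (hasDerivAt_arctanTrunc n (u x)).comp_hasFDerivAt x (hu x).hasFDerivAt
  rw [X, X, h1.fderiv]
  simp only [_root_.smul_apply, smul_eq_mul]
  rw [mul_pow]
  refine mul_le_of_le_one_left (sq_nonneg _) (pow_le_one₀ (by positivity) ?_)
  rw [div_le_one (by positivity)]
  nlinarith [sq_nonneg (u x / (n + 1))]

/-- Truncation by a C¹ contraction of the line does not increase gradients, so the bounded case
applies with a right-hand side independent of n. Integrability of the limit is part of the claim and
comes from Fatou's lemma. -/
theorem Regular.lsConfig (h : Regular φ V J) (hs : SiteFamily (singleSite φ V J) q C κ)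
    (hC : 0 < C) (hκ₁ : lipFactor q C κ * 3 ^ N ≤ 1 / 2) (hκ₂ : slopeFactor q C κ * 3 ^ N ≤ 1 / 4)
    {a : ℝ} (hκ : lipFactor q C κ * (3 ^ N * Real.exp (max a 0 + 1)) ≤ 1 / 2)
    {ν : Measure (Config N)} (hν : IsGibbs φ V J ν) (ht : IsTempered a ν) : LSConfig ν q (16 * C) := by
  intro f hfm hf hFi hGfin
  have := hν.1
  have hq0 : 0 < q := by linarith [hs.one_lt]
  set F : Config N → ℝ := fun ω => |f ω| ^ q with hF
  have hFm : Measurable F := hfm.abs.pow_const q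
  have hF0 : ∀ ω, 0 ≤ F ω := fun ω => Real.rpow_nonneg (abs_nonneg _) q
  set m := ∫ ω, F ω ∂ν with hmd
  set D : ℝ≥0∞ := ENNReal.ofReal (16 * C)
    * ∫⁻ ω, ∑' i : Site N, ENNReal.ofReal (siteGradNorm f i ω ^ q) ∂ν with hD
  have hDfin : D ≠ ∞ := ENNReal.mul_ne_top ENNReal.ofReal_ne_top hGfin
  rcases (integral_nonneg hF0 : 0 ≤ m).eq_or_lt with hm | hm
  · have hz : F =ᵐ[ν] 0 := (integral_eq_zero_iff_of_nonneg hF0 hFi).1 hm.symm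
    have hz' : (fun ω => F ω * Real.log (F ω / m)) =ᵐ[ν] fun _ => 0 := by
      filter_upwards [hz] with ω hω
      simp [hω]
    refine ⟨(integrable_congr hz').2 (integrable_zero _ _ _), ?_⟩
    rw [integral_congr_ae hz']
    simp
  set fn : ℕ → Config N → ℝ := fun n ω => arctanTrunc n (f ω) with hfn
  set Fn : ℕ → Config N → ℝ := fun n ω => |fn n ω| ^ q with hFn
  have hfnm : ∀ n, Measurable (fn n) := fun n => (contDiff_arctanTrunc n).continuous.measurable.comp hfm
  have hFnm : ∀ n, Measurable (Fn n) := fun n => (hfnm n).abs.pow_const q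
  have hFn0 : ∀ n ω, 0 ≤ Fn n ω := fun n ω => Real.rpow_nonneg (abs_nonneg _) q
  have hFnF : ∀ n ω, Fn n ω ≤ F ω := fun n ω =>
    Real.rpow_le_rpow (abs_nonneg _) (abs_arctanTrunc_le_abs n _) hq0.le
  have hFnB : ∀ n ω, Fn n ω ≤ (((n : ℝ) + 1) * (Real.pi / 2)) ^ q := fun n ω =>
    Real.rpow_le_rpow (abs_nonneg _) (abs_arctanTrunc_le n _) hq0.le
  have hFnlim : ∀ ω, Filter.Tendsto (fun n => Fn n ω) Filter.atTop (nhds (F ω)) := fun ω =>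
    ((tendsto_arctanTrunc (f ω)).abs).rpow_const (Or.inr hq0.le)
  have hFni : ∀ n, Integrable (Fn n) ν := fun n => integrable_of_bounds (hFnm n) (hFn0 n) (hFnB n)
  set mn : ℕ → ℝ := fun n => ∫ ω, Fn n ω ∂ν with hmn
  have hmlim : Filter.Tendsto mn Filter.atTop (nhds m) :=
    tendsto_integral_of_dominated_convergence F (fun n => (hFnm n).aestronglyMeasurable) hFi
      (fun n => Filter.Eventually.of_forall fun ω => by
        rw [Real.norm_eq_abs, abs_of_nonneg (hFn0 n ω)]; exact hFnF n ω)
      (Filter.Eventually.of_forall hFnlim)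
  have hent : ∀ n, ENNReal.ofReal (ent ν (Fn n)) ≤ D := by
    intro n
    have hsep : SepC1 (fn n) := fun i ω => (contDiff_arctanTrunc n).comp (hf i ω)
    refine (h.ofReal_ent_le hs hC hκ₁ hκ₂ hκ hν ht (hfnm n) (fun ω => abs_arctanTrunc_le n _) hsep).trans ?_
    refine mul_le_mul_right (lintegral_mono fun ω => ENNReal.tsum_le_tsum fun i => ?_) _
    rw [ENNReal.ofReal_rpow_of_nonneg (pgrad_nonneg _ _) hq0.le]
    refine ENNReal.ofReal_le_ofReal (Real.rpow_le_rpow (pgrad_nonneg _ _) ?_ hq0.le)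
    exact subgradNorm_arctanTrunc_le n ((hf i ω).differentiable one_ne_zero) (ω i)
  -- F log(F/m) changes sign, so Fatou does not apply to it. Adding m - F, which has mean 0, makes
  -- it nonnegative without changing the integral.
  set H : Config N → ℝ := fun ω => F ω * Real.log (F ω / m) - F ω + m with hH
  set Hn : ℕ → Config N → ℝ := fun n ω => Fn n ω * Real.log (Fn n ω / mn n) - Fn n ω + mn n with hHn
  have hlogm : ∀ {G : Config N → ℝ}, Measurable G → ∀ r : ℝ,
      Measurable fun ω => G ω * Real.log (G ω / r) := fun hG r => hG.mul (hG.div_const r).log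
  have hHm : Measurable H := ((hlogm hFm m).sub hFm).add_const m
  have hHnm : ∀ n, Measurable (Hn n) := fun n => ((hlogm (hFnm n) (mn n)).sub (hFnm n)).add_const _
  have hH0 : ∀ ω, 0 ≤ H ω := fun ω => by
    have := young_entropy (b := 0) (hF0 ω) hm
    simpa using this
  have hHlim : ∀ ω, Filter.Tendsto (fun n => Hn n ω) Filter.atTop (nhds (H ω)) := by
    intro ω
    refine Filter.Tendsto.add (Filter.Tendsto.sub ?_ (hFnlim ω)) hmlim
    have h1 : ∀ᶠ n in Filter.atTop, Fn n ω * Real.log (Fn n ω) - Fn n ω * Real.log (mn n)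
        = Fn n ω * Real.log (Fn n ω / mn n) := by
      filter_upwards [hmlim.eventually (lt_mem_nhds hm)] with n hn
      rw [mul_log_div hn.ne']
    refine Filter.Tendsto.congr' h1 ?_
    rw [mul_log_div hm.ne']
    refine Filter.Tendsto.sub ((Real.continuous_mul_log.tendsto _).comp (hFnlim ω)) ?_
    exact (hFnlim ω).mul (hmlim.log hm.ne')
  have hHn_le : ∀ᶠ n in Filter.atTop, ∫⁻ ω, ENNReal.ofReal (Hn n ω) ∂ν ≤ D := by
    filter_upwards [hmlim.eventually (lt_mem_nhds hm)] with n hn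
    have hl := integrable_mul_log (μ := ν) (hFnm n) (hFn0 n) (hFnB n)
    have hl' : Integrable (fun ω => Fn n ω * Real.log (Fn n ω / mn n)) ν := by
      simp only [mul_log_div hn.ne']
      exact hl.sub ((hFni n).mul_const _)
    have hHni : Integrable (Hn n) ν := (hl'.sub (hFni n)).add (integrable_const _)
    have hHn0 : ∀ ω, 0 ≤ Hn n ω := fun ω => by
      have := young_entropy (b := 0) (hFn0 n ω) hn
      simpa using this
    rw [← ofReal_integral_eq_lintegral_ofReal hHni (Filter.Eventually.of_forall hHn0)]
    refine le_trans (le_of_eq ?_) (hent n)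
    congr 1
    rw [ent_eq_integral (hFn0 n) (hFni n) hl]
    simp only [hHn]
    rw [integral_add (f := fun ω => Fn n ω * Real.log (Fn n ω / mn n) - Fn n ω) (hl'.sub (hFni n))
      (integrable_const _), integral_sub hl' (hFni n)]
    simp [hmn]
  have hHle : ∫⁻ ω, ENNReal.ofReal (H ω) ∂ν ≤ D := by
    calc ∫⁻ ω, ENNReal.ofReal (H ω) ∂ν
        = ∫⁻ ω, Filter.liminf (fun n => ENNReal.ofReal (Hn n ω)) Filter.atTop ∂ν := by
          congr 1
          funext ω
          exact ((ENNReal.tendsto_ofReal (hHlim ω)).liminf_eq).symm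
      _ ≤ Filter.liminf (fun n => ∫⁻ ω, ENNReal.ofReal (Hn n ω) ∂ν) Filter.atTop :=
          lintegral_liminf_le fun n => (hHnm n).ennreal_ofReal
      _ ≤ D := Filter.liminf_le_of_frequently_le' hHn_le.frequently
  have hHi : Integrable H ν := by
    refine ⟨hHm.aestronglyMeasurable, ?_⟩
    rw [hasFiniteIntegral_iff_ofReal (Filter.Eventually.of_forall hH0)]
    exact hHle.trans_lt hDfin.lt_top
  have hrew : (fun ω => F ω * Real.log (F ω / m)) = fun ω => H ω + (F ω - m) := by
    funext ω
    simp only [hH]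
    ring
  refine ⟨?_, ?_⟩
  · change Integrable (fun ω => F ω * Real.log (F ω / m)) ν
    rw [hrew]
    exact hHi.add (hFi.sub (integrable_const m))
  · change ENNReal.ofReal (∫ ω, F ω * Real.log (F ω / m) ∂ν) ≤ D
    rw [hrew, integral_add (g := fun ω => F ω - m) hHi (hFi.sub (integrable_const m)), integral_sub hFi (integrable_const m)]
    simp only [integral_const, probReal_univ, one_smul, ← hmd, sub_self, add_zero]
    rw [ofReal_integral_eq_lintegral_ofReal hHi (Filter.Eventually.of_forall hH0)]
    exact hHle

theorem exists_couplingConst (N : ℕ) {q C : ℝ} (hq : 1 < q) (hC : 0 ≤ C) (b : ℝ) :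
    ∃ κ : ℝ, 0 < κ ∧ lipFactor q C κ * (3 ^ N * Real.exp b) ≤ 1 / 2 ∧
      slopeFactor q C κ * 3 ^ N ≤ 1 / 4 := by
  set A : ℝ := 12 * Real.exp (C / (q - 1)) ^ 2 * (3 ^ N * Real.exp b) + 1 with hA
  set B : ℝ := covConst q C * 3 ^ N + 1 with hB
  have hcov := covConst_nonneg hq hC
  have hA0 : 1 ≤ A := le_add_of_nonneg_left (by positivity)
  have hB0 : 1 ≤ B := le_add_of_nonneg_left (by positivity)
  have hAp : 0 < A := by linarith
  have hBp : 0 < B := by linarith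
  -- Both factors are linear in κ, and A, B ≥ 1 exceed their coefficients by 1, so this κ meets both
  -- thresholds.
  refine ⟨1 / (4 * A * B), by positivity, ?_, ?_⟩
  · have h1 : lipFactor q C (1 / (4 * A * B)) * (3 ^ N * Real.exp b) = (A - 1) * (1 / (4 * A * B)) := by
      rw [lipFactor, hA]; ring
    rw [h1, mul_one_div, div_le_div_iff₀ (by positivity) two_pos]
    nlinarith
  · have h1 : slopeFactor q C (1 / (4 * A * B)) * 3 ^ N = (B - 1) * (1 / (4 * A * B)) := by
      rw [slopeFactor, hB]; ring
    rw [h1, mul_one_div, div_le_div_iff₀ (by positivity) four_pos]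
    nlinarith

end HeisGibbs

end

theorem theorem5p1 (N : ℕ) (q : ℝ) (hq₁ : 1 < q) (hq₂ : q ≤ 2) (c : ℝ) (hc : 0 < c) (M a : ℝ) :
    ∃ J₀ : ℝ, 0 < J₀ ∧ ∃ C : ℝ, 0 < C ∧ ∀ (φ : HeisGibbs.Heis → ℝ) (V : HeisGibbs.Heis → HeisGibbs.Heis → ℝ)
      (J : HeisGibbs.Site N → HeisGibbs.Site N → ℝ),
      Continuous φ → Continuous (fun p : HeisGibbs.Heis × HeisGibbs.Heis => V p.1 p.2) →
      (∀ i j, |J i j| ≤ J₀) →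
      HeisGibbs.FinitePartition φ V J →
      HeisGibbs.H0 φ V J q c →
      HeisGibbs.H1 V M →
      (∀ ν₁ ν₂ : MeasureTheory.Measure (HeisGibbs.Config N),
        HeisGibbs.IsGibbs φ V J ν₁ → HeisGibbs.IsTempered a ν₁ →
        HeisGibbs.IsGibbs φ V J ν₂ → HeisGibbs.IsTempered a ν₂ → ν₁ = ν₂) ∧
      ∀ ν : MeasureTheory.Measure (HeisGibbs.Config N),
        HeisGibbs.IsGibbs φ V J ν → HeisGibbs.IsTempered a ν → HeisGibbs.LSConfig ν q C := by
  obtain ⟨κ, hκ, hκ₁, hκ₂⟩ := HeisGibbs.exists_couplingConst N hq₁ (C := 2 * c) (by positivity)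
    (max a 0 + 1)
  -- Chosen so that 2 J₀ M ≤ κ. In the constant, 2c is the Lipschitz form of (H0), and 16 collects 4
  -- from the sum over sites, 2 from mollification on the product and 2 from the cutoff.
  refine ⟨κ / (2 * (|M| + 1)), by positivity, 16 * (2 * c), by positivity,
    fun φ V J hφ hV hJ hfin h0 h1 => ?_⟩
  have h : HeisGibbs.Regular φ V J := ⟨hφ, hV, hfin⟩
  have hJκ : 2 * (κ / (2 * (|M| + 1))) * M ≤ κ := by
    have h2 : 2 * (κ / (2 * (|M| + 1))) * M = κ * (M / (|M| + 1)) := by field_simp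
    rw [h2]
    refine mul_le_of_le_one_right hκ.le ((div_le_one (by positivity)).2 ?_)
    linarith [le_abs_self M]
  have hs := h.siteFamily hq₁ hq₂ hc.le h0 h1 hJ hκ hJκ
  have hκ₃ : HeisGibbs.SiteFamily.lipFactor q (2 * c) κ * 3 ^ N ≤ 1 / 2 := by
    refine le_trans (mul_le_mul_of_nonneg_left ?_ hs.lipFactor_nonneg) hκ₁
    exact le_mul_of_one_le_right (by positivity)
      (Real.one_le_exp (add_nonneg (le_max_right _ _) zero_le_one))
  exact ⟨fun ν₁ ν₂ hν₁ ht₁ hν₂ ht₂ => h.isGibbs_unique hs hκ₁ hν₁ ht₁ hν₂ ht₂,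
    fun ν hν ht => h.lsConfig hs (by positivity) hκ₃ hκ₂ hκ₁ hν ht⟩
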